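/- **Setting.** Let $S\subset\mathbb R^3$ be an asymptotically flat support surface: a properly embedded (closed as a subset), connected, non-compact smooth surface, oriented by a unit normal field $\mu$, for which there is a compact set $\Omega$ such that every component $\hat S$ of $S\setminus\Omega$ (an end of $S$) is, after a rotation, the graph over $\{x\in\mathbb R^2:|x|>R_0\}$ of a $C^2$ function $\psi$ with $|x||\nabla\psi|+|x|^2|\nabla^2\psi|\le c$. The rotation is chosen such that $\mu\cdot e_3<0$ on the graph. The exterior mass of the end is $$m_{ext}=\lim_{r\to\infty}\frac1{2\pi}\int_{\partial D_r^2(0)}\frac{x_i}{|x|}\,\partial_i\psi .$$ Let $M^S$ be the union of $S$ and the component of $\mathbb R^3\setminus S$ which $\mu$ points out of, with the Euclidean metric $g_e$. A Riemannian three-manifold $(M,g)$ with boundary is an asymptotically flat half-space if it is complete, $\partial M$ is non-compact, and there is a compact set $\Omega\subset M$ such that every component $\hat M$ of $M\setminus\Omega$ (an end of $M$) has a diffeomorphism from $\{x\in\mathbb R^3:x_3\ge0,\ |x|>R\}$, for some $R>0$, onto it in which $|g_{ij}-\delta_{ij}|+|x||\partial_lg_{ij}|\le c|x|^{-1}$ and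 $\operatorname{Rc}\ge-c|x|^{-2}g$. In such a chart $$m_{ADM}=\lim_{r\to\infty}\frac1{16\pi}\Big(\int_{\mathbb S_r\cap\{x_3\ge0\}}(\partial_jg_{ij}-\partial_ig_{jj})\frac{x_i}{|x|}+\int_{\partial D_r^2(0)\times\{0\}}g_{i3}\frac{x_i}{|x|}\Big).$$ A mass is well-defined if the limit exists in $\mathbb R$. A compact connected embedded smooth surface $\Sigma\subset M^S$ is a free boundary surface if $\partial\Sigma\ne\emptyset$, $\Sigma\cap S=\partial\Sigma$ and $\Sigma$ meets $S$ orthogonally along $\partial \Sigma$; it is closed if $\partial\Sigma=\emptyset=\Sigma\cap S$. A closed, connected, non-compact subset $S'\subset S$ is an exterior surface if there is a non-empty finite disjoint family of free boundary minimal surfaces whose boundaries together form the boundary of $S'$ relative to $S$, and every free boundary minimal surface with boundary in $S'$ belongs to this family. A non-compact region $M'\subset M^S$ (the closure of its interior, the interior being connected) is an exterior region if its interior boundary $\overline{\partial M'\setminus S}$ is a finite disjoint union of closed and free boundary minimal surfaces and $M'$ contains no other closed or free boundary minimal surfaces. Its exterior boundary is $\hat\partial M'=\partial M'\cap S$. (Here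 $\partial M'$ is the topological boundary in $\mathbb R^3$.) **Lemma.** 1. Suppose that different ends of $S$ border different ends of $M^S$, that is, for some compact $\Omega$ as in the definition of a support surface no component of $M^S\setminus\Omega$ meets two components of $S\setminus\Omega$ (this is automatic if $S$ has one end). Then $(M^S,g_e)$ is an asymptotically flat half-space. 2. Let $\hat S$ be an end of $S$ given as the graph of $\psi$ as above, and let $\hat M$ be a component of $M^S\setminus\Omega'$, with $\Omega'$ compact, which contains $\hat S$ up to a bounded set. For every chart of $\hat M$ as in the definition of an asymptotically flat half-space, $m_{ext}$ is well-defined if and only if $m_{ADM}$ is, and in this case $m_{ext}=4\,m_{ADM}$. 3. For every exterior surface $S'\subset S$ there is an exterior region $M'\subset M^S$ with $S'=\hat\partial M'$. -/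

import Mathlib

open Set Filter Topology
open scoped ContDiff

/-- Euclidean three-space. -/
abbrev E3 := EuclideanSpace ℝ (Fin 3)

/-- The Euclidean plane. -/
abbrev E2 := EuclideanSpace ℝ (Fin 2)

/-- The set of connected components of a subset of `ℝ³`. -/
def componentsOf (X : Set E3) : Set (Set E3) :=
  {C | ∃ x ∈ X, C = connectedComponentIn X x}

/-! ### Riemannian metrics on domains of `ℝ³` -/

/-- The partial derivative `∂ₖ f` of a function on `X ⊆ ℝ³`, one-sided at the boundary of `X`. -/
noncomputable def pd {F : Type*} [NormedAddCommGroup F] [NormedSpace ℝ F]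
    (X : Set E3) (k : Fin 3) (f : E3 → F) (x : E3) : F :=
  fderivWithin ℝ f X x (EuclideanSpace.single k 1)

/-- The quadratic form of a symmetric matrix. -/
def quadForm (A : Matrix (Fin 3) (Fin 3) ℝ) (v : E3) : ℝ :=
  ∑ i, ∑ j, A i j * v i * v j

/-- `M ⊆ ℝ³` is a three-dimensional smooth submanifold with boundary. -/
def IsSmoothDomain (M : Set E3) : Prop :=
  ∀ p ∈ M, p ∈ interior M ∨
    ∃ (U : Set E3) (f : E3 → ℝ), IsOpen U ∧ p ∈ U ∧ ContDiffOn ℝ ∞ f U ∧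
      f p = 0 ∧ gradient f p ≠ 0 ∧ ∀ q ∈ U, q ∈ M ↔ f q ≤ 0

/-- The boundary of a smooth domain, as a manifold with boundary. -/
def domainBoundary (M : Set E3) : Set E3 := M \ interior M

/-- `G` (the matrix of coefficients in the standard coordinates) is a smooth Riemannian metric
on `M`. -/
def IsMetricOn (M : Set E3) (G : E3 → Matrix (Fin 3) (Fin 3) ℝ) : Prop :=
  (∀ i j, ContDiffOn ℝ ∞ (fun x => G x i j) M) ∧ ∀ x ∈ M, (G x).PosDef

/-- The Euclidean metric `g_e`. -/
def euclideanMetric : E3 → Matrix (Fin 3) (Fin 3) ℝ := fun _ => 1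

/-- The length of a curve `γ : [0,1] → M` with respect to the metric `G`. -/
noncomputable def curveLength (G : E3 → Matrix (Fin 3) (Fin 3) ℝ) (γ : ℝ → E3) : ENNReal :=
  ∫⁻ t in Icc (0 : ℝ) 1,
    ENNReal.ofReal (Real.sqrt (quadForm (G (γ t)) (derivWithin γ (Icc 0 1) t)))

/-- The Riemannian distance of `(M, G)`. -/
noncomputable def riemDist (M : Set E3) (G : E3 → Matrix (Fin 3) (Fin 3) ℝ) (x y : E3) :
    ENNReal :=
  ⨅ (γ : ℝ → E3) (_ : ContDiffOn ℝ 1 γ (Icc 0 1)) (_ : MapsTo γ (Icc 0 1) M)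
    (_ : γ 0 = x) (_ : γ 1 = y), curveLength G γ

/-- Completeness of the Riemannian distance of `(M, G)`. -/
def IsRiemComplete (M : Set E3) (G : E3 → Matrix (Fin 3) (Fin 3) ℝ) : Prop :=
  ∀ x : ℕ → E3, (∀ n, x n ∈ M) →
    (∀ ε : ENNReal, 0 < ε → ∃ N, ∀ m ≥ N, ∀ n ≥ N, riemDist M G (x m) (x n) < ε) →
    ∃ p ∈ M, Tendsto (fun n => riemDist M G (x n) p) atTop (𝓝 0)

/-- The Christoffel symbol `Γ^k_{ij}`. -/
noncomputable def christoffel (M : Set E3) (G : E3 → Matrix (Fin 3) (Fin 3) ℝ)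
    (k i j : Fin 3) (x : E3) : ℝ :=
  1 / 2 * ∑ l, (G x)⁻¹ k l *
    (pd M i (fun y => G y j l) x + pd M j (fun y => G y i l) x - pd M l (fun y => G y i j) x)

/-- The Ricci tensor `Rc_{ij}` of `(M, G)` in the standard coordinates. -/
noncomputable def ricci (M : Set E3) (G : E3 → Matrix (Fin 3) (Fin 3) ℝ) (x : E3) :
    Matrix (Fin 3) (Fin 3) ℝ := fun i j =>
  ∑ k, (pd M k (christoffel M G k i j) x - pd M i (christoffel M G k k j) x)
    + ∑ k, ∑ p, (christoffel M G k k p x * christoffel M G p i j x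
      - christoffel M G k i p x * christoffel M G p k j x)

/-! ### Asymptotically flat half-spaces and their mass -/

/-- `{x ∈ ℝ³ | x₃ ≥ 0, |x| > R}`, the half-space with a ball removed. -/
def halfSpaceEnd (R : ℝ) : Set E3 := {x | 0 ≤ x 2 ∧ R < ‖x‖}

/-- The coefficient `g_{ij}` of the metric `G` in the chart `Φ`. -/
noncomputable def chartMetric (G : E3 → Matrix (Fin 3) (Fin 3) ℝ) (R : ℝ) (Φ : E3 → E3)
    (i j : Fin 3) (x : E3) : ℝ :=
  ∑ a, ∑ b, G (Φ x) a b * pd (halfSpaceEnd R) i Φ x a * pd (halfSpaceEnd R) j Φ x b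

/-- `Φ` identifies `{x₃ ≥ 0, |x| > R}` diffeomorphically with the end `Mhat` of `(M, G)`, and the
metric in this chart satisfies `|g_{ij} - δ_{ij}| + |x||∂_l g_{ij}| ≤ c|x|⁻¹` and
`Rc ≥ -c|x|⁻² g`. The Ricci bound is between tensors, so it is evaluated in the standard
coordinates at `Φ x`. -/
structure IsAFChart (M : Set E3) (G : E3 → Matrix (Fin 3) (Fin 3) ℝ) (Mhat : Set E3) (R : ℝ)
    (Φ : E3 → E3) : Prop where
  pos : 0 < R
  bijOn : BijOn Φ (halfSpaceEnd R) Mhat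
  smooth : ContDiffOn ℝ ∞ Φ (halfSpaceEnd R)
  smooth_inv : ∃ Ξ : E3 → E3, InvOn Ξ Φ (halfSpaceEnd R) Mhat ∧ ContDiffOn ℝ ∞ Ξ Mhat
  decay : ∃ c : ℝ, 0 < c ∧ ∀ x ∈ halfSpaceEnd R,
    (∀ i j l, |chartMetric G R Φ i j x - if i = j then 1 else 0|
        + ‖x‖ * |pd (halfSpaceEnd R) l (chartMetric G R Φ i j) x| ≤ c * ‖x‖⁻¹) ∧
    ∀ v : E3, -c * (‖x‖ ^ 2)⁻¹ * quadForm (G (Φ x)) v ≤ quadForm (ricci M G (Φ x)) v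

/-- `(M, G)` is an asymptotically flat half-space. -/
structure IsAFHalfSpace (M : Set E3) (G : E3 → Matrix (Fin 3) (Fin 3) ℝ) : Prop where
  domain : IsSmoothDomain M
  metric : IsMetricOn M G
  complete : IsRiemComplete M G
  boundary_noncompact : ¬ IsCompact (domainBoundary M)
  ends : ∃ Ω : Set E3, IsCompact Ω ∧ Ω ⊆ M ∧
    ∀ Mhat ∈ componentsOf (M \ Ω), ∃ R Φ, IsAFChart M G Mhat R Φ

/-- The point of the sphere of radius `r` with angle `θ` to the third axis and longitude `φ`. -/
noncomputable def spherePt (r θ φ : ℝ) : E3 :=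
  !₂[r * (Real.sin θ * Real.cos φ), r * (Real.sin θ * Real.sin φ), r * Real.cos θ]

/-- `∫_{S_r ∩ ℝ³₊} (∂ⱼ g_{ij} - ∂ᵢ g_{jj}) xᵢ/|x| dvol_e`, in spherical coordinates. -/
noncomputable def hemisphereFlux (G : E3 → Matrix (Fin 3) (Fin 3) ℝ) (R : ℝ) (Φ : E3 → E3)
    (r : ℝ) : ℝ :=
  ∫ φ in (0 : ℝ)..(2 * Real.pi), ∫ θ in (0 : ℝ)..(Real.pi / 2),
    (∑ i, ∑ j,
      (pd (halfSpaceEnd R) j (chartMetric G R Φ i j) (spherePt r θ φ)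
        - pd (halfSpaceEnd R) i (chartMetric G R Φ j j) (spherePt r θ φ))
      * (spherePt r θ φ i / ‖spherePt r θ φ‖)) * (r ^ 2 * Real.sin θ)

/-- `∫_{∂D_r × {0}} g_{i3} xᵢ/|x| dvol_e`. -/
noncomputable def circleFlux (G : E3 → Matrix (Fin 3) (Fin 3) ℝ) (R : ℝ) (Φ : E3 → E3)
    (r : ℝ) : ℝ :=
  ∫ φ in (0 : ℝ)..(2 * Real.pi),
    (∑ i, chartMetric G R Φ i 2 (spherePt r (Real.pi / 2) φ)
      * (spherePt r (Real.pi / 2) φ i / ‖spherePt r (Real.pi / 2) φ‖)) * r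

/-- In the chart `Φ` the limit defining the ADM-mass exists and equals `m`. -/
def HasADMMass (G : E3 → Matrix (Fin 3) (Fin 3) ℝ) (R : ℝ) (Φ : E3 → E3) (m : ℝ) : Prop :=
  Tendsto (fun r : ℝ => 1 / (16 * Real.pi) * (hemisphereFlux G R Φ r + circleFlux G R Φ r))
    atTop (𝓝 m)

/-! ### Asymptotically flat support surfaces and the region they bound -/

/-- `S` is a smooth embedded surface without boundary, two-sided and oriented by the unit normal
field `μ`: near each of its points it is a regular level set `{f = 0}` with `μ = ∇f/|∇f|`. -/
def IsOrientedSurface (S : Set E3) (μ : E3 → E3) : Prop :=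
  ∀ p ∈ S, ∃ (U : Set E3) (f : E3 → ℝ), IsOpen U ∧ p ∈ U ∧ ContDiffOn ℝ ∞ f U ∧
    (∀ q ∈ U, q ∈ S ↔ f q = 0) ∧
    ∀ q ∈ S ∩ U, gradient f q ≠ 0 ∧ μ q = ‖gradient f q‖⁻¹ • gradient f q

/-- The region `M^S`: the surface `S` together with the component of its complement which `μ`
points out of. -/
def regionOf (S : Set E3) (μ : E3 → E3) : Set E3 :=
  S ∪ {x | ∃ p ∈ S, ∃ ε > 0, ∀ t ∈ Ioo (0 : ℝ) ε, x ∈ connectedComponentIn Sᶜ (p - t • μ p)}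

/-- After the rotation `A`, the end `Shat` is the graph over `{|x| > R}` of a `C²`-function `ψ`
with `|x||∇ψ| + |x|²|∇²ψ| ≤ c`; the rotation is chosen such that `μ` points downwards, that is,
`M^S` lies locally above the graph (this fixes the sign of `ψ`). -/
structure IsGraphEnd (μ : E3 → E3) (Shat : Set E3) (A : E3 ≃ₗᵢ[ℝ] E3) (R : ℝ) (ψ : E2 → ℝ) :
    Prop where
  rotation : LinearMap.det (A.toLinearEquiv : E3 →ₗ[ℝ] E3) = 1
  pos : 0 < R
  smooth : ContDiffOn ℝ 2 ψ {x | R < ‖x‖}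
  decay : ∃ c : ℝ, ∀ x : E2, R < ‖x‖ →
    ‖x‖ * ‖fderiv ℝ ψ x‖ + ‖x‖ ^ 2 * ‖fderiv ℝ (fderiv ℝ ψ) x‖ ≤ c
  graph : Shat = (fun x : E2 => A !₂[x 0, x 1, ψ x]) '' {x | R < ‖x‖}
  normal_down : ∀ p ∈ Shat, inner ℝ (μ p) (A (EuclideanSpace.single 2 1)) < 0

/-- Outside of `Ω`, every component of `S` is a graphical end. -/
def HasGraphEnds (S : Set E3) (μ : E3 → E3) (Ω : Set E3) : Prop :=
  ∀ Shat ∈ componentsOf (S \ Ω), ∃ A R ψ, IsGraphEnd μ Shat A R ψ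

/-- `S`, oriented by `μ`, is an asymptotically flat support surface. -/
structure IsAFSupportSurface (S : Set E3) (μ : E3 → E3) : Prop where
  closed : IsClosed S
  connected : IsConnected S
  noncompact : ¬ IsCompact S
  surface : IsOrientedSurface S μ
  ends : ∃ Ω : Set E3, IsCompact Ω ∧ HasGraphEnds S μ Ω

/-- Different ends of `S` border different ends of `M^S`: for some compact `Ω` as in the
definition of a support surface, no component of `M^S - Ω` meets two components of `S - Ω`. -/
def EndsAreSeparated (S : Set E3) (μ : E3 → E3) : Prop :=
  ∃ Ω : Set E3, IsCompact Ω ∧ HasGraphEnds S μ Ω ∧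
    ∀ p ∈ S \ Ω, ∀ q ∈ S \ Ω, q ∈ connectedComponentIn (regionOf S μ \ Ω) p →
      q ∈ connectedComponentIn (S \ Ω) p

/-- The limit `lim (1/2π) ∫_{∂D_r} xᵢ/|x| ∂ᵢψ dvol_e` defining the exterior mass of the end which
is the graph of `ψ` exists and equals `m`. -/
def HasExteriorMass (ψ : E2 → ℝ) (m : ℝ) : Prop :=
  Tendsto (fun r : ℝ => 1 / (2 * Real.pi) * ∫ φ in (0 : ℝ)..(2 * Real.pi),
    fderiv ℝ ψ !₂[r * Real.cos φ, r * Real.sin φ] !₂[Real.cos φ, Real.sin φ] * r)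
    atTop (𝓝 m)

/-! ### Minimal surfaces, exterior surfaces and exterior regions -/

/-- On the open set `U`, the set `X` lies in the regular level set `{f = 0}`. -/
def IsDefiningOn (X U : Set E3) (f : E3 → ℝ) : Prop :=
  IsOpen U ∧ ContDiffOn ℝ ∞ f U ∧ ∀ q ∈ X ∩ U, f q = 0 ∧ gradient f q ≠ 0

/-- Near `p`, `X` is a smooth surface without boundary. -/
def IsInteriorPt (X : Set E3) (p : E3) : Prop :=
  p ∈ X ∧ ∃ (U : Set E3) (f : E3 → ℝ), p ∈ U ∧ IsDefiningOn X U f ∧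
    ∀ q ∈ U, q ∈ X ↔ f q = 0

/-- Near `p`, `X` is a smooth surface `{f = 0, h ≥ 0}` with boundary `{f = 0, h = 0}`, and `p` is
on the boundary. -/
def IsBoundaryPt (X : Set E3) (p : E3) : Prop :=
  p ∈ X ∧ ∃ (U : Set E3) (f h : E3 → ℝ), p ∈ U ∧ IsDefiningOn X U f ∧ ContDiffOn ℝ ∞ h U ∧
    h p = 0 ∧ LinearIndependent ℝ ![gradient f p, gradient h p] ∧
    ∀ q ∈ U, q ∈ X ↔ f q = 0 ∧ 0 ≤ h q

/-- The boundary of a smooth surface with boundary. -/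
def surfaceBoundary (X : Set E3) : Set E3 := {p | IsBoundaryPt X p}

/-- The mean curvature `div(∇f/|∇f|)` of the level sets of `f`. -/
noncomputable def levelMeanCurvature (f : E3 → ℝ) (x : E3) : ℝ :=
  LinearMap.trace ℝ E3 (fderiv ℝ (fun y => ‖gradient f y‖⁻¹ • gradient f y) x : E3 →ₗ[ℝ] E3)

/-- The surface `X` has vanishing mean curvature. -/
def IsMinimal (X : Set E3) : Prop :=
  ∀ p ∈ X, ∃ (U : Set E3) (f : E3 → ℝ), p ∈ U ∧ IsDefiningOn X U f ∧
    ∀ q ∈ X ∩ U, levelMeanCurvature f q = 0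

/-- `X` is a free boundary surface in `M^S`, with respect to `S = ∂M^S`: a compact connected
hypersurface with non-empty boundary, meeting `S` exactly in its boundary, and orthogonally. -/
structure IsFreeBoundarySurface (S : Set E3) (μ : E3 → E3) (X : Set E3) : Prop where
  subset : X ⊆ regionOf S μ
  compact : IsCompact X
  connected : IsConnected X
  surface : ∀ p ∈ X, IsInteriorPt X p ∨ IsBoundaryPt X p
  boundary_nonempty : (surfaceBoundary X).Nonempty
  inter_eq : X ∩ S = surfaceBoundary X
  orthogonal : ∀ p ∈ surfaceBoundary X, ∃ (U : Set E3) (f : E3 → ℝ), p ∈ U ∧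
    IsDefiningOn X U f ∧ inner ℝ (gradient f p) (μ p) = 0

/-- `X` is a closed surface in `M^S`: compact, connected, without boundary, disjoint from `S`. -/
structure IsClosedSurface (S : Set E3) (μ : E3 → E3) (X : Set E3) : Prop where
  subset : X ⊆ regionOf S μ
  compact : IsCompact X
  connected : IsConnected X
  surface : ∀ p ∈ X, IsInteriorPt X p
  disjoint : Disjoint X S

/-- `S' ⊆ S` is an exterior surface. The free boundary minimal surface in the definition may be
disconnected; `𝓕` is the set of its components. -/
def IsExteriorSurface (S : Set E3) (μ : E3 → E3) (S' : Set E3) : Prop :=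
  S' ⊆ S ∧ IsClosed S' ∧ IsConnected S' ∧ ¬ IsCompact S' ∧
  ∃ 𝓕 : Set (Set E3), 𝓕.Finite ∧ 𝓕.Nonempty ∧ 𝓕.PairwiseDisjoint id ∧
    (∀ X ∈ 𝓕, IsFreeBoundarySurface S μ X ∧ IsMinimal X) ∧
    (⋃ X ∈ 𝓕, surfaceBoundary X) = S' ∩ closure (S \ S') ∧
    ∀ X, IsFreeBoundarySurface S μ X → IsMinimal X → surfaceBoundary X ⊆ S' → X ∈ 𝓕

/-- The interior boundary of `M'`. -/
def interiorBoundary (S M' : Set E3) : Set E3 := closure (frontier M' \ S)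

/-- The exterior boundary of `M'`. -/
def exteriorBoundary (S M' : Set E3) : Set E3 := frontier M' ∩ S

/-- `M' ⊆ M^S` is an exterior region of `(M^S, g_e)`: a non-compact connected (closed) region
whose interior boundary consists of closed and free boundary minimal surfaces, and which contains
no other such surfaces. -/
def IsExteriorRegion (S : Set E3) (μ : E3 → E3) (M' : Set E3) : Prop :=
  M' ⊆ regionOf S μ ∧ M' = closure (interior M') ∧ IsConnected (interior M') ∧ ¬ IsCompact M' ∧
  ∃ 𝓕 : Set (Set E3), 𝓕.Finite ∧ 𝓕.PairwiseDisjoint id ∧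
    (∀ X ∈ 𝓕, (IsClosedSurface S μ X ∨ IsFreeBoundarySurface S μ X) ∧ IsMinimal X) ∧
    interiorBoundary S M' = ⋃₀ 𝓕 ∧
    ∀ X ⊆ M', (IsClosedSurface S μ X ∨ IsFreeBoundarySurface S μ X) → IsMinimal X → X ∈ 𝓕

/-! Sides of surfaces. A closed, locally flat surface `T` in space separates a small neighbourhood
of each of its points into two sides, which can be coloured by `0` and `1`. Two local colourings
differ by a locally constant element of `ZMod 2`, so the local colourings define a cocycle, and
since `ℝ³` is simply connected it is a coboundary (`exists_coboundary`). Hence the complement of `T`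
has a global colouring which changes across `T` (`exists_isColoring`). For `T = S` this shows that
the component `W` behind `μ` touches `S` from one side only, so that `M^S = S ∪ W` is a smooth
domain (`exists_isInnerSide`).

Exterior regions. Let `T` be the union of `S'` and the free boundary surfaces of the family. A free
boundary surface meets `S` orthogonally, so in suitable charts `T` has a corner which unfolds to a
plane, and `T` is locally flat. The component of `ℝ³ - (S ∪ ⋃₀ 𝓕)` which borders `S'` from inside is
the interior of the region sought; colours and connectedness of `S`, `S'` and the surfaces identify
its closure (`IsCutBy.exists_region`). A further free boundary minimal surface in this closure has
its boundary in `S'` and thus belongs to the family. A closed minimal surface does not exist at all,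
by comparison with a sphere at its farthest point (`not_isMinimal_of_isClosedSurface`).

Asymptotic flatness. The bound on `|x||∇ψ|` makes `ψ` grow at most logarithmically, in particular
sublinearly. If ends are separated, the vertical ray above a far point of an end cannot meet `S`
again and stays in `W` (`IsGraphEnd.ray_subset`). Two ends then have opposite upward directions
(`IsUpperEnd.normal_eq_neg`), so there are at most two, and outside a ball `M^S` is the disjoint
union of the sets above them. The chart of such a set is `x ↦ A (x + Ψ x e₃)`, where `Ψ` extends `ψ`
to space with `|x||DΨ|` and `|x|²|D²Ψ|` bounded. The metric is `δ` plus terms of order `|x|⁻¹`, and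
its Ricci tensor vanishes.

Masses. An arbitrary chart `Φ` is compared with a rigid motion. Koszul's formula bounds `D²Φ` by a
multiple of `|x|⁻²` (`IsDecaying.norm_pd_pd_le`), so `DΦ` converges to a linear isometry `O`, and `F
= O⁻¹ ∘ Φ` is asymptotic to the identity in first derivatives. To first order in `DF - id`, the
integrand over the hemisphere is `-ν · curl curl F`; by Stokes' theorem it contributes `-∫ ⟨curl F,
∂_φ⟩` along the equator. The circle integrand is `⟨curl F, ∂_φ⟩ + 2r ∂_r F₃` to the same order. The
curls cancel, the quadratic errors are `O(1/r)`, and `2r ∫ ∂_r F₃` remains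
(`IsAsymptoticIdentity.exists_flux_bound`). A chart maps boundary to boundary, so `F₃` on the plane
is `ψ` composed with the horizontal part of `F`, up to an isometry of the plane. Its radial
derivative agrees with that of `ψ` up to `o(1/r)`. The factor between the masses is explained by
`2/(16π) = (1/4) · 1/(2π)`. -/

/-! ### Two-colourings of the complement of a locally flat hypersurface -/

/-- A cocycle of locally constant functions on a simply connected space is a coboundary. -/
theorem exists_coboundary {X G ι : Type*} [TopologicalSpace X] [SimplyConnectedSpace X]
    [LocallyPathConnectedSpace X] [AddCommGroup G] [TopologicalSpace G] [DiscreteTopology G]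
    (U : ι → Set X) (hU : ∀ i, IsOpen (U i)) (hcov : ∀ x, ∃ i, x ∈ U i) (d : ι → ι → X → G)
    (hd : ∀ i j, ContinuousOn (d i j) (U i ∩ U j))
    (hdd : ∀ i j k, ∀ x ∈ U i ∩ U j ∩ U k, d i j x + d j k x = d i k x) :
    ∃ t : ι → X → G, (∀ i, ContinuousOn (t i) (U i)) ∧
      ∀ i j, ∀ x ∈ U i ∩ U j, t j x = t i x + d i j x := by
  choose idx hidx using hcov
  have hself : ∀ i, ∀ x ∈ U i, d i i x = 0 := fun i x hx => by
    have := hdd i i i x ⟨⟨hx, hx⟩, hx⟩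
    simpa using this
  -- The bundle with discrete fibre `G` whose transition functions are the translations by `d i j`.
  -- It is a covering, and a section of it read in the `i`-th trivialization is the function `t i`.
  let Z : FiberBundleCore ι X G :=
    { baseSet := U
      isOpen_baseSet := hU
      indexAt := idx
      mem_baseSet_at := hidx
      coordChange := fun i j x v => v + d i j x
      coordChange_self := fun i x hx v => by simp [hself i x hx]
      continuousOn_coordChange := fun i j => by
        refine ContinuousOn.add continuousOn_snd ?_
        exact (hd i j).comp continuousOn_fst fun p hp => hp.1
      coordChange_comp := fun i j k x hx v => by
        rw [add_assoc, hdd i j k x hx] }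
  have hcm : IsCoveringMap Z.proj := FiberBundle.isCoveringMap
  obtain ⟨x₀⟩ : Nonempty X := inferInstance
  -- A global section is a lift of the identity, which exists because `X` is simply connected and
  -- locally path connected.
  obtain ⟨σ, ⟨-, hσ⟩, -⟩ := hcm.existsUnique_continuousMap_lifts (ContinuousMap.id X)
    (a₀ := x₀) (e₀ := ⟨x₀, (0 : G)⟩) rfl
  have hσ' : ∀ x, (σ x).1 = x := fun x => congrFun hσ x
  refine ⟨fun i x => (Z.localTriv i (σ x)).2, fun i => ?_, fun i j x hx => ?_⟩
  · refine continuous_snd.comp_continuousOn ?_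
    refine (Z.localTriv i).continuousOn_toFun.comp σ.continuous.continuousOn fun x hx => ?_
    show (σ x).1 ∈ U i
    rwa [hσ']
  · let w : G := (σ x).2
    have h : ∀ k, (Z.localTriv k (σ x)).2 = w + d (idx x) k x := fun k => by
      rw [FiberBundleCore.localTriv_apply]
      show w + d (idx (σ x).1) k (σ x).1 = _
      rw [hσ']
    simp only [h]
    rw [add_assoc, hdd _ i j x ⟨⟨hidx x, hx.1⟩, hx.2⟩]

/-- `e` is a chart of `ℝ³` in which `T` is the plane `{x₁ = 0}`. -/
structure IsFlatChart (T : Set E3) (p : E3) (e : OpenPartialHomeomorph E3 E3) : Prop where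
  mem : p ∈ e.source
  mem_iff : ∀ x ∈ e.source, x ∈ T ↔ e x 0 = 0

theorem frequently_coord_lt (y : E3) (hy : y 0 = 0) : ∃ᶠ z in 𝓝 y, z 0 < 0 := by
  have hc : Tendsto (fun t : ℝ => y - t • EuclideanSpace.single (0 : Fin 3) (1 : ℝ))
      (𝓝[>] 0) (𝓝 y) := by
    have : Continuous (fun t : ℝ => y - t • EuclideanSpace.single (0 : Fin 3) (1 : ℝ)) := by
      fun_prop
    have h := this.tendsto 0
    simp only [zero_smul, sub_zero] at h
    exact h.mono_left nhdsWithin_le_nhds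
  refine hc.frequently (Eventually.frequently ?_)
  filter_upwards [self_mem_nhdsWithin] with t ht
  simpa [hy] using ht

theorem frequently_coord_gt (y : E3) (hy : y 0 = 0) : ∃ᶠ z in 𝓝 y, 0 < z 0 := by
  have hc : Tendsto (fun t : ℝ => y + t • EuclideanSpace.single (0 : Fin 3) (1 : ℝ))
      (𝓝[>] 0) (𝓝 y) := by
    have : Continuous (fun t : ℝ => y + t • EuclideanSpace.single (0 : Fin 3) (1 : ℝ)) := by
      fun_prop
    have h := this.tendsto 0
    simp only [zero_smul, add_zero] at h
    exact h.mono_left nhdsWithin_le_nhds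
  refine hc.frequently (Eventually.frequently ?_)
  filter_upwards [self_mem_nhdsWithin] with t ht
  simpa [hy] using ht

/-- Pulling back a property along a chart. -/
theorem OpenPartialHomeomorph.frequently_comp {X Y : Type*} [TopologicalSpace X]
    [TopologicalSpace Y] (e : OpenPartialHomeomorph X Y) {x : X} (hx : x ∈ e.source)
    {P : Y → Prop} (h : ∃ᶠ y in 𝓝 (e x), P y) : ∃ᶠ z in 𝓝 x, P (e z) := by
  rw [← e.map_nhds_eq hx] at h
  exact h

/-- Each point has arbitrarily small neighbourhoods whose intersections with preimages of convex
sets under a chart are preconnected. -/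
theorem OpenPartialHomeomorph.exists_nhds_convex (e : OpenPartialHomeomorph E3 E3) {p : E3}
    (hp : p ∈ e.source) {V : Set E3} (hV : V ∈ 𝓝 p) :
    ∃ N ⊆ V ∩ e.source, IsOpen N ∧ p ∈ N ∧
      ∀ C : Set E3, Convex ℝ C → IsPreconnected (N ∩ {x | e x ∈ C}) := by
  obtain ⟨W, hWV, hW, hpW⟩ := mem_nhds_iff.1 hV
  have h1 : e.target ∩ e.symm ⁻¹' W ∈ 𝓝 (e p) := by
    refine (e.isOpen_inter_preimage_symm hW).mem_nhds ⟨e.map_source hp, ?_⟩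
    rw [mem_preimage, e.left_inv hp]
    exact hpW
  obtain ⟨ε, hε, hball⟩ := Metric.mem_nhds_iff.1 h1
  refine ⟨e.symm '' Metric.ball (e p) ε, ?_, ?_, ?_, fun C hC => ?_⟩
  · rintro _ ⟨y, hy, rfl⟩
    exact ⟨hWV (hball hy).2, e.map_target (hball hy).1⟩
  · exact e.symm.isOpen_image_of_subset_source Metric.isOpen_ball fun y hy => (hball hy).1
  · exact ⟨e p, Metric.mem_ball_self hε, e.left_inv hp⟩
  · have key : e.symm '' (Metric.ball (e p) ε ∩ C) =
        (e.symm '' Metric.ball (e p) ε) ∩ {x | e x ∈ C} := by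
      ext x
      constructor
      · rintro ⟨y, hy, rfl⟩
        refine ⟨⟨y, hy.1, rfl⟩, ?_⟩
        rw [mem_ofPred_eq, e.right_inv (hball hy.1).1]
        exact hy.2
      · rintro ⟨⟨y, hy, rfl⟩, h⟩
        rw [mem_ofPred_eq, e.right_inv (hball hy).1] at h
        exact ⟨y, ⟨hy, h⟩, rfl⟩
    rw [← key]
    exact (((convex_ball _ _).inter hC).isPreconnected).image _
      (e.continuousOn_symm.mono fun y hy => (hball hy.1).1)

theorem isLinearMap_coord (i : Fin 3) : IsLinearMap ℝ (fun x : E3 => x i) :=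
  ⟨fun _ _ => rfl, fun _ _ => rfl⟩

/-- Each point has arbitrarily small neighbourhoods in which both sides of the plane are
preconnected. -/
theorem OpenPartialHomeomorph.exists_nhds_sides (e : OpenPartialHomeomorph E3 E3) {p : E3}
    (hp : p ∈ e.source) {V : Set E3} (hV : V ∈ 𝓝 p) :
    ∃ N ⊆ V ∩ e.source, IsOpen N ∧ p ∈ N ∧
      IsPreconnected (N ∩ {x | e x 0 < 0}) ∧ IsPreconnected (N ∩ {x | 0 < e x 0}) := by
  obtain ⟨N, hN, hNo, hpN, h⟩ := e.exists_nhds_convex hp hV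
  exact ⟨N, hN, hNo, hpN, h {x | x 0 < 0} (convex_halfSpace_lt (isLinearMap_coord 0) 0),
    h {x | 0 < x 0} (convex_halfSpace_gt (isLinearMap_coord 0) 0)⟩

/-- `s` is a locally constant colouring of the complement of `T` which takes both values near
every point of `T`. -/
structure IsColoring (T U : Set E3) (s : E3 → ZMod 2) : Prop where
  eventually_eq : ∀ x ∈ U \ T, ∀ᶠ y in 𝓝 x, s y = s x
  frequently_eq : ∀ x ∈ T ∩ U, ∀ c, ∃ᶠ y in 𝓝 x, y ∉ T ∧ s y = c

theorem ZMod.eq_add_one_of_ne {a b : ZMod 2} (h : a ≠ b) : a = b + 1 := by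
  revert a b; decide

theorem ZMod.add_one_ne_two (a : ZMod 2) : a + 1 ≠ a := by
  revert a; decide

theorem constant_of_eventually_eq {X Y : Type*} [TopologicalSpace X] {A : Set X} {s : X → Y}
    (hA : IsPreconnected A) (h : ∀ x ∈ A, ∀ᶠ y in 𝓝 x, s y = s x) {x y : X} (hx : x ∈ A)
    (hy : y ∈ A) : s x = s y := by
  -- With the discrete topology on the values, locally constant means continuous.
  let _ : TopologicalSpace Y := ⊥
  have _ : DiscreteTopology Y := ⟨rfl⟩
  refine hA.constant (f := s) (fun z hz => ?_) hx hy
  refine ContinuousAt.continuousWithinAt ?_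
  have : s =ᶠ[𝓝 z] fun _ => s z := h z hz
  exact continuousAt_const.congr this.symm

/-- On the two sides of a flat chart a colouring is constant, with different values. -/
theorem IsColoring.exists_sides {T U : Set E3} {s : E3 → ZMod 2} (hs : IsColoring T U s)
    (hU : IsOpen U) {p : E3} (hpT : p ∈ T) (hpU : p ∈ U) {e : OpenPartialHomeomorph E3 E3}
    (he : IsFlatChart T p e) :
    ∃ c, ∀ᶠ x in 𝓝 p, (e x 0 < 0 → s x = c) ∧ (0 < e x 0 → s x = c + 1) := by
  obtain ⟨N, hN, hNo, hpN, h1, h2⟩ := e.exists_nhds_sides he.mem (hU.mem_nhds hpU)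
  have e0 : e p 0 = 0 := (he.mem_iff p he.mem).1 hpT
  have hf : ∀ P : E3 → Prop, (∃ᶠ z in 𝓝 (e p), P z) → ∃ x ∈ N, P (e x) := fun P hP =>
    ((e.frequently_comp he.mem hP).and_eventually (hNo.mem_nhds hpN)).exists.imp
      fun x hx => ⟨hx.2, hx.1⟩
  obtain ⟨a, haN, ha⟩ := hf _ (frequently_coord_lt (e p) e0)
  obtain ⟨b, hbN, hb⟩ := hf _ (frequently_coord_gt (e p) e0)
  have hconst : ∀ A ⊆ N, IsPreconnected A → Disjoint A T → ∀ x ∈ A, ∀ y ∈ A, s x = s y := by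
    intro A hAN hA hAT x hx y hy
    exact constant_of_eventually_eq hA
      (fun z hz => hs.eventually_eq z ⟨(hN (hAN hz)).1, disjoint_left.1 hAT hz⟩) hx hy
  have hc1 : ∀ x ∈ N, e x 0 < 0 → s x = s a := fun x hx hx0 =>
    hconst _ inter_subset_left h1 (disjoint_left.2 fun z hz hzT =>
      (ne_of_lt hz.2) ((he.mem_iff z (hN hz.1).2).1 hzT)) x ⟨hx, hx0⟩ a ⟨haN, ha⟩
  have hc2 : ∀ x ∈ N, 0 < e x 0 → s x = s b := fun x hx hx0 =>
    hconst _ inter_subset_left h2 (disjoint_left.2 fun z hz hzT =>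
      (ne_of_gt hz.2) ((he.mem_iff z (hN hz.1).2).1 hzT)) x ⟨hx, hx0⟩ b ⟨hbN, hb⟩
  -- If the two sides had the same colour, the other colour would not occur near `p`, although a
  -- colouring takes both values there.
  have hab : s b = s a + 1 := by
    apply ZMod.eq_add_one_of_ne
    intro hab
    obtain ⟨x, ⟨hxT, hx⟩, hxN⟩ := ((hs.frequently_eq p ⟨hpT, hpU⟩ (s a + 1)).and_eventually
      (hNo.mem_nhds hpN)).exists
    have h0 : e x 0 ≠ 0 := fun h => hxT ((he.mem_iff x (hN hxN).2).2 h)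
    have : s x = s a := by
      rcases lt_or_gt_of_ne h0 with h | h
      · exact hc1 x hxN h
      · exact (hc2 x hxN h).trans hab
    exact ZMod.add_one_ne_two (s a) (hx.symm.trans this)
  refine ⟨s a, ?_⟩
  filter_upwards [hNo.mem_nhds hpN] with x hx
  exact ⟨hc1 x hx, fun h => (hc2 x hx h).trans hab⟩

/-- The local piece of the global colouring: the sign of the first coordinate of a chart. -/
theorem IsFlatChart.isColoring {T : Set E3} {p : E3} {e : OpenPartialHomeomorph E3 E3}
    (he : IsFlatChart T p e) : IsColoring T e.source (fun x => if e x 0 < 0 then 1 else 0) := by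
  have hcont : ∀ x ∈ e.source, ContinuousAt (fun y => e y 0) x := fun x hx => by
    have := e.continuousAt hx
    fun_prop
  constructor
  · rintro x ⟨hx, hxT⟩
    have h0 : e x 0 ≠ 0 := fun h => hxT ((he.mem_iff x hx).2 h)
    rcases lt_or_gt_of_ne h0 with h | h
    · filter_upwards [(hcont x hx).eventually_lt continuousAt_const h] with y hy
      simp [hy, h]
    · filter_upwards [continuousAt_const.eventually_lt (hcont x hx) h] with y hy
      simp [not_lt.2 hy.le, not_lt.2 h.le]
  · rintro x ⟨hxT, hx⟩ c
    have e0 := (he.mem_iff x hx).1 hxT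
    have hsrc : ∀ᶠ y in 𝓝 x, y ∈ e.source := e.open_source.mem_nhds hx
    by_cases hc : c = 1
    · refine ((e.frequently_comp hx (frequently_coord_lt _ e0)).and_eventually hsrc).mono ?_
      rintro y ⟨hy, hys⟩
      exact ⟨fun h => (ne_of_lt hy) ((he.mem_iff y hys).1 h), by simp [hy, hc]⟩
    · have hc' : c = 0 := by revert c; decide
      refine ((e.frequently_comp hx (frequently_coord_gt _ e0)).and_eventually hsrc).mono ?_
      rintro y ⟨hy, hys⟩
      exact ⟨fun h => (ne_of_gt hy) ((he.mem_iff y hys).1 h), by simp [not_lt.2 hy.le, hc']⟩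

/-- The difference of two colourings is locally constant across `T`. -/
theorem IsColoring.exists_sub {T U V : Set E3} {s t : E3 → ZMod 2} (hs : IsColoring T U s)
    (ht : IsColoring T V t) (hU : IsOpen U) (hV : IsOpen V)
    (hflat : ∀ p ∈ T, ∃ e, IsFlatChart T p e) {x : E3} (hx : x ∈ U ∩ V) :
    ∃ c, ∀ᶠ y in 𝓝 x, y ∉ T → t y - s y = c := by
  by_cases hxT : x ∈ T
  · obtain ⟨e, he⟩ := hflat x hxT
    obtain ⟨c, hc⟩ := hs.exists_sides hU hxT hx.1 he
    obtain ⟨c', hc'⟩ := ht.exists_sides hV hxT hx.2 he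
    refine ⟨c' - c, ?_⟩
    filter_upwards [hc, hc', e.open_source.mem_nhds he.mem] with y hy hy' hys hyT
    have h0 : e y 0 ≠ 0 := fun h => hyT ((he.mem_iff y hys).2 h)
    rcases lt_or_gt_of_ne h0 with h | h
    · rw [hy.1 h, hy'.1 h]
    · rw [hy.2 h, hy'.2 h]; ring
  · refine ⟨t x - s x, ?_⟩
    filter_upwards [hs.eventually_eq x ⟨hx.1, hxT⟩, ht.eventually_eq x ⟨hx.2, hxT⟩] with y h h' _
    rw [h, h']

/-- The complement of a closed locally flat surface in `ℝ³` can be coloured by two colours. -/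
theorem exists_isColoring {T : Set E3} (hT : IsClosed T)
    (hflat : ∀ p ∈ T, ∃ e, IsFlatChart T p e) : ∃ s, IsColoring T univ s := by
  classical
  have hflat' := hflat
  have _ : Nonempty (OpenPartialHomeomorph E3 E3) := ⟨OpenPartialHomeomorph.refl E3⟩
  choose! e he using hflat
  have hfreq : ∀ x, ∃ᶠ y in 𝓝 x, y ∉ T := by
    intro x
    by_cases hx : x ∈ T
    · exact ((he x hx).isColoring.frequently_eq x ⟨hx, (he x hx).mem⟩ 0).mono fun y hy => hy.1
    · exact (Eventually.frequently (hT.isOpen_compl.mem_nhds hx))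
  -- The cover is indexed by the points of space: a point of `T` contributes the domain of a flat
  -- chart, any other point the whole complement of `T` with the constant colour `0`.
  let U : E3 → Set E3 := fun p => if p ∈ T then (e p).source else Tᶜ
  let s : E3 → E3 → ZMod 2 := fun p x => if p ∈ T then (if e p x 0 < 0 then 1 else 0) else 0
  have hU : ∀ p, IsOpen (U p) := fun p => by
    by_cases hp : p ∈ T
    · simpa [U, hp] using (e p).open_source
    · simp [U, hp, hT]
  have hs : ∀ p, IsColoring T (U p) (s p) := fun p => by
    by_cases hp : p ∈ T
    · simpa [U, s, hp] using (he p hp).isColoring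
    · refine ⟨fun x _ => by simp [s, hp], fun x hx => ?_⟩
      simp only [U, hp, if_false] at hx
      exact absurd hx.1 hx.2
  have hcov : ∀ p, p ∈ U p := fun p => by
    by_cases hp : p ∈ T
    · simpa [U, hp] using (he p hp).mem
    · simp [U, hp]
  -- The difference of two local colourings has the same value on both sides of `T`, so it defines a
  -- function also at points of `T`. The value is unique since the complement of `T` is dense.
  have hex : ∀ i j x, ∃ c, x ∈ U i ∩ U j → ∀ᶠ y in 𝓝 x, y ∉ T → s j y - s i y = c := by
    intro i j x
    by_cases hx : x ∈ U i ∩ U j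
    · obtain ⟨c, hc⟩ := (hs i).exists_sub (hs j) (hU i) (hU j) hflat' hx
      exact ⟨c, fun _ => hc⟩
    · exact ⟨0, fun h => absurd h hx⟩
  choose d hd using hex
  have huniq : ∀ i j x c, x ∈ U i ∩ U j → (∀ᶠ y in 𝓝 x, y ∉ T → s j y - s i y = c) →
      d i j x = c := by
    intro i j x c hx hc
    obtain ⟨y, hyT, hy, hy'⟩ := ((hfreq x).and_eventually (hc.and (hd i j x hx))).exists
    rw [← hy hyT, hy' hyT]
  -- Since `t j = t i + d i j`, the corrected colourings `s i - t i` agree on overlaps off `T`.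
  obtain ⟨t, ht, htd⟩ := exists_coboundary U hU (fun x => ⟨x, hcov x⟩) d
    (fun i j x hx => by
      refine ContinuousAt.continuousWithinAt ?_
      have h : d i j =ᶠ[𝓝 x] fun _ => d i j x := by
        filter_upwards [eventually_eventually_nhds.2 (hd i j x hx), (hU i).mem_nhds hx.1,
          (hU j).mem_nhds hx.2] with y hy hyi hyj
        exact huniq i j y _ ⟨hyi, hyj⟩ hy
      exact continuousAt_const.congr h.symm)
    (fun i j k x hx => by
      refine (huniq i k x _ ⟨hx.1.1, hx.2⟩ ?_).symm
      filter_upwards [hd i j x hx.1, hd j k x ⟨hx.1.2, hx.2⟩] with y h1 h2 hy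
      rw [← h1 hy, ← h2 hy]; ring)
  have hglob : ∀ i, ∀ x ∈ U i, x ∉ T → s x x - t x x = s i x - t i x := by
    intro i x hx hxT
    have h1 := htd i x x ⟨hx, hcov x⟩
    have h2 := (hd i x x ⟨hx, hcov x⟩).self_of_nhds hxT
    rw [h1, ← h2]; ring
  have htc : ∀ i, ∀ x ∈ U i, ∀ᶠ y in 𝓝 x, t i y = t i x := fun i x hx => by
    have := ((ht i).continuousAt ((hU i).mem_nhds hx))
    exact this.eventually (isOpen_discrete {t i x} |>.mem_nhds rfl)
  refine ⟨fun x => s x x - t x x, ⟨fun x hx => ?_, fun x hx c => ?_⟩⟩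
  · filter_upwards [(hs x).eventually_eq x ⟨hcov x, hx.2⟩, htc x x (hcov x),
      (hU x).mem_nhds (hcov x), hT.isOpen_compl.mem_nhds hx.2] with y h1 h2 hy hyT
    rw [hglob x y hy hyT, h1, h2]
  · refine (((hs x).frequently_eq x ⟨hx.1, hcov x⟩ (c + t x x)).and_eventually
      ((htc x x (hcov x)).and ((hU x).mem_nhds (hcov x)))).mono ?_
    rintro y ⟨⟨hyT, h1⟩, h2, hy⟩
    refine ⟨hyT, ?_⟩
    rw [hglob x y hy hyT, h1, h2]; ring

/-! ### Smooth charts -/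

/-- The inverse function theorem, with a smooth inverse. -/
theorem exists_smooth_chart {F : E3 → E3} {U : Set E3} {p : E3} (hU : IsOpen U) (hp : p ∈ U)
    (hF : ContDiffOn ℝ ∞ F U) (hinj : ∀ v, fderiv ℝ F p v = 0 → v = 0) :
    ∃ e : OpenPartialHomeomorph E3 E3, (e : E3 → E3) = F ∧ p ∈ e.source ∧ e.source ⊆ U ∧
      ContDiffOn ℝ ∞ e.symm e.target := by
  have hFat : ∀ x ∈ U, ContDiffAt ℝ ∞ F x := fun x hx => hF.contDiffAt (hU.mem_nhds hx)
  have hinj' : Function.Injective (fderiv ℝ F p) :=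
    (injective_iff_map_eq_zero (fderiv ℝ F p)).2 hinj
  let L : E3 ≃L[ℝ] E3 :=
    (LinearEquiv.ofInjectiveEndo (fderiv ℝ F p : E3 →ₗ[ℝ] E3) hinj').toContinuousLinearEquiv
  have hL : (L : E3 →L[ℝ] E3) = fderiv ℝ F p := by ext v : 1; rfl
  have hd : HasFDerivAt F (L : E3 →L[ℝ] E3) p := by
    rw [hL]; exact ((hFat p hp).differentiableAt (by simp)).hasFDerivAt
  let e := (hFat p hp).toOpenPartialHomeomorph F hd (by simp)
  have he : (e : E3 → E3) = F := ContDiffAt.toOpenPartialHomeomorph_coe ..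
  have hpe : p ∈ e.source := ContDiffAt.mem_toOpenPartialHomeomorph_source ..
  have hcont : ContinuousOn (fderiv ℝ F) U := hF.continuousOn_fderiv_of_isOpen hU (by simp)
  -- Smoothness of the inverse requires an invertible derivative at every point of the source, not
  -- only at `p`.
  let V : Set E3 := U ∩ fderiv ℝ F ⁻¹' range ((↑) : (E3 ≃L[ℝ] E3) → E3 →L[ℝ] E3)
  have hV : IsOpen V := hcont.isOpen_inter_preimage hU ContinuousLinearEquiv.isOpen
  refine ⟨e.restrOpen V hV, ?_, ?_, ?_, ?_⟩
  · simpa using he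
  · exact ⟨hpe, hp, L, hL⟩
  · exact fun x hx => hx.2.1
  · intro y hy
    have hy' : y ∈ e.target ∧ e.symm y ∈ V := by
      simpa [OpenPartialHomeomorph.restrOpen, PartialEquiv.restr, PartialEquiv.trans] using hy
    obtain ⟨h1, h2, L', hL'⟩ := hy'
    refine ContDiffAt.contDiffWithinAt ?_
    refine e.contDiffAt_symm h1 (f₀' := L') ?_ ?_
    · rw [he, hL']; exact ((hFat _ h2).differentiableAt (by simp)).hasFDerivAt
    · rw [he]; exact hFat _ h2

/-- The orthogonal complement of the span of `a` and `b` is a line, and `w` spans it. The linear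
function given by `w` serves as the missing third coordinate. -/
theorem exists_orthogonal_completion {a b : E3} (h : LinearIndependent ℝ ![a, b]) :
    ∃ w : E3, ∀ v : E3, inner ℝ a v = 0 → inner ℝ b v = 0 → inner ℝ w v = 0 → v = 0 := by
  let K : Submodule ℝ E3 := Submodule.span ℝ (range ![a, b])
  have hK : Module.finrank ℝ K = 2 := by simpa using finrank_span_eq_card h
  have hK' : Module.finrank ℝ Kᗮ = 1 := by
    have := K.finrank_add_finrank_orthogonal
    rw [hK, finrank_euclideanSpace] at this
    simp at this; omega
  obtain ⟨w, hw, hspan⟩ := finrank_eq_one_iff'.1 hK'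
  refine ⟨w, fun v h1 h2 h3 => ?_⟩
  have hv : v ∈ Kᗮ := by
    rw [Submodule.mem_orthogonal]
    intro u hu
    induction hu using Submodule.span_induction with
    | mem x hx =>
      obtain ⟨i, rfl⟩ := hx
      fin_cases i
      · exact h1
      · exact h2
    | zero => simp
    | add x y _ _ hx hy => rw [inner_add_left, hx, hy, add_zero]
    | smul c x _ hx => rw [inner_smul_left, hx, mul_zero]
  obtain ⟨c, hc⟩ := hspan ⟨v, hv⟩
  have hc' : v = c • (w : E3) := (congrArg Subtype.val hc).symm
  rw [hc', inner_smul_right] at h3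
  have hw' : (w : E3) ≠ 0 := fun h => hw (Subtype.ext h)
  have : c = 0 := by
    rcases mul_eq_zero.1 h3 with h | h
    · exact h
    · exact absurd (inner_self_eq_zero.1 h) hw'
  rw [hc', this, zero_smul]

/-- `e` is a smooth chart around `p`, defined within `U`. -/
structure IsSmoothChart (p : E3) (U : Set E3) (e : OpenPartialHomeomorph E3 E3) : Prop where
  mem : p ∈ e.source
  subset : e.source ⊆ U
  smooth : ContDiffOn ℝ ∞ e e.source
  smooth_symm : ContDiffOn ℝ ∞ e.symm e.target

/-- The inverse function theorem for `(f, g, ⟨w, ·⟩)`, whose derivative at `p` has trivial kernel.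
The chart is this map itself, so the coordinate identities hold everywhere and not only on the
source. -/
theorem exists_chart_pair {f g : E3 → ℝ} {U : Set E3} {p : E3} (hU : IsOpen U) (hp : p ∈ U)
    (hf : ContDiffOn ℝ ∞ f U) (hg : ContDiffOn ℝ ∞ g U)
    (hli : LinearIndependent ℝ ![gradient f p, gradient g p]) :
    ∃ e, IsSmoothChart p U e ∧ ∀ x, e x 0 = f x ∧ e x 1 = g x := by
  obtain ⟨w, hw⟩ := exists_orthogonal_completion hli
  let F : E3 → E3 := fun x => !₂[f x, g x, inner ℝ w x]
  have hF : ContDiffOn ℝ ∞ F U := by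
    rw [contDiffOn_euclidean]
    intro i
    fin_cases i
    · exact hf
    · exact hg
    · exact (contDiff_const.inner ℝ contDiff_id).contDiffOn
  have hdF : DifferentiableAt ℝ F p := (hF.contDiffAt (hU.mem_nhds hp)).differentiableAt (by simp)
  have hcoord : ∀ i v, fderiv ℝ F p v i = fderiv ℝ (fun x => F x i) p v := by
    intro i v
    have h := ((hasFDerivWithinAt_euclidean (t := univ)).1 hdF.hasFDerivAt.hasFDerivWithinAt i)
    rw [hasFDerivWithinAt_univ] at h
    rw [h.fderiv]; rfl
  obtain ⟨e, he, hpe, heU, hsymm⟩ := exists_smooth_chart hU hp hF (fun v hv => by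
    have h : ∀ i, fderiv ℝ (fun x => F x i) p v = 0 := fun i => by rw [← hcoord, hv]; rfl
    refine hw v ?_ ?_ ?_
    · rw [inner_gradient_left]; exact h 0
    · rw [inner_gradient_left]; exact h 1
    · have h2 := h 2
      have : (fun x => F x 2) = fun x => (innerSL ℝ w) x := rfl
      rw [this, ContinuousLinearMap.fderiv] at h2
      exact h2)
  refine ⟨e, ⟨hpe, heU, he ▸ hF.mono heU, hsymm⟩, fun x => ?_⟩
  rw [he]
  exact ⟨rfl, rfl⟩

theorem exists_linearIndependent_pair {a : E3} (ha : a ≠ 0) :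
    ∃ b, LinearIndependent ℝ ![a, b] := by
  by_contra! h
  have h1 : ∀ b, ∃ c : ℝ, c • a = b := by
    intro b
    have := h b
    rw [LinearIndependent.pair_iff' ha] at this
    push Not at this
    exact this
  have : Module.finrank ℝ E3 ≤ 1 := finrank_le_one a h1
  rw [finrank_euclideanSpace] at this
  simp at this

theorem gradient_inner_const (b x : E3) : gradient (fun y : E3 => inner ℝ b y) x = b := by
  refine ext_inner_right ℝ fun v => ?_
  rw [inner_gradient_left]
  have : (fun y : E3 => inner ℝ b y) = fun y => (innerSL ℝ b) y := rfl
  rw [this, ContinuousLinearMap.fderiv]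
  rfl

theorem exists_chart_single {f : E3 → ℝ} {U : Set E3} {p : E3} (hU : IsOpen U) (hp : p ∈ U)
    (hf : ContDiffOn ℝ ∞ f U) (h0 : gradient f p ≠ 0) :
    ∃ e, IsSmoothChart p U e ∧ ∀ x, e x 0 = f x := by
  obtain ⟨b, hb⟩ := exists_linearIndependent_pair h0
  obtain ⟨e, he, hfg⟩ := exists_chart_pair (g := fun y => inner ℝ b y) hU hp hf
    (contDiff_const.inner ℝ contDiff_id).contDiffOn (by rwa [gradient_inner_const])
  exact ⟨e, he, fun x => (hfg x).1⟩

/-- A function which vanishes on a piece `{f = 0, h ≥ 0}` of a surface with boundary has a gradient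
parallel to that of `f`. -/
theorem exists_gradient_eq_smul {f h g : E3 → ℝ} {U : Set E3} {p : E3} (hU : IsOpen U)
    (hp : p ∈ U) (hf : ContDiffOn ℝ ∞ f U) (hh : ContDiffOn ℝ ∞ h U) (hg : ContDiffOn ℝ ∞ g U)
    (hfp : f p = 0) (hhp : 0 ≤ h p) (hli : LinearIndependent ℝ ![gradient f p, gradient h p])
    (hgz : ∀ᶠ x in 𝓝 p, f x = 0 → 0 ≤ h x → g x = 0) :
    ∃ c : ℝ, gradient g p = c • gradient f p := by
  obtain ⟨e, he, hfh⟩ := exists_chart_pair hU hp hf hh hli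
  have hpt : e p ∈ e.target := e.map_source he.mem
  have hsymm : HasFDerivAt e.symm (fderiv ℝ e.symm (e p)) (e p) :=
    ((he.smooth_symm.contDiffAt (e.open_target.mem_nhds hpt)).differentiableAt
      (by simp)).hasFDerivAt
  have hgd : HasFDerivAt g (fderiv ℝ g p) p :=
    ((hg.contDiffAt (hU.mem_nhds hp)).differentiableAt (by simp)).hasFDerivAt
  have hed : HasFDerivAt e (fderiv ℝ e p) p :=
    ((he.smooth.contDiffAt (e.open_source.mem_nhds he.mem)).differentiableAt
      (by simp)).hasFDerivAt
  have hG : HasFDerivAt (g ∘ e.symm) ((fderiv ℝ g p).comp (fderiv ℝ e.symm (e p))) (e p) := by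
    refine HasFDerivAt.comp (e p) ?_ hsymm
    rw [e.left_inv he.mem]; exact hgd
  -- In the chart, `{f = 0, h ≥ 0}` contains a short half-line in each direction `w` of the
  -- half-plane. As `g` vanishes on it, the one-sided derivative of `g` vanishes.
  have hzero : ∀ w : E3, w 0 = 0 → 0 ≤ w 1 → fderiv ℝ g p (fderiv ℝ e.symm (e p) w) = 0 := by
    intro w hw0 hw1
    have hline : HasDerivAt (fun t : ℝ => e p + t • w) w 0 := by
      simpa using ((hasDerivAt_id (0 : ℝ)).smul_const w).const_add (e p)
    have hline0 : e p + (0 : ℝ) • w = e p := by simp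
    have hcomp : HasDerivAt (fun t : ℝ => (g ∘ e.symm) (e p + t • w))
        (fderiv ℝ g p (fderiv ℝ e.symm (e p) w)) 0 := by
      have := HasFDerivAt.comp_hasDerivAt (0 : ℝ) (by rw [hline0]; exact hG) hline
      exact this
    have htend : Tendsto (fun t : ℝ => e.symm (e p + t • w)) (𝓝[≥] 0) (𝓝 p) := by
      have h1 : ContinuousAt e.symm (e p + (0 : ℝ) • w) := by
        rw [hline0]; exact e.continuousAt_symm hpt
      have h2 := (h1.comp (f := fun t : ℝ => e p + t • w) hline.continuousAt).tendsto
      simp only [Function.comp_def, hline0, e.left_inv he.mem] at h2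
      exact h2.mono_left nhdsWithin_le_nhds
    have htgt : ∀ᶠ t in 𝓝[≥] (0 : ℝ), e p + t • w ∈ e.target := by
      have := hline.continuousAt.tendsto
      rw [hline0] at this
      exact (this.mono_left nhdsWithin_le_nhds).eventually (e.open_target.mem_nhds hpt)
    have hev : ∀ᶠ t in 𝓝[≥] (0 : ℝ), (g ∘ e.symm) (e p + t • w) = 0 := by
      filter_upwards [htend.eventually hgz, htgt, self_mem_nhdsWithin] with t ht htt ht0
      refine ht ?_ ?_
      · rw [← (hfh _).1, e.right_inv htt]
        simp [hw0, (hfh p).1, hfp]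
      · rw [← (hfh _).2, e.right_inv htt]
        have : 0 ≤ t * w 1 := mul_nonneg ht0 hw1
        simp [(hfh p).2]; linarith
    have hd0 : HasDerivWithinAt (fun t : ℝ => (g ∘ e.symm) (e p + t • w)) 0 (Ici 0) 0 := by
      refine (hasDerivWithinAt_const (0 : ℝ) (Ici 0) (0 : ℝ)).congr_of_eventuallyEq hev ?_
      exact hev.self_of_nhdsWithin (self_mem_Ici)
    exact (uniqueDiffWithinAt_Ici (0 : ℝ)).eq_deriv _ hcomp.hasDerivWithinAt hd0
  -- Either `w` or `-w` lies in the half-plane, so linearity yields the whole tangent plane.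
  have hzero' : ∀ w : E3, w 0 = 0 → fderiv ℝ g p (fderiv ℝ e.symm (e p) w) = 0 := by
    intro w hw
    rcases le_total 0 (w 1) with h | h
    · exact hzero w hw h
    · have := hzero (-w) (by simp [hw]) (by simp [h])
      simpa using this
  have hinv : ∀ v, fderiv ℝ e.symm (e p) (fderiv ℝ e p v) = v := by
    have h1 : HasFDerivAt (e.symm ∘ e) ((fderiv ℝ e.symm (e p)).comp (fderiv ℝ e p)) p :=
      hsymm.comp p hed
    have h2 : HasFDerivAt (e.symm ∘ e) (ContinuousLinearMap.id ℝ E3) p := by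
      refine (hasFDerivAt_id p).congr_of_eventuallyEq ?_
      filter_upwards [e.open_source.mem_nhds he.mem] with x hx
      exact e.left_inv hx
    intro v
    exact DFunLike.congr_fun (h1.unique h2) v
  have hcoord : ∀ v, fderiv ℝ e p v 0 = fderiv ℝ f p v := by
    intro v
    have h := ((hasFDerivWithinAt_euclidean (t := univ)).1 hed.hasFDerivWithinAt 0)
    rw [hasFDerivWithinAt_univ] at h
    have h' : (fun x => e x 0) = f := funext fun x => (hfh x).1
    rw [h'] at h
    rw [h.fderiv]; rfl
  -- The factor is the derivative of `g` along the coordinate curve on which `f` increases at unit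
  -- speed.
  refine ⟨fderiv ℝ g p (fderiv ℝ e.symm (e p) (EuclideanSpace.single 0 1)), ?_⟩
  refine ext_inner_right ℝ fun v => ?_
  rw [inner_smul_left, inner_gradient_left, inner_gradient_left]
  have hv : v = fderiv ℝ e.symm (e p) (fderiv ℝ e p v - fderiv ℝ f p v • EuclideanSpace.single 0 1)
      + fderiv ℝ f p v • fderiv ℝ e.symm (e p) (EuclideanSpace.single 0 1) := by
    rw [map_sub, map_smul, sub_add_cancel, hinv]
  conv_lhs => rw [hv]
  rw [map_add, hzero' _ (by simp [hcoord]), map_smul]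
  simp [mul_comm]

/-- If `{f = 0} ⊆ {g = 0}` near `p`, with both level sets regular, then the level sets agree. -/
theorem eventually_eq_zero_of_subset {f g : E3 → ℝ} {U : Set E3} {p : E3} (hU : IsOpen U)
    (hp : p ∈ U) (hf : ContDiffOn ℝ ∞ f U) (hg : ContDiffOn ℝ ∞ g U) (hfp : f p = 0)
    (hf0 : gradient f p ≠ 0) (hg0 : gradient g p ≠ 0)
    (hfg : ∀ᶠ x in 𝓝 p, f x = 0 → g x = 0) : ∀ᶠ x in 𝓝 p, g x = 0 → f x = 0 := by
  obtain ⟨b, hb⟩ := exists_linearIndependent_pair hf0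
  -- Here `g` vanishes on all of `{f = 0}`, so any `h` with `h p = 0` and independent gradient can
  -- cut out a half.
  obtain ⟨c, hc⟩ := exists_gradient_eq_smul (h := fun y => inner ℝ b y - inner ℝ b p) hU hp hf
    ((contDiff_const.inner ℝ contDiff_id).sub contDiff_const).contDiffOn hg hfp (by simp)
    (by
      have : gradient (fun y => inner ℝ b y - inner ℝ b p) p = b := by
        refine ext_inner_right ℝ fun v => ?_
        rw [inner_gradient_left, fderiv_sub_const, ← inner_gradient_left, gradient_inner_const]
      rwa [this]) (hfg.mono fun x hx h _ => hx h)
  have hc0 : c ≠ 0 := fun h => hg0 (by rw [hc, h, zero_smul])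
  obtain ⟨e, he, hef⟩ := exists_chart_single hU hp hf hf0
  have hpt : e p ∈ e.target := e.map_source he.mem
  have hsymm := (he.smooth_symm.contDiffAt (e.open_target.mem_nhds hpt)).hasStrictFDerivAt
    (by simp)
  have hgs : HasStrictFDerivAt g (fderiv ℝ g p) p :=
    (hg.contDiffAt (hU.mem_nhds hp)).hasStrictFDerivAt (by simp)
  have hfs : HasStrictFDerivAt f (fderiv ℝ f p) p :=
    (hf.contDiffAt (hU.mem_nhds hp)).hasStrictFDerivAt (by simp)
  -- The function `g - c f` has strict derivative zero at `p`. In the chart it is therefore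
  -- Lipschitz near `e p` with constant `|c| / 2`.
  have hG : HasStrictFDerivAt (fun y => g (e.symm y) - c * f (e.symm y)) (0 : E3 →L[ℝ] ℝ)
      (e p) := by
    have hl := e.left_inv he.mem
    have h1 := HasStrictFDerivAt.comp (e p) (g := g) (g' := fderiv ℝ g p) (by rwa [hl]) hsymm
    have h2 := HasStrictFDerivAt.comp (e p) (g := f) (g' := fderiv ℝ f p) (by rwa [hl]) hsymm
    have h3 := h1.sub (h2.const_mul c)
    convert! h3 using 1
    ext v : 1
    simp [← inner_gradient_left, hc, inner_smul_left]
  have hlo := hG.isLittleO.def (half_pos (abs_pos.2 hc0))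
  let P : E3 → E3 := fun y => y - y 0 • EuclideanSpace.single 0 1
  have hP : Tendsto (fun x => (e x, P (e x))) (𝓝 p) (𝓝 (e p, e p)) := by
    have hP0 : P (e p) = e p := by simp [P, hef, hfp]
    have hPc : Continuous P := by fun_prop
    have h1 := e.continuousAt he.mem
    have h2 : ContinuousAt (fun x => P (e x)) p := hPc.continuousAt.comp h1
    have := (h1.prodMk h2).tendsto
    rwa [hP0] at this
  have hP2 : ∀ᶠ x in 𝓝 p, P (e x) ∈ e.target ∧ (f (e.symm (P (e x))) = 0 →
      g (e.symm (P (e x))) = 0) := by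
    have h2 := (continuous_snd.tendsto _).comp hP
    refine (h2.eventually (e.open_target.mem_nhds hpt)).and ?_
    have h3 : Tendsto e.symm (𝓝 (e p)) (𝓝 p) := e.tendsto_symm he.mem
    exact (h3.comp h2).eventually hfg
  filter_upwards [hP.eventually hlo, hP2, e.open_source.mem_nhds he.mem] with x hx hPx hxs hgx
  have hf' : f (e.symm (P (e x))) = 0 := by
    rw [← hef, e.right_inv hPx.1]; simp [P]
  simp only [e.left_inv hxs, hgx, hf', hPx.2 hf'] at hx
  have hn : ‖e x - P (e x)‖ = |f x| := by
    simp [P, hef, norm_smul]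
  rw [hn] at hx
  simp only [mul_zero, sub_zero, zero_sub, norm_neg, Real.norm_eq_abs, abs_mul,
    zero_apply] at hx
  have hc1 := abs_pos.2 hc0
  -- At a zero `x` of `g`, comparison with the projection of `x` to `{f = 0}`, where `g` vanishes as
  -- well, yields `|c| |f x| ≤ (|c| / 2) |f x|`.
  have : |f x| ≤ 0 := by nlinarith [abs_nonneg (f x)]
  exact abs_nonpos_iff.1 this

/-! ### The region bounded by a support surface -/

/-- The relative form allows a property to be propagated along a surface, where it is known only for
neighbouring points of that surface. -/
theorem constant_of_eventually_eq_within {X Y : Type*} [TopologicalSpace X] {A : Set X}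
    {s : X → Y} (hA : IsPreconnected A) (h : ∀ x ∈ A, ∀ᶠ y in 𝓝[A] x, s y = s x) {x y : X}
    (hx : x ∈ A) (hy : y ∈ A) : s x = s y := by
  let _ : TopologicalSpace Y := ⊥
  have _ : DiscreteTopology Y := ⟨rfl⟩
  refine hA.constant (f := s) (fun z hz => ?_) hx hy
  have : s =ᶠ[𝓝[A] z] fun _ => s z := h z hz
  exact (continuousWithinAt_const (b := s z)).congr_of_eventuallyEq this rfl

/-- On `U`, `S = {f = 0}` and `W = {f < 0}`, and `μ = ∇f/|∇f|` on `S`. -/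
structure IsInnerDefining (S : Set E3) (μ : E3 → E3) (W U : Set E3) (f : E3 → ℝ) : Prop where
  isOpen : IsOpen U
  smooth : ContDiffOn ℝ ∞ f U
  mem_surface : ∀ q ∈ U, q ∈ S ↔ f q = 0
  mem_inner : ∀ q ∈ U, q ∈ W ↔ f q < 0
  gradient_ne : ∀ q ∈ S ∩ U, gradient f q ≠ 0
  normal_eq : ∀ q ∈ S ∩ U, μ q = ‖gradient f q‖⁻¹ • gradient f q

/-- `W` is the component of `ℝ³ - S` which `μ` points out of. -/
structure IsInnerSide (S : Set E3) (μ : E3 → E3) (W : Set E3) : Prop where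
  isOpen : IsOpen W
  isPreconnected : IsPreconnected W
  disjoint : Disjoint S W
  region_eq : regionOf S μ = S ∪ W
  isClosed_union : IsClosed (S ∪ W)
  subset_of_preconnected : ∀ A, IsPreconnected A → Disjoint S A → (A ∩ W).Nonempty → A ⊆ W
  exists_defining : ∀ p ∈ S, ∃ U f, p ∈ U ∧ IsInnerDefining S μ W U f

/-- Moving against the direction of the gradient decreases a function. -/
theorem eventually_lt_of_inner_neg {f : E3 → ℝ} {q v : E3} (hf : DifferentiableAt ℝ f q)
    (h : inner ℝ (gradient f q) v < 0) : ∀ᶠ t : ℝ in 𝓝[>] 0, f (q + t • v) < f q := by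
  have hline : HasDerivAt (fun t : ℝ => q + t • v) v 0 := by
    simpa using ((hasDerivAt_id (0 : ℝ)).smul_const v).const_add q
  have hd : HasDerivAt (fun t : ℝ => f (q + t • v)) (fderiv ℝ f q v) 0 := by
    have hf' : HasFDerivAt f (fderiv ℝ f q) (q + (0 : ℝ) • v) := by simpa using hf.hasFDerivAt
    exact hf'.comp_hasDerivAt (0 : ℝ) hline
  rw [inner_gradient_left] at h
  have h1 := (hasDerivAt_iff_tendsto_slope.1 hd).mono_left
    (nhdsWithin_mono (0 : ℝ) (fun t (ht : 0 < t) => ht.ne'))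
  filter_upwards [h1.eventually_lt_const h, self_mem_nhdsWithin] with t ht ht0
  rw [slope_def_field, sub_zero, zero_smul, add_zero, div_lt_iff₀ ht0] at ht
  linarith

/-- A point outside the union lies in another component of `Sᶜ`, and components of an open set of
`ℝ³` are open. -/
theorem isClosed_union_component {S : Set E3} (hS : IsClosed S) (x : E3) :
    IsClosed (S ∪ connectedComponentIn Sᶜ x) := by
  rw [← isOpen_compl_iff, isOpen_iff_mem_nhds]
  intro y hy
  rw [compl_union] at hy
  have hopen : IsOpen (connectedComponentIn Sᶜ y) := hS.isOpen_compl.connectedComponentIn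
  refine mem_of_superset (hopen.mem_nhds (mem_connectedComponentIn hy.1)) fun z hz => ?_
  rw [compl_union]
  refine ⟨connectedComponentIn_subset _ _ hz, fun hzx => hy.2 ?_⟩
  rw [connectedComponentIn_eq hzx, ← connectedComponentIn_eq hz]
  exact mem_connectedComponentIn hy.1

theorem IsOrientedSurface.isFlatChart {S : Set E3} {μ : E3 → E3} (h : IsOrientedSurface S μ) :
    ∀ p ∈ S, ∃ e, IsFlatChart S p e := by
  intro p hp
  obtain ⟨U, f, hU, hpU, hf, hS, hg⟩ := h p hp
  obtain ⟨e, he, hef⟩ := exists_chart_single hU hpU hf (hg p ⟨hp, hpU⟩).1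
  exact ⟨e, he.mem, fun x hx => by rw [hef, hS x (he.subset hx)]⟩

/-- The component entered when leaving `S` against `μ` is locally constant along `S`, hence one
component `W` for all of the connected surface. The colouring excludes that `W` returns to the other
side of `S`: it is constant on `W` and changes across `S`. -/
theorem exists_isInnerSide {S : Set E3} {μ : E3 → E3} (hcl : IsClosed S) (hconn : IsConnected S)
    (hor : IsOrientedSurface S μ) : ∃ W, IsInnerSide S μ W := by
  obtain ⟨s, hs⟩ := exists_isColoring hcl hor.isFlatChart
  have hloc : ∀ p ∈ S, ∃ (N : Set E3) (f : E3 → ℝ), IsOpen N ∧ p ∈ N ∧ ContDiffOn ℝ ∞ f N ∧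
      (∀ q ∈ N, q ∈ S ↔ f q = 0) ∧
      (∀ q ∈ S ∩ N, gradient f q ≠ 0 ∧ μ q = ‖gradient f q‖⁻¹ • gradient f q) ∧
      IsPreconnected (N ∩ {x | f x < 0}) ∧
      ∃ c, ∀ x ∈ N, (f x < 0 → s x = c) ∧ (0 < f x → s x = c + 1) := by
    intro p hp
    obtain ⟨U, f, hU, hpU, hf, hS, hg⟩ := hor p hp
    obtain ⟨e, he, hef⟩ := exists_chart_single hU hpU hf (hg p ⟨hp, hpU⟩).1
    have hflat : IsFlatChart S p e := ⟨he.mem, fun x hx => by rw [hef, hS x (he.subset hx)]⟩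
    obtain ⟨c, hc⟩ := hs.exists_sides isOpen_univ hp (mem_univ p) hflat
    obtain ⟨N, hN, hNo, hpN, h1, -⟩ := e.exists_nhds_sides he.mem hc
    have hNU : N ⊆ U := fun x hx => he.subset (hN hx).2
    refine ⟨N, f, hNo, hpN, hf.mono hNU, fun q hq => hS q (hNU hq),
      fun q hq => hg q ⟨hq.1, hNU hq.2⟩, ?_, c, fun x hx => ?_⟩
    · simpa only [hef] using h1
    · simpa only [hef, mem_ofPred_eq] using (hN hx).1
  have hinner : ∀ q N (f : E3 → ℝ), q ∈ S → IsOpen N → q ∈ N → ContDiffOn ℝ ∞ f N →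
      (∀ q ∈ N, q ∈ S ↔ f q = 0) →
      (gradient f q ≠ 0 ∧ μ q = ‖gradient f q‖⁻¹ • gradient f q) →
      ∀ᶠ t : ℝ in 𝓝[>] 0, q - t • μ q ∈ N ∩ {x | f x < 0} := by
    intro q N f hqS hN hq hf hSf hg
    have hd : DifferentiableAt ℝ f q := (hf.contDiffAt (hN.mem_nhds hq)).differentiableAt (by simp)
    have h1 := eventually_lt_of_inner_neg (v := -μ q) hd (by
      rw [hg.2, inner_neg_right, inner_smul_right, real_inner_self_eq_norm_sq]
      have := norm_pos_iff.2 hg.1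
      have : 0 < ‖gradient f q‖⁻¹ * ‖gradient f q‖ ^ 2 := by positivity
      linarith)
    have h2 : ∀ᶠ t : ℝ in 𝓝[>] 0, q - t • μ q ∈ N := by
      have hc : ContinuousAt (fun t : ℝ => q - t • μ q) 0 := by fun_prop
      have h3 := hc.tendsto
      simp only [zero_smul, sub_zero] at h3
      exact (h3.mono_left nhdsWithin_le_nhds).eventually (hN.mem_nhds hq)
    filter_upwards [h1, h2] with t ht ht2
    refine ⟨ht2, ?_⟩
    rw [(hSf q hq).1 hqS, smul_neg, ← sub_eq_add_neg] at ht
    exact ht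
  obtain ⟨p₀, hp₀⟩ := hconn.nonempty
  obtain ⟨N₀, f₀, hN₀, hpN₀, hf₀, hS₀, hg₀, hpre₀, -⟩ := hloc p₀ hp₀
  obtain ⟨t₀, ht₀⟩ := (hinner p₀ N₀ f₀ hp₀ hN₀ hpN₀ hf₀ hS₀ (hg₀ p₀ ⟨hp₀, hpN₀⟩)).exists
  let x₀ := p₀ - t₀ • μ p₀
  have hx₀ : x₀ ∉ S := fun h => (ne_of_lt ht₀.2) ((hS₀ x₀ ht₀.1).1 h)
  let W := connectedComponentIn Sᶜ x₀
  have hWsub : ∀ A, IsPreconnected A → Disjoint S A → (A ∩ W).Nonempty → A ⊆ W := by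
    rintro A hA hAS ⟨y, hyA, hyW⟩
    have : W = connectedComponentIn Sᶜ y := connectedComponentIn_eq hyW
    rw [this]
    exact hA.subset_connectedComponentIn hyA (disjoint_right.1 hAS)
  let I : E3 → Prop := fun q => ∀ᶠ t : ℝ in 𝓝[>] 0, q - t • μ q ∈ W
  have hdisj : ∀ N (f : E3 → ℝ), (∀ q ∈ N, q ∈ S ↔ f q = 0) →
      Disjoint S (N ∩ {x | f x < 0}) := fun N f h =>
    disjoint_right.2 fun x hx hxS => (ne_of_lt hx.2) ((h x hx.1).1 hxS)
  -- In a chart neighbourhood the inner side is connected and disjoint from `S`, so it lies in `W`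
  -- as soon as it meets `W`. This makes `I` locally constant on `S`.
  have hIiff : ∀ p ∈ S, ∀ N (f : E3 → ℝ), IsOpen N → p ∈ N → ContDiffOn ℝ ∞ f N →
      (∀ q ∈ N, q ∈ S ↔ f q = 0) →
      (∀ q ∈ S ∩ N, gradient f q ≠ 0 ∧ μ q = ‖gradient f q‖⁻¹ • gradient f q) →
      IsPreconnected (N ∩ {x | f x < 0}) → (I p ↔ N ∩ {x | f x < 0} ⊆ W) := by
    intro p hp N f hN hpN hf hSf hg hpre
    have h := hinner p N f hp hN hpN hf hSf (hg p ⟨hp, hpN⟩)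
    constructor
    · intro hI
      obtain ⟨t, ht, ht'⟩ := (hI.and h).exists
      exact hWsub _ hpre (hdisj N f hSf) ⟨_, ht', ht⟩
    · intro hsub
      filter_upwards [h] with t ht using hsub ht
  have hIall : ∀ p ∈ S, I p := by
    intro p hp
    have hI0 : I p₀ := by
      rw [hIiff p₀ hp₀ N₀ f₀ hN₀ hpN₀ hf₀ hS₀ hg₀ hpre₀]
      exact hWsub _ hpre₀ (hdisj N₀ f₀ hS₀) ⟨x₀, ht₀, mem_connectedComponentIn hx₀⟩
    have : I p = I p₀ := by
      refine constant_of_eventually_eq_within hconn.isPreconnected (fun q hq => ?_) hp hp₀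
      obtain ⟨N, f, hN, hqN, hf, hSf, hg, hpre, -⟩ := hloc q hq
      filter_upwards [self_mem_nhdsWithin, mem_nhdsWithin_of_mem_nhds (hN.mem_nhds hqN)]
        with r hr hrN
      rw [eq_iff_iff, hIiff q hq N f hN hqN hf hSf hg hpre, hIiff r hr N f hN hrN hf hSf hg hpre]
    rw [this]; exact hI0
  have hWo : IsOpen W := hcl.isOpen_compl.connectedComponentIn
  have hWp : IsPreconnected W := isPreconnected_connectedComponentIn
  have hWS : Disjoint S W := disjoint_right.2 fun x hx => connectedComponentIn_subset _ _ hx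
  refine ⟨W, hWo, hWp, hWS, ?_, isClosed_union_component hcl x₀, hWsub, fun p hp => ?_⟩
  · refine congrArg (S ∪ ·) (Set.ext fun x => ⟨?_, fun hx => ?_⟩)
    · rintro ⟨p, hp, ε, hε, h⟩
      obtain ⟨t, ht, ht'⟩ := ((hIall p hp).and (Ioo_mem_nhdsGT hε)).exists
      have h1 := h t ht'
      have : W = connectedComponentIn Sᶜ (p - t • μ p) := connectedComponentIn_eq ht
      rwa [this]
    · obtain ⟨ε, hε, h⟩ := mem_nhdsGT_iff_exists_Ioo_subset.1 (hIall p₀ hp₀)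
      refine ⟨p₀, hp₀, ε, hε, fun t ht => ?_⟩
      rw [← connectedComponentIn_eq (h ht)]
      exact hx
  · obtain ⟨N, f, hN, hpN, hf, hSf, hg, hpre, c, hc⟩ := hloc p hp
    have hsub := (hIiff p hp N f hN hpN hf hSf hg hpre).1 (hIall p hp)
    refine ⟨N, f, hpN, hN, hf, hSf, fun q hq => ⟨fun hqW => ?_, fun h => hsub ⟨hq, h⟩⟩,
      fun q hq => (hg q hq).1, fun q hq => (hg q hq).2⟩
    -- A point of `W` with `f > 0` has colour `c + 1`, while the points of `W` just behind `p` have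
    -- colour `c`.
    by_contra! hfq
    have hne : f q ≠ 0 := fun h => disjoint_right.1 hWS hqW ((hSf q hq).2 h)
    have h1 := (hc q hq).2 (lt_of_le_of_ne hfq hne.symm)
    obtain ⟨t, ht, ht'⟩ := ((hIall p hp).and (hinner p N f hp hN hpN hf hSf (hg p ⟨hp, hpN⟩))).exists
    have h2 := (hc _ ht'.1).1 ht'.2
    have h3 := constant_of_eventually_eq hWp (fun z hz =>
      hs.eventually_eq z ⟨mem_univ z, disjoint_right.1 hWS hz⟩) hqW ht
    rw [h1, h2] at h3
    exact ZMod.add_one_ne_two c h3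

namespace IsInnerSide

variable {S W : Set E3} {μ : E3 → E3}

theorem mem_region_iff (h : IsInnerSide S μ W) {U : Set E3} {f : E3 → ℝ}
    (hf : IsInnerDefining S μ W U f) {q : E3} (hq : q ∈ U) : q ∈ regionOf S μ ↔ f q ≤ 0 := by
  rw [h.region_eq, mem_union, hf.mem_surface q hq, hf.mem_inner q hq, le_iff_lt_or_eq, or_comm]

/-- Otherwise the defining function would be non-positive around `p` with value `0` at `p`, and its
gradient would vanish at this maximum. -/
theorem notMem_interior (h : IsInnerSide S μ W) {p : E3} (hp : p ∈ S) :
    p ∉ interior (regionOf S μ) := by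
  intro hpi
  obtain ⟨U, f, hpU, hf⟩ := h.exists_defining p hp
  have hd : DifferentiableAt ℝ f p :=
    (hf.smooth.contDiffAt (hf.isOpen.mem_nhds hpU)).differentiableAt (by simp)
  have hne := hf.gradient_ne p ⟨hp, hpU⟩
  have hmax : IsLocalMax f p := by
    filter_upwards [mem_interior_iff_mem_nhds.1 hpi, hf.isOpen.mem_nhds hpU] with x hx hxU
    rw [(hf.mem_surface p hpU).1 hp]
    exact (h.mem_region_iff hf hxU).1 hx
  apply hne
  rw [gradient, hmax.fderiv_eq_zero, map_zero]

theorem interior_eq (h : IsInnerSide S μ W) : interior (regionOf S μ) = W := by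
  refine Subset.antisymm (fun x hx => ?_) ?_
  · have := interior_subset hx
    rw [h.region_eq] at this
    exact this.resolve_left fun hxS => h.notMem_interior hxS hx
  · exact interior_maximal (by rw [h.region_eq]; exact subset_union_right) h.isOpen

theorem isClosed_region (h : IsInnerSide S μ W) : IsClosed (regionOf S μ) := by
  rw [h.region_eq]; exact h.isClosed_union

theorem isSmoothDomain (h : IsInnerSide S μ W) : IsSmoothDomain (regionOf S μ) := by
  intro p hp
  rw [h.region_eq] at hp
  rcases hp with hp | hp
  · right
    obtain ⟨U, f, hpU, hf⟩ := h.exists_defining p hp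
    exact ⟨U, f, hf.isOpen, hpU, hf.smooth, (hf.mem_surface p hpU).1 hp,
      hf.gradient_ne p ⟨hp, hpU⟩, fun q hq => h.mem_region_iff hf hq⟩
  · left
    rwa [h.interior_eq]

theorem domainBoundary_eq (h : IsInnerSide S μ W) : domainBoundary (regionOf S μ) = S := by
  rw [domainBoundary, h.interior_eq, h.region_eq]
  ext x
  constructor
  · rintro ⟨h1 | h1, h2⟩
    · exact h1
    · exact absurd h1 h2
  · exact fun hx => ⟨Or.inl hx, disjoint_left.1 h.disjoint hx⟩

end IsInnerSide

/-! ### Local models of free boundary surfaces -/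

theorem gradient_sub' {f g : E3 → ℝ} {p : E3} (hf : DifferentiableAt ℝ f p)
    (hg : DifferentiableAt ℝ g p) :
    gradient (fun x => f x - g x) p = gradient f p - gradient g p := by
  refine ext_inner_right ℝ fun v => ?_
  rw [inner_sub_left, inner_gradient_left, inner_gradient_left, inner_gradient_left,
    fderiv_fun_sub hf hg]
  rfl

theorem linearIndependent_pair_of_inner_eq_zero {a b : E3} (ha : a ≠ 0) (hb : b ≠ 0)
    (h : inner ℝ a b = 0) : LinearIndependent ℝ ![a, b] := by
  rw [LinearIndependent.pair_iff' ha]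
  rintro c rfl
  rw [inner_smul_right] at h
  rcases mul_eq_zero.1 h with h | h
  · exact hb (by rw [h, zero_smul])
  · exact ha (inner_self_eq_zero.1 h)

theorem ContDiffOn.continuousOn_gradient {f : E3 → ℝ} {U : Set E3} (hf : ContDiffOn ℝ ∞ f U)
    (hU : IsOpen U) : ContinuousOn (gradient f) U :=
  (InnerProductSpace.toDual ℝ E3).symm.continuous.comp_continuousOn
    (hf.continuousOn_fderiv_of_isOpen hU (by simp))

theorem LinearIndependent.eventually_gradient {f h : E3 → ℝ} {U : Set E3} {p : E3}
    (hli : LinearIndependent ℝ ![gradient f p, gradient h p]) (hU : IsOpen U) (hp : p ∈ U)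
    (hf : ContDiffOn ℝ ∞ f U) (hh : ContDiffOn ℝ ∞ h U) :
    ∀ᶠ x in 𝓝 p, LinearIndependent ℝ ![gradient f x, gradient h x] := by
  have h1 := (hf.continuousOn_gradient hU).continuousAt (hU.mem_nhds hp)
  have h2 := (hh.continuousOn_gradient hU).continuousAt (hU.mem_nhds hp)
  have h3 : ContinuousAt (fun x => ![gradient f x, gradient h x]) p := by
    rw [continuousAt_pi]
    intro i
    fin_cases i
    · exact h1
    · exact h2
  exact h3.tendsto.eventually (isOpen_setOfPred_linearIndependent.mem_nhds hli)

/-- Consider the surface `{f = 0}` with the transversal function `σ`. If `h` cuts out a piece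
`{h ≥ 0}` of it with boundary `{h = 0}`, which lies in `{σ ≤ 0}` with boundary in `{σ = 0}`, then
this piece is `{σ ≤ 0}`. -/
theorem eventually_nonneg_iff_nonpos {f h σ : E3 → ℝ} {U : Set E3} {p : E3} (hU : IsOpen U)
    (hp : p ∈ U) (hf : ContDiffOn ℝ ∞ f U) (hh : ContDiffOn ℝ ∞ h U) (hσ : ContDiffOn ℝ ∞ σ U)
    (hfp : f p = 0) (hhp : h p = 0)
    (hfh : LinearIndependent ℝ ![gradient f p, gradient h p])
    (hσf : LinearIndependent ℝ ![gradient σ p, gradient f p])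
    (hle : ∀ᶠ x in 𝓝 p, f x = 0 → 0 ≤ h x → σ x ≤ 0)
    (heq : ∀ᶠ x in 𝓝 p, f x = 0 → h x = 0 → σ x = 0) :
    ∀ᶠ x in 𝓝 p, f x = 0 → (0 ≤ h x ↔ σ x ≤ 0) := by
  obtain ⟨e, he, hσfe⟩ := exists_chart_pair hU hp hσ hf hσf
  have hpt : e p ∈ e.target := e.map_source he.mem
  -- In the chart with coordinates `σ` and `f`, setting the coordinate `f` to zero gives a
  -- retraction `π` to `{f = 0}` which preserves `σ`. With `k = h ∘ π` the statement concerns `k`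
  -- and `σ` in a full neighbourhood.
  let P : E3 → E3 := fun y => y - y 1 • EuclideanSpace.single 1 1
  have hP : ContDiff ℝ ∞ P := by
    have h1 : ContDiff ℝ ∞ fun y : E3 => y 1 :=
      (EuclideanSpace.proj (𝕜 := ℝ) (1 : Fin 3)).contDiff
    exact contDiff_id.sub (h1.smul contDiff_const)
  have hPp : P (e p) = e p := by simp [P, hσfe, hfp]
  let V : Set E3 := e.source ∩ (fun x => P (e x)) ⁻¹' e.target
  have hPe : ContDiffOn ℝ ∞ (fun x => P (e x)) e.source := hP.comp_contDiffOn he.smooth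
  have hV : IsOpen V := hPe.continuousOn.isOpen_inter_preimage e.open_source e.open_target
  have hpV : p ∈ V := ⟨he.mem, by rw [mem_preimage, hPp]; exact hpt⟩
  let π : E3 → E3 := fun x => e.symm (P (e x))
  have hπ : ContDiffOn ℝ ∞ π V := by
    refine he.smooth_symm.comp (hPe.mono inter_subset_left) fun x hx => hx.2
  have hπU : MapsTo π V U := fun x hx => he.subset (e.map_target hx.2)
  have hπp : π p = p := by simp only [π]; rw [hPp, e.left_inv he.mem]
  have hπσ : ∀ x ∈ V, σ (π x) = σ x := fun x hx => by
    rw [← (hσfe _).1, e.right_inv hx.2]; simp [P, hσfe]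
  have hπf : ∀ x ∈ V, f (π x) = 0 := fun x hx => by
    rw [← (hσfe _).2, e.right_inv hx.2]; simp [P]
  have hπid : ∀ x ∈ V, f x = 0 → π x = x := fun x hx h0 => by
    have : P (e x) = e x := by simp [P, hσfe, h0]
    simp only [π]; rw [this, e.left_inv hx.1]
  have hπt : Tendsto π (𝓝 p) (𝓝 p) := by
    have := (hπ.continuousOn.continuousAt (hV.mem_nhds hpV)).tendsto
    rwa [hπp] at this
  let k : E3 → ℝ := fun x => h (π x)
  have hVU : V ⊆ U := fun x hx => he.subset hx.1
  have hk : ContDiffOn ℝ ∞ k V := hh.comp hπ hπU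
  have hd : ∀ {g : E3 → ℝ} {O : Set E3}, IsOpen O → p ∈ O → ContDiffOn ℝ ∞ g O →
      DifferentiableAt ℝ g p := fun hO hpO hg =>
    (hg.contDiffAt (hO.mem_nhds hpO)).differentiableAt (by simp)
  -- `h - k` vanishes on `{f = 0}`, so its gradient is parallel to that of `f`. If `k` had zero
  -- gradient, this would contradict the independence of the gradients of `f` and `h`.
  have hk0 : gradient k p ≠ 0 := by
    intro hk0
    obtain ⟨c, hc⟩ := exists_gradient_eq_smul (g := fun x => h x - k x) hV hpV (hf.mono hVU)
      (hh.mono hVU) ((hh.mono hVU).sub hk) hfp hhp.ge hfh (by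
        filter_upwards [hV.mem_nhds hpV] with x hx h0 _
        simp only [k]; rw [hπid x hx h0, sub_self])
    rw [gradient_sub' (hd hU hp hh) (hd hV hpV hk), hk0, sub_zero] at hc
    have hf0 : gradient f p ≠ 0 := hfh.ne_zero 0
    exact (LinearIndependent.pair_iff' hf0).1 hfh c hc.symm
  have hσ0 : gradient σ p ≠ 0 := hσf.ne_zero 0
  have hkp : k p = 0 := by simp only [k]; rw [hπp, hhp]
  have hVev : ∀ᶠ x in 𝓝 p, x ∈ V := hV.mem_nhds hpV
  have hkσ : ∀ᶠ x in 𝓝 p, k x = 0 → σ x = 0 := by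
    filter_upwards [hπt.eventually heq, hVev] with x hx hxV h0
    rw [← hπσ x hxV]
    exact hx (hπf x hxV) h0
  have hkle : ∀ᶠ x in 𝓝 p, 0 ≤ k x → σ x ≤ 0 := by
    filter_upwards [hπt.eventually hle, hVev] with x hx hxV h0
    rw [← hπσ x hxV]
    exact hx (hπf x hxV) h0
  have hσk : ∀ᶠ x in 𝓝 p, σ x = 0 → k x = 0 :=
    eventually_eq_zero_of_subset hV hpV hk (hσ.mono hVU) hkp hk0 hσ0 hkσ
  obtain ⟨N, hN, hNo, hpN, hneg, -⟩ := e.exists_nhds_sides he.mem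
    (inter_mem (inter_mem hkσ hkle) (inter_mem hσk hVev))
  have hside : N ∩ {x | e x 0 < 0} = N ∩ {x | σ x < 0} := by simp only [hσfe]
  rw [hside] at hneg
  -- On the connected side `{σ < 0}` the function `k` has no zero. If it were non-positive at one
  -- point there, it would be non-positive near `p`, and `p` would be a maximum with non-zero
  -- gradient.
  have hpos : ∀ x ∈ N, σ x < 0 → 0 < k x := by
    by_contra! hcon
    obtain ⟨x, hx, hσx, hkx⟩ := hcon
    have hall : ∀ y ∈ N, k y ≤ 0 := by
      intro y hy
      by_contra! hky
      have hσy : σ y ≤ 0 := (hN hy).1.1.2 hky.le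
      have hσy' : σ y ≠ 0 := fun h0 => hky.ne' ((hN hy).1.2.1 h0)
      obtain ⟨z, hz, hz0⟩ := hneg.intermediate_value₂ (f := k) (g := fun _ => 0) ⟨hx, hσx⟩
        ⟨hy, lt_of_le_of_ne hσy hσy'⟩
        (hk.continuousOn.mono fun z hz => (hN hz.1).1.2.2) continuousOn_const hkx hky.le
      exact hz.2.ne ((hN hz.1).1.1.1 hz0)
    apply hk0
    have hmax : IsLocalMax k p := by
      filter_upwards [hNo.mem_nhds hpN] with y hy
      rw [hkp]; exact hall y hy
    rw [gradient, hmax.fderiv_eq_zero, map_zero]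
  filter_upwards [hNo.mem_nhds hpN] with x hx h0
  have hkx : k x = h x := by simp only [k]; rw [hπid x (hN hx).1.2.2 h0]
  rw [← hkx]
  refine ⟨(hN hx).1.1.2, fun hσx => ?_⟩
  rcases hσx.lt_or_eq with h1 | h1
  · exact (hpos x hx h1).le
  · exact ((hN hx).1.2.1 h1).ge

/-- Near a boundary point, a free boundary surface is the half-plane `{x₂ = 0, x₁ ≤ 0}` in a chart
in which `W` is the half-space `{x₁ < 0}`. -/
theorem IsFreeBoundarySurface.exists_chart {S W X : Set E3} {μ : E3 → E3}
    (hW : IsInnerSide S μ W) (hX : IsFreeBoundarySurface S μ X) {p : E3}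
    (hp : p ∈ surfaceBoundary X) :
    ∃ e : OpenPartialHomeomorph E3 E3, p ∈ e.source ∧ ∀ x ∈ e.source, (x ∈ S ↔ e x 0 = 0) ∧
      (x ∈ W ↔ e x 0 < 0) ∧ (x ∈ X ↔ e x 1 = 0 ∧ e x 0 ≤ 0) := by
  have hpX : p ∈ X ∩ S := by rw [hX.inter_eq]; exact hp
  obtain ⟨U₂, g, hpU₂, ⟨hU₂, hg, hgX⟩, horth⟩ := hX.orthogonal p hp
  obtain ⟨U₃, σ, hpU₃, hσ⟩ := hW.exists_defining p hpX.2
  have hp' := hp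
  obtain ⟨-, U₁, f, h, hpU₁, ⟨hU₁, hf, hfX⟩, hh, hhp, hli, hXiff⟩ := hp'
  let U := U₁ ∩ (U₂ ∩ U₃)
  have hU : IsOpen U := hU₁.inter (hU₂.inter hσ.isOpen)
  have hpU : p ∈ U := ⟨hpU₁, hpU₂, hpU₃⟩
  have hf' := hf.mono (inter_subset_left : U ⊆ U₁)
  have hh' := hh.mono (inter_subset_left : U ⊆ U₁)
  have hg' := hg.mono (fun x hx => hx.2.1 : U ⊆ U₂)
  have hσ' := hσ.smooth.mono (fun x hx => hx.2.2 : U ⊆ U₃)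
  have hfp : f p = 0 := (hfX p ⟨hpX.1, hpU₁⟩).1
  have hf0 := (hfX p ⟨hpX.1, hpU₁⟩).2
  have hσ0 := hσ.gradient_ne p ⟨hpX.2, hpU₃⟩
  -- Orthogonality is known for one defining function `g`, the half-plane structure for another,
  -- `f`. Their gradients at `p` are parallel, so `f` inherits orthogonality and `X` is transversal
  -- to `S`.
  obtain ⟨c, hc⟩ := exists_gradient_eq_smul hU hpU hf' hh' hg' hfp hhp.ge hli (by
    filter_upwards [hU.mem_nhds hpU] with x hx h1 h2
    exact (hgX x ⟨(hXiff x hx.1).2 ⟨h1, h2⟩, hx.2.1⟩).1)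
  have hc0 : c ≠ 0 := fun h0 => (hgX p ⟨hpX.1, hpU₂⟩).2 (by rw [hc, h0, zero_smul])
  have hσf : LinearIndependent ℝ ![gradient σ p, gradient f p] := by
    refine linearIndependent_pair_of_inner_eq_zero hσ0 hf0 ?_
    rw [hc, hσ.normal_eq p ⟨hpX.2, hpU₃⟩, inner_smul_left, inner_smul_right] at horth
    have h1 : ‖gradient σ p‖⁻¹ ≠ 0 := inv_ne_zero (norm_ne_zero_iff.2 hσ0)
    have h2 : inner ℝ (gradient f p) (gradient σ p) = 0 := by
      simpa [hc0, h1, norm_ne_zero_iff.2 hσ0, hσ0] using horth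
    rw [real_inner_comm]; exact h2
  have key := eventually_nonneg_iff_nonpos hU hpU hf' hh' hσ' hfp hhp hli hσf (by
      filter_upwards [hU.mem_nhds hpU] with x hx h1 h2
      exact (hW.mem_region_iff hσ hx.2.2).1 (hX.subset ((hXiff x hx.1).2 ⟨h1, h2⟩)))
    (by
      filter_upwards [hU.mem_nhds hpU, hli.eventually_gradient hU hpU hf' hh'] with x hx hxli h1 h2
      have hxX : x ∈ X := (hXiff x hx.1).2 ⟨h1, h2.ge⟩
      have : x ∈ surfaceBoundary X := ⟨hxX, U₁, f, h, hx.1, ⟨hU₁, hf, hfX⟩, hh, h2, hxli, hXiff⟩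
      rw [← hX.inter_eq] at this
      exact (hσ.mem_surface x hx.2.2).1 this.2)
  obtain ⟨N, hN, hNo, hpN⟩ := mem_nhds_iff.1 key
  obtain ⟨e, he, hee⟩ := exists_chart_pair (hU.inter hNo) ⟨hpU, hpN⟩
    (hσ'.mono inter_subset_left) (hf'.mono inter_subset_left) hσf
  refine ⟨e, he.mem, fun x hx => ?_⟩
  have hxU := he.subset hx
  rw [(hee x).1, (hee x).2]
  refine ⟨hσ.mem_surface x hxU.1.2.2, hσ.mem_inner x hxU.1.2.2, ?_⟩
  rw [hXiff x hxU.1.1]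
  exact and_congr_right fun h0 => hN hxU.2 h0

theorem IsInteriorPt.exists_flatChart {X : Set E3} {p : E3} (h : IsInteriorPt X p) :
    ∃ e, IsFlatChart X p e := by
  obtain ⟨hpX, U, f, hpU, ⟨hU, hf, hfX⟩, hiff⟩ := h
  obtain ⟨e, he, hef⟩ := exists_chart_single hU hpU hf (hfX p ⟨hpX, hpU⟩).2
  exact ⟨e, he.mem, fun x hx => by rw [hef, hiff x (he.subset hx)]⟩

/-- The homeomorphism of `ℝ³` which unfolds the quadrant `{x₁ < 0 < x₂}` to a half-space. -/
noncomputable def unfoldQuadrant : E3 ≃ₜ E3 where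
  -- The maximum is negative exactly in the quadrant and vanishes exactly on its boundary; the sum
  -- is a coordinate along that boundary.
  toFun y := !₂[max (y 0) (-(y 1)), y 0 + y 1, y 2]
  invFun z := !₂[z 0 + min (z 1) 0, max (z 1) 0 - z 0, z 2]
  left_inv y := by
    ext i
    fin_cases i
    · simp only [Fin.zero_eta, Matrix.cons_val]
      rcases le_total (y 0) (-(y 1)) with h | h
      · rw [max_eq_right h, min_eq_left (by linarith)]; ring
      · rw [max_eq_left h, min_eq_right (by linarith)]; ring
    · simp only [Fin.mk_one, Matrix.cons_val]
      rcases le_total (y 0) (-(y 1)) with h | h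
      · rw [max_eq_right h, max_eq_right (by linarith)]; ring
      · rw [max_eq_left h, max_eq_left (by linarith)]; ring
    · rfl
  right_inv z := by
    ext i
    fin_cases i
    · simp only [Fin.zero_eta, Matrix.cons_val]
      rcases le_total (z 1) 0 with h | h
      · rw [min_eq_left h, max_eq_right h, max_eq_right (by linarith)]; ring
      · rw [min_eq_right h, max_eq_left h, max_eq_left (by linarith)]; ring
    · simp only [Fin.mk_one, Matrix.cons_val]
      linarith [min_add_max (z 1) 0]
    · rfl
  continuous_toFun := by
    refine (PiLp.continuous_toLp 2 _).comp (continuous_pi fun i => ?_)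
    fin_cases i
    · exact Continuous.max (by fun_prop) (by fun_prop)
    · exact Continuous.add (by fun_prop) (by fun_prop)
    · show Continuous fun y : E3 => y 2
      fun_prop
  continuous_invFun := by
    refine (PiLp.continuous_toLp 2 _).comp (continuous_pi fun i => ?_)
    fin_cases i
    · exact Continuous.add (by fun_prop) (Continuous.min (by fun_prop) (by fun_prop))
    · exact Continuous.sub (Continuous.max (by fun_prop) (by fun_prop)) (by fun_prop)
    · show Continuous fun y : E3 => y 2
      fun_prop

/-! ### Exterior regions from exterior surfaces -/

/-- `S'` is a closed piece of `S` whose relative boundary is the union of the boundaries of the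
members of the finite disjoint family `𝓕` of free boundary surfaces. -/
structure IsCutBy (S : Set E3) (μ : E3 → E3) (W S' : Set E3) (𝓕 : Set (Set E3)) : Prop where
  inner : IsInnerSide S μ W
  isClosed_surface : IsClosed S
  isConnected_surface : IsConnected S
  subset : S' ⊆ S
  isClosed : IsClosed S'
  isConnected : IsConnected S'
  not_isCompact : ¬ IsCompact S'
  finite : 𝓕.Finite
  pairwiseDisjoint : 𝓕.PairwiseDisjoint id
  freeBoundary : ∀ X ∈ 𝓕, IsFreeBoundarySurface S μ X
  boundary_eq : (⋃ X ∈ 𝓕, surfaceBoundary X) = S' ∩ closure (S \ S')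

namespace IsCutBy

variable {S W S' : Set E3} {μ : E3 → E3} {𝓕 : Set (Set E3)}

theorem isCompact_sUnion (h : IsCutBy S μ W S' 𝓕) : IsCompact (⋃₀ 𝓕) :=
  h.finite.isCompact_sUnion fun X hX => (h.freeBoundary X hX).compact

theorem isClosed_sUnion (h : IsCutBy S μ W S' 𝓕) : IsClosed (⋃₀ 𝓕) := h.isCompact_sUnion.isClosed

theorem sUnion_inter (h : IsCutBy S μ W S' 𝓕) : ⋃₀ 𝓕 ∩ S = S' ∩ closure (S \ S') := by
  rw [← h.boundary_eq]
  ext x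
  simp only [mem_inter_iff, mem_sUnion, mem_iUnion, exists_prop]
  constructor
  · rintro ⟨⟨X, hX, hx⟩, hxS⟩
    exact ⟨X, hX, by rw [← (h.freeBoundary X hX).inter_eq]; exact ⟨hx, hxS⟩⟩
  · rintro ⟨X, hX, hx⟩
    rw [← (h.freeBoundary X hX).inter_eq] at hx
    exact ⟨⟨X, hX, hx.1⟩, hx.2⟩

theorem mem_of_mem_sUnion (h : IsCutBy S μ W S' 𝓕) {x : E3} (hx : x ∈ ⋃₀ 𝓕) (hS : x ∈ S) :
    x ∈ S' := by
  have : x ∈ ⋃₀ 𝓕 ∩ S := ⟨hx, hS⟩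
  rw [h.sUnion_inter] at this
  exact this.1

/-- The other members of the finite disjoint family form a compact set which avoids `p`. -/
theorem eventually_mem_sUnion_iff (h : IsCutBy S μ W S' 𝓕) {X : Set E3} (hX : X ∈ 𝓕) {p : E3}
    (hp : p ∈ X) : ∀ᶠ x in 𝓝 p, x ∈ ⋃₀ 𝓕 ↔ x ∈ X := by
  have hcl : IsClosed (⋃₀ (𝓕 \ {X})) :=
    ((h.finite.subset sdiff_subset).isCompact_sUnion
      fun Y hY => (h.freeBoundary Y hY.1).compact).isClosed
  have hpn : p ∉ ⋃₀ (𝓕 \ {X}) := by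
    rintro ⟨Y, ⟨hY, hYX⟩, hpY⟩
    exact disjoint_left.1 (h.pairwiseDisjoint hY hX hYX) hpY hp
  filter_upwards [hcl.isOpen_compl.mem_nhds hpn] with x hx
  refine ⟨?_, fun hxX => ⟨X, hX, hxX⟩⟩
  rintro ⟨Y, hY, hxY⟩
  by_contra hxX
  exact hx ⟨Y, ⟨hY, fun hYX => hxX (hYX ▸ hxY)⟩, hxY⟩

/-- Away from its relative boundary, `S'` agrees with `S`. -/
theorem eventually_mem_iff (h : IsCutBy S μ W S' 𝓕) {p : E3} (hp : p ∈ S') (hpF : p ∉ ⋃₀ 𝓕) :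
    ∀ᶠ x in 𝓝 p, (x ∈ S' ↔ x ∈ S) ∧ x ∉ ⋃₀ 𝓕 := by
  have hpc : p ∉ closure (S \ S') := fun hc => by
    have : p ∈ ⋃₀ 𝓕 ∩ S := by rw [h.sUnion_inter]; exact ⟨hp, hc⟩
    exact hpF this.1
  filter_upwards [isClosed_closure.isOpen_compl.mem_nhds hpc,
    h.isClosed_sUnion.isOpen_compl.mem_nhds hpF] with x hx hxF
  refine ⟨⟨fun hxS' => h.subset hxS', fun hxS => ?_⟩, hxF⟩
  by_contra hxS'
  exact hx (subset_closure ⟨hxS, hxS'⟩)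

/-- Near a point of the relative boundary of `S'`, either `S'` reduces to its relative boundary,
or it is the half-plane `{x₁ = 0, x₂ ≥ 0}` in a suitable chart. -/
theorem exists_boundary_chart (h : IsCutBy S μ W S' 𝓕) {p : E3} (hp : p ∈ S')
    (hpF : p ∈ ⋃₀ 𝓕) :
    (∀ᶠ x in 𝓝 p, x ∈ S' → x ∈ ⋃₀ 𝓕) ∨
    ∃ e : OpenPartialHomeomorph E3 E3, p ∈ e.source ∧ ∀ x ∈ e.source, (x ∈ S ↔ e x 0 = 0) ∧
      (x ∈ W ↔ e x 0 < 0) ∧ (x ∈ ⋃₀ 𝓕 ↔ e x 1 = 0 ∧ e x 0 ≤ 0) ∧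
      (x ∈ S' ↔ e x 0 = 0 ∧ 0 ≤ e x 1) := by
  obtain ⟨X, hX, hpX⟩ := hpF
  have hpS := h.subset hp
  have hpb : p ∈ surfaceBoundary X := by
    rw [← (h.freeBoundary X hX).inter_eq]; exact ⟨hpX, hpS⟩
  obtain ⟨e, hpe, he⟩ := (h.freeBoundary X hX).exists_chart h.inner hpb
  obtain ⟨N, hN, hNo, hpN, hconv⟩ := e.exists_nhds_convex hpe (h.eventually_mem_sUnion_iff hX hpX)
  have heF : ∀ x ∈ N, x ∈ ⋃₀ 𝓕 ↔ e x 1 = 0 ∧ e x 0 ≤ 0 := fun x hx => by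
    have h1 : x ∈ ⋃₀ 𝓕 ↔ x ∈ X := (hN hx).1
    rw [h1]; exact (he x (hN hx).2).2.2
  have hzero : ∀ x ∈ N, e x 0 = 0 → e x 1 = 0 → x ∈ S' := fun x hx h0 h1 =>
    h.mem_of_mem_sUnion ((heF x hx).2 ⟨h1, h0.le⟩) ((he x (hN hx).2).1.2 h0)
  -- Away from the surfaces, `S'` is both open and closed in `S`. Each half of `S ∩ N` cut off by
  -- the surface therefore lies in `S'` entirely or not at all.
  have hside : ∀ A ⊆ N, IsPreconnected A → (∀ x ∈ A, e x 0 = 0 ∧ e x 1 ≠ 0) →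
      ∀ x ∈ A, ∀ y ∈ A, x ∈ S' → y ∈ S' := by
    intro A hA hAp hA0 x hx y hy hxS'
    have := constant_of_eventually_eq_within (s := fun z => z ∈ S') hAp (fun z hz => by
      have hzF : z ∉ ⋃₀ 𝓕 := fun hzF => (hA0 z hz).2 ((heF z (hA hz)).1 hzF).1
      have hzS : ∀ w ∈ A, w ∈ S := fun w hw => (he w (hN (hA hw)).2).1.2 (hA0 w hw).1
      by_cases hz' : z ∈ S'
      · filter_upwards [self_mem_nhdsWithin, mem_nhdsWithin_of_mem_nhds
          (h.eventually_mem_iff hz' hzF)] with w hw hw2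
        exact propext ⟨fun _ => hz', fun _ => hw2.1.2 (hzS w hw)⟩
      · filter_upwards [mem_nhdsWithin_of_mem_nhds (h.isClosed.isOpen_compl.mem_nhds hz')]
          with w hw
        exact propext ⟨fun h1 => absurd h1 hw, fun h1 => absurd h1 hz'⟩) hx hy
    exact (iff_of_eq this).1 hxS'
  have hc0 : Convex ℝ {x : E3 | x 0 = 0} := convex_hyperplane (isLinearMap_coord 0) 0
  have hside1 : ∀ x ∈ N, ∀ y ∈ N, e x 0 = 0 → e y 0 = 0 → 0 < e x 1 → 0 < e y 1 → x ∈ S' →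
      y ∈ S' := fun x hx y hy hx0 hy0 hx1 hy1 =>
    hside _ inter_subset_left
      (hconv _ (hc0.inter (convex_halfSpace_gt (isLinearMap_coord 1) 0)))
      (fun z hz => ⟨hz.2.1, (ne_of_gt hz.2.2)⟩) x ⟨hx, hx0, hx1⟩ y ⟨hy, hy0, hy1⟩
  have hside2 : ∀ x ∈ N, ∀ y ∈ N, e x 0 = 0 → e y 0 = 0 → e x 1 < 0 → e y 1 < 0 → x ∈ S' →
      y ∈ S' := fun x hx y hy hx0 hy0 hx1 hy1 =>
    hside _ inter_subset_left
      (hconv _ (hc0.inter (convex_halfSpace_lt (isLinearMap_coord 1) 0)))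
      (fun z hz => ⟨hz.2.1, (ne_of_lt hz.2.2)⟩) x ⟨hx, hx0, hx1⟩ y ⟨hy, hy0, hy1⟩
  -- A relative boundary point is a limit of points of `S` outside `S'`, so at least one of the two
  -- halves is missing from `S'`.
  have hpc : p ∈ closure (S \ S') := by
    have : p ∈ ⋃₀ 𝓕 ∩ S := ⟨⟨X, hX, hpX⟩, hpS⟩
    rw [h.sUnion_inter] at this; exact this.2
  obtain ⟨y, hyN, hyS, hyS'⟩ := mem_closure_iff.1 hpc N hNo hpN
  have hy0 : e y 0 = 0 := (he y (hN hyN).2).1.1 hyS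
  have hy1 : e y 1 ≠ 0 := fun h1 => hyS' (hzero y hyN hy0 h1)
  by_cases hex : ∃ x ∈ N, x ∈ S' ∧ e x 1 ≠ 0
  · right
    obtain ⟨x, hxN, hxS', hx1⟩ := hex
    have hx0 : e x 0 = 0 := (he x (hN hxN).2).1.1 (h.subset hxS')
    have hNs : N ⊆ e.source := fun z hz => (hN hz).2
    rcases lt_or_gt_of_ne hx1 with hx1 | hx1
    · have hy1' : 0 < e y 1 := by
        by_contra! hle
        exact hyS' (hside2 x hxN y hyN hx0 hy0 hx1 (lt_of_le_of_ne hle hy1) hxS')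
      -- The half in `S'` is the negative one, and a reflection of the second coordinate exchanges
      -- the halves.
      let R : E3 ≃ₜ E3 := (LinearIsometryEquiv.piLpCongrRight 2 (fun i : Fin 3 =>
        if i = 1 then LinearIsometryEquiv.neg ℝ else LinearIsometryEquiv.refl ℝ ℝ)).toHomeomorph
      have hR0 : ∀ z, R z 0 = z 0 := fun z => rfl
      have hR1 : ∀ z, R z 1 = -(z 1) := fun z => rfl
      refine ⟨(e.restrOpen N hNo).transHomeomorph R, ⟨hpe, hpN⟩, fun z hz => ?_⟩
      have hzN : z ∈ N := hz.2
      have hz0 : ((e.restrOpen N hNo).transHomeomorph R) z 0 = e z 0 := rfl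
      have hz1 : ((e.restrOpen N hNo).transHomeomorph R) z 1 = -(e z 1) := rfl
      rw [hz0, hz1, neg_eq_zero, Left.nonneg_neg_iff]
      refine ⟨(he z hz.1).1, (he z hz.1).2.1, heF z hzN, fun hzS' => ?_, fun ⟨h0, h1⟩ => ?_⟩
      · have h0 := (he z hz.1).1.1 (h.subset hzS')
        refine ⟨h0, ?_⟩
        by_contra! hpos
        exact hyS' (hside1 z hzN y hyN h0 hy0 hpos hy1' hzS')
      · rcases h1.lt_or_eq with h1 | h1
        · exact hside2 x hxN z hzN hx0 h0 hx1 h1 hxS'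
        · exact hzero z hzN h0 h1
    · have hy1' : e y 1 < 0 := by
        by_contra! hle
        exact hyS' (hside1 x hxN y hyN hx0 hy0 hx1 (lt_of_le_of_ne hle hy1.symm) hxS')
      refine ⟨e.restrOpen N hNo, ⟨hpe, hpN⟩, fun z hz => ?_⟩
      have hzN : z ∈ N := hz.2
      refine ⟨(he z hz.1).1, (he z hz.1).2.1, heF z hzN, fun hzS' => ?_, fun ⟨h0, h1⟩ => ?_⟩
      · have h0 := (he z hz.1).1.1 (h.subset hzS')
        refine ⟨h0, ?_⟩
        by_contra! hneg
        exact hyS' (hside2 z hzN y hyN h0 hy0 hneg hy1' hzS')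
      · rcases h1.lt_or_eq with h1 | h1
        · exact hside1 x hxN z hzN hx0 h0 hx1 h1 hxS'
        · exact hzero z hzN h0 h1.symm
  · left
    push Not at hex
    filter_upwards [hNo.mem_nhds hpN] with x hx hxS'
    exact (heF x hx).2 ⟨hex x hx hxS', ((he x (hN hx).2).1.1 (h.subset hxS')).le⟩

theorem frequently_edge {y : E3} (hy0 : y 0 = 0) (hy1 : 0 ≤ y 1) :
    ∃ᶠ z : E3 in 𝓝 y, z 0 = 0 ∧ 0 < z 1 := by
  have hc : Tendsto (fun t : ℝ => y + t • EuclideanSpace.single (1 : Fin 3) (1 : ℝ))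
      (𝓝[>] 0) (𝓝 y) := by
    have : Continuous (fun t : ℝ => y + t • EuclideanSpace.single (1 : Fin 3) (1 : ℝ)) := by
      fun_prop
    have h := this.tendsto 0
    simp only [zero_smul, add_zero] at h
    exact h.mono_left nhdsWithin_le_nhds
  refine hc.frequently (Eventually.frequently ?_)
  filter_upwards [self_mem_nhdsWithin] with t ht
  have ht' : (0 : ℝ) < t := ht
  simp [hy0]
  linarith

/-- The second alternative always holds. -/
theorem exists_boundary_chart' (h : IsCutBy S μ W S' 𝓕) {p : E3} (hp : p ∈ S')
    (hpF : p ∈ ⋃₀ 𝓕) :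
    ∃ e : OpenPartialHomeomorph E3 E3, p ∈ e.source ∧ ∀ x ∈ e.source, (x ∈ S ↔ e x 0 = 0) ∧
      (x ∈ W ↔ e x 0 < 0) ∧ (x ∈ ⋃₀ 𝓕 ↔ e x 1 = 0 ∧ e x 0 ≤ 0) ∧
      (x ∈ S' ↔ e x 0 = 0 ∧ 0 ≤ e x 1) := by
  refine (h.exists_boundary_chart hp hpF).resolve_left fun hbad => ?_
  -- The degenerate alternative is open and closed in the connected set `S'`. If it held at one
  -- point, `S'` would be a closed subset of the compact set `⋃₀ 𝓕`.
  let Z : E3 → Prop := fun q => ∀ᶠ x in 𝓝 q, x ∈ S' → x ∈ ⋃₀ 𝓕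
  have hfalse : ∀ q ∈ S', ¬ Z q → ∀ᶠ r in 𝓝[S'] q, ¬ Z r := by
    intro q hq hZq
    by_cases hqF : q ∈ ⋃₀ 𝓕
    · obtain ⟨e, hqe, he⟩ := (h.exists_boundary_chart hq hqF).resolve_left hZq
      filter_upwards [self_mem_nhdsWithin, mem_nhdsWithin_of_mem_nhds (e.open_source.mem_nhds hqe)]
        with r hr hrs hZ
      have hr' := (he r hrs).2.2.2.1 hr
      obtain ⟨x, ⟨hx0, hx1⟩, hxZ, hxs⟩ := ((e.frequently_comp hrs
        (frequently_edge hr'.1 hr'.2)).and_eventually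
        (hZ.and (e.open_source.mem_nhds hrs))).exists
      have := hxZ ((he x hxs).2.2.2.2 ⟨hx0, hx1.le⟩)
      exact hx1.ne' ((he x hxs).2.2.1.1 this).1
    · filter_upwards [self_mem_nhdsWithin,
        mem_nhdsWithin_of_mem_nhds (h.isClosed_sUnion.isOpen_compl.mem_nhds hqF)] with r hr hrF hZ
      exact hrF (hZ.self_of_nhds hr)
  have hconst : ∀ q ∈ S', Z q := by
    intro q hq
    have : Z q = Z p := constant_of_eventually_eq_within h.isConnected.isPreconnected
      (fun r hr => by
        by_cases hZ : Z r
        · filter_upwards [mem_nhdsWithin_of_mem_nhds (eventually_eventually_nhds.2 hZ)] with x hx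
          exact propext ⟨fun _ => hZ, fun _ => hx⟩
        · filter_upwards [hfalse r hr hZ] with x hx
          exact propext ⟨fun h1 => absurd h1 hx, fun h1 => absurd h1 hZ⟩) hq hp
    rw [this]; exact hbad
  exact h.not_isCompact (h.isCompact_sUnion.of_isClosed_subset h.isClosed
    fun q hq => (hconst q hq).self_of_nhds hq)

/-- A chart in which `S' ∪ ⋃₀ 𝓕` is a plane, one side of which lies in `W` and borders `S'`. -/
structure IsInnerChart (S W S' : Set E3) (𝓕 : Set (Set E3)) (p : E3)
    (e : OpenPartialHomeomorph E3 E3) : Prop where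
  flat : IsFlatChart (S' ∪ ⋃₀ 𝓕) p e
  inner : ∀ x ∈ e.source, e x 0 < 0 → x ∈ W ∧ x ∉ ⋃₀ 𝓕
  eventually : ∀ x ∈ e.source, x ∈ S' → x ∉ ⋃₀ 𝓕 → ∀ᶠ y in 𝓝 x, y ∈ W → e y 0 < 0

/-- At a relative boundary point `S'` and the surface form the boundary of a quadrant of `W`, which
`unfoldQuadrant` flattens. At any other point of `S'` the wall is just `S`. -/
theorem exists_isInnerChart (h : IsCutBy S μ W S' 𝓕) {p : E3} (hp : p ∈ S') :
    ∃ e, IsInnerChart S W S' 𝓕 p e := by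
  by_cases hpF : p ∈ ⋃₀ 𝓕
  · obtain ⟨e, hpe, he⟩ := h.exists_boundary_chart' hp hpF
    let e' := e.transHomeomorph unfoldQuadrant
    have he' : ∀ x, e' x 0 = max (e x 0) (-(e x 1)) := fun x => rfl
    refine ⟨e', ⟨hpe, fun x hx => ?_⟩, fun x hx hx0 => ?_, fun x hx hxS' hxF => ?_⟩
    · rw [he', mem_union, (he x hx).2.2.1, (he x hx).2.2.2]
      constructor
      · rintro (⟨h0, h1⟩ | ⟨h1, h0⟩)
        · rw [h0, max_eq_left (by linarith)]
        · rw [h1, neg_zero, max_eq_right h0]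
      · intro hmax
        rcases le_total (e x 0) (-(e x 1)) with hle | hle
        · rw [max_eq_right hle] at hmax
          exact Or.inr ⟨by linarith, by linarith⟩
        · rw [max_eq_left hle] at hmax
          exact Or.inl ⟨hmax, by linarith⟩
    · rw [he', max_lt_iff] at hx0
      refine ⟨(he x hx).2.1.2 hx0.1, fun hxF => ?_⟩
      have := ((he x hx).2.2.1.1 hxF).1
      linarith [hx0.2]
    · have hx' := (he x hx).2.2.2.1 hxS'
      have hx1 : 0 < e x 1 := lt_of_le_of_ne hx'.2 fun h1 =>
        hxF ((he x hx).2.2.1.2 ⟨h1.symm, hx'.1.le⟩)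
      have hc : ContinuousAt (fun y => e y 1) x := by
        have := e.continuousAt hx
        fun_prop
      filter_upwards [continuousAt_const.eventually_lt hc hx1, e.open_source.mem_nhds hx]
        with y hy hys hyW
      rw [he', max_lt_iff]
      exact ⟨(he y hys).2.1.1 hyW, by linarith⟩
  · obtain ⟨U, f, hpU, hf⟩ := h.inner.exists_defining p (h.subset hp)
    obtain ⟨N, hN, hNo, hpN⟩ := mem_nhds_iff.1 (h.eventually_mem_iff hp hpF)
    obtain ⟨e, he, hef⟩ := exists_chart_single (hf.isOpen.inter hNo) ⟨hpU, hpN⟩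
      (hf.smooth.mono inter_subset_left) (hf.gradient_ne p ⟨h.subset hp, hpU⟩)
    refine ⟨e, ⟨he.mem, fun x hx => ?_⟩, fun x hx hx0 => ?_, fun x hx hxS' hxF => ?_⟩
    · have hx' := hN (he.subset hx).2
      rw [mem_union, or_iff_left hx'.2, hx'.1, hef]
      exact hf.mem_surface x (he.subset hx).1
    · refine ⟨(hf.mem_inner x (he.subset hx).1).2 (by rwa [← hef]), (hN (he.subset hx).2).2⟩
    · filter_upwards [e.open_source.mem_nhds hx] with y hy hyW
      rw [hef]
      exact (hf.mem_inner y (he.subset hy).1).1 hyW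

theorem frequently_mem_diff (h : IsCutBy S μ W S' 𝓕) {p : E3} (hp : p ∈ S') :
    ∃ᶠ x in 𝓝 p, x ∈ S' ∧ x ∉ ⋃₀ 𝓕 := by
  by_cases hpF : p ∈ ⋃₀ 𝓕
  · obtain ⟨e, hpe, he⟩ := h.exists_boundary_chart' hp hpF
    have hp' := (he p hpe).2.2.2.1 hp
    refine ((e.frequently_comp hpe (frequently_edge hp'.1 hp'.2)).and_eventually
      (e.open_source.mem_nhds hpe)).mono ?_
    rintro x ⟨⟨h0, h1⟩, hx⟩
    exact ⟨(he x hx).2.2.2.2 ⟨h0, h1.le⟩, fun hxF => h1.ne' ((he x hx).2.2.1.1 hxF).1⟩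
  · exact frequently_iff.2 fun hU => ⟨p, mem_of_mem_nhds hU, hp, hpF⟩

theorem isClosed_wall (h : IsCutBy S μ W S' 𝓕) : IsClosed (S' ∪ ⋃₀ 𝓕) :=
  h.isClosed.union h.isClosed_sUnion

/-- The wall has corners along the relative boundary of `S'` and is flat only topologically there.
For this reason flat charts are homeomorphisms and no smoothness is required. -/
theorem exists_isFlatChart (h : IsCutBy S μ W S' 𝓕) :
    ∀ p ∈ S' ∪ ⋃₀ 𝓕, ∃ e, IsFlatChart (S' ∪ ⋃₀ 𝓕) p e := by
  intro p hp
  by_cases hpS : p ∈ S'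
  · obtain ⟨e, he⟩ := h.exists_isInnerChart hpS
    exact ⟨e, he.flat⟩
  · have hpF := hp.resolve_left hpS
    obtain ⟨X, hX, hpX⟩ := hpF
    have hpint : IsInteriorPt X p := by
      refine ((h.freeBoundary X hX).surface p hpX).resolve_right fun hb => hpS ?_
      have hb' : p ∈ X ∩ S := by rw [(h.freeBoundary X hX).inter_eq]; exact hb
      exact h.mem_of_mem_sUnion ⟨X, hX, hpX⟩ hb'.2
    obtain ⟨e, he⟩ := hpint.exists_flatChart
    obtain ⟨N, hN, hNo, hpN⟩ := mem_nhds_iff.1 ((h.eventually_mem_sUnion_iff hX hpX).and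
      (h.isClosed.isOpen_compl.mem_nhds hpS))
    refine ⟨e.restrOpen N hNo, ⟨he.mem, hpN⟩, fun x hx => ?_⟩
    have hx' := hN hx.2
    rw [mem_union, or_iff_right hx'.2, hx'.1]
    exact he.mem_iff x hx.1

/-- The region bounded by `S'` and the surfaces in `𝓕`. -/
theorem exists_region (h : IsCutBy S μ W S' 𝓕) :
    ∃ V : Set E3, IsOpen V ∧ IsConnected V ∧ V ⊆ W ∧ interior (closure V) = V ∧
      closure V = V ∪ (S' ∪ ⋃₀ 𝓕) ∧ Disjoint V (S' ∪ ⋃₀ 𝓕) := by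
  obtain ⟨s, hs⟩ := exists_isColoring h.isClosed_wall h.exists_isFlatChart
  obtain ⟨p₀', hp₀'⟩ := h.isConnected.nonempty
  obtain ⟨p₀, hp₀, hp₀F⟩ := (h.frequently_mem_diff hp₀').exists
  -- The region is a component of the complement of all of `S` and the surfaces, so that it stays in
  -- `W`. That the rest of `S` is not on its boundary is shown with the colouring of the complement
  -- of the smaller wall `S' ∪ ⋃₀ 𝓕`.
  let Y := S ∪ ⋃₀ 𝓕
  have hY : IsClosed Y := h.isClosed_surface.union h.isClosed_sUnion
  have hTY : S' ∪ ⋃₀ 𝓕 ⊆ Y := union_subset_union_left _ h.subset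
  -- sides of charts
  have hcharts : ∀ p ∈ S', ∃ e N, IsInnerChart S W S' 𝓕 p e ∧ N ⊆ e.source ∧ IsOpen N ∧ p ∈ N ∧
      IsPreconnected (N ∩ {x | e x 0 < 0}) ∧
      ∃ c, ∀ x ∈ N, (e x 0 < 0 → s x = c) ∧ (0 < e x 0 → s x = c + 1) := by
    intro p hp
    obtain ⟨e, he⟩ := h.exists_isInnerChart hp
    obtain ⟨c, hc⟩ := hs.exists_sides isOpen_univ (Or.inl hp) (mem_univ p) he.flat
    obtain ⟨N, hN, hNo, hpN, h1, -⟩ := e.exists_nhds_sides he.flat.mem hc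
    exact ⟨e, N, he, fun x hx => (hN hx).2, hNo, hpN, h1, c, fun x hx => (hN hx).1⟩
  have hsideY : ∀ e : OpenPartialHomeomorph E3 E3, ∀ N ⊆ e.source, ∀ p,
      IsInnerChart S W S' 𝓕 p e → N ∩ {x | e x 0 < 0} ⊆ Yᶜ := by
    rintro e N hN p he x ⟨hxN, hx⟩ (hxS | hxF)
    · exact disjoint_left.1 h.inner.disjoint hxS (he.inner x (hN hxN) hx).1
    · exact (he.inner x (hN hxN) hx).2 hxF
  have hfreq : ∀ (e : OpenPartialHomeomorph E3 E3) p q, IsInnerChart S W S' 𝓕 p e →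
      q ∈ e.source → q ∈ S' ∪ ⋃₀ 𝓕 → ∃ᶠ x in 𝓝 q, e x 0 < 0 := fun e p q he hqe hq =>
    e.frequently_comp hqe (frequently_coord_lt _ ((he.flat.mem_iff q hqe).1 hq))
  obtain ⟨e₀, N₀, he₀, hN₀, hN₀o, hpN₀, hpre₀, -⟩ := hcharts p₀ hp₀
  obtain ⟨x₀, hx₀, hx₀N⟩ := ((hfreq e₀ p₀ p₀ he₀ he₀.flat.mem (Or.inl hp₀)).and_eventually
    (hN₀o.mem_nhds hpN₀)).exists
  let V := connectedComponentIn Yᶜ x₀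
  have hx₀Y : x₀ ∈ Yᶜ := hsideY e₀ N₀ hN₀ p₀ he₀ ⟨hx₀N, hx₀⟩
  have hVo : IsOpen V := hY.isOpen_compl.connectedComponentIn
  have hVp : IsPreconnected V := isPreconnected_connectedComponentIn
  have hx₀V : x₀ ∈ V := mem_connectedComponentIn hx₀Y
  have hVY : V ⊆ Yᶜ := connectedComponentIn_subset _ _
  have hVsub : ∀ A, IsPreconnected A → A ⊆ Yᶜ → (A ∩ V).Nonempty → A ⊆ V := by
    rintro A hA hAY ⟨y, hyA, hyV⟩
    have : V = connectedComponentIn Yᶜ y := connectedComponentIn_eq hyV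
    rw [this]
    exact hA.subset_connectedComponentIn hyA hAY
  have hVW : V ⊆ W := by
    refine h.inner.subset_of_preconnected V hVp
      (disjoint_right.2 fun x hx hxS => hVY hx (Or.inl hxS)) ⟨x₀, hx₀V, ?_⟩
    exact (he₀.inner x₀ (hN₀ hx₀N) hx₀).1
  -- the inner sides of all charts around points of `S'` lie in `V`
  let K : E3 → Prop := fun q => ∃ᶠ r in 𝓝 q, (r ∈ S' ∧ r ∉ ⋃₀ 𝓕) ∧ ∀ᶠ x in 𝓝 r, x ∈ W → x ∈ V
  -- Where a surface of the family meets `S`, it divides `W` locally. The condition in `K` is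
  -- therefore imposed only at nearby points of `S'` off the surfaces, where `W` has a single local
  -- side.
  have hKiff : ∀ p e N, IsInnerChart S W S' 𝓕 p e → N ⊆ e.source → IsOpen N →
      IsPreconnected (N ∩ {x | e x 0 < 0}) → ∀ q ∈ N, q ∈ S' →
      (K q ↔ N ∩ {x | e x 0 < 0} ⊆ V) := by
    intro p e N he hN hNo hpre q hq hqS'
    constructor
    · intro hK
      obtain ⟨r, ⟨⟨hrS', hrF⟩, hr⟩, hrN⟩ := (hK.and_eventually (hNo.mem_nhds hq)).exists
      obtain ⟨x, hx, hxr, hxN⟩ := ((hfreq e p r he (hN hrN) (Or.inl hrS')).and_eventually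
        (hr.and (hNo.mem_nhds hrN))).exists
      exact hVsub _ hpre (hsideY e N hN p he) ⟨x, ⟨hxN, hx⟩, hxr (he.inner x (hN hxN) hx).1⟩
    · intro hsub
      refine ((h.frequently_mem_diff hqS').and_eventually (hNo.mem_nhds hq)).mono ?_
      rintro r ⟨hr, hrN⟩
      refine ⟨hr, ?_⟩
      filter_upwards [he.eventually r (hN hrN) hr.1 hr.2, hNo.mem_nhds hrN] with x hx hxN hxW
      exact hsub ⟨hxN, hx hxW⟩
  have hKall : ∀ p ∈ S', K p := by
    intro p hp
    have hK0 : K p₀ := (hKiff p₀ e₀ N₀ he₀ hN₀ hN₀o hpre₀ p₀ hpN₀ hp₀).2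
      (hVsub _ hpre₀ (hsideY e₀ N₀ hN₀ p₀ he₀) ⟨x₀, ⟨hx₀N, hx₀⟩, hx₀V⟩)
    have : K p = K p₀ := by
      refine constant_of_eventually_eq_within h.isConnected.isPreconnected (fun q hq => ?_) hp hp₀
      obtain ⟨e, N, he, hN, hNo, hqN, hpre, -⟩ := hcharts q hq
      filter_upwards [self_mem_nhdsWithin, mem_nhdsWithin_of_mem_nhds (hNo.mem_nhds hqN)]
        with r hr hrN
      rw [eq_iff_iff, hKiff q e N he hN hNo hpre q hqN hq, hKiff q e N he hN hNo hpre r hrN hr]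
    rw [this]; exact hK0
  -- `V` is connected and avoids the wall, so it has one colour.
  have hVcol : ∀ x ∈ V, s x = s x₀ := fun x hx =>
    constant_of_eventually_eq hVp (fun z hz => hs.eventually_eq z
      ⟨mem_univ z, fun hzT => hVY hz (hTY hzT)⟩) hx hx₀V
  have hinner : ∀ p ∈ S', ∃ e N, IsInnerChart S W S' 𝓕 p e ∧ N ⊆ e.source ∧ IsOpen N ∧ p ∈ N ∧
      N ∩ {x | e x 0 < 0} ⊆ V ∧ ∀ x ∈ N, 0 < e x 0 → s x = s x₀ + 1 := by
    intro p hp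
    obtain ⟨e, N, he, hN, hNo, hpN, hpre, c, hc⟩ := hcharts p hp
    have hsub := (hKiff p e N he hN hNo hpre p hpN hp).1 (hKall p hp)
    refine ⟨e, N, he, hN, hNo, hpN, hsub, fun x hx hx0 => ?_⟩
    obtain ⟨y, hy, hyN⟩ := ((hfreq e p p he he.flat.mem (Or.inl hp)).and_eventually
      (hNo.mem_nhds hpN)).exists
    rw [(hc x hx).2 hx0, ← (hc y hyN).1 hy, hVcol y (hsub ⟨hyN, hy⟩)]
  have hS'V : S' ⊆ closure V := by
    intro p hp
    obtain ⟨e, N, he, hN, hNo, hpN, hsub, -⟩ := hinner p hp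
    rw [mem_closure_iff_frequently]
    exact ((hfreq e p p he he.flat.mem (Or.inl hp)).and_eventually (hNo.mem_nhds hpN)).mono
      fun x hx => hsub ⟨hx.2, hx.1⟩
  -- the rest of `S` is not in the closure of `V`
  have hout : ∀ p ∈ S, p ∉ S' → p ∉ closure V := by
    intro p hpS hpS'
    have hnT : ∀ q ∈ S, q ∉ S' → q ∉ S' ∪ ⋃₀ 𝓕 := fun q hq hq' hqT =>
      hq' (h.mem_of_mem_sUnion (hqT.resolve_left hq') hq)
    -- Near a point of `S'`, the points of `S` outside `S'` cannot be on the inner side, which lies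
    -- in `W`, and thus have the colour opposite to that of `V`. Hence the points of `S` outside
    -- `S'` with the colour of `V` form an open and closed subset of the connected surface `S` which
    -- misses `p₀`.
    have hD : ∀ q ∈ S, ¬ (q ∉ S' ∧ s q = s x₀) := by
      intro q hq
      have : (q ∉ S' ∧ s q = s x₀) = (p₀ ∉ S' ∧ s p₀ = s x₀) := by
        refine constant_of_eventually_eq_within (s := fun q => q ∉ S' ∧ s q = s x₀)
          h.isConnected_surface.isPreconnected (fun r hr => ?_) hq (h.subset hp₀)
        by_cases hrS' : r ∈ S'
        · obtain ⟨e, N, he, hN, hNo, hrN, -, hcol⟩ := hinner r hrS'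
          filter_upwards [self_mem_nhdsWithin, mem_nhdsWithin_of_mem_nhds (hNo.mem_nhds hrN)]
            with z hz hzN
          refine propext ⟨fun hz' => ?_, fun h1 => absurd hrS' h1.1⟩
          exfalso
          have hz0 : e z 0 ≠ 0 := fun h0 => hnT z hz hz'.1 ((he.flat.mem_iff z (hN hzN)).2 h0)
          rcases lt_or_gt_of_ne hz0 with h0 | h0
          · exact disjoint_left.1 h.inner.disjoint hz (he.inner z (hN hzN) h0).1
          · exact ZMod.add_one_ne_two _ ((hcol z hzN h0).symm.trans hz'.2)
        · filter_upwards [mem_nhdsWithin_of_mem_nhds (hs.eventually_eq r ⟨mem_univ r, hnT r hr hrS'⟩),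
            mem_nhdsWithin_of_mem_nhds (h.isClosed.isOpen_compl.mem_nhds hrS')] with z hz hzS'
          rw [hz]
          exact propext ⟨fun h1 => ⟨hrS', h1.2⟩, fun h1 => ⟨hzS', h1.2⟩⟩
      rw [this]
      exact fun h1 => h1.1 hp₀
    intro hpV
    have h1 := hs.eventually_eq p ⟨mem_univ p, hnT p hpS hpS'⟩
    obtain ⟨x, hxV, hx⟩ := ((mem_closure_iff_frequently.1 hpV).and_eventually h1).exists
    exact hD p hpS ⟨hpS', by rw [← hx, hVcol x hxV]⟩
  -- the surfaces in `𝓕` are in the closure of `V`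
  have hFV : ⋃₀ 𝓕 ⊆ closure V := by
    rintro p ⟨X, hX, hpX⟩
    have hXF := h.freeBoundary X hX
    obtain ⟨q, hq⟩ := hXF.boundary_nonempty
    have hqX : q ∈ X ∩ S := by rw [hXF.inter_eq]; exact hq
    have hqV : q ∈ closure V := hS'V (h.mem_of_mem_sUnion ⟨X, hX, hqX.1⟩ hqX.2)
    -- `closure V` is open and closed relative to the connected surface `X`, and `X` has a boundary
    -- point in `S'`. Openness away from `S` holds because a side of `X` which meets `V` lies in
    -- `V`.
    have : (p ∈ closure V) = (q ∈ closure V) := by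
      refine constant_of_eventually_eq_within (s := fun q => q ∈ closure V)
        hXF.connected.isPreconnected (fun r hr => ?_) hpX hqX.1
      by_cases hrV : r ∈ closure V
      · have hgoal : ∀ᶠ z in 𝓝[X] r, z ∈ closure V := by
          by_cases hrS' : r ∈ S'
          · obtain ⟨e, N, he, hN, hNo, hrN, hsub, -⟩ := hinner r hrS'
            filter_upwards [self_mem_nhdsWithin, mem_nhdsWithin_of_mem_nhds (hNo.mem_nhds hrN)]
              with z hz hzN
            rw [mem_closure_iff_frequently]
            exact ((hfreq e r z he (hN hzN) (Or.inr ⟨X, hX, hz⟩)).and_eventually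
              (hNo.mem_nhds hzN)).mono fun x hx => hsub ⟨hx.2, hx.1⟩
          · have hrS : r ∉ S := fun hrS => hrS' (h.mem_of_mem_sUnion ⟨X, hX, hr⟩ hrS)
            have hrT : r ∈ S' ∪ ⋃₀ 𝓕 := Or.inr ⟨X, hX, hr⟩
            obtain ⟨e, he⟩ := h.exists_isFlatChart r hrT
            obtain ⟨N, hN, hNo, hrN, h1, h2⟩ := e.exists_nhds_sides he.mem
              (h.isClosed_surface.isOpen_compl.mem_nhds hrS)
            have hNY : ∀ x ∈ N, e x 0 ≠ 0 → x ∈ Yᶜ := by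
              rintro x hx h0 (hxS | hxF)
              · exact (hN hx).1 hxS
              · exact h0 ((he.mem_iff x (hN hx).2).1 (Or.inr hxF))
            obtain ⟨x, hxV, hxN⟩ := ((mem_closure_iff_frequently.1 hrV).and_eventually
              (hNo.mem_nhds hrN)).exists
            have hx0 : e x 0 ≠ 0 := fun h0 =>
              hVY hxV (hTY ((he.mem_iff x (hN hxN).2).2 h0))
            filter_upwards [self_mem_nhdsWithin, mem_nhdsWithin_of_mem_nhds (hNo.mem_nhds hrN)]
              with z hz hzN
            have hz0 : e z 0 = 0 := (he.mem_iff z (hN hzN).2).1 (Or.inr ⟨X, hX, hz⟩)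
            rw [mem_closure_iff_frequently]
            rcases lt_or_gt_of_ne hx0 with h0 | h0
            · have hsub := hVsub _ h1 (fun y hy => hNY y hy.1 (ne_of_lt hy.2)) ⟨x, ⟨hxN, h0⟩, hxV⟩
              exact ((e.frequently_comp (hN hzN).2 (frequently_coord_lt _ hz0)).and_eventually
                (hNo.mem_nhds hzN)).mono fun y hy => hsub ⟨hy.2, hy.1⟩
            · have hsub := hVsub _ h2 (fun y hy => hNY y hy.1 (ne_of_gt hy.2)) ⟨x, ⟨hxN, h0⟩, hxV⟩
              exact ((e.frequently_comp (hN hzN).2 (frequently_coord_gt _ hz0)).and_eventually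
                (hNo.mem_nhds hzN)).mono fun y hy => hsub ⟨hy.2, hy.1⟩
        filter_upwards [hgoal] with z hz
        exact propext ⟨fun _ => hrV, fun _ => hz⟩
      · filter_upwards [mem_nhdsWithin_of_mem_nhds (isClosed_closure.isOpen_compl.mem_nhds hrV)]
          with z hz
        exact propext ⟨fun h1 => absurd h1 hz, fun h1 => absurd h1 hrV⟩
    rw [this]; exact hqV
  -- A limit point of `V` off the wall is not in `Y`; its component of `Yᶜ` is open, meets `V`, and
  -- so is `V`.
  have hVclosed : closure V ⊆ V ∪ (S' ∪ ⋃₀ 𝓕) := by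
    intro x hx
    by_contra hxn
    rw [mem_union, not_or] at hxn
    have hxY : x ∈ Yᶜ := by
      rintro (hxS | hxF)
      · exact hout x hxS (fun h1 => hxn.2 (Or.inl h1)) hx
      · exact hxn.2 (Or.inr hxF)
    have hopen : IsOpen (connectedComponentIn Yᶜ x) := hY.isOpen_compl.connectedComponentIn
    obtain ⟨y, hyc, hyV⟩ := mem_closure_iff.1 hx _ hopen (mem_connectedComponentIn hxY)
    exact hxn.1 (hVsub _ isPreconnected_connectedComponentIn (connectedComponentIn_subset _ _)
      ⟨y, hyc, hyV⟩ (mem_connectedComponentIn hxY))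
  have hVdisj : Disjoint V (S' ∪ ⋃₀ 𝓕) := disjoint_left.2 fun x hx hxT => hVY hx (hTY hxT)
  refine ⟨V, hVo, ⟨⟨x₀, hx₀V⟩, hVp⟩, hVW, ?_, ?_, hVdisj⟩
  · refine Subset.antisymm (fun x hx => ?_) (interior_maximal subset_closure hVo)
    refine (hVclosed (interior_subset hx)).resolve_right fun hxT => ?_
    -- Points of the wall are not interior to `closure V`, since both colours occur near them and
    -- `V` has only one.
    obtain ⟨y, ⟨hyT, hy⟩, hyi⟩ := ((hs.frequently_eq x ⟨hxT, mem_univ x⟩ (s x₀ + 1)).and_eventually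
      (isOpen_interior.mem_nhds hx)).exists
    obtain ⟨z, hzV, hz⟩ := ((mem_closure_iff_frequently.1 (interior_subset hyi)).and_eventually
      (hs.eventually_eq y ⟨mem_univ y, hyT⟩)).exists
    rw [hVcol z hzV, hy] at hz
    exact ZMod.add_one_ne_two _ hz.symm
  · exact Subset.antisymm hVclosed (union_subset subset_closure (union_subset hS'V hFV))

end IsCutBy

/-! ### There are no closed minimal surfaces in Euclidean space -/

/-- On the level set `{g = 0}`, a function `φ` with critical point `p` and a local maximum at `p`
relative to the level set has non-positive Hessian in tangential directions. The gradient of `φ` is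
denoted by `Ψ`. -/
theorem inner_hessian_nonpos {g φ : E3 → ℝ} {Ψ : E3 → E3} {Ψ' : E3 →L[ℝ] E3} {U : Set E3} {p v : E3}
    (hU : IsOpen U) (hp : p ∈ U) (hg : ContDiffOn ℝ ∞ g U) (hg0 : gradient g p ≠ 0)
    (hgp : g p = 0) (hφ : ∀ x ∈ U, HasGradientAt φ (Ψ x) x) (hΨp : Ψ p = 0)
    (hΨ : HasFDerivAt Ψ Ψ' p) (hmax : ∀ᶠ x in 𝓝 p, g x = 0 → φ x ≤ φ p)
    (hv : inner ℝ (gradient g p) v = 0) : inner ℝ (Ψ' v) v ≤ 0 := by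
  obtain ⟨e, he, heg⟩ := exists_chart_single hU hp hg hg0
  have hpt : e p ∈ e.target := e.map_source he.mem
  have hed : HasFDerivAt e (fderiv ℝ e p) p :=
    ((he.smooth.contDiffAt (e.open_source.mem_nhds he.mem)).differentiableAt
      (by simp)).hasFDerivAt
  let w := fderiv ℝ e p v
  have hw0 : w 0 = 0 := by
    have h := ((hasFDerivWithinAt_euclidean (t := univ)).1 hed.hasFDerivWithinAt 0)
    rw [hasFDerivWithinAt_univ] at h
    have h' : (fun x => e x 0) = g := funext heg
    rw [h'] at h
    rw [inner_gradient_left, h.fderiv] at hv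
    exact hv
  -- The preimage of a line under a straightening chart is a curve in the level set through `p` with
  -- velocity `v`.
  let ℓ : ℝ → E3 := fun t => e p + t • w
  have hℓ : ContDiff ℝ ∞ ℓ := contDiff_const.add (contDiff_id.smul contDiff_const)
  have hℓ0 : ℓ 0 = e p := by simp [ℓ]
  let J : Set ℝ := ℓ ⁻¹' e.target
  have hJ : IsOpen J := e.open_target.preimage hℓ.continuous
  have h0J : (0 : ℝ) ∈ J := by show ℓ 0 ∈ e.target; rwa [hℓ0]
  let c : ℝ → E3 := fun t => e.symm (ℓ t)
  have hc : ContDiffOn ℝ ∞ c J := he.smooth_symm.comp hℓ.contDiffOn fun t ht => ht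
  have hc0 : c 0 = p := by simp only [c, hℓ0]; exact e.left_inv he.mem
  have hcU : ∀ t ∈ J, c t ∈ U := fun t ht => he.subset (e.map_target ht)
  have hgc : ∀ t ∈ J, g (c t) = 0 := fun t ht => by
    rw [← heg, e.right_inv ht]
    simp [ℓ, hw0, heg, hgp]
  have hcd : ∀ t ∈ J, HasDerivAt c (deriv c t) t := fun t ht =>
    ((hc.contDiffAt (hJ.mem_nhds ht)).differentiableAt (by simp)).hasDerivAt
  have hcv : deriv c 0 = v := by
    have hs : HasFDerivAt e.symm (fderiv ℝ e.symm (e p)) (e p) :=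
      ((he.smooth_symm.contDiffAt (e.open_target.mem_nhds hpt)).differentiableAt
        (by simp)).hasFDerivAt
    have h1 : HasFDerivAt (e.symm ∘ e) ((fderiv ℝ e.symm (e p)).comp (fderiv ℝ e p)) p :=
      hs.comp p hed
    have h2 : HasFDerivAt (e.symm ∘ e) (ContinuousLinearMap.id ℝ E3) p := by
      refine (hasFDerivAt_id p).congr_of_eventuallyEq ?_
      filter_upwards [e.open_source.mem_nhds he.mem] with x hx
      exact e.left_inv hx
    have h3 : fderiv ℝ e.symm (e p) w = v := DFunLike.congr_fun (h1.unique h2) v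
    have h4 : HasDerivAt (fun t : ℝ => e p + t • w) w 0 := by
      simpa using ((hasDerivAt_id (0 : ℝ)).smul_const w).const_add (e p)
    have h5 : HasDerivAt c (fderiv ℝ e.symm (e p) w) 0 :=
      HasFDerivAt.comp_hasDerivAt (0 : ℝ) (by rwa [hℓ0]) h4
    rw [h5.deriv, h3]
  have hc2 : HasDerivAt (deriv c) (deriv (deriv c) 0) 0 := by
    have h1 : ContDiffAt ℝ 1 (deriv c) 0 := by
      have h2 : ContDiffOn ℝ 1 (deriv c) J := hc.deriv_of_isOpen hJ (by norm_cast)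
      exact h2.contDiffAt (hJ.mem_nhds h0J)
    exact (h1.differentiableAt (by simp)).hasDerivAt
  have hd1 : ∀ t ∈ J, HasDerivAt (fun t => φ (c t)) (inner ℝ (Ψ (c t)) (deriv c t)) t := by
    intro t ht
    have := (hφ (c t) (hcU t ht)).hasFDerivAt.comp_hasDerivAt t (hcd t ht)
    exact this
  have hd1' : deriv (fun t => φ (c t)) =ᶠ[𝓝 0] fun t => inner ℝ (Ψ (c t)) (deriv c t) := by
    filter_upwards [hJ.mem_nhds h0J] with t ht using (hd1 t ht).deriv
  have hΨc : HasDerivAt (fun t => Ψ (c t)) (Ψ' v) 0 := by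
    have h1 : HasFDerivAt Ψ Ψ' (c 0) := by rwa [hc0]
    have := h1.comp_hasDerivAt (0 : ℝ) (hcd 0 h0J)
    rwa [hcv] at this
  -- The acceleration of the curve is paired with the gradient of `φ`, which vanishes at `p`.
  have hd2 : deriv (deriv fun t => φ (c t)) 0 = inner ℝ (Ψ' v) v := by
    rw [hd1'.deriv_eq]
    have := (hΨc.inner ℝ hc2).deriv
    rw [this, hc0, hΨp, inner_zero_left, zero_add, hcv]
  have hd0 : deriv (fun t => φ (c t)) 0 = 0 := by
    rw [(hd1 0 h0J).deriv, hc0, hΨp, inner_zero_left]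
  by_contra! hpos
  have hcont : ContinuousAt (fun t => φ (c t)) 0 := (hd1 0 h0J).continuousAt
  have hmin := isLocalMin_of_deriv_deriv_pos (by rw [hd2]; exact hpos) hd0 hcont
  have hct : Tendsto c (𝓝 0) (𝓝 p) := by
    have := (hcd 0 h0J).continuousAt.tendsto
    rwa [hc0] at this
  -- With a positive second derivative the point would be a local minimum along the curve besides
  -- being a maximum. Then `φ` is constant along the curve, and the second derivative is zero.
  have hconst : (fun t => φ (c t)) =ᶠ[𝓝 0] fun _ => φ p := by
    filter_upwards [hmin, hct.eventually hmax, hJ.mem_nhds h0J] with t h1 h2 h3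
    rw [hc0] at h1
    exact le_antisymm (h2 (hgc t h3)) h1
  have h1 : deriv (fun t => φ (c t)) =ᶠ[𝓝 0] fun _ => 0 := by
    refine hconst.deriv.trans ?_
    simp
  rw [← hd2, h1.deriv_eq] at hpos
  simp at hpos

theorem hasGradientAt_norm_sq (x : E3) : HasGradientAt (fun y : E3 => ‖y‖ ^ 2) ((2 : ℝ) • x) x := by
  rw [hasGradientAt_iff_hasFDerivAt]
  convert! (hasStrictFDerivAt_norm_sq x).hasFDerivAt using 1
  ext v : 1
  simp

theorem contDiffOn_gradient {g : E3 → ℝ} {U : Set E3} (hg : ContDiffOn ℝ ∞ g U) (hU : IsOpen U) :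
    ContDiffOn ℝ ∞ (gradient g) U := by
  have h1 : ContDiffOn ℝ ∞ (fderiv ℝ g) U := hg.fderiv_of_isOpen hU (by simp)
  exact (InnerProductSpace.toDual ℝ E3).symm.contDiff.comp_contDiffOn h1

/-- The trace defining the mean curvature only involves tangential directions. -/
theorem levelMeanCurvature_eq {g : E3 → ℝ} {U : Set E3} {p : E3} (hU : IsOpen U) (hp : p ∈ U)
    (hg : ContDiffOn ℝ ∞ g U) (hg0 : gradient g p ≠ 0) (b : OrthonormalBasis (Fin 3) ℝ E3)
    (hb : b 0 = ‖gradient g p‖⁻¹ • gradient g p) :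
    levelMeanCurvature g p = ‖gradient g p‖⁻¹ *
      (inner ℝ (fderiv ℝ (gradient g) p (b 1)) (b 1) +
        inner ℝ (fderiv ℝ (gradient g) p (b 2)) (b 2)) := by
  have hG : DifferentiableAt ℝ (gradient g) p :=
    ((contDiffOn_gradient hg hU).contDiffAt (hU.mem_nhds hp)).differentiableAt (by simp)
  have hn : DifferentiableAt ℝ (fun y => ‖gradient g y‖⁻¹) p :=
    (hG.norm ℝ hg0).inv (norm_ne_zero_iff.2 hg0)
  have hN : HasFDerivAt (fun y => ‖gradient g y‖⁻¹ • gradient g y)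
      (‖gradient g p‖⁻¹ • fderiv ℝ (gradient g) p +
        (fderiv ℝ (fun y => ‖gradient g y‖⁻¹) p).smulRight (gradient g p)) p :=
    hn.hasFDerivAt.smul hG.hasFDerivAt
  -- The unit normal field has constant length, so its derivative has no normal component and the
  -- normal direction does not contribute to the trace.
  have hunit : ∀ v, inner ℝ (b 0)
      (fderiv ℝ (fun y => ‖gradient g y‖⁻¹ • gradient g y) p v) = 0 := by
    intro v
    have h1 := hN.differentiableAt.hasFDerivAt.norm_sq
    have h2 : (fun y => ‖‖gradient g y‖⁻¹ • gradient g y‖ ^ 2) =ᶠ[𝓝 p] fun _ => 1 := by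
      filter_upwards [hG.continuousAt.eventually_ne hg0] with y hy
      rw [norm_smul, norm_inv, norm_norm, inv_mul_cancel₀ (norm_ne_zero_iff.2 hy), one_pow]
    have h3 := h1.unique ((hasFDerivAt_const (1 : ℝ) p).congr_of_eventuallyEq h2)
    have h4 := DFunLike.congr_fun h3 v
    have h5 : 2 * inner ℝ (‖gradient g p‖⁻¹ • gradient g p)
        (fderiv ℝ (fun y => ‖gradient g y‖⁻¹ • gradient g y) p v) = 0 := by
      rw [two_mul, ← two_smul ℕ]
      exact h4
    rw [hb]
    linarith
  have horth : ∀ i, i ≠ 0 → inner ℝ (b i) (gradient g p) = 0 := by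
    intro i hi
    have h1 : inner ℝ (b i) (b 0) = 0 := b.orthonormal.2 hi
    rw [hb, inner_smul_right] at h1
    exact (mul_eq_zero.1 h1).resolve_left (inv_ne_zero (norm_ne_zero_iff.2 hg0))
  rw [levelMeanCurvature, LinearMap.trace_eq_sum_inner _ b, Fin.sum_univ_three]
  simp only [ContinuousLinearMap.coe_coe]
  rw [hunit, hN.fderiv]
  simp only [add_apply, smul_apply,
    ContinuousLinearMap.smulRight_apply, inner_add_right, inner_smul_right,
    horth 1 (by decide), horth 2 (by decide), mul_zero, add_zero, zero_add]
  rw [real_inner_comm, real_inner_comm (b 2)]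
  ring

/-- At a point farthest from the origin the surface lies inside the sphere through that point, and
its mean curvature is at least that of the sphere in absolute value. -/
theorem not_isMinimal_of_isClosedSurface {S X : Set E3} {μ : E3 → E3}
    (hX : IsClosedSurface S μ X) : ¬ IsMinimal X := by
  intro hmin
  obtain ⟨p, hpX, hpmax⟩ := hX.compact.exists_isMaxOn hX.connected.nonempty
    continuous_norm.continuousOn
  obtain ⟨-, U₁, f, hpU₁, ⟨hU₁, hf, hfX⟩, hiff⟩ := hX.surface p hpX
  obtain ⟨U₂, g, hpU₂, ⟨hU₂, hg, hgX⟩, hH⟩ := hmin p hpX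
  have hfp := hfX p ⟨hpX, hpU₁⟩
  have hgp := hgX p ⟨hpX, hpU₂⟩
  have hH0 := hH p ⟨hpX, hpU₂⟩
  -- Minimality only provides a function `g` whose zero set contains `X`; near `p` the zero set is
  -- exactly `X`.
  have hzero : ∀ᶠ x in 𝓝 p, g x = 0 → f x = 0 :=
    eventually_eq_zero_of_subset (hU₁.inter hU₂) ⟨hpU₁, hpU₂⟩ (hf.mono inter_subset_left)
      (hg.mono inter_subset_right) hfp.1 hfp.2 hgp.2 (by
        filter_upwards [hU₁.mem_nhds hpU₁, hU₂.mem_nhds hpU₂] with x h1 h2 h0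
        exact (hgX x ⟨(hiff x h1).2 h0, h2⟩).1)
  have hle : ∀ᶠ x in 𝓝 p, g x = 0 → ‖x‖ ^ 2 ≤ ‖p‖ ^ 2 := by
    filter_upwards [hzero, hU₁.mem_nhds hpU₁] with x hx h1 h0
    have : ‖x‖ ≤ ‖p‖ := hpmax ((hiff x h1).2 (hx h0))
    gcongr
  -- A Lagrange multiplier. If `p` were not a multiple of the normal, `g` and `|x|² - |p|²` would be
  -- coordinates, and `X` would contain points farther out.
  obtain ⟨l, hl⟩ : ∃ l : ℝ, p = l • gradient g p := by
    by_contra! hne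
    have hli : LinearIndependent ℝ ![gradient g p, gradient (fun y : E3 => ‖y‖ ^ 2 - ‖p‖ ^ 2) p] := by
      have h1 : gradient (fun y : E3 => ‖y‖ ^ 2 - ‖p‖ ^ 2) p = (2 : ℝ) • p := by
        have := (hasGradientAt_norm_sq p).hasFDerivAt.sub_const (‖p‖ ^ 2)
        exact (hasGradientAt_iff_hasFDerivAt.2 this).gradient
      rw [h1, LinearIndependent.pair_iff' hgp.2]
      intro a ha
      refine hne (a / 2) ?_
      rw [div_eq_inv_mul, mul_smul, ha, smul_smul]
      norm_num
    obtain ⟨e, he, hee⟩ := exists_chart_pair hU₂ hpU₂ hg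
      ((contDiff_norm_sq ℝ).sub contDiff_const).contDiffOn hli
    obtain ⟨x, ⟨h0, h1⟩, hx⟩ := ((e.frequently_comp he.mem (IsCutBy.frequently_edge
      (by rw [(hee p).1]; exact hgp.1) (by rw [(hee p).2]; simp))).and_eventually hle).exists
    rw [(hee x).1] at h0
    rw [(hee x).2] at h1
    linarith [hx h0]
  have hG : HasFDerivAt (gradient g) (fderiv ℝ (gradient g) p) p :=
    (((contDiffOn_gradient hg hU₂).contDiffAt (hU₂.mem_nhds hpU₂)).differentiableAt
      (by simp)).hasFDerivAt
  have htang : ∀ v, inner ℝ (gradient g p) v = 0 →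
      ‖v‖ ^ 2 ≤ l * inner ℝ (fderiv ℝ (gradient g) p v) v := by
    intro v hv
    -- The subtracted multiple of `g` makes `p` critical in all directions and does not change `φ`
    -- on the surface. Summed over two tangent directions, the resulting inequality gives `2 ≤ 0` if
    -- the mean curvature vanishes.
    have h := inner_hessian_nonpos (φ := fun x => ‖x‖ ^ 2 - 2 * l * g x)
      (Ψ := fun x => (2 : ℝ) • x - (2 * l) • gradient g x) hU₂ hpU₂ hg hgp.2 hgp.1
      (fun x hx => by
        have hgx : DifferentiableAt ℝ g x :=
          (hg.contDiffAt (hU₂.mem_nhds hx)).differentiableAt (by simp)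
        have h1 := (hasGradientAt_norm_sq x).hasFDerivAt.sub
          (hgx.hasGradientAt.hasFDerivAt.const_mul (2 * l))
        rw [hasGradientAt_iff_hasFDerivAt]
        convert! h1 using 1
        ext w : 1
        simp)
      (by
        show (2 : ℝ) • p - (2 * l) • gradient g p = 0
        rw [mul_smul, ← hl, sub_self])
      (((hasFDerivAt_id p).const_smul (2 : ℝ)).sub (hG.const_smul (2 * l)))
      (by
        filter_upwards [hle] with x hx h0
        simp only [h0, hgp.1, mul_zero, sub_zero]
        exact hx h0) hv
    simp only [sub_apply, smul_apply, inner_sub_left,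
      inner_smul_left, ContinuousLinearMap.id_apply, real_inner_self_eq_norm_sq] at h
    simp at h
    nlinarith
  have hn : ‖‖gradient g p‖⁻¹ • gradient g p‖ = 1 := by
    rw [norm_smul, norm_inv, norm_norm, inv_mul_cancel₀ (norm_ne_zero_iff.2 hgp.2)]
  obtain ⟨b, hb⟩ := Orthonormal.exists_orthonormalBasis_extension_of_card_eq
    (𝕜 := ℝ) (E := E3) (ι := Fin 3) (by simp) (v := fun _ => ‖gradient g p‖⁻¹ • gradient g p)
    (s := {0}) ⟨fun _ => hn, fun i j hij => absurd (Subsingleton.elim i j) hij⟩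
  have hb0 := hb 0 rfl
  rw [levelMeanCurvature_eq hU₂ hpU₂ hg hgp.2 b hb0] at hH0
  have horth : ∀ i, i ≠ 0 → inner ℝ (gradient g p) (b i) = 0 := by
    intro i hi
    have h1 : inner ℝ (b 0) (b i) = 0 := b.orthonormal.2 hi.symm
    rw [hb0, inner_smul_left] at h1
    exact (mul_eq_zero.1 h1).resolve_left (by simpa using hgp.2)
  have h1 := htang (b 1) (horth 1 (by decide))
  have h2 := htang (b 2) (horth 2 (by decide))
  have h3 := (mul_eq_zero.1 hH0).resolve_left (inv_ne_zero (norm_ne_zero_iff.2 hgp.2))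
  rw [b.orthonormal.1] at h1 h2
  have : l * (inner ℝ (fderiv ℝ (gradient g) p (b 1)) (b 1) +
        inner ℝ (fderiv ℝ (gradient g) p (b 2)) (b 2)) = 0 := by rw [h3, mul_zero]
  linarith

/-! ### Exterior surfaces bound exterior regions -/

/-- The region is the closure of the set from `IsCutBy.exists_region`. It meets `S` only in `S'`, so
the maximality of the family for `S'` covers every free boundary minimal surface inside; closed
minimal surfaces do not exist. -/
theorem exists_exteriorRegion {S W S' : Set E3} {μ : E3 → E3} (hW : IsInnerSide S μ W)
    (hS : IsClosed S) (hSc : IsConnected S) (hS' : IsExteriorSurface S μ S') :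
    ∃ M', IsExteriorRegion S μ M' ∧ S' = exteriorBoundary S M' := by
  obtain ⟨hsub, hcl, hconn, hnc, 𝓕, hfin, -, hdisj, hF, hbd, hall⟩ := hS'
  have h : IsCutBy S μ W S' 𝓕 :=
    ⟨hW, hS, hSc, hsub, hcl, hconn, hnc, hfin, hdisj, fun X hX => (hF X hX).1, hbd⟩
  obtain ⟨V, hVo, hVc, hVW, hVi, hVcl, hVd⟩ := h.exists_region
  have hfront : frontier (closure V) = S' ∪ ⋃₀ 𝓕 := by
    rw [frontier, closure_closure, hVi, hVcl, union_sdiff_left, hVd.symm.sdiff_eq_left]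
  have hFS : ⋃₀ 𝓕 ∩ S ⊆ S' := fun x hx => h.mem_of_mem_sUnion hx.1 hx.2
  have hext : S' = exteriorBoundary S (closure V) := by
    rw [exteriorBoundary, hfront, union_inter_distrib_right, inter_eq_left.2 hsub,
      union_eq_left.2 hFS]
  have hMS : closure V ∩ S = S' := by
    rw [hVcl, union_inter_distrib_right, (hW.disjoint.mono_right hVW).symm.inter_eq, empty_union,
      union_inter_distrib_right, inter_eq_left.2 hsub, union_eq_left.2 hFS]
  refine ⟨closure V, ⟨?_, by rw [hVi], by rwa [hVi], fun hc => ?_, 𝓕, hfin, hdisj, fun X hX =>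
    ⟨Or.inr (hF X hX).1, (hF X hX).2⟩, ?_, fun X hXM hX hmin => ?_⟩, hext⟩
  · refine closure_minimal ?_ hW.isClosed_region
    rw [hW.region_eq]
    exact hVW.trans subset_union_right
  · refine hnc (hc.of_isClosed_subset hcl ?_)
    rw [hVcl]; exact subset_union_left.trans subset_union_right
  · rw [interiorBoundary, hfront]
    refine Subset.antisymm (closure_minimal ?_ h.isClosed_sUnion) ?_
    · rintro x ⟨hx | hx, hxS⟩
      · exact absurd (hsub hx) hxS
      · exact hx
    · rintro x ⟨X, hX, hxX⟩
      by_cases hxS : x ∈ S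
      -- A boundary point of `X` is a limit of points of `X` off `S`, because `X` is a half-plane in
      -- the chart.
      · have hxb : x ∈ surfaceBoundary X := by
          rw [← (hF X hX).1.inter_eq]; exact ⟨hxX, hxS⟩
        obtain ⟨e, hxe, he⟩ := (hF X hX).1.exists_chart hW hxb
        rw [mem_closure_iff_frequently]
        have hx1 := ((he x hxe).2.2.1 hxX).1
        have hx0 := (he x hxe).1.1 hxS
        have hfr : ∃ᶠ z : E3 in 𝓝 (e x), z 1 = 0 ∧ z 0 < 0 := by
          have hc : Tendsto (fun t : ℝ => e x - t • EuclideanSpace.single (0 : Fin 3) (1 : ℝ))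
              (𝓝[>] 0) (𝓝 (e x)) := by
            have : Continuous (fun t : ℝ =>
                e x - t • EuclideanSpace.single (0 : Fin 3) (1 : ℝ)) := by fun_prop
            have h := this.tendsto 0
            simp only [zero_smul, sub_zero] at h
            exact h.mono_left nhdsWithin_le_nhds
          refine hc.frequently (Eventually.frequently ?_)
          filter_upwards [self_mem_nhdsWithin] with t ht
          have ht' : (0 : ℝ) < t := ht
          simp [hx0, hx1, ht']
        refine ((e.frequently_comp hxe hfr).and_eventually (e.open_source.mem_nhds hxe)).mono ?_
        rintro z ⟨⟨hz1, hz0⟩, hz⟩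
        refine ⟨Or.inr ⟨X, hX, (he z hz).2.2.2 ⟨hz1, hz0.le⟩⟩, fun hzS => ?_⟩
        exact hz0.ne ((he z hz).1.1 hzS)
      · exact subset_closure ⟨Or.inr ⟨X, hX, hxX⟩, hxS⟩
  · rcases hX with hX | hX
    · exact absurd hmin (not_isMinimal_of_isClosedSurface hX)
    · refine hall X hX hmin ?_
      rw [← hX.inter_eq, ← hMS]
      exact inter_subset_inter_left _ hXM

/-! ### Completeness of the Euclidean metric on the region -/

theorem quadForm_one (v : E3) : quadForm 1 v = ‖v‖ ^ 2 := by
  rw [EuclideanSpace.norm_sq_eq]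
  simp [quadForm, Matrix.one_apply, pow_two]

theorem curveLength_euclideanMetric (γ : ℝ → E3) :
    curveLength euclideanMetric γ = ∫⁻ t in Icc (0 : ℝ) 1, ‖derivWithin γ (Icc 0 1) t‖ₑ := by
  simp only [curveLength, euclideanMetric, quadForm_one, Real.sqrt_sq (norm_nonneg _),
    ofReal_norm]

/-- A curve is at least as long as its chord. Cauchy sequences for the intrinsic distance are
therefore Cauchy in space. -/
theorem edist_le_riemDist (M : Set E3) (x y : E3) : edist x y ≤ riemDist M euclideanMetric x y := by
  refine le_iInf fun γ => le_iInf fun hγ => le_iInf fun _ => le_iInf fun h0 => le_iInf fun h1 => ?_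
  rw [curveLength_euclideanMetric, edist_comm, edist_eq_enorm_sub, ← h0, ← h1]
  exact enorm_sub_le_lintegral_derivWithin_Icc_of_contDiffOn_Icc hγ zero_le_one

/-- In a chart in which `M` is convex, nearby points are close with respect to the Riemannian
distance. -/
theorem tendsto_riemDist_of_chart {M C : Set E3} {e : OpenPartialHomeomorph E3 E3} {p : E3}
    (hp : p ∈ e.source) (hsymm : ContDiffOn ℝ ∞ e.symm e.target) (hC : Convex ℝ C)
    (hM : ∀ x ∈ e.source, x ∈ M ↔ e x ∈ C) (hpM : p ∈ M) :
    Tendsto (fun x => riemDist M euclideanMetric x p) (𝓝[M] p) (𝓝 0) := by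
  have hpt : e p ∈ e.target := e.map_source hp
  have hcont : ContinuousAt (fderiv ℝ e.symm) (e p) :=
    (hsymm.continuousOn_fderiv_of_isOpen e.open_target (by simp)).continuousAt
      (e.open_target.mem_nhds hpt)
  obtain ⟨L, hL⟩ : ∃ L, ‖fderiv ℝ e.symm (e p)‖ < L := exists_gt _
  have hK : ∀ᶠ y in 𝓝 (e p), ‖fderiv ℝ e.symm y‖ < L := hcont.norm.eventually_lt_const hL
  obtain ⟨ε, hε, hball⟩ := Metric.mem_nhds_iff.1
    (hK.and (e.open_target.eventually_mem hpt))
  have hx : ∀ᶠ x in 𝓝[M] p, riemDist M euclideanMetric x p ≤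
      ENNReal.ofReal (L * ‖e p - e x‖) := by
    filter_upwards [self_mem_nhdsWithin, mem_nhdsWithin_of_mem_nhds (e.open_source.mem_nhds hp),
      mem_nhdsWithin_of_mem_nhds ((e.continuousAt hp).preimage_mem_nhds
        (Metric.ball_mem_nhds _ hε))] with x hxM hxs hxb
    rw [mem_preimage] at hxb
    -- The competing curve is the preimage of a segment. It stays in `M` by convexity of `C`, and
    -- `L` bounds the derivative of the inverse chart along it.
    let ℓ : ℝ → E3 := fun t => e x + t • (e p - e x)
    have hℓ : ContDiff ℝ ∞ ℓ := contDiff_const.add (contDiff_id.smul contDiff_const)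
    have hℓb : ∀ t ∈ Icc (0 : ℝ) 1, ℓ t ∈ Metric.ball (e p) ε := fun t ht =>
      (convex_ball _ _).add_smul_sub_mem hxb (Metric.mem_ball_self hε) ht
    have hℓC : ∀ t ∈ Icc (0 : ℝ) 1, ℓ t ∈ C := fun t ht =>
      hC.add_smul_sub_mem ((hM x hxs).1 hxM) ((hM p hp).1 hpM) ht
    have hder : ∀ t ∈ Icc (0 : ℝ) 1, ‖derivWithin (fun t => e.symm (ℓ t)) (Icc 0 1) t‖ₑ ≤
        ENNReal.ofReal (L * ‖e p - e x‖) := by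
      intro t ht
      have hy := hball (hℓb t ht)
      have hs : HasFDerivAt e.symm (fderiv ℝ e.symm (ℓ t)) (ℓ t) :=
        ((hsymm.contDiffAt (e.open_target.mem_nhds hy.2)).differentiableAt (by simp)).hasFDerivAt
      have h4 : HasDerivAt (fun t : ℝ => e x + t • (e p - e x)) (e p - e x) t := by
        simpa using ((hasDerivAt_id t).smul_const (e p - e x)).const_add (e x)
      have h5 : HasDerivAt (fun t => e.symm (ℓ t)) (fderiv ℝ e.symm (ℓ t) (e p - e x)) t :=
        hs.comp_hasDerivAt t h4
      rw [h5.hasDerivWithinAt.derivWithin (uniqueDiffOn_Icc zero_lt_one t ht), ← ofReal_norm]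
      refine ENNReal.ofReal_le_ofReal ((ContinuousLinearMap.le_opNorm _ _).trans ?_)
      exact mul_le_mul_of_nonneg_right hy.1.le (norm_nonneg _)
    have hle : riemDist M euclideanMetric x p ≤
        curveLength euclideanMetric (fun t => e.symm (ℓ t)) := by
      refine (iInf_le _ (fun t => e.symm (ℓ t))).trans ((iInf_le _ ?_).trans ((iInf_le _ ?_).trans
        ((iInf_le _ ?_).trans (iInf_le _ ?_))))
      · have h1 : ContDiffOn ℝ ∞ (fun t => e.symm (ℓ t)) (Icc 0 1) :=
          hsymm.comp hℓ.contDiffOn fun t ht => (hball (hℓb t ht)).2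
        exact h1.of_le (by norm_cast)
      · intro t ht
        have hy := hball (hℓb t ht)
        rw [hM _ (e.map_target hy.2), e.right_inv hy.2]
        exact hℓC t ht
      · simp [ℓ, e.left_inv hxs]
      · simp [ℓ, e.left_inv hp]
    refine hle.trans ?_
    rw [curveLength_euclideanMetric]
    refine (MeasureTheory.setLIntegral_mono measurable_const hder).trans ?_
    simp
  have hlim : Tendsto (fun x => ENNReal.ofReal (L * ‖e p - e x‖)) (𝓝[M] p) (𝓝 0) := by
    have h1 : ContinuousAt (fun x => ENNReal.ofReal (L * ‖e p - e x‖)) p := by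
      refine ENNReal.continuous_ofReal.continuousAt.comp ?_
      exact continuousAt_const.mul (continuousAt_const.sub (e.continuousAt hp)).norm
    have h2 := h1.tendsto
    simp only [sub_self, norm_zero, mul_zero, ENNReal.ofReal_zero] at h2
    exact h2.mono_left nhdsWithin_le_nhds
  exact tendsto_of_tendsto_of_tendsto_of_le_of_le' tendsto_const_nhds hlim
    (Eventually.of_forall fun _ => zero_le) hx

theorem IsInnerSide.tendsto_riemDist {S W : Set E3} {μ : E3 → E3} (h : IsInnerSide S μ W) {p : E3}
    (hp : p ∈ regionOf S μ) :
    Tendsto (fun x => riemDist (regionOf S μ) euclideanMetric x p) (𝓝[regionOf S μ] p) (𝓝 0) := by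
  have hp' := hp
  rw [h.region_eq] at hp'
  rcases hp' with hpS | hpW
  · obtain ⟨U, f, hpU, hf⟩ := h.exists_defining p hpS
    obtain ⟨e, he, hef⟩ := exists_chart_single hf.isOpen hpU hf.smooth
      (hf.gradient_ne p ⟨hpS, hpU⟩)
    refine tendsto_riemDist_of_chart he.mem he.smooth_symm
      (convex_halfSpace_le (isLinearMap_coord 0) 0) (fun x hx => ?_) hp
    rw [h.mem_region_iff hf (he.subset hx), mem_ofPred_eq, hef]
  · refine tendsto_riemDist_of_chart (e := OpenPartialHomeomorph.ofSet W h.isOpen) (C := univ) hpW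
      contDiffOn_id convex_univ (fun x hx => ?_) hp
    rw [h.region_eq]
    exact ⟨fun _ => mem_univ _, fun _ => Or.inr hx⟩

/-- The Euclidean limit lies in the closed region. Convergence also holds intrinsically, because the
region is a half-space or a full neighbourhood in a chart. -/
theorem IsInnerSide.isRiemComplete {S W : Set E3} {μ : E3 → E3} (h : IsInnerSide S μ W) :
    IsRiemComplete (regionOf S μ) euclideanMetric := by
  intro x hx hcauchy
  have hc : CauchySeq x := by
    rw [EMetric.cauchySeq_iff]
    intro ε hε
    obtain ⟨N, hN⟩ := hcauchy ε hε
    exact ⟨N, fun m hm n hn => (edist_le_riemDist _ _ _).trans_lt (hN m hm n hn)⟩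
  obtain ⟨p, hp⟩ := cauchySeq_tendsto_of_complete hc
  have hpM : p ∈ regionOf S μ := h.isClosed_region.mem_of_tendsto hp (Eventually.of_forall hx)
  refine ⟨p, hpM, (h.tendsto_riemDist hpM).comp ?_⟩
  exact tendsto_nhdsWithin_iff.2 ⟨hp, Eventually.of_forall hx⟩

/-! ### Horizontal and vertical coordinates -/

/-- The point of `ℝ³` above `x ∈ ℝ²` at height `z`. -/
def lift3 (x : E2) (z : ℝ) : E3 := !₂[x 0, x 1, z]

/-- The third unit vector. -/
noncomputable def e3 : E3 := EuclideanSpace.single 2 1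

/-- The projection of `ℝ³` to the horizontal plane. -/
noncomputable def proj2 : E3 →L[ℝ] E2 :=
  LinearMap.toContinuousLinearMap
    { toFun := fun x => !₂[x 0, x 1]
      map_add' := fun x y => by ext i; fin_cases i <;> rfl
      map_smul' := fun c x => by ext i; fin_cases i <;> rfl }

@[simp] theorem proj2_zero (x : E3) : proj2 x 0 = x 0 := rfl
@[simp] theorem proj2_one (x : E3) : proj2 x 1 = x 1 := rfl
@[simp] theorem lift3_zero (x : E2) (z : ℝ) : lift3 x z 0 = x 0 := rfl
@[simp] theorem lift3_one (x : E2) (z : ℝ) : lift3 x z 1 = x 1 := rfl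
@[simp] theorem lift3_two (x : E2) (z : ℝ) : lift3 x z 2 = z := rfl
@[simp] theorem e3_zero : e3 0 = 0 := by simp [e3]
@[simp] theorem e3_one : e3 1 = 0 := by simp [e3]
@[simp] theorem e3_two : e3 2 = 1 := by simp [e3]

theorem E3.ext {x y : E3} (h0 : x 0 = y 0) (h1 : x 1 = y 1) (h2 : x 2 = y 2) : x = y := by
  ext i; fin_cases i
  · exact h0
  · exact h1
  · exact h2

theorem E2.ext {x y : E2} (h0 : x 0 = y 0) (h1 : x 1 = y 1) : x = y := by
  ext i; fin_cases i
  · exact h0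
  · exact h1

@[simp] theorem proj2_lift3 (x : E2) (z : ℝ) : proj2 (lift3 x z) = x := E2.ext (by simp) (by simp)

@[simp] theorem lift3_proj2 (x : E3) : lift3 (proj2 x) (x 2) = x :=
  E3.ext (by simp) (by simp) (by simp)

theorem lift3_add_smul (x : E2) (z t : ℝ) : lift3 x z + t • e3 = lift3 x (z + t) :=
  E3.ext (by simp) (by simp) (by simp)

theorem lift3_sub_lift3 (x : E2) (z t : ℝ) : lift3 x z - lift3 x t = (z - t) • e3 :=
  E3.ext (by simp) (by simp) (by simp)

theorem E2.norm_sq (x : E2) : ‖x‖ ^ 2 = x 0 ^ 2 + x 1 ^ 2 := by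
  rw [EuclideanSpace.norm_sq_eq]; simp [Fin.sum_univ_two]

theorem E3.norm_sq (x : E3) : ‖x‖ ^ 2 = x 0 ^ 2 + x 1 ^ 2 + x 2 ^ 2 := by
  rw [EuclideanSpace.norm_sq_eq]; simp [Fin.sum_univ_three]

theorem E3.norm_sq' (x : E3) : ‖x‖ ^ 2 = ‖proj2 x‖ ^ 2 + x 2 ^ 2 := by
  rw [E3.norm_sq, E2.norm_sq]; simp

theorem norm_lift3_sq (x : E2) (z : ℝ) : ‖lift3 x z‖ ^ 2 = ‖x‖ ^ 2 + z ^ 2 := by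
  rw [E3.norm_sq']; simp

theorem norm_proj2_le (x : E3) : ‖proj2 x‖ ≤ ‖x‖ := by
  refine abs_le_of_sq_le_sq' ?_ (norm_nonneg _) |>.2
  rw [E3.norm_sq' x]; nlinarith [sq_nonneg (x 2)]

theorem abs_coord_le (x : E3) (i : Fin 3) : |x i| ≤ ‖x‖ := by
  have := PiLp.norm_apply_le x i
  simpa using this

theorem norm_lift3_le (x : E2) (z : ℝ) : ‖lift3 x z‖ ≤ ‖x‖ + |z| := by
  refine abs_le_of_sq_le_sq' ?_ (by positivity) |>.2
  rw [norm_lift3_sq]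
  nlinarith [norm_nonneg x, abs_nonneg z, sq_abs z, mul_nonneg (norm_nonneg x) (abs_nonneg z)]

theorem norm_le_norm_lift3 (x : E2) (z : ℝ) : ‖x‖ ≤ ‖lift3 x z‖ := by
  have := norm_proj2_le (lift3 x z)
  simpa using this

@[simp] theorem norm_e3 : ‖e3‖ = 1 := by simp [e3]

/-- The inclusion of the horizontal plane. -/
noncomputable def incl2 : E2 →L[ℝ] E3 :=
  LinearMap.toContinuousLinearMap
    { toFun := fun x => lift3 x 0
      map_add' := fun x y => E3.ext (by simp) (by simp) (by simp)
      map_smul' := fun c x => E3.ext (by simp) (by simp) (by simp) }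

theorem incl2_apply (x : E2) : incl2 x = lift3 x 0 := rfl

theorem lift3_eq (x : E2) (z : ℝ) : lift3 x z = incl2 x + z • e3 := by
  rw [incl2_apply, lift3_add_smul, zero_add]

theorem continuous_lift3 : Continuous fun p : E2 × ℝ => lift3 p.1 p.2 := by
  simp only [lift3_eq]; fun_prop

/-! ### Functions with bounded logarithmic gradient -/

/-- Polar coordinates in the plane. -/
noncomputable def polarPt (r φ : ℝ) : E2 := !₂[r * Real.cos φ, r * Real.sin φ]

@[simp] theorem polarPt_zero (r φ : ℝ) : polarPt r φ 0 = r * Real.cos φ := rfl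
@[simp] theorem polarPt_one (r φ : ℝ) : polarPt r φ 1 = r * Real.sin φ := rfl

theorem norm_polarPt {r : ℝ} (hr : 0 ≤ r) (φ : ℝ) : ‖polarPt r φ‖ = r := by
  have h : ‖polarPt r φ‖ ^ 2 = r ^ 2 := by
    rw [E2.norm_sq]; simp
    nlinarith [Real.sin_sq_add_cos_sq φ]
  exact (pow_left_inj₀ (norm_nonneg _) hr two_ne_zero).1 h

theorem exists_polarPt (x : E2) : ∃ φ, |φ| ≤ Real.pi ∧ x = polarPt ‖x‖ φ := by
  let z : ℂ := ⟨x 0, x 1⟩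
  have hz : ‖z‖ = ‖x‖ := by
    refine (pow_left_inj₀ (norm_nonneg _) (norm_nonneg _) two_ne_zero).1 ?_
    rw [E2.norm_sq, ← Complex.normSq_eq_norm_sq, Complex.normSq_apply]
    ring
  refine ⟨z.arg, Complex.abs_arg_le_pi z, E2.ext ?_ ?_⟩
  · rw [polarPt_zero, ← hz, Complex.norm_mul_cos_arg]
  · rw [polarPt_one, ← hz, Complex.norm_mul_sin_arg]

theorem polarPt_eq_single (r φ : ℝ) : polarPt r φ =
    (r * Real.cos φ) • EuclideanSpace.single 0 1 + (r * Real.sin φ) • EuclideanSpace.single 1 1 :=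
  E2.ext (by simp) (by simp)

theorem hasDerivAt_polarPt_angle (r φ : ℝ) :
    HasDerivAt (fun φ => polarPt r φ) (polarPt r (φ + Real.pi / 2)) φ := by
  simp only [polarPt_eq_single, Real.cos_add_pi_div_two, Real.sin_add_pi_div_two]
  exact (((Real.hasDerivAt_cos φ).const_mul r).smul_const _).add
    (((Real.hasDerivAt_sin φ).const_mul r).smul_const _)

theorem polarPt_eq_smul (r φ : ℝ) : polarPt r φ = r • polarPt 1 φ :=
  E2.ext (by simp) (by simp)

/-- If `|x||∇f| ≤ c` then `f` is Lipschitz in logarithmic polar coordinates. -/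
theorem norm_sub_le_of_log_gradient {F : Type*} [NormedAddCommGroup F] [NormedSpace ℝ F]
    {f : E2 → F} {R c : ℝ} (hR : 0 < R)
    (hf : ∀ x : E2, R < ‖x‖ → DifferentiableAt ℝ f x)
    (hc : ∀ x : E2, R < ‖x‖ → ‖x‖ * ‖fderiv ℝ f x‖ ≤ c) {x y : E2} (hx : R < ‖x‖) (hy : R < ‖y‖) :
    ‖f x - f y‖ ≤ c * (2 * Real.pi + |Real.log (‖x‖ / ‖y‖)|) := by
  obtain ⟨a, ha, hxa⟩ := exists_polarPt x
  obtain ⟨b, hb, hyb⟩ := exists_polarPt y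
  have hx0 : 0 < ‖x‖ := hR.trans hx
  have hy0 : 0 < ‖y‖ := hR.trans hy
  -- Along a circle the derivative in the angle is at most `c`, and the two angles differ by at most
  -- `2π`.
  have h1 : ‖f (polarPt ‖x‖ a) - f (polarPt ‖x‖ b)‖ ≤ c * ‖a - b‖ := by
    refine convex_univ.norm_image_sub_le_of_norm_hasDerivWithin_le
      (f := fun φ => f (polarPt ‖x‖ φ))
      (f' := fun φ => fderiv ℝ f (polarPt ‖x‖ φ) (polarPt ‖x‖ (φ + Real.pi / 2)))
      (fun φ _ => ?_) (fun φ _ => ?_) (mem_univ _) (mem_univ _)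
    · have hφ : R < ‖polarPt ‖x‖ φ‖ := by rwa [norm_polarPt hx0.le]
      exact ((hf _ hφ).hasFDerivAt.comp_hasDerivAt φ
        (hasDerivAt_polarPt_angle _ _)).hasDerivWithinAt
    · have hφ : R < ‖polarPt ‖x‖ φ‖ := by rwa [norm_polarPt hx0.le]
      refine (ContinuousLinearMap.le_opNorm _ _).trans ?_
      rw [norm_polarPt hx0.le, mul_comm]
      have := hc _ hφ
      rwa [norm_polarPt hx0.le] at this
  -- Along a ray the derivative in the logarithm of the radius is at most `c`.
  have h2 : ‖f (polarPt (Real.exp (Real.log ‖x‖)) b) - f (polarPt (Real.exp (Real.log ‖y‖)) b)‖ ≤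
      c * ‖Real.log ‖x‖ - Real.log ‖y‖‖ := by
    refine (convex_Ioi (Real.log R)).norm_image_sub_le_of_norm_hasDerivWithin_le
      (f := fun τ => f (polarPt (Real.exp τ) b))
      (f' := fun τ => fderiv ℝ f (polarPt (Real.exp τ) b) (Real.exp τ • polarPt 1 b))
      (fun τ hτ => ?_) (fun τ hτ => ?_) (Real.log_lt_log hR hy) (Real.log_lt_log hR hx)
    · have hτ' : R < ‖polarPt (Real.exp τ) b‖ := by
        rw [norm_polarPt (Real.exp_pos τ).le, ← Real.exp_log hR]
        exact Real.exp_lt_exp.2 hτ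
      have h3 : HasDerivAt (fun τ => polarPt (Real.exp τ) b) (Real.exp τ • polarPt 1 b) τ := by
        have : (fun τ => polarPt (Real.exp τ) b) = fun τ => Real.exp τ • polarPt 1 b :=
          funext fun τ => polarPt_eq_smul _ _
        rw [this]
        exact (Real.hasDerivAt_exp τ).smul_const _
      exact ((hf _ hτ').hasFDerivAt.comp_hasDerivAt τ h3).hasDerivWithinAt
    · have hτ' : R < ‖polarPt (Real.exp τ) b‖ := by
        rw [norm_polarPt (Real.exp_pos τ).le, ← Real.exp_log hR]
        exact Real.exp_lt_exp.2 hτ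
      refine (ContinuousLinearMap.le_opNorm _ _).trans ?_
      rw [← polarPt_eq_smul, mul_comm]
      exact hc _ hτ'
  rw [Real.exp_log hx0, Real.exp_log hy0, ← hyb] at h2
  rw [← hxa] at h1
  rw [← Real.log_div hx0.ne' hy0.ne'] at h2
  have hc0 : 0 ≤ c := (by positivity : (0:ℝ) ≤ ‖x‖ * ‖fderiv ℝ f x‖).trans (hc x hx)
  have hab : ‖a - b‖ ≤ 2 * Real.pi := by
    rw [Real.norm_eq_abs]
    have := abs_sub a b
    linarith
  calc ‖f x - f y‖ ≤ ‖f x - f (polarPt ‖x‖ b)‖ + ‖f (polarPt ‖x‖ b) - f y‖ :=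
        norm_sub_le_norm_sub_add_norm_sub _ _ _
    _ ≤ c * (2 * Real.pi) + c * |Real.log (‖x‖ / ‖y‖)| := by
        refine add_le_add (h1.trans ?_) h2
        gcongr
    _ = _ := by ring

/-- Functions with `|x||∇f| ≤ c` grow slower than any multiple of `|x|`. -/
theorem exists_sublinear_bound {F : Type*} [NormedAddCommGroup F] [NormedSpace ℝ F]
    {f : E2 → F} {R c : ℝ} (hR : 0 < R) (hf : ∀ x : E2, R < ‖x‖ → DifferentiableAt ℝ f x)
    (hc : ∀ x : E2, R < ‖x‖ → ‖x‖ * ‖fderiv ℝ f x‖ ≤ c) {ε : ℝ} (hε : 0 < ε) :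
    ∃ C, 0 ≤ C ∧ ∀ x : E2, R < ‖x‖ → ‖f x‖ ≤ ε * ‖x‖ + C := by
  let y : E2 := polarPt (R + 1) 0
  have hyn : ‖y‖ = R + 1 := norm_polarPt (by linarith) 0
  have hy : R < ‖y‖ := by linarith
  have hc0 : 0 ≤ c := (by positivity : (0:ℝ) ≤ ‖y‖ * ‖fderiv ℝ f y‖).trans (hc y hy)
  -- The inequality `log (δ t) ≤ δ t - 1` bounds the logarithm by `δ t` plus a constant, and `c δ ≤
  -- ε` absorbs the factor `c`.
  obtain ⟨δ, hδ, hδc⟩ : ∃ δ > 0, c * δ ≤ ε := by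
    refine ⟨ε / (c + 1), by positivity, ?_⟩
    rw [mul_div_assoc', div_le_iff₀ (by linarith)]
    nlinarith
  have hlog : ∀ t, R < t → |Real.log (t / ‖y‖)| ≤ δ * t + (|Real.log δ| + |Real.log ‖y‖| + |Real.log R|) := by
    intro t ht
    have ht0 : 0 < t := hR.trans ht
    have h1 : Real.log t ≤ δ * t + |Real.log δ| := by
      have := Real.log_le_sub_one_of_pos (mul_pos hδ ht0)
      rw [Real.log_mul hδ.ne' ht0.ne'] at this
      have := neg_abs_le (Real.log δ)
      linarith
    have h2 : -|Real.log R| ≤ Real.log t :=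
      (neg_abs_le _).trans (Real.log_le_log hR ht.le)
    rw [Real.log_div ht0.ne' (by linarith)]
    have h3 := abs_nonneg (Real.log δ)
    have h4 := abs_nonneg (Real.log R)
    have h5 := neg_abs_le (Real.log ‖y‖)
    have h6 := le_abs_self (Real.log ‖y‖)
    have h7 := mul_pos hδ ht0
    rw [abs_le]
    constructor <;> linarith
  refine ⟨c * (2 * Real.pi + (|Real.log δ| + |Real.log ‖y‖| + |Real.log R|)) + ‖f y‖, by positivity,
    fun x hx => ?_⟩
  have h1 := norm_sub_le_of_log_gradient hR hf hc hx hy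
  have h2 := hlog ‖x‖ hx
  have h3 : ‖f x‖ ≤ ‖f x - f y‖ + ‖f y‖ := by
    simpa using norm_add_le (f x - f y) (f y)
  have h4 : c * |Real.log (‖x‖ / ‖y‖)| ≤ c * (δ * ‖x‖ + (|Real.log δ| + |Real.log ‖y‖| + |Real.log R|)) :=
    mul_le_mul_of_nonneg_left h2 hc0
  have h5 : c * δ * ‖x‖ ≤ ε * ‖x‖ := mul_le_mul_of_nonneg_right hδc (norm_nonneg x)
  nlinarith

/-! ### Graphical ends -/

theorem lt_of_fderiv_neg {F : E3 → ℝ} {B : Set E3} (hB : Convex ℝ B) {v x : E3} {t : ℝ}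
    (hF : ∀ y ∈ B, DifferentiableAt ℝ F y ∧ fderiv ℝ F y v < 0) (ht : 0 < t) (hx : x ∈ B)
    (hxt : x + t • v ∈ B) : F (x + t • v) < F x := by
  obtain ⟨z, hz, h⟩ := domain_mvt (f' := fderiv ℝ F)
    (fun y hy => ((hF y hy).1.hasFDerivAt).hasFDerivWithinAt) hB hx hxt
  have hzB := hB.segment_subset hx hxt hz
  rw [add_sub_cancel_left, map_smul, smul_eq_mul] at h
  have := mul_neg_of_pos_of_neg ht (hF z hzB).2
  linarith

section

variable {S W C : Set E3} {μ : E3 → E3} {A : E3 ≃ₗᵢ[ℝ] E3} {R : ℝ} {ψ : E2 → ℝ}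

theorem IsGraphEnd.mem (hG : IsGraphEnd μ C A R ψ) {h : E2} (hh : R < ‖h‖) :
    A (lift3 h (ψ h)) ∈ C := by
  rw [hG.graph]; exact ⟨h, hh, rfl⟩

theorem IsGraphEnd.mem_iff (hG : IsGraphEnd μ C A R ψ) {y : E3} :
    y ∈ C ↔ R < ‖proj2 (A.symm y)‖ ∧ A.symm y 2 = ψ (proj2 (A.symm y)) := by
  constructor
  · intro hy
    rw [hG.graph] at hy
    obtain ⟨h, hh, rfl⟩ := hy
    have : A.symm ((fun x : E2 => A !₂[x 0, x 1, ψ x]) h) = lift3 h (ψ h) := A.symm_apply_apply _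
    rw [this]
    simpa using hh
  · rintro ⟨h1, h2⟩
    have := hG.mem h1
    rwa [← h2, lift3_proj2, A.apply_symm_apply] at this

theorem isOpen_exterior (R : ℝ) : IsOpen {x : E2 | R < ‖x‖} :=
  isOpen_lt continuous_const continuous_norm

theorem IsGraphEnd.contDiffAt (hG : IsGraphEnd μ C A R ψ) {h : E2} (hh : R < ‖h‖) :
    ContDiffAt ℝ 2 ψ h :=
  hG.smooth.contDiffAt ((isOpen_exterior R).mem_nhds hh)

/-- Near a point of a graphical end there is a defining function which decreases vertically. -/
theorem IsGraphEnd.exists_vertical (hG : IsGraphEnd μ C A R ψ) (hW : IsInnerSide S μ W)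
    (hCS : C ⊆ S) {h : E2} (hh : R < ‖h‖) :
    ∃ (V : Set E3) (F : E3 → ℝ), IsOpen V ∧ Convex ℝ V ∧ lift3 h (ψ h) ∈ V ∧ ContDiffOn ℝ ∞ F V ∧
      (∀ x ∈ V, fderiv ℝ F x e3 < 0) ∧ (∀ x ∈ V, A x ∈ S ↔ F x = 0) ∧
      ∀ x ∈ V, A x ∈ W ↔ F x < 0 := by
  have hqC := hG.mem hh
  obtain ⟨U, f, hqU, hf⟩ := hW.exists_defining _ (hCS hqC)
  have hVo : IsOpen (A ⁻¹' U) := hf.isOpen.preimage A.continuous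
  have hF : ContDiffOn ℝ ∞ (fun x => f (A x)) (A ⁻¹' U) :=
    hf.smooth.comp A.contDiff.contDiffOn (mapsTo_preimage _ _)
  have hcont : ContinuousOn (fun x => fderiv ℝ (fun x => f (A x)) x e3) (A ⁻¹' U) :=
    (hF.continuousOn_fderiv_of_isOpen hVo (by simp)).clm_apply continuousOn_const
  have hneg : fderiv ℝ (fun x => f (A x)) (lift3 h (ψ h)) e3 < 0 := by
    have hd : DifferentiableAt ℝ f (A (lift3 h (ψ h))) :=
      (hf.smooth.contDiffAt (hf.isOpen.mem_nhds hqU)).differentiableAt (by simp)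
    have h1 : HasFDerivAt (fun x => f (A x))
        ((fderiv ℝ f (A (lift3 h (ψ h)))).comp (A.toContinuousLinearEquiv : E3 →L[ℝ] E3))
        (lift3 h (ψ h)) := hd.hasFDerivAt.comp _ A.toContinuousLinearEquiv.hasFDerivAt
    rw [h1.fderiv]
    have h2 := hG.normal_down _ hqC
    rw [hf.normal_eq _ ⟨hCS hqC, hqU⟩, inner_smul_left, inner_gradient_left] at h2
    have h3 : (0 : ℝ) < ‖gradient f (A (lift3 h (ψ h)))‖⁻¹ :=
      inv_pos.2 (norm_pos_iff.2 (hf.gradient_ne _ ⟨hCS hqC, hqU⟩))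
    exact neg_of_mul_neg_right h2 h3.le
  have hnhds : ∀ᶠ x in 𝓝 (lift3 h (ψ h)), x ∈ A ⁻¹' U ∧ fderiv ℝ (fun x => f (A x)) x e3 < 0 :=
    Eventually.and (hVo.mem_nhds hqU) ((hcont.continuousAt (hVo.mem_nhds hqU)).eventually_lt_const hneg)
  obtain ⟨ε, hε, hball⟩ := Metric.eventually_nhds_iff_ball.1 hnhds
  exact ⟨Metric.ball _ ε, fun x => f (A x), Metric.isOpen_ball, convex_ball _ _,
    Metric.mem_ball_self hε, hF.mono fun x hx => (hball x hx).1, fun x hx => (hball x hx).2,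
    fun x hx => hf.mem_surface _ (hball x hx).1, fun x hx => hf.mem_inner _ (hball x hx).1⟩

theorem IsGraphEnd.tendsto_foot (hG : IsGraphEnd μ C A R ψ) {h : E2} (hh : R < ‖h‖) :
    Tendsto (fun x : E3 => lift3 (proj2 x) (ψ (proj2 x))) (𝓝 (lift3 h (ψ h)))
      (𝓝 (lift3 h (ψ h))) := by
  have h1 : ContinuousAt (fun x : E3 => ψ (proj2 x)) (lift3 h (ψ h)) :=
    ContinuousAt.comp (g := ψ) (by simpa using (hG.contDiffAt hh).continuousAt)
      proj2.continuous.continuousAt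
  have h2 := (continuous_lift3.continuousAt (x := (h, ψ h))).tendsto.comp
    (f := fun x : E3 => (proj2 x, ψ (proj2 x))) (x := 𝓝 (lift3 h (ψ h)))
    (by
      have := (proj2.continuous.continuousAt (x := lift3 h (ψ h))).prodMk h1
      simpa [ContinuousAt] using this)
  exact h2

/-- Near a graphical end, the region lies above the graph. -/
theorem IsGraphEnd.eventually_above (hG : IsGraphEnd μ C A R ψ) (hW : IsInnerSide S μ W)
    (hCS : C ⊆ S) {h : E2} (hh : R < ‖h‖) :
    ∀ᶠ x in 𝓝 (lift3 h (ψ h)), (A x ∈ W ↔ ψ (proj2 x) < x 2) ∧ (A x ∈ S ↔ x 2 = ψ (proj2 x)) := by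
  obtain ⟨V, F, hVo, hVc, hV, hF, hneg, hFS, hFW⟩ := hG.exists_vertical hW hCS hh
  have hext : ∀ᶠ x : E3 in 𝓝 (lift3 h (ψ h)), R < ‖proj2 x‖ :=
    (isOpen_lt continuous_const (continuous_norm.comp proj2.continuous)).mem_nhds (by simpa using hh)
  filter_upwards [hVo.mem_nhds hV, (hG.tendsto_foot hh).eventually (hVo.mem_nhds hV), hext]
    with x hx hx' hxR
  have h0 : F (lift3 (proj2 x) (ψ (proj2 x))) = 0 := (hFS _ hx').1 (hCS (hG.mem hxR))
  have hd : ∀ y ∈ V, DifferentiableAt ℝ F y ∧ fderiv ℝ F y e3 < 0 := fun y hy =>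
    ⟨(hF.contDiffAt (hVo.mem_nhds hy)).differentiableAt (by simp), hneg y hy⟩
  rw [hFS x hx, hFW x hx]
  -- The function `F` vanishes at the foot point on the graph below or above `x` and decreases
  -- strictly along the vertical segment, so its sign at `x` is determined by the height.
  rcases lt_trichotomy (x 2) (ψ (proj2 x)) with hlt | heq | hgt
  · have h1 : x + (ψ (proj2 x) - x 2) • e3 = lift3 (proj2 x) (ψ (proj2 x)) :=
      E3.ext (by simp) (by simp) (by simp)
    have h2 := lt_of_fderiv_neg hVc hd (sub_pos.2 hlt) hx (by rwa [h1])
    rw [h1, h0] at h2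
    exact ⟨⟨fun h => absurd h h2.not_gt, fun h => absurd h hlt.not_gt⟩,
      ⟨fun h => absurd h h2.ne', fun h => absurd h hlt.ne⟩⟩
  · have h1 : x = lift3 (proj2 x) (ψ (proj2 x)) := by rw [← heq, lift3_proj2]
    rw [← h1] at h0
    simp [h0, heq]
  · have h1 : lift3 (proj2 x) (ψ (proj2 x)) + (x 2 - ψ (proj2 x)) • e3 = x :=
      E3.ext (by simp) (by simp) (by simp)
    have h2 := lt_of_fderiv_neg hVc hd (sub_pos.2 hgt) hx' (by rwa [h1])
    rw [h1, h0] at h2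
    exact ⟨⟨fun _ => hgt, fun _ => h2⟩, ⟨fun h => absurd h h2.ne, fun h => absurd h hgt.ne'⟩⟩

/-- The function of which an end is the graph is smooth. -/
theorem IsGraphEnd.contDiffAt_top (hG : IsGraphEnd μ C A R ψ) (hW : IsInnerSide S μ W)
    (hCS : C ⊆ S) {h : E2} (hh : R < ‖h‖) : ContDiffAt ℝ ∞ ψ h := by
  obtain ⟨V, F, hVo, hVc, hV, hF, hneg, hFS, hFW⟩ := hG.exists_vertical hW hCS hh
  -- The implicit function theorem: replacing the height by `F` is a local diffeomorphism, and `ψ h`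
  -- is the height of the preimage of `(h, 0)`.
  let Φ : E3 → E3 := fun x => incl2 (proj2 x) + F x • e3
  have hΦ : ContDiffOn ℝ ∞ Φ V :=
    (incl2.contDiff.comp proj2.contDiff).contDiffOn.add (hF.smul contDiffOn_const)
  have hFd := ((hF.contDiffAt (hVo.mem_nhds hV)).differentiableAt (by simp)).hasFDerivAt
  have hd : HasFDerivAt Φ (incl2.comp proj2 +
      (fderiv ℝ F (lift3 h (ψ h))).smulRight e3) (lift3 h (ψ h)) :=
    (incl2.comp proj2).hasFDerivAt.add (hFd.smul_const e3)
  obtain ⟨e, he, hpe, hsub, hsymm⟩ := exists_smooth_chart hVo hV hΦ (by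
    intro v hv
    rw [hd.fderiv] at hv
    have h1 : ∀ i, (incl2 (proj2 v) + fderiv ℝ F (lift3 h (ψ h)) v • e3) i = 0 := fun i => by
      have := congrArg (fun w : E3 => w i) hv
      simpa using this
    have hv0 := h1 0
    have hv1 := h1 1
    have hv2 := h1 2
    simp [incl2_apply] at hv0 hv1 hv2
    have hve : v = v 2 • e3 := E3.ext (by simp [hv0]) (by simp [hv1]) (by simp)
    rw [hve, map_smul, smul_eq_mul] at hv2
    rcases mul_eq_zero.1 hv2 with h | h
    · rw [hve, h, zero_smul]
    · exact absurd h (hneg _ hV).ne)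
  have hfoot : Tendsto (fun k : E2 => lift3 k (ψ k)) (𝓝 h) (𝓝 (lift3 h (ψ h))) :=
    (continuous_lift3.continuousAt (x := (h, ψ h))).tendsto.comp
      (f := fun k : E2 => (k, ψ k)) (continuousAt_id.prodMk (hG.contDiffAt hh).continuousAt)
  have hval : ∀ k : E2, R < ‖k‖ → lift3 k (ψ k) ∈ V → Φ (lift3 k (ψ k)) = incl2 k := by
    intro k hk hkV
    have : F (lift3 k (ψ k)) = 0 := (hFS _ hkV).1 (hCS (hG.mem hk))
    simp [Φ, this]
  have hev : ψ =ᶠ[𝓝 h] fun k => e.symm (incl2 k) 2 := by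
    filter_upwards [hfoot.eventually (e.open_source.mem_nhds hpe), (isOpen_exterior R).mem_nhds hh]
      with k hk hkR
    have h1 := e.left_inv hk
    rw [he, hval k hkR (hsub hk)] at h1
    rw [h1]; simp
  have htar : incl2 h ∈ e.target := by
    rw [← hval h hh hV, ← he]; exact e.map_source hpe
  have h1 : ContDiffAt ℝ ∞ (fun k => e.symm (incl2 k)) h :=
    (hsymm.contDiffAt (e.open_target.mem_nhds htar)).comp h incl2.contDiff.contDiffAt
  exact ContDiffAt.congr_of_eventuallyEq (contDiffAt_euclidean.1 h1 2) hev

/-- The ray above a point of an end. -/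
theorem isPreconnected_vertical (A : E3 ≃ₗᵢ[ℝ] E3) (h : E2) {I : Set ℝ} (hI : IsPreconnected I) :
    IsPreconnected ((fun z => A (lift3 h z)) '' I) :=
  hI.image _ (A.continuous.comp (continuous_lift3.comp (Continuous.prodMk_right h))).continuousOn

theorem IsGraphEnd.eventually_mem_inner (hG : IsGraphEnd μ C A R ψ) (hW : IsInnerSide S μ W)
    (hCS : C ⊆ S) {h : E2} (hh : R < ‖h‖) :
    ∃ δ > 0, ∀ z, |z - ψ h| < δ → (A (lift3 h z) ∈ W ↔ ψ h < z) ∧ (A (lift3 h z) ∈ S ↔ z = ψ h) := by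
  have h1 : Tendsto (fun z => lift3 h z) (𝓝 (ψ h)) (𝓝 (lift3 h (ψ h))) :=
    (continuous_lift3.comp (Continuous.prodMk_right h)).tendsto _
  obtain ⟨δ, hδ, h2⟩ := Metric.eventually_nhds_iff.1 (h1.eventually (hG.eventually_above hW hCS hh))
  exact ⟨δ, hδ, fun z hz => by simpa using h2 hz⟩

/-- If different ends border different ends of the region, the rays above an end far out lie in the
region. -/
theorem IsGraphEnd.ray_subset (hG : IsGraphEnd μ C A R ψ) (hW : IsInnerSide S μ W)
    (hcl : IsClosed S) {Ω : Set E3} (hC : C ∈ componentsOf (S \ Ω))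
    (hsep : ∀ p ∈ S \ Ω, ∀ q ∈ S \ Ω, q ∈ connectedComponentIn (regionOf S μ \ Ω) p →
      q ∈ connectedComponentIn (S \ Ω) p) {ρ : ℝ} (hρ : ∀ y ∈ Ω, ‖y‖ ≤ ρ) {h : E2} (hh : R < ‖h‖)
    (hhρ : ρ < ‖h‖) {z : ℝ} (hz : ψ h < z) : A (lift3 h z) ∈ W := by
  obtain ⟨p₀, hp₀, rfl⟩ := hC
  have hCS : connectedComponentIn (S \ Ω) p₀ ⊆ S :=
    (connectedComponentIn_subset _ _).trans sdiff_subset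
  obtain ⟨δ, hδ, hnear⟩ := hG.eventually_mem_inner hW hCS hh
  have hcont : Continuous fun z => A (lift3 h z) :=
    A.continuous.comp (continuous_lift3.comp (Continuous.prodMk_right h))
  have hnW : A (lift3 h (ψ h + δ / 2)) ∈ W :=
    (hnear _ (by rw [add_sub_cancel_left, abs_of_pos] <;> linarith)).1.2 (by linarith)
  have hsub : ∀ I : Set ℝ, IsPreconnected I → ψ h + δ / 2 ∈ I →
      (∀ t ∈ I, A (lift3 h t) ∉ S) → (fun z => A (lift3 h z)) '' I ⊆ W := by
    intro I hI hmem hdis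
    refine hW.subset_of_preconnected _ (isPreconnected_vertical A h hI) ?_
      ⟨_, mem_image_of_mem _ hmem, hnW⟩
    rw [Set.disjoint_right]
    rintro _ ⟨t, ht, rfl⟩
    exact hdis t ht
  by_cases hT : ∃ t, ψ h < t ∧ A (lift3 h t) ∈ S
  · exfalso
    -- At the first height `t₀` where the ray meets `S` again, the segment below connects the end to
    -- this point within `M^S - Ω`. By separation the point belongs to the same end, which as a
    -- graph meets the vertical line only once.
    let T : Set ℝ := {t | ψ h + δ / 2 ≤ t ∧ A (lift3 h t) ∈ S}
    have hTcl : IsClosed T := isClosed_Ici.inter (hcl.preimage hcont)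
    have hTbd : BddBelow T := ⟨ψ h + δ / 2, fun t ht => ht.1⟩
    have hlow : ∀ t, ψ h < t → A (lift3 h t) ∈ S → ψ h + δ ≤ t := by
      intro t ht htS
      by_contra! hlt
      have := (hnear t (by rw [abs_of_pos] <;> linarith)).2.1 htS
      linarith
    have hTne : T.Nonempty := by
      obtain ⟨t, ht, htS⟩ := hT
      exact ⟨t, by linarith [hlow t ht htS], htS⟩
    have hmin := hTcl.csInf_mem hTne hTbd
    set t₀ := sInf T
    have ht₀ : ψ h + δ ≤ t₀ := hlow t₀ (by linarith [hmin.1]) hmin.2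
    have hIoo : (fun z => A (lift3 h z)) '' Ioo (ψ h) t₀ ⊆ W := by
      refine hsub _ isPreconnected_Ioo ⟨by linarith, by linarith⟩ fun t ht htS => ?_
      have h1 := hlow t ht.1 htS
      have h2 : t₀ ≤ t := csInf_le hTbd ⟨by linarith, htS⟩
      exact absurd ht.2 h2.not_gt
    have hnorm : ∀ t, A (lift3 h t) ∉ Ω := by
      intro t ht
      have h1 := hρ _ ht
      rw [A.norm_map] at h1
      linarith [norm_le_norm_lift3 h t]
    have hIcc : (fun z => A (lift3 h z)) '' Icc (ψ h) t₀ ⊆ regionOf S μ \ Ω := by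
      rintro _ ⟨t, ht, rfl⟩
      refine ⟨?_, hnorm t⟩
      rw [hW.region_eq]
      rcases ht.1.eq_or_lt with h1 | h1
      · left; rw [← h1]; exact hCS (hG.mem hh)
      · rcases ht.2.eq_or_lt with h2 | h2
        · left; rw [h2]; exact hmin.2
        · right; exact hIoo ⟨t, ⟨h1, h2⟩, rfl⟩
    have hq := (isPreconnected_vertical A h isPreconnected_Icc).subset_connectedComponentIn
      ⟨ψ h, ⟨le_rfl, by linarith⟩, rfl⟩ hIcc ⟨t₀, ⟨by linarith, le_rfl⟩, rfl⟩
    have hpC : A (lift3 h (ψ h)) ∈ connectedComponentIn (S \ Ω) p₀ := hG.mem hh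
    have hq' := hsep _ (connectedComponentIn_subset _ _ hpC) _ ⟨hmin.2, hnorm t₀⟩ hq
    rw [← connectedComponentIn_eq hpC] at hq'
    have := (hG.mem_iff.1 hq').2
    simp at this
    linarith
  · push Not at hT
    exact hsub (Ioi (ψ h)) isPreconnected_Ioi (by simp [hδ]) (fun t ht => hT t ht) ⟨z, hz, rfl⟩

end

/-! ### The region far out -/

theorem symm_coord_two (A : E3 ≃ₗᵢ[ℝ] E3) (y : E3) : A.symm y 2 = inner ℝ y (A e3) := by
  have h : inner ℝ (A.symm y) e3 = inner ℝ y (A e3) := by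
    rw [← A.inner_map_map, A.apply_symm_apply]
  rw [← h]
  simp [e3, EuclideanSpace.inner_single_right]

theorem IsGraphEnd.exists_sublinear {C : Set E3} {μ : E3 → E3} {A : E3 ≃ₗᵢ[ℝ] E3} {R : ℝ}
    {ψ : E2 → ℝ} (hG : IsGraphEnd μ C A R ψ) {ε : ℝ} (hε : 0 < ε) :
    ∃ K, 0 ≤ K ∧ ∀ h : E2, R < ‖h‖ → |ψ h| ≤ ε * ‖h‖ + K := by
  obtain ⟨c, hc⟩ := hG.decay
  exact exists_sublinear_bound (c := c) hG.pos
    (fun x hx => (hG.contDiffAt hx).differentiableAt (by simp))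
    (fun x hx => le_trans (le_add_of_nonneg_right (by positivity)) (hc x hx)) hε

/-- A graphical end of `S` above which `W` lies. -/
structure IsUpperEnd (S W : Set E3) (μ : E3 → E3) (C : Set E3) (A : E3 ≃ₗᵢ[ℝ] E3) (R : ℝ)
    (ψ : E2 → ℝ) (ρ : ℝ) : Prop where
  graph : IsGraphEnd μ C A R ψ
  subset : C ⊆ S
  le : R ≤ ρ
  ray : ∀ h : E2, ρ < ‖h‖ → ∀ z, ψ h < z → A (lift3 h z) ∈ W

theorem exists_orthogonal_of_transversal {u : E3} (hu : ‖u‖ = 1) (h2 : u 2 ^ 2 ≠ 1) :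
    ∃ w : E3, inner ℝ w u = 0 ∧ 0 < w 2 ∧ 0 < ‖proj2 w‖ := by
  have hu' := E3.norm_sq u
  rw [hu] at hu'
  have hs : 0 < u 0 ^ 2 + u 1 ^ 2 := by
    refine lt_of_le_of_ne (by positivity) fun h => h2 (by linarith)
  -- This is the projection of `e₃` to the complement of `u`, plus the horizontal vector `(-u₁, u₀,
  -- 0)`, also orthogonal to `u`. The second summand keeps the horizontal part non-zero when `u`
  -- itself is horizontal.
  refine ⟨!₂[-(u 2 * u 0) - u 1, -(u 2 * u 1) + u 0, u 0 ^ 2 + u 1 ^ 2], ?_, hs, ?_⟩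
  · simp [PiLp.inner_apply, Fin.sum_univ_three]
    ring
  · have h3 : ‖proj2 !₂[-(u 2 * u 0) - u 1, -(u 2 * u 1) + u 0, u 0 ^ 2 + u 1 ^ 2]‖ ^ 2 =
        (u 2 ^ 2 + 1) * (u 0 ^ 2 + u 1 ^ 2) := by
      rw [E2.norm_sq]; simp; ring
    have h4 : 0 < (u 2 ^ 2 + 1) * (u 0 ^ 2 + u 1 ^ 2) := by positivity
    refine lt_of_le_of_ne (norm_nonneg _) fun h0 => ?_
    rw [← h0, zero_pow two_ne_zero] at h3
    exact h4.ne h3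

section

variable {S W C₁ C₂ : Set E3} {μ : E3 → E3} {A₁ A₂ : E3 ≃ₗᵢ[ℝ] E3} {R₁ R₂ ρ : ℝ}
  {ψ₁ ψ₂ : E2 → ℝ}

/-- The asymptotic planes of two ends are parallel. -/
theorem IsUpperEnd.parallel (h₁ : IsUpperEnd S W μ C₁ A₁ R₁ ψ₁ ρ)
    (h₂ : IsUpperEnd S W μ C₂ A₂ R₂ ψ₂ ρ) (hSW : Disjoint S W) :
    A₁.symm (A₂ e3) 2 ^ 2 = 1 := by
  by_contra hne
  set u := A₁.symm (A₂ e3)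
  have hu : ‖u‖ = 1 := by simp [u]
  -- `u` is the vertical direction of the second end seen from the first. Along `w`, which is
  -- horizontal for the second end but rises for the first, the second end climbs linearly above the
  -- sublinear first graph and so enters `W`, although it is part of `S`.
  obtain ⟨w, hwu, hw2, hwp⟩ := exists_orthogonal_of_transversal hu hne
  set y := A₂.symm (A₁ w)
  have hy2 : y 2 = 0 := by
    rw [symm_coord_two, ← hwu, ← A₁.inner_map_map w u, A₁.apply_symm_apply]
  have hyn : ‖proj2 y‖ = ‖w‖ := by
    have h1 := E3.norm_sq' y
    rw [hy2] at h1
    have h2 : ‖y‖ = ‖w‖ := by simp [y]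
    rw [← h2]
    exact ((pow_left_inj₀ (norm_nonneg _) (norm_nonneg _) two_ne_zero).1 (by linarith)).symm
  set a := ‖proj2 w‖
  set b := ‖w‖
  have hb : 0 < b := hwp.trans_le (norm_proj2_le w)
  -- At distance `t b` the height of the second graph is then at most `t a / 2` and at most `t w₂ /
  -- 4`, up to a constant. This keeps the point away from the axis of the first end and above its
  -- graph.
  obtain ⟨K₂, hK₂, hψ₂⟩ := h₂.graph.exists_sublinear
    (ε := min (a / (2 * b)) (w 2 / (4 * b))) (by positivity)
  obtain ⟨K₁, hK₁, hψ₁⟩ := h₁.graph.exists_sublinear (ε := w 2 / (4 * (b + w 2))) (by positivity)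
  obtain ⟨t, ht0, ht1, ht2, ht3⟩ : ∃ t : ℝ, 0 < t ∧ ρ + K₂ < t * (a / 2) ∧ R₂ < t * b ∧
      K₂ + w 2 / (4 * (b + w 2)) * K₂ + K₁ < t * (w 2 / 2) := by
    have hev : ∀ (k m : ℝ), 0 < k → ∀ᶠ t : ℝ in atTop, m < t * k := fun k m hk =>
      (tendsto_id.atTop_mul_const hk).eventually_gt_atTop m
    exact ((eventually_gt_atTop 0).and ((hev (a / 2) _ (by positivity)).and
      ((hev b R₂ hb).and (hev (w 2 / 2) _ (by positivity))))).exists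
  have hh : ‖t • proj2 y‖ = t * b := by rw [norm_smul, hyn, Real.norm_of_nonneg ht0.le]
  have hmem := h₂.graph.mem (h := t • proj2 y) (by rwa [hh])
  set s := ψ₂ (t • proj2 y)
  have hs : |s| ≤ min (a / (2 * b)) (w 2 / (4 * b)) * (t * b) + K₂ := by
    have := hψ₂ (t • proj2 y) (by rwa [hh])
    rwa [hh] at this
  have hs1 : |s| ≤ t * (a / 2) + K₂ := by
    refine hs.trans (add_le_add_left ((mul_le_mul_of_nonneg_right (min_le_left _ _)
      (by positivity)).trans (le_of_eq (by field_simp))) _)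
  have hs2 : |s| ≤ t * (w 2 / 4) + K₂ := by
    refine hs.trans (add_le_add_left ((mul_le_mul_of_nonneg_right (min_le_right _ _)
      (by positivity)).trans (le_of_eq (by field_simp))) _)
  set x := t • w + s • u
  have hx : A₂ (lift3 (t • proj2 y) s) = A₁ x := by
    have h1 : lift3 (t • proj2 y) s = t • y + s • e3 :=
      E3.ext (by simp) (by simp) (by simp [hy2])
    rw [h1, map_add, map_smul, map_smul, map_add, map_smul, map_smul, A₁.apply_symm_apply,
      A₂.apply_symm_apply]
  have hxn : ‖x‖ ≤ t * b + |s| := by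
    refine (norm_add_le _ _).trans ?_
    rw [norm_smul, norm_smul, hu, Real.norm_of_nonneg ht0.le, mul_one, Real.norm_eq_abs]
  have hxp : ρ < ‖proj2 x‖ := by
    have h1 : ‖t • proj2 w‖ ≤ ‖proj2 x‖ + ‖s • proj2 u‖ := by
      have : t • proj2 w = proj2 x - s • proj2 u := by simp [x]
      rw [this]; exact norm_sub_le _ _
    rw [norm_smul, norm_smul, Real.norm_of_nonneg ht0.le, Real.norm_eq_abs] at h1
    have h2 : |s| * ‖proj2 u‖ ≤ |s| := by
      refine mul_le_of_le_one_right (abs_nonneg s) ((norm_proj2_le u).trans hu.le)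
    have h3 : t * a ≤ ‖proj2 x‖ + |s| := h1.trans (by linarith)
    by_contra! hle
    nlinarith
  have hx2 : ψ₁ (proj2 x) < x 2 := by
    have h1 := (le_abs_self _).trans (hψ₁ (proj2 x) (h₁.le.trans_lt hxp))
    have h2 : x 2 = t * w 2 + s * u 2 := by simp [x]
    have h3 : |s * u 2| ≤ |s| := by
      rw [abs_mul]
      exact mul_le_of_le_one_right (abs_nonneg s) ((abs_coord_le u 2).trans hu.le)
    have h4 := neg_abs_le (s * u 2)
    have h5 : ‖proj2 x‖ ≤ t * (b + w 2) + K₂ := by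
      have := norm_proj2_le x
      nlinarith
    have h6 : w 2 / (4 * (b + w 2)) * ‖proj2 x‖ ≤ t * (w 2 / 4) + w 2 / (4 * (b + w 2)) * K₂ := by
      refine (mul_le_mul_of_nonneg_left h5 (by positivity)).trans (le_of_eq ?_)
      field_simp
    nlinarith
  have hW := h₁.ray _ hxp _ hx2
  rw [lift3_proj2, ← hx] at hW
  exact Set.disjoint_left.1 hSW (h₂.subset hmem) hW

/-- Two disjoint ends have opposite normals. -/
theorem IsUpperEnd.normal_eq_neg (h₁ : IsUpperEnd S W μ C₁ A₁ R₁ ψ₁ ρ)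
    (h₂ : IsUpperEnd S W μ C₂ A₂ R₂ ψ₂ ρ) (hSW : Disjoint S W) (hd : Disjoint C₁ C₂) :
    A₂ e3 = -A₁ e3 := by
  have hsq := h₁.parallel h₂ hSW
  set u := A₁.symm (A₂ e3) with hu_def
  have hu : ‖u‖ = 1 := by simp [u]
  have hnorm := E3.norm_sq u
  rw [hu, hsq] at hnorm
  have hu0 : u 0 = 0 := by nlinarith [sq_nonneg (u 0), sq_nonneg (u 1)]
  have hu1 : u 1 = 0 := by nlinarith [sq_nonneg (u 0), sq_nonneg (u 1)]
  have hA₂ : A₂ e3 = A₁ u := by simp [u]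
  rcases sq_eq_sq_iff_eq_or_eq_neg.1 (hsq.trans (one_pow 2).symm) with h | h
  -- With equal upward directions both ends are graphs over one plane. Over a far point one of them
  -- lies above the other, hence in `W`, or they intersect.
  · exfalso
    have hue : u = e3 := E3.ext (by simp [hu0]) (by simp [hu1]) (by simp [h])
    rw [hue] at hA₂
    let x : E2 := polarPt (ρ + 1) 0
    have hρ : 0 < ρ := h₁.graph.pos.trans_le h₁.le
    have hx : ‖x‖ = ρ + 1 := norm_polarPt (by linarith) 0
    set v := A₁.symm (A₂ (lift3 x 0)) with hv
    have hv2 : v 2 = 0 := by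
      rw [symm_coord_two, ← hA₂, A₂.inner_map_map]
      simp [e3, EuclideanSpace.inner_single_right]
    have hvn : ‖proj2 v‖ = ρ + 1 := by
      have h1 := E3.norm_sq' v
      have h2 : ‖v‖ ^ 2 = ‖x‖ ^ 2 := by
        rw [hv, A₁.symm.norm_map, A₂.norm_map, norm_lift3_sq]; simp
      rw [hv2, h2, hx] at h1
      exact (pow_left_inj₀ (norm_nonneg _) (by linarith) two_ne_zero).1 (by linarith)
    have hlift : ∀ z, A₂ (lift3 x z) = A₁ (lift3 (proj2 v) z) := by
      intro z
      have h1 : lift3 x z = lift3 x 0 + z • e3 := by rw [lift3_add_smul, zero_add]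
      have h2 : lift3 (proj2 v) z = v + z • e3 :=
        E3.ext (by simp) (by simp) (by simp [hv2])
      rw [h1, h2, map_add, map_add, map_smul, map_smul, hA₂, hv, A₁.apply_symm_apply]
    have hm₁ := h₁.graph.mem (h := proj2 v) (by rw [hvn]; linarith [h₁.le])
    have hm₂ := h₂.graph.mem (h := x) (by rw [hx]; linarith [h₂.le])
    rcases lt_trichotomy (ψ₂ x) (ψ₁ (proj2 v)) with hlt | heq | hgt
    · have := h₂.ray x (by rw [hx]; linarith) _ hlt
      rw [hlift] at this
      exact Set.disjoint_left.1 hSW (h₁.subset hm₁) this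
    · rw [hlift, heq] at hm₂
      exact Set.disjoint_left.1 hd hm₁ hm₂
    · have := h₁.ray (proj2 v) (by rw [hvn]; linarith) _ hgt
      rw [← hlift] at this
      exact Set.disjoint_left.1 hSW (h₂.subset hm₂) this
  · have hue : u = -e3 := E3.ext (by simp [hu0]) (by simp [hu1]) (by simp [h])
    rw [hA₂, hue, map_neg]

end

/-- The part of space above the graph of `ψ`, and above the height `Z` near the axis. -/
def aboveEnd (A : E3 ≃ₗᵢ[ℝ] E3) (ψ : E2 → ℝ) (ρ Z : ℝ) : Set E3 :=
  {y | ρ < ‖proj2 (A.symm y)‖ ∧ ψ (proj2 (A.symm y)) ≤ A.symm y 2 ∨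
    ‖proj2 (A.symm y)‖ ≤ ρ ∧ Z < A.symm y 2}

/-- The ends of `S`, with constants which are uniform in the end. -/
structure IsEndSystem (S W : Set E3) (μ : E3 → E3) (𝒞 : Set (Set E3))
    (A : Set E3 → E3 ≃ₗᵢ[ℝ] E3) (R : Set E3 → ℝ) (ψ : Set E3 → E2 → ℝ) (ρ Z : ℝ) : Prop where
  nonempty : 𝒞.Nonempty
  upper : ∀ C ∈ 𝒞, IsUpperEnd S W μ C (A C) (R C) (ψ C) ρ
  disjoint : 𝒞.PairwiseDisjoint id
  cover : ∀ y ∈ S, ρ < ‖y‖ → ∃ C ∈ 𝒞, y ∈ C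
  bound : ∀ C ∈ 𝒞, ∀ h : E2, R C < ‖h‖ → ‖h‖ ≤ ρ + 1 → |ψ C h| ≤ Z
  lt : ρ < Z

/-! ### The decomposition of the region far out into the parts above the ends -/

section

variable {S W : Set E3} {μ : E3 → E3} {𝒞 : Set (Set E3)} {A : Set E3 → E3 ≃ₗᵢ[ℝ] E3}
  {R : Set E3 → ℝ} {ψ : Set E3 → E2 → ℝ} {ρ Z : ℝ}

theorem IsEndSystem.pos (h : IsEndSystem S W μ 𝒞 A R ψ ρ Z) : 0 < ρ := by
  obtain ⟨C, hC⟩ := h.nonempty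
  exact (h.upper C hC).graph.pos.trans_le (h.upper C hC).le

theorem IsEndSystem.normal_eq_neg (h : IsEndSystem S W μ 𝒞 A R ψ ρ Z) (hSW : Disjoint S W)
    {C D : Set E3} (hC : C ∈ 𝒞) (hD : D ∈ 𝒞) (hCD : C ≠ D) : A D e3 = -A C e3 :=
  (h.upper C hC).normal_eq_neg (h.upper D hD) hSW (h.disjoint hC hD hCD)

theorem IsEndSystem.coord_eq_neg (h : IsEndSystem S W μ 𝒞 A R ψ ρ Z) (hSW : Disjoint S W)
    {C D : Set E3} (hC : C ∈ 𝒞) (hD : D ∈ 𝒞) (hCD : C ≠ D) (y : E3) :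
    (A D).symm y 2 = -(A C).symm y 2 := by
  rw [symm_coord_two, symm_coord_two, h.normal_eq_neg hSW hC hD hCD, inner_neg_right]

theorem IsEndSystem.norm_proj_eq (h : IsEndSystem S W μ 𝒞 A R ψ ρ Z) (hSW : Disjoint S W)
    {C D : Set E3} (hC : C ∈ 𝒞) (hD : D ∈ 𝒞) (y : E3) :
    ‖proj2 ((A D).symm y)‖ = ‖proj2 ((A C).symm y)‖ := by
  rcases eq_or_ne C D with rfl | hCD
  · rfl
  · have h1 := E3.norm_sq' ((A D).symm y)
    have h2 := E3.norm_sq' ((A C).symm y)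
    rw [LinearIsometryEquiv.norm_map] at h1 h2
    rw [h.coord_eq_neg hSW hC hD hCD, neg_sq] at h1
    exact (pow_left_inj₀ (norm_nonneg _) (norm_nonneg _) two_ne_zero).1 (by linarith)

theorem symm_add_smul_normal (A : E3 ≃ₗᵢ[ℝ] E3) (y : E3) (t : ℝ) :
    A.symm (y + t • A e3) = A.symm y + t • e3 := by
  rw [map_add, map_smul, A.symm_apply_apply]

/-- A point of `S` near the axis with height beyond `Z` would be outside the ball of radius `ρ` and
therefore on an end, whose height there is at most `Z`. -/
theorem IsEndSystem.abs_coord_le_of_mem (h : IsEndSystem S W μ 𝒞 A R ψ ρ Z) (hSW : Disjoint S W)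
    {C : Set E3} (hC : C ∈ 𝒞) {y : E3} (hy : y ∈ S) (hyρ : ‖proj2 ((A C).symm y)‖ ≤ ρ + 1) :
    |(A C).symm y 2| ≤ Z := by
  by_contra! hlt
  have h1 : ρ < ‖y‖ := by
    have := abs_coord_le ((A C).symm y) 2
    rw [LinearIsometryEquiv.norm_map] at this
    linarith [h.lt]
  obtain ⟨D, hD, hyD⟩ := h.cover y hy h1
  obtain ⟨h2, h3⟩ := (h.upper D hD).graph.mem_iff.1 hyD
  have h4 := h.bound D hD _ h2 (by rwa [h.norm_proj_eq hSW hC hD])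
  rw [← h3] at h4
  have h5 : |(A D).symm y 2| = |(A C).symm y 2| := by
    rcases eq_or_ne C D with rfl | hCD
    · rfl
    · rw [h.coord_eq_neg hSW hC hD hCD, abs_neg]
  linarith

/-- The half-cylinders around the axis of the ends do not meet `S`. -/
theorem IsEndSystem.cylinder_subset (h : IsEndSystem S W μ 𝒞 A R ψ ρ Z)
    (hW : IsInnerSide S μ W) {C : Set E3} (hC : C ∈ 𝒞) {σ : ℝ} (hσ : |σ| = 1) {x x' : E3}
    (hxW : A C x ∈ W) (hx : ‖proj2 x‖ < ρ + 1 ∧ Z < σ * x 2)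
    (hx' : ‖proj2 x'‖ < ρ + 1 ∧ Z < σ * x' 2) : A C x' ∈ W := by
  -- `Q` is convex and its image avoids `S`, so the image lies in `W` as soon as it meets `W`.
  let Q : Set E3 := {x | ‖proj2 x‖ < ρ + 1 ∧ Z < σ * x 2}
  have hQ : Convex ℝ Q := by
    have h1 : Convex ℝ (proj2 ⁻¹' Metric.ball (0 : E2) (ρ + 1)) :=
      (convex_ball (0 : E2) (ρ + 1)).linear_preimage (proj2 : E3 →ₗ[ℝ] E2)
    have h2 : Convex ℝ {x : E3 | Z < σ * x 2} :=
      convex_halfSpace_gt ⟨fun x y => by simp [mul_add], fun c x => by simp; ring⟩ Z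
    have h3 : Q = proj2 ⁻¹' Metric.ball (0 : E2) (ρ + 1) ∩ {x : E3 | Z < σ * x 2} := by
      ext x; simp [Q]
    rw [h3]; exact h1.inter h2
  refine hW.subset_of_preconnected (A C '' Q)
    (hQ.isPreconnected.image _ (A C).continuous.continuousOn) ?_ ⟨_, ⟨x, hx, rfl⟩, hxW⟩
    ⟨x', hx', rfl⟩
  rw [Set.disjoint_right]
  rintro _ ⟨y, hy, rfl⟩ hyS
  have h1 := h.abs_coord_le_of_mem hW.disjoint hC hyS (by
    rw [LinearIsometryEquiv.symm_apply_apply]; exact hy.1.le)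
  rw [LinearIsometryEquiv.symm_apply_apply] at h1
  have h2 : σ * y 2 ≤ |y 2| := by
    refine (le_abs_self _).trans ?_
    rw [abs_mul, hσ, one_mul]
  linarith [hy.2]

/-- Away from the axis this is the property of the rays. Near the axis the half-cylinder is entered
from rays over the annulus between `ρ` and `ρ + 1`, which is why the bound by `Z` extends to radius
`ρ + 1`. -/
theorem IsEndSystem.aboveEnd_subset (h : IsEndSystem S W μ 𝒞 A R ψ ρ Z)
    (hW : IsInnerSide S μ W) {C : Set E3} (hC : C ∈ 𝒞) :
    aboveEnd (A C) (ψ C) ρ Z ⊆ regionOf S μ := by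
  intro y hy
  rw [hW.region_eq]
  have hu := h.upper C hC
  rcases hy with ⟨h1, h2⟩ | ⟨h1, h2⟩
  · rcases h2.eq_or_lt with h3 | h3
    · left
      exact hu.subset (hu.graph.mem_iff.2 ⟨hu.le.trans_lt h1, h3.symm⟩)
    · right
      simpa using hu.ray _ h1 _ h3
  · right
    have hρ := h.pos
    let k : E2 := polarPt (ρ + 1 / 2) 0
    have hk : ‖k‖ = ρ + 1 / 2 := norm_polarPt (by linarith) 0
    have h3 := h.cylinder_subset hW hC (σ := 1) (by simp) (x := lift3 k (max Z (ψ C k) + 1))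
      (x' := (A C).symm y) (hu.ray k (by linarith) _ (by linarith [le_max_right Z (ψ C k)]))
      ⟨by simp only [proj2_lift3]; linarith, by simp; linarith [le_max_left Z (ψ C k)]⟩
      ⟨by linarith, by linarith⟩
    simpa using h3

/-- A point of `W` below the graph of `C` is moved up to just below the graph, where `W` is absent.
The segment thus crosses `S`, necessarily in another end `D`, whose upward direction is opposite; so
the point is above `D`. -/
theorem IsEndSystem.mem_aboveEnd_of_lt (h : IsEndSystem S W μ 𝒞 A R ψ ρ Z)
    (hW : IsInnerSide S μ W) {C : Set E3} (hC : C ∈ 𝒞) {y : E3} (hy : y ∈ regionOf S μ)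
    (hyρ : ρ < ‖proj2 ((A C).symm y)‖) : ∃ D ∈ 𝒞, y ∈ aboveEnd (A D) (ψ D) ρ Z := by
  have hu := h.upper C hC
  rw [hW.region_eq] at hy
  rcases hy with hy | hy
  · obtain ⟨D, hD, hyD⟩ := h.cover y hy (by
      have := norm_proj2_le ((A C).symm y)
      rw [LinearIsometryEquiv.norm_map] at this
      linarith)
    refine ⟨D, hD, Or.inl ⟨by rwa [h.norm_proj_eq hW.disjoint hC hD], ?_⟩⟩
    exact ((h.upper D hD).graph.mem_iff.1 hyD).2.ge
  set x := (A C).symm y with hx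
  have hyx : y = A C x := by simp [x]
  by_cases hge : ψ C (proj2 x) ≤ x 2
  · exact ⟨C, hC, Or.inl ⟨hyρ, hge⟩⟩
  push Not at hge
  obtain ⟨δ, hδ, hnear⟩ := hu.graph.eventually_mem_inner hW hu.subset (hu.le.trans_lt hyρ)
  obtain ⟨z, hz1, hz2, hz3⟩ : ∃ z, x 2 < z ∧ z < ψ C (proj2 x) ∧ ψ C (proj2 x) - δ < z := by
    obtain ⟨z, hz, hz'⟩ := exists_between (max_lt hge (sub_lt_self _ hδ))
    exact ⟨z, (le_max_left _ _).trans_lt hz, hz', (le_max_right _ _).trans_lt hz⟩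
  have hzW : A C (lift3 (proj2 x) z) ∉ W := fun hmem => by
    have := (hnear z (by rw [abs_lt]; constructor <;> linarith)).1.1 hmem
    linarith
  by_cases hS : ∃ t ∈ Icc (x 2) z, A C (lift3 (proj2 x) t) ∈ S
  · obtain ⟨t, ht, htS⟩ := hS
    obtain ⟨D, hD, htD⟩ := h.cover _ htS (by
      rw [LinearIsometryEquiv.norm_map]
      exact hyρ.trans_le (norm_le_norm_lift3 _ _))
    have hCD : C ≠ D := by
      rintro rfl
      have := (hu.graph.mem_iff.1 htD).2
      simp at this
      linarith [ht.2]
    refine ⟨D, hD, Or.inl ⟨by rwa [h.norm_proj_eq hW.disjoint hC hD], ?_⟩⟩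
    have h1 := ((h.upper D hD).graph.mem_iff.1 htD).2
    have h2 : y = A C (lift3 (proj2 x) t) + (t - x 2) • A D e3 := by
      rw [h.normal_eq_neg hW.disjoint hC hD hCD, hyx, smul_neg, ← map_smul, ← sub_eq_add_neg,
        ← map_sub]
      congr 1
      exact E3.ext (by simp) (by simp) (by simp)
    rw [h2, symm_add_smul_normal]
    have h3 : proj2 ((A D).symm (A C (lift3 (proj2 x) t)) + (t - x 2) • e3) =
        proj2 ((A D).symm (A C (lift3 (proj2 x) t))) := E2.ext (by simp) (by simp)
    rw [h3, ← h1]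
    simp
    linarith [ht.1]
  · push Not at hS
    have hseg := hW.subset_of_preconnected _
      (isPreconnected_vertical (A C) (proj2 x) (isPreconnected_Icc (a := x 2) (b := z))) (by
        rw [Set.disjoint_right]
        rintro _ ⟨t, ht, rfl⟩
        exact hS t ht) ⟨y, ⟨x 2, ⟨le_rfl, hz1.le⟩, by simp [x]⟩, hy⟩
    exact absurd (hseg ⟨z, ⟨hz1.le, le_rfl⟩, rfl⟩) hzW

/-- Far out, every point of the region lies above one of the ends. -/
theorem IsEndSystem.exists_mem_aboveEnd (h : IsEndSystem S W μ 𝒞 A R ψ ρ Z)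
    (hW : IsInnerSide S μ W) {y : E3} (hy : y ∈ regionOf S μ) (hyn : ρ + Z < ‖y‖) :
    ∃ D ∈ 𝒞, y ∈ aboveEnd (A D) (ψ D) ρ Z := by
  obtain ⟨C, hC⟩ := h.nonempty
  rcases lt_or_ge ρ ‖proj2 ((A C).symm y)‖ with h1 | h1
  · exact h.mem_aboveEnd_of_lt hW hC hy h1
  set x := (A C).symm y with hx
  have hyx : y = A C x := by simp [x]
  have h2 : Z < |x 2| := by
    have := norm_lift3_le (proj2 x) (x 2)
    rw [lift3_proj2, hx, LinearIsometryEquiv.norm_map] at this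
    linarith
  rcases le_or_gt 0 (x 2) with h3 | h3
  · rw [abs_of_nonneg h3] at h2
    exact ⟨C, hC, Or.inr ⟨h1, h2⟩⟩
  rw [abs_of_neg h3] at h2
  have hyW : y ∈ W := by
    rw [hW.region_eq] at hy
    refine hy.resolve_left fun hyS => ?_
    have := h.abs_coord_le_of_mem hW.disjoint hC hyS (by linarith)
    rw [← hx, abs_of_neg h3] at this
    linarith
  have hρ := h.pos
  let k : E2 := polarPt (ρ + 1 / 2) 0
  have hk : ‖k‖ = ρ + 1 / 2 := norm_polarPt (by linarith) 0
  -- On the lower half of the axis the point is moved horizontally, within `W`, to radius `ρ + 1/2`.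
  -- There the previous case applies, and the large negative height excludes the end `C` itself.
  have h4 := h.cylinder_subset hW hC (σ := -1) (by simp) (x := x) (x' := lift3 k (x 2))
    (by rwa [← hyx]) ⟨by linarith, by linarith⟩
    ⟨by simp only [proj2_lift3]; linarith, by simp only [lift3_two]; linarith⟩
  have h5 : ρ < ‖proj2 ((A C).symm (A C (lift3 k (x 2))))‖ := by
    rw [LinearIsometryEquiv.symm_apply_apply, proj2_lift3]; linarith
  obtain ⟨D, hD, hmem⟩ := h.mem_aboveEnd_of_lt hW hC
    (by rw [hW.region_eq]; exact Or.inr h4) h5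
  have hpD := h.norm_proj_eq hW.disjoint hC hD (A C (lift3 k (x 2)))
  rw [(A C).symm_apply_apply, proj2_lift3, hk] at hpD
  have hψ := h.bound D hD (proj2 ((A D).symm (A C (lift3 k (x 2)))))
    (by rw [hpD]; linarith [(h.upper D hD).le]) (by rw [hpD]; linarith)
  have hz : -Z ≤ (A D).symm (A C (lift3 k (x 2))) 2 := by
    rcases hmem with h6 | h6
    · linarith [(abs_le.1 hψ).1, h6.2]
    · rw [hpD] at h6; linarith [h6.1]
  rcases eq_or_ne C D with rfl | hCD
  · rw [(A C).symm_apply_apply, lift3_two] at hz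
    linarith
  · refine ⟨D, hD, Or.inr ⟨by rwa [h.norm_proj_eq hW.disjoint hC hD], ?_⟩⟩
    rwa [h.coord_eq_neg hW.disjoint hC hD hCD]

/-- The regions above different ends are disjoint. -/
theorem IsEndSystem.disjoint_aboveEnd (h : IsEndSystem S W μ 𝒞 A R ψ ρ Z)
    (hSW : Disjoint S W) {C D : Set E3} (hC : C ∈ 𝒞) (hD : D ∈ 𝒞) (hCD : C ≠ D) :
    Disjoint (aboveEnd (A C) (ψ C) ρ Z) (aboveEnd (A D) (ψ D) ρ Z) := by
  rw [Set.disjoint_left]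
  rintro y hyC hyD
  have hp := h.norm_proj_eq hSW hC hD y
  have hz := h.coord_eq_neg hSW hC hD hCD y
  rcases hyC with ⟨h1, h2⟩ | ⟨h1, h2⟩
  · rcases hyD with ⟨h3, h4⟩ | ⟨h3, h4⟩
    · set x := (A D).symm y
      have huC := h.upper C hC
      have huD := h.upper D hD
      have hm := huD.graph.mem (huD.le.trans_lt h3)
      -- Descending from `y` to the graph of `D` means ascending in the direction of `C`. A point of
      -- `S` would lie on or above the graph of `C`, which is impossible by disjointness.
      have h5 : A D (lift3 (proj2 x) (ψ D (proj2 x))) =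
          y + (x 2 - ψ D (proj2 x)) • A C e3 := by
        have h6 : A C e3 = -A D e3 := by rw [h.normal_eq_neg hSW hC hD hCD, neg_neg]
        have h7 : y = A D x := by simp [x]
        rw [h6, h7, smul_neg, ← map_smul, ← sub_eq_add_neg, ← map_sub]
        congr 1
        exact E3.ext (by simp) (by simp) (by simp)
      rw [h5] at hm
      have h8 : (A C).symm (y + (x 2 - ψ D (proj2 x)) • A C e3) =
          lift3 (proj2 ((A C).symm y)) ((A C).symm y 2 + (x 2 - ψ D (proj2 x))) := by
        rw [symm_add_smul_normal, ← lift3_add_smul, lift3_proj2]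
      rcases (sub_nonneg.2 h4).eq_or_lt with h9 | h9
      · refine Set.disjoint_left.1 (h.disjoint hC hD hCD) (huC.graph.mem_iff.2 ?_) hm
        rcases h2.eq_or_lt with h10 | h10
        · rw [h8, proj2_lift3, lift3_two, ← h9, add_zero]
          exact ⟨huC.le.trans_lt h1, h10.symm⟩
        · exfalso
          have h11 := huC.ray _ h1 _ h10
          rw [lift3_proj2, LinearIsometryEquiv.apply_symm_apply] at h11
          rw [← h9, zero_smul, add_zero] at hm
          exact Set.disjoint_left.1 hSW (huD.subset hm) h11
      · have h11 := huC.ray _ h1 ((A C).symm y 2 + (x 2 - ψ D (proj2 x))) (by linarith)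
        rw [← h8, LinearIsometryEquiv.apply_symm_apply] at h11
        exact Set.disjoint_left.1 hSW (huD.subset hm) h11
    · linarith
  · rcases hyD with ⟨h3, h4⟩ | ⟨h3, h4⟩
    · linarith
    · linarith [h.pos, h.lt]

end

theorem componentsOf_disjoint {X C D : Set E3} (hC : C ∈ componentsOf X) (hD : D ∈ componentsOf X)
    (hCD : C ≠ D) : Disjoint C D := by
  obtain ⟨p, hp, rfl⟩ := hC
  obtain ⟨q, hq, rfl⟩ := hD
  rw [Set.disjoint_left]
  intro y hy hy'
  exact hCD ((connectedComponentIn_eq hy).trans (connectedComponentIn_eq hy').symm)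

theorem IsUpperEnd.mono {S W C : Set E3} {μ : E3 → E3} {A : E3 ≃ₗᵢ[ℝ] E3} {R ρ ρ' : ℝ}
    {ψ : E2 → ℝ} (h : IsUpperEnd S W μ C A R ψ ρ) (hρ : ρ ≤ ρ') : IsUpperEnd S W μ C A R ψ ρ' :=
  ⟨h.graph, h.subset, h.le.trans hρ, fun k hk => h.ray k (hρ.trans_lt hk)⟩

theorem Set.Finite.exists_upper_bound {α : Type*} {s : Set α} (hs : s.Finite) (f : α → ℝ) :
    ∃ b, ∀ x ∈ s, f x ≤ b := by
  obtain ⟨b, hb⟩ := (hs.image f).bddAbove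
  exact ⟨b, fun x hx => hb (mem_image_of_mem f hx)⟩

/-- The ends of a support surface whose ends border different ends of the region. -/
theorem exists_endSystem {S W : Set E3} {μ : E3 → E3} (hW : IsInnerSide S μ W)
    (hS : IsAFSupportSurface S μ) (hsep : EndsAreSeparated S μ) :
    ∃ (𝒞 : Set (Set E3)) (A : Set E3 → E3 ≃ₗᵢ[ℝ] E3) (R : Set E3 → ℝ) (ψ : Set E3 → E2 → ℝ)
      (ρ₀ : ℝ), 𝒞.Finite ∧ ∀ ρ ≥ ρ₀, ∃ Z, IsEndSystem S W μ 𝒞 A R ψ ρ Z := by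
  obtain ⟨Ω, hΩ, hends, hsep⟩ := hsep
  obtain ⟨ρΩ, hρΩ⟩ := hΩ.isBounded.exists_norm_le
  choose! A R ψ hG using hends
  have hne : (componentsOf (S \ Ω)).Nonempty := by
    by_contra hem
    have hsub : S ⊆ Ω := by
      intro x hx
      by_contra hxΩ
      exact hem ⟨_, x, ⟨hx, hxΩ⟩, rfl⟩
    exact hS.noncompact (hΩ.of_isClosed_subset hS.closed hsub)
  have hup : ∀ C ∈ componentsOf (S \ Ω), IsUpperEnd S W μ C (A C) (R C) (ψ C) (max ρΩ (R C)) := by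
    intro C hC
    refine ⟨hG C hC, ?_, le_max_right _ _, fun h hh z hz => ?_⟩
    · obtain ⟨p, -, rfl⟩ := hC
      exact (connectedComponentIn_subset _ _).trans sdiff_subset
    · exact (hG C hC).ray_subset hW hS.closed hC hsep hρΩ ((le_max_right _ _).trans_lt hh)
        ((le_max_left _ _).trans_lt hh) hz
  have hneg : ∀ C ∈ componentsOf (S \ Ω), ∀ D ∈ componentsOf (S \ Ω), C ≠ D →
      A D e3 = -A C e3 := fun C hC D hD hCD =>
    ((hup C hC).mono (le_max_left _ (max ρΩ (R D)))).normal_eq_neg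
      ((hup D hD).mono (le_max_right (max ρΩ (R C)) _)) hW.disjoint
      (componentsOf_disjoint hC hD hCD)
  -- There are at most two ends, since three unit vectors cannot be pairwise opposite.
  have hfin : (componentsOf (S \ Ω)).Finite := by
    obtain ⟨C, hC⟩ := hne
    have h1 : (componentsOf (S \ Ω) \ {C}).Subsingleton := by
      intro D hD E hE
      by_contra hDE
      have h2 := hneg C hC D hD.1 (fun h => hD.2 h.symm)
      have h3 := hneg C hC E hE.1 (fun h => hE.2 h.symm)
      have h4 := hneg D hD.1 E hE.1 hDE
      rw [h3, h2, neg_neg] at h4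
      have h5 : A C e3 = 0 := by
        have h6 : (2 : ℝ) • A C e3 = 0 := by
          rw [two_smul]; nth_rewrite 1 [← h4]; simp
        simpa using h6
      have h7 := congrArg norm h5
      rw [LinearIsometryEquiv.norm_map] at h7
      simp at h7
    refine ((Set.finite_singleton C).union h1.finite).subset fun D hD => ?_
    by_cases h : D = C
    · exact Or.inl h
    · exact Or.inr ⟨hD, h⟩
  obtain ⟨Rm, hRm⟩ := hfin.exists_upper_bound R
  have hK : ∀ C ∈ componentsOf (S \ Ω), ∃ K, ∀ h : E2, R C < ‖h‖ → |ψ C h| ≤ 1 * ‖h‖ + K :=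
    fun C hC => by
      obtain ⟨K, -, hK⟩ := (hG C hC).exists_sublinear one_pos
      exact ⟨K, hK⟩
  choose! K hK using hK
  obtain ⟨Km, hKm⟩ := hfin.exists_upper_bound K
  -- The value of `Z` comes from `|ψ h| ≤ |h| + K` for `|h| ≤ ρ + 1`, with `Km` bounding the
  -- constants of all ends.
  refine ⟨_, A, R, ψ, max ρΩ Rm, hfin, fun ρ hρ => ⟨ρ + 1 + |Km|, hne, fun C hC =>
    (hup C hC).mono ((max_le_max le_rfl (hRm C hC)).trans hρ), fun C hC D hD hCD =>
      componentsOf_disjoint hC hD hCD, fun y hy hyρ => ?_, fun C hC h hh hhρ => ?_, ?_⟩⟩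
  · have hyΩ : y ∉ Ω := fun h => by
      have := hρΩ y h
      linarith [le_max_left ρΩ Rm]
    exact ⟨_, ⟨y, ⟨hy, hyΩ⟩, rfl⟩, mem_connectedComponentIn ⟨hy, hyΩ⟩⟩
  · have := hK C hC h hh
    have := hKm C hC
    have := le_abs_self Km
    linarith
  · have := abs_nonneg Km
    linarith

/-! ### Functions of the same order as a logarithm -/

theorem ContDiffAt.eventually_differentiableAt {E F : Type*} [NormedAddCommGroup E]
    [NormedSpace ℝ E] [NormedAddCommGroup F] [NormedSpace ℝ F] {f : E → F} {x : E}
    (h : ContDiffAt ℝ 2 f x) : ∀ᶠ y in 𝓝 x, DifferentiableAt ℝ f y :=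
  (h.eventually (by simp)).mono fun _ hy => hy.differentiableAt (by simp)

theorem ContDiffAt.hasFDerivAt_fderiv {E F : Type*} [NormedAddCommGroup E] [NormedSpace ℝ E]
    [NormedAddCommGroup F] [NormedSpace ℝ F] {f : E → F} {x : E} (h : ContDiffAt ℝ 2 f x) :
    HasFDerivAt (fderiv ℝ f) (fderiv ℝ (fderiv ℝ f) x) x :=
  ((h.fderiv_right (m := 1) (by norm_num)).differentiableAt (by simp)).hasFDerivAt

/-- The bounds `|x||Df| ≤ c`, `|x|²|D²f| ≤ c`. -/
structure LogBound {E : Type*} [NormedAddCommGroup E] [NormedSpace ℝ E] (f : E → ℝ) (x : E) (c : ℝ) : Prop where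
  contDiffAt : ContDiffAt ℝ 2 f x
  first : ‖x‖ * ‖fderiv ℝ f x‖ ≤ c
  second : ‖x‖ ^ 2 * ‖fderiv ℝ (fderiv ℝ f) x‖ ≤ c

section

variable {E : Type*} [NormedAddCommGroup E] [NormedSpace ℝ E]

variable {F : Type*} [NormedAddCommGroup F] [NormedSpace ℝ F]

theorem opNorm_neg_eq (T : E →L[ℝ] F) : ‖-T‖ = ‖T‖ := norm_neg T

theorem opNorm_add_le_add (T T' : E →L[ℝ] F) : ‖T + T'‖ ≤ ‖T‖ + ‖T'‖ := norm_add_le T T'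

theorem opNorm_smul_eq (c : ℝ) (T : E →L[ℝ] F) : ‖c • T‖ = |c| * ‖T‖ := norm_smul c T

theorem opNorm_smul_le_of_le {a c : ℝ} (T : E →L[ℝ] F) (h : |c| ≤ a) : ‖c • T‖ ≤ a * ‖T‖ :=
  (opNorm_smul_eq c T).trans_le (mul_le_mul_of_nonneg_right h (norm_nonneg T))

theorem norm_smulRight_le (T : E →L[ℝ] ℝ) (v : F) : ‖T.smulRight v‖ ≤ ‖T‖ * ‖v‖ :=
  (ContinuousLinearMap.norm_smulRight_apply T v).le

theorem LogBound.congr {f g : E → ℝ} {x : E} {c : ℝ} (h : LogBound f x c) (hfg : g =ᶠ[𝓝 x] f) :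
    LogBound g x c := by
  refine ⟨h.contDiffAt.congr_of_eventuallyEq hfg, ?_, ?_⟩
  · rw [hfg.fderiv_eq]; exact h.first
  · rw [hfg.fderiv.fderiv_eq]; exact h.second

theorem LogBound.mono {f : E → ℝ} {x : E} {c d : ℝ} (h : LogBound f x c) (hcd : c ≤ d) :
    LogBound f x d :=
  ⟨h.contDiffAt, h.first.trans hcd, h.second.trans hcd⟩

theorem LogBound.nonneg {f : E → ℝ} {x : E} {c : ℝ} (h : LogBound f x c) : 0 ≤ c :=
  le_trans (by positivity) h.first

theorem LogBound.add {f g : E → ℝ} {x : E} {c d : ℝ} (hf : LogBound f x c)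
    (hg : LogBound g x d) : LogBound (fun y => f y + g y) x (c + d) := by
  have hev : fderiv ℝ (fun y => f y + g y) =ᶠ[𝓝 x] fun y => fderiv ℝ f y + fderiv ℝ g y := by
    filter_upwards [hf.contDiffAt.eventually_differentiableAt,
      hg.contDiffAt.eventually_differentiableAt] with y h1 h2
    exact fderiv_fun_add h1 h2
  refine ⟨hf.contDiffAt.add hg.contDiffAt, ?_, ?_⟩
  · rw [hev.eq_of_nhds]
    nlinarith [norm_add_le (fderiv ℝ f x) (fderiv ℝ g x), hf.first, hg.first, norm_nonneg x]
  · rw [hev.fderiv_eq, (hf.contDiffAt.hasFDerivAt_fderiv.fun_add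
      hg.contDiffAt.hasFDerivAt_fderiv).fderiv]
    nlinarith [norm_add_le (fderiv ℝ (fderiv ℝ f) x) (fderiv ℝ (fderiv ℝ g) x), hf.second,
      hg.second, sq_nonneg ‖x‖]

theorem LogBound.neg {f : E → ℝ} {x : E} {c : ℝ} (hf : LogBound f x c) :
    LogBound (fun y => -f y) x c := by
  have hev : fderiv ℝ (fun y => -f y) = fun y => -fderiv ℝ f y := funext fun y => fderiv_fun_neg
  refine ⟨hf.contDiffAt.neg, ?_, ?_⟩
  · rw [hev, norm_neg]; exact hf.first
  · rw [hev, fderiv_fun_neg]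
    exact (congrArg (‖x‖ ^ 2 * ·) (opNorm_neg_eq _)).trans_le hf.second

/-- A function with these derivative bounds can itself be unbounded, so the product rule needs
separate bounds on the values. -/
theorem LogBound.mul {f g : E → ℝ} {x : E} {c d a b : ℝ} (hf : LogBound f x c)
    (hg : LogBound g x d) (ha : |f x| ≤ a) (hb : |g x| ≤ b) :
    LogBound (fun y => f y * g y) x (a * d + b * c + 2 * c * d) := by
  have hc := hf.nonneg
  have hd := hg.nonneg
  have hev : fderiv ℝ (fun y => f y * g y) =ᶠ[𝓝 x]
      fun y => f y • fderiv ℝ g y + g y • fderiv ℝ f y := by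
    filter_upwards [hf.contDiffAt.eventually_differentiableAt,
      hg.contDiffAt.eventually_differentiableAt] with y h1 h2
    exact fderiv_fun_mul h1 h2
  have hf' := (hf.contDiffAt.differentiableAt (by simp)).hasFDerivAt
  have hg' := (hg.contDiffAt.differentiableAt (by simp)).hasFDerivAt
  refine ⟨hf.contDiffAt.mul hg.contDiffAt, ?_, ?_⟩
  · rw [hev.eq_of_nhds]
    have h1 : ‖f x • fderiv ℝ g x + g x • fderiv ℝ f x‖ ≤
        a * ‖fderiv ℝ g x‖ + b * ‖fderiv ℝ f x‖ := by
      refine (norm_add_le _ _).trans ?_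
      rw [norm_smul, norm_smul]
      gcongr <;> assumption
    have h2 := mul_le_mul_of_nonneg_left h1 (norm_nonneg x)
    have h3 := mul_le_mul_of_nonneg_left hg.first ((abs_nonneg _).trans ha)
    have h4 := mul_le_mul_of_nonneg_left hf.first ((abs_nonneg _).trans hb)
    nlinarith [mul_nonneg hc hd]
  · rw [hev.fderiv_eq, ((hf'.fun_smul hg.contDiffAt.hasFDerivAt_fderiv).fun_add
      (hg'.fun_smul hf.contDiffAt.hasFDerivAt_fderiv)).fderiv]
    have h1 : ‖f x • fderiv ℝ (fderiv ℝ g) x + (fderiv ℝ f x).smulRight (fderiv ℝ g x) +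
        (g x • fderiv ℝ (fderiv ℝ f) x + (fderiv ℝ g x).smulRight (fderiv ℝ f x))‖ ≤
        a * ‖fderiv ℝ (fderiv ℝ g) x‖ + ‖fderiv ℝ f x‖ * ‖fderiv ℝ g x‖ +
          (b * ‖fderiv ℝ (fderiv ℝ f) x‖ + ‖fderiv ℝ g x‖ * ‖fderiv ℝ f x‖) := by
      refine (opNorm_add_le_add _ _).trans (add_le_add ((opNorm_add_le_add _ _).trans ?_)
        ((opNorm_add_le_add _ _).trans ?_))
      · exact add_le_add (opNorm_smul_le_of_le _ ha) (norm_smulRight_le _ _)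
      · exact add_le_add (opNorm_smul_le_of_le _ hb) (norm_smulRight_le _ _)
    have h2 := mul_le_mul_of_nonneg_left h1 (sq_nonneg ‖x‖)
    have h3 := mul_le_mul_of_nonneg_left hg.second ((abs_nonneg _).trans ha)
    have h4 := mul_le_mul_of_nonneg_left hf.second ((abs_nonneg _).trans hb)
    have h5 : (‖x‖ * ‖fderiv ℝ f x‖) * (‖x‖ * ‖fderiv ℝ g x‖) ≤ c * d :=
      mul_le_mul hf.first hg.first (by positivity) hc
    nlinarith

/-- Where `|x| < 2 |L x|`, decay in `L x` is decay in `x`; the factor `4` is the square of this `2`.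
-/
theorem LogBound.comp_linear {E' : Type*} [NormedAddCommGroup E']
    [NormedSpace ℝ E'] {ψ : E' → ℝ} {L : E →L[ℝ] E'} {x : E} {c : ℝ}
    (hψ : ContDiffAt ℝ 2 ψ (L x))
    (hc : ‖L x‖ * ‖fderiv ℝ ψ (L x)‖ + ‖L x‖ ^ 2 * ‖fderiv ℝ (fderiv ℝ ψ) (L x)‖ ≤ c)
    (hL : ‖L‖ ≤ 1) (hx : ‖x‖ / 2 < ‖L x‖) : LogBound (fun y => ψ (L y)) x (4 * c) := by
  have h1 : ‖L x‖ * ‖fderiv ℝ ψ (L x)‖ ≤ c :=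
    le_trans (le_add_of_nonneg_right (by positivity)) hc
  have h2 : ‖L x‖ ^ 2 * ‖fderiv ℝ (fderiv ℝ ψ) (L x)‖ ≤ c :=
    le_trans (le_add_of_nonneg_left (by positivity)) hc
  have hev : fderiv ℝ (fun y => ψ (L y)) =ᶠ[𝓝 x] fun y => (fderiv ℝ ψ (L y)).comp L := by
    filter_upwards [L.continuous.continuousAt.eventually hψ.eventually_differentiableAt] with y hy
    exact (hy.hasFDerivAt.comp y L.hasFDerivAt).fderiv
  have hsec : HasFDerivAt (fun y => (fderiv ℝ ψ (L y)).comp L)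
      (((ContinuousLinearMap.compL ℝ E E' ℝ).flip L).comp
        ((fderiv ℝ (fderiv ℝ ψ) (L x)).comp L)) x :=
    ((ContinuousLinearMap.compL ℝ E E' ℝ).flip L).hasFDerivAt.comp x
      (hψ.hasFDerivAt_fderiv.comp x L.hasFDerivAt)
  refine ⟨hψ.comp x L.contDiff.contDiffAt, ?_, ?_⟩
  · rw [hev.eq_of_nhds]
    have h3 : ‖(fderiv ℝ ψ (L x)).comp L‖ ≤ ‖fderiv ℝ ψ (L x)‖ :=
      (ContinuousLinearMap.opNorm_comp_le _ _).trans (mul_le_of_le_one_right (norm_nonneg _) hL)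
    nlinarith [norm_nonneg x, norm_nonneg (fderiv ℝ ψ (L x)), norm_nonneg (L x)]
  · rw [hev.fderiv_eq, hsec.fderiv]
    have h3 : ‖((ContinuousLinearMap.compL ℝ E E' ℝ).flip L).comp
        ((fderiv ℝ (fderiv ℝ ψ) (L x)).comp L)‖ ≤ ‖fderiv ℝ (fderiv ℝ ψ) (L x)‖ := by
      refine ContinuousLinearMap.opNorm_le_bound _ (ContinuousLinearMap.opNorm_nonneg _) fun v => ?_
      calc ‖(fderiv ℝ (fderiv ℝ ψ) (L x) (L v)).comp L‖
          ≤ ‖fderiv ℝ (fderiv ℝ ψ) (L x) (L v)‖ * ‖L‖ := ContinuousLinearMap.opNorm_comp_le _ _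
        _ ≤ ‖fderiv ℝ (fderiv ℝ ψ) (L x) (L v)‖ := mul_le_of_le_one_right (norm_nonneg _) hL
        _ ≤ ‖fderiv ℝ (fderiv ℝ ψ) (L x)‖ * ‖L v‖ := ContinuousLinearMap.le_opNorm _ _
        _ ≤ ‖fderiv ℝ (fderiv ℝ ψ) (L x)‖ * ‖v‖ := by
          gcongr
          exact (L.le_opNorm v).trans (mul_le_of_le_one_left (norm_nonneg _) hL)
    have h4 : ‖x‖ ^ 2 ≤ 4 * ‖L x‖ ^ 2 := by nlinarith [norm_nonneg x, norm_nonneg (L x)]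
    calc _ ≤ (4 * ‖L x‖ ^ 2) * ‖fderiv ℝ (fderiv ℝ ψ) (L x)‖ := by gcongr
      _ ≤ 4 * c := by linarith

/-- Smooth functions which are homogeneous of degree zero. -/
theorem exists_logBound_of_homogeneous [FiniteDimensional ℝ E] {f : E → ℝ} (hf : ∀ x, x ≠ 0 → ContDiffAt ℝ ∞ f x)
    (hhom : ∀ t : ℝ, 0 < t → ∀ x, f (t • x) = f x) : ∃ c, ∀ x, x ≠ 0 → LogBound f x c := by
  have h1 : ∀ t : ℝ, 0 < t → ∀ x, fderiv ℝ f x = t • fderiv ℝ f (t • x) := by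
    -- The first and second derivatives are homogeneous of degree `-1` and `-2`, so the weighted
    -- bounds reduce to the compact unit sphere.
    intro t ht x
    have h2 : f = fun y => f (t • y) := funext fun y => (hhom t ht y).symm
    conv_lhs => rw [h2]
    exact fderiv_comp_smul t
  have h2 : ∀ t : ℝ, 0 < t → ∀ x, fderiv ℝ (fderiv ℝ f) x =
      t • t • fderiv ℝ (fderiv ℝ f) (t • x) := by
    intro t ht x
    have h3 : fderiv ℝ f = fun y => t • fderiv ℝ f (t • y) := funext fun y => h1 t ht y
    have h4 : fderiv ℝ (fun y => t • fderiv ℝ f (t • y)) x =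
        t • fderiv ℝ (fun y => fderiv ℝ f (t • y)) x :=
      congrFun (fderiv_const_smul_field (f := fun y => fderiv ℝ f (t • y)) t) x
    conv_lhs => rw [h3]
    rw [h4, fderiv_comp_smul t]
  have hcs : IsCompact (Metric.sphere (0 : E) 1) := isCompact_sphere _ _
  have hne : ∀ x ∈ Metric.sphere (0 : E) 1, x ≠ 0 := by
    rintro x hx rfl; simp at hx
  obtain ⟨c₁, hc₁⟩ := hcs.exists_bound_of_continuousOn (f := fderiv ℝ f) fun x hx =>
    ((hf x (hne x hx)).fderiv_right (m := 0) (by simp)).continuousAt.continuousWithinAt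
  obtain ⟨c₂, hc₂⟩ := hcs.exists_bound_of_continuousOn (f := fderiv ℝ (fderiv ℝ f)) fun x hx =>
    (((hf x (hne x hx)).fderiv_right (m := 1) (by norm_cast)).fderiv_right (m := 0)
      (by simp)).continuousAt.continuousWithinAt
  refine ⟨max c₁ c₂, fun x hx => ⟨(hf x hx).of_le (by norm_cast), ?_, ?_⟩⟩
  · have hx0 : 0 < ‖x‖ := norm_pos_iff.2 hx
    have hs : ‖x‖⁻¹ • x ∈ Metric.sphere (0 : E) 1 := by
      rw [mem_sphere_zero_iff_norm, norm_smul, norm_inv, norm_norm, inv_mul_cancel₀ hx0.ne']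
    rw [h1 ‖x‖⁻¹ (inv_pos.2 hx0) x, norm_smul, norm_inv, norm_norm, mul_inv_cancel_left₀ hx0.ne']
    exact (hc₁ _ hs).trans (le_max_left _ _)
  · have hx0 : 0 < ‖x‖ := norm_pos_iff.2 hx
    have hs : ‖x‖⁻¹ • x ∈ Metric.sphere (0 : E) 1 := by
      rw [mem_sphere_zero_iff_norm, norm_smul, norm_inv, norm_norm, inv_mul_cancel₀ hx0.ne']
    rw [h2 ‖x‖⁻¹ (inv_pos.2 hx0) x]
    refine le_trans (le_of_eq ?_) ((hc₂ _ hs).trans (le_max_right _ _))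
    refine (congrArg (‖x‖ ^ 2 * ·) ((opNorm_smul_eq _ _).trans
      (congrArg (|‖x‖⁻¹| * ·) (opNorm_smul_eq _ _)))).trans ?_
    simp only [abs_inv, abs_norm]
    field_simp

end

/-! ### The extension of a function from the plane to the half-space -/

/-- A cutoff function, homogeneous of degree zero, which is `1` near the horizontal plane and `0`
near the vertical axis. -/
noncomputable def conicalCutoff (x : E3) : ℝ :=
  Real.smoothTransition (2 - 3 * (x 2 ^ 2 / ‖x‖ ^ 2))

theorem contDiffAt_conicalCutoff {x : E3} (hx : x ≠ 0) : ContDiffAt ℝ ∞ conicalCutoff x := by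
  have h1 : ContDiffAt ℝ ∞ (fun x : E3 => x 2) x :=
    (EuclideanSpace.proj (𝕜 := ℝ) (2 : Fin 3)).contDiff.contDiffAt
  have h2 : ContDiffAt ℝ ∞ (fun x : E3 => ‖x‖ ^ 2) x := (contDiff_norm_sq ℝ).contDiffAt
  exact Real.smoothTransition.contDiffAt.comp x (contDiffAt_const.sub
    (contDiffAt_const.mul ((h1.pow 2).div h2 (by simpa using hx))))

theorem conicalCutoff_smul (t : ℝ) (ht : 0 < t) (x : E3) :
    conicalCutoff (t • x) = conicalCutoff x := by
  unfold conicalCutoff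
  congr 3
  rw [norm_smul, PiLp.smul_apply, smul_eq_mul, mul_pow, mul_pow, Real.norm_eq_abs, sq_abs,
    mul_div_mul_left _ _ (by positivity)]

theorem conicalCutoff_mem (x : E3) : 0 ≤ conicalCutoff x ∧ conicalCutoff x ≤ 1 :=
  ⟨Real.smoothTransition.nonneg _, Real.smoothTransition.le_one _⟩

theorem conicalCutoff_eq_one {x : E3} (hx : x 2 ^ 2 / ‖x‖ ^ 2 ≤ 1 / 3) : conicalCutoff x = 1 :=
  Real.smoothTransition.one_of_one_le (by linarith)

theorem conicalCutoff_eq_zero {x : E3} (hx : 2 / 3 ≤ x 2 ^ 2 / ‖x‖ ^ 2) : conicalCutoff x = 0 :=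
  Real.smoothTransition.zero_of_nonpos (by linarith)

/-- The projection to the vertical axis, which is identified with an axis of the plane. -/
noncomputable def projAxis : E3 →L[ℝ] E2 :=
  (EuclideanSpace.proj (𝕜 := ℝ) (2 : Fin 3)).smulRight (EuclideanSpace.single 0 1)

theorem norm_projAxis (x : E3) : ‖projAxis x‖ = |x 2| := by
  simp [projAxis, norm_smul]

/-- The extension of a function from the plane to the half-space. -/
noncomputable def extendPlane (ψ : E2 → ℝ) (x : E3) : ℝ :=
  -- Near the vertical axis `proj2 x` leaves the domain of `ψ`, whereas `projAxis x` has norm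
  -- comparable to that of `x`. The cutoff interpolates between the two evaluations where both
  -- projections are large.
  ψ (projAxis x) + conicalCutoff x * (ψ (proj2 x) + -ψ (projAxis x))

theorem half_lt_norm_proj2 {x : E3} (hx : x ≠ 0) (h : x 2 ^ 2 / ‖x‖ ^ 2 < 3 / 4) :
    ‖x‖ / 2 < ‖proj2 x‖ := by
  have hx0 : 0 < ‖x‖ := norm_pos_iff.2 hx
  rw [div_lt_iff₀ (by positivity)] at h
  refine lt_of_pow_lt_pow_left₀ 2 (norm_nonneg _) ?_
  nlinarith [E3.norm_sq' x]

theorem half_lt_norm_projAxis {x : E3} (hx : x ≠ 0) (h : 1 / 4 < x 2 ^ 2 / ‖x‖ ^ 2) :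
    ‖x‖ / 2 < ‖projAxis x‖ := by
  have hx0 : 0 < ‖x‖ := norm_pos_iff.2 hx
  rw [lt_div_iff₀ (by positivity)] at h
  refine lt_of_pow_lt_pow_left₀ 2 (norm_nonneg _) ?_
  rw [norm_projAxis, sq_abs]
  nlinarith

theorem continuousAt_slope {x : E3} (hx : x ≠ 0) :
    ContinuousAt (fun x : E3 => x 2 ^ 2 / ‖x‖ ^ 2) x := by
  have h1 : ContinuousAt (fun x : E3 => x 2) x :=
    (EuclideanSpace.proj (𝕜 := ℝ) (2 : Fin 3)).continuous.continuousAt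
  exact (h1.pow 2).div (continuous_norm.pow 2).continuousAt (by simpa using hx)

theorem extendPlane_eventuallyEq_proj2 (ψ : E2 → ℝ) {x : E3} (hx : x ≠ 0)
    (h : x 2 ^ 2 / ‖x‖ ^ 2 < 1 / 3) : extendPlane ψ =ᶠ[𝓝 x] fun y => ψ (proj2 y) := by
  filter_upwards [(continuousAt_slope hx).eventually_lt_const h] with y hy
  simp [extendPlane, conicalCutoff_eq_one hy.le]

theorem extendPlane_eventuallyEq_projAxis (ψ : E2 → ℝ) {x : E3} (hx : x ≠ 0)
    (h : 2 / 3 < x 2 ^ 2 / ‖x‖ ^ 2) : extendPlane ψ =ᶠ[𝓝 x] fun y => ψ (projAxis y) := by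
  filter_upwards [(continuousAt_slope hx).eventually_const_lt h] with y hy
  simp [extendPlane, conicalCutoff_eq_zero hy.le]

theorem norm_proj2_clm : ‖proj2‖ ≤ 1 :=
  ContinuousLinearMap.opNorm_le_bound _ zero_le_one fun x => by
    rw [one_mul]; exact norm_proj2_le x

theorem norm_projAxis_clm : ‖projAxis‖ ≤ 1 :=
  ContinuousLinearMap.opNorm_le_bound _ zero_le_one fun x => by
    rw [one_mul, norm_projAxis]; exact abs_coord_le x 2

theorem extendPlane_lift3 (ψ : E2 → ℝ) {h : E2} : extendPlane ψ (lift3 h 0) = ψ h := by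
  simp [extendPlane, conicalCutoff_eq_one (x := lift3 h 0) (by simp)]

section

variable {μ : E3 → E3} {C : Set E3} {A : E3 ≃ₗᵢ[ℝ] E3} {R : ℝ} {ψ : E2 → ℝ}

/-- Each value of `ψ` which enters near `x` is taken at a point of norm above `|x| / 2`, hence the
radius `2R`. -/
theorem contDiffAt_extendPlane (hR : 0 < R) (hψ : ∀ h : E2, R < ‖h‖ → ContDiffAt ℝ ∞ ψ h) {x : E3}
    (hx : 2 * R < ‖x‖) : ContDiffAt ℝ ∞ (extendPlane ψ) x := by
  have hx0 : x ≠ 0 := by rintro rfl; simp at hx; linarith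
  have h1 : x 2 ^ 2 / ‖x‖ ^ 2 < 3 / 4 → ContDiffAt ℝ ∞ (fun y => ψ (proj2 y)) x := fun h =>
    (hψ (proj2 x) (by linarith [half_lt_norm_proj2 hx0 h])).comp x proj2.contDiff.contDiffAt
  have h2 : 1 / 4 < x 2 ^ 2 / ‖x‖ ^ 2 → ContDiffAt ℝ ∞ (fun y => ψ (projAxis y)) x := fun h =>
    (hψ (projAxis x) (by linarith [half_lt_norm_projAxis hx0 h])).comp x
      projAxis.contDiff.contDiffAt
  rcases lt_or_ge (x 2 ^ 2 / ‖x‖ ^ 2) (1 / 3) with h | h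
  · exact (h1 (by linarith)).congr_of_eventuallyEq (extendPlane_eventuallyEq_proj2 ψ hx0 h)
  rcases lt_or_ge (2 / 3) (x 2 ^ 2 / ‖x‖ ^ 2) with h' | h'
  · exact (h2 (by linarith)).congr_of_eventuallyEq (extendPlane_eventuallyEq_projAxis ψ hx0 h')
  · have h3 := h1 (by linarith)
    have h4 := h2 (by linarith)
    exact h4.add ((contDiffAt_conicalCutoff hx0).mul (h3.add h4.neg))

/-- The delicate term is the derivative of the cutoff times the difference of the two values of `ψ`.
In the transition cone the two arguments have comparable norms, so by the logarithmic estimate the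
difference is bounded although `ψ` need not be. -/
theorem IsGraphEnd.exists_logBound_extendPlane (hG : IsGraphEnd μ C A R ψ) :
    ∃ c, ∀ x : E3, 2 * R < ‖x‖ → LogBound (extendPlane ψ) x c := by
  obtain ⟨c, hc⟩ := hG.decay
  have hR := hG.pos
  have hc0 : 0 ≤ c := by
    have h1 : ‖polarPt (R + 1) 0‖ = R + 1 := norm_polarPt (by linarith) 0
    exact le_trans (by positivity) (hc (polarPt (R + 1) 0) (by linarith))
  obtain ⟨k, hk⟩ := exists_logBound_of_homogeneous (fun x hx => contDiffAt_conicalCutoff hx)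
    conicalCutoff_smul
  have hk0 : 0 ≤ k := (hk e3 (by rw [← norm_pos_iff]; simp)).nonneg
  set b := c * (2 * Real.pi + 1)
  have hb : 0 ≤ b := by positivity
  refine ⟨4 * c + (1 * (4 * c + 4 * c) + b * k + 2 * k * (4 * c + 4 * c)), fun x hx => ?_⟩
  have hx0 : x ≠ 0 := by rintro rfl; simp at hx; linarith
  have h1 : x 2 ^ 2 / ‖x‖ ^ 2 < 3 / 4 → R < ‖proj2 x‖ := fun h => by
    linarith [half_lt_norm_proj2 hx0 h]
  have h2 : 1 / 4 < x 2 ^ 2 / ‖x‖ ^ 2 → R < ‖projAxis x‖ := fun h => by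
    linarith [half_lt_norm_projAxis hx0 h]
  have h3 : x 2 ^ 2 / ‖x‖ ^ 2 < 3 / 4 → LogBound (fun y => ψ (proj2 y)) x (4 * c) := fun h =>
    .comp_linear (hG.contDiffAt (h1 h)) (hc _ (h1 h)) norm_proj2_clm (half_lt_norm_proj2 hx0 h)
  have h4 : 1 / 4 < x 2 ^ 2 / ‖x‖ ^ 2 → LogBound (fun y => ψ (projAxis y)) x (4 * c) := fun h =>
    .comp_linear (hG.contDiffAt (h2 h)) (hc _ (h2 h)) norm_projAxis_clm
      (half_lt_norm_projAxis hx0 h)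
  have hge : 4 * c ≤ 4 * c + (1 * (4 * c + 4 * c) + b * k + 2 * k * (4 * c + 4 * c)) :=
    le_add_of_nonneg_right (by positivity)
  rcases lt_or_ge (x 2 ^ 2 / ‖x‖ ^ 2) (1 / 3) with h | h
  · exact ((h3 (by linarith)).congr (extendPlane_eventuallyEq_proj2 ψ hx0 h)).mono hge
  rcases lt_or_ge (2 / 3) (x 2 ^ 2 / ‖x‖ ^ 2) with h' | h'
  · exact ((h4 (by linarith)).congr (extendPlane_eventuallyEq_projAxis ψ hx0 h')).mono hge
  · have hp := half_lt_norm_proj2 hx0 (h'.trans_lt (by norm_num))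
    have ha := half_lt_norm_projAxis hx0 (lt_of_lt_of_le (by norm_num) h)
    have hp' := norm_proj2_le x
    have ha' : ‖projAxis x‖ ≤ ‖x‖ := by rw [norm_projAxis]; exact abs_coord_le x 2
    have hx' : 0 < ‖x‖ := norm_pos_iff.2 hx0
    have hlog : |Real.log (‖proj2 x‖ / ‖projAxis x‖)| ≤ 1 := by
      have h5 : ‖proj2 x‖ / ‖projAxis x‖ ≤ 2 := by rw [div_le_iff₀ (by linarith)]; linarith
      have h6 : 1 / 2 ≤ ‖proj2 x‖ / ‖projAxis x‖ := by rw [le_div_iff₀ (by linarith)]; linarith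
      have h7 := Real.log_le_log (by linarith) h5
      have h8 := Real.log_le_log (by norm_num) h6
      rw [one_div, Real.log_inv] at h8
      have h9 := Real.log_two_lt_d9
      rw [abs_le]; constructor <;> linarith
    have hdiff := norm_sub_le_of_log_gradient hR
      (fun x hx => (hG.contDiffAt hx).differentiableAt (by simp))
      (fun x hx => le_trans (le_add_of_nonneg_right (by positivity)) (hc x hx))
      (h1 (by linarith)) (h2 (by linarith))
    have hcut : |conicalCutoff x| ≤ 1 := by
      rw [abs_of_nonneg (conicalCutoff_mem x).1]; exact (conicalCutoff_mem x).2
    refine (h4 (by linarith)).add ((hk x hx0).mul ((h3 (by linarith)).add (h4 (by linarith)).neg)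
      hcut ?_)
    rw [← sub_eq_add_neg]
    exact hdiff.trans (mul_le_mul_of_nonneg_left (by linarith) hc0)

/-- The extension is a convex combination of two values of `ψ` at points of norm at most `|x|`. -/
theorem IsGraphEnd.exists_sublinear_extendPlane (hG : IsGraphEnd μ C A R ψ) {ε : ℝ} (hε : 0 < ε) :
    ∃ K, 0 ≤ K ∧ ∀ x : E3, 2 * R < ‖x‖ → |extendPlane ψ x| ≤ ε * ‖x‖ + K := by
  obtain ⟨K, hK, h⟩ := hG.exists_sublinear hε
  refine ⟨K, hK, fun x hx => ?_⟩
  have hR := hG.pos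
  have hx0 : x ≠ 0 := by rintro rfl; simp at hx; linarith
  have h1 : x 2 ^ 2 / ‖x‖ ^ 2 < 3 / 4 → |ψ (proj2 x)| ≤ ε * ‖x‖ + K := fun h' =>
    (h _ (by linarith [half_lt_norm_proj2 hx0 h'])).trans (by gcongr; exact norm_proj2_le x)
  have h2 : 1 / 4 < x 2 ^ 2 / ‖x‖ ^ 2 → |ψ (projAxis x)| ≤ ε * ‖x‖ + K := fun h' =>
    (h _ (by linarith [half_lt_norm_projAxis hx0 h'])).trans (by
      gcongr; rw [norm_projAxis]; exact abs_coord_le x 2)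
  rcases lt_or_ge (x 2 ^ 2 / ‖x‖ ^ 2) (1 / 3) with h' | h'
  · rw [(extendPlane_eventuallyEq_proj2 ψ hx0 h').eq_of_nhds]
    exact h1 (by linarith)
  rcases lt_or_ge (2 / 3) (x 2 ^ 2 / ‖x‖ ^ 2) with h'' | h''
  · rw [(extendPlane_eventuallyEq_projAxis ψ hx0 h'').eq_of_nhds]
    exact h2 (by linarith)
  · have h3 := abs_le.1 (h1 (by linarith))
    have h4 := abs_le.1 (h2 (by linarith))
    obtain ⟨h5, h6⟩ := conicalCutoff_mem x
    rw [abs_le, extendPlane]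
    constructor <;> nlinarith

end

/-! ### Charts of the ends of the region -/

/-- By injectivity the global inverse agrees near each image point with the local inverse from the
inverse function theorem. -/
theorem exists_smooth_inverse {H : E3 → E3} {D : Set E3} (hD : IsOpen D) (hH : ContDiffOn ℝ ∞ H D)
    (hinj : InjOn H D) (hd : ∀ x ∈ D, ∀ v, fderiv ℝ H x v = 0 → v = 0) :
    IsOpen (H '' D) ∧ ∃ Ξ : E3 → E3, (∀ x ∈ D, Ξ (H x) = x) ∧ ContDiffOn ℝ ∞ Ξ (H '' D) := by
  have hloc : ∀ x ∈ D, ∃ e : OpenPartialHomeomorph E3 E3, (e : E3 → E3) = H ∧ x ∈ e.source ∧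
      e.source ⊆ D ∧ ContDiffOn ℝ ∞ e.symm e.target :=
    fun x hx => exists_smooth_chart hD hx hH (hd x hx)
  have hmem : ∀ x (e : OpenPartialHomeomorph E3 E3), (e : E3 → E3) = H → x ∈ e.source →
      H x ∈ e.target := fun x e he hx => he ▸ e.map_source hx
  refine ⟨?_, Function.invFunOn H D, fun x hx => hinj.leftInvOn_invFunOn hx, ?_⟩
  · rw [isOpen_iff_mem_nhds]
    rintro _ ⟨x, hx, rfl⟩
    obtain ⟨e, he, hxe, hsub, -⟩ := hloc x hx
    filter_upwards [e.open_target.mem_nhds (hmem x e he hxe)] with y hy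
    exact ⟨e.symm y, hsub (e.map_target hy), by rw [← he, e.right_inv hy]⟩
  · rintro _ ⟨x, hx, rfl⟩
    obtain ⟨e, he, hxe, hsub, hsm⟩ := hloc x hx
    have ht := e.open_target.mem_nhds (hmem x e he hxe)
    refine ((hsm.contDiffAt ht).congr_of_eventuallyEq ?_).contDiffWithinAt
    filter_upwards [ht] with y hy
    have h1 : H (e.symm y) = y := by rw [← he, e.right_inv hy]
    have h2 := hinj.leftInvOn_invFunOn (hsub (e.map_target hy))
    rwa [h1] at h2

/-- The chart of the end of the region above the graph of `ψ`. -/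
noncomputable def graphChart (A : E3 ≃ₗᵢ[ℝ] E3) (ψ : E2 → ℝ) (x : E3) : E3 :=
  A (x + extendPlane ψ x • e3)

/-- Outside the ball of radius `R₁` the extension of `ψ` is smooth, and its gradient is small. -/
structure IsChartRadius (ψ : E2 → ℝ) (R₁ : ℝ) : Prop where
  pos : 0 < R₁
  smooth : ∀ x : E3, R₁ < ‖x‖ → ContDiffAt ℝ ∞ (extendPlane ψ) x
  small : ∀ x : E3, R₁ < ‖x‖ → ‖fderiv ℝ (extendPlane ψ) x‖ ≤ 1 / 2

/-- A neighbourhood of the half-space near infinity. -/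
def thickEnd (R₁ : ℝ) : Set E3 := {x | R₁ < ‖proj2 x‖ ∨ R₁ < x 2}

theorem isOpen_thickEnd (R₁ : ℝ) : IsOpen (thickEnd R₁) :=
  (isOpen_lt continuous_const (continuous_norm.comp proj2.continuous)).union
    (isOpen_lt continuous_const (EuclideanSpace.proj (𝕜 := ℝ) (2 : Fin 3)).continuous)

theorem lt_norm_of_mem_thickEnd {R₁ : ℝ} {x : E3} (hx : x ∈ thickEnd R₁) : R₁ < ‖x‖ := by
  rcases hx with h | h
  · exact h.trans_le (norm_proj2_le x)
  · exact h.trans_le ((le_abs_self _).trans (abs_coord_le x 2))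

theorem norm_le_proj_add (x : E3) : ‖x‖ ≤ ‖proj2 x‖ + |x 2| := by
  have := norm_lift3_le (proj2 x) (x 2)
  rwa [lift3_proj2] at this

theorem halfSpaceEnd_subset_thickEnd {R₁ R₂ : ℝ} (h : 2 * R₁ ≤ R₂) :
    halfSpaceEnd R₂ ⊆ thickEnd R₁ := by
  rintro x ⟨h1, h2⟩
  by_contra hx
  have h3 : ¬ R₁ < ‖proj2 x‖ := fun h => hx (Or.inl h)
  have h4 : ¬ R₁ < x 2 := fun h => hx (Or.inr h)
  have := norm_le_proj_add x
  rw [abs_of_nonneg h1] at this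
  linarith

theorem isConnected_halfSpaceEnd {R : ℝ} (hR : 0 < R) : IsConnected (halfSpaceEnd R) := by
  have hrank : 1 < Module.rank ℝ E3 := by
    rw [rank_eq_card_basis (EuclideanSpace.basisFun (Fin 3) ℝ).toBasis]
    simp only [Fintype.card_fin, Nat.cast_ofNat]
    norm_num
  -- Multiplication of the unit sphere by radii above `R`, followed by reflection of the lower
  -- half-space, maps a connected product onto the set.
  let F : ℝ × E3 → E3 := fun p => lift3 (proj2 (p.1 • p.2)) |(p.1 • p.2) 2|
  have hF : Continuous F := by
    have h1 : Continuous fun p : ℝ × E3 => p.1 • p.2 := continuous_fst.smul continuous_snd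
    exact continuous_lift3.comp ((proj2.continuous.comp h1).prodMk
      (continuous_abs.comp ((EuclideanSpace.proj (𝕜 := ℝ) (2 : Fin 3)).continuous.comp h1)))
  have himg : F '' (Ioi R ×ˢ Metric.sphere (0 : E3) 1) = halfSpaceEnd R := by
    have hn : ∀ p, ‖F p‖ = ‖p.1 • p.2‖ := fun p => by
      refine (pow_left_inj₀ (norm_nonneg _) (norm_nonneg _) two_ne_zero).1 ?_
      rw [norm_lift3_sq, E3.norm_sq' (p.1 • p.2), sq_abs]
    ext x
    constructor
    · rintro ⟨⟨t, v⟩, ⟨ht, hv⟩, rfl⟩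
      refine ⟨abs_nonneg _, ?_⟩
      rw [hn, norm_smul, mem_sphere_zero_iff_norm.1 hv, mul_one, Real.norm_of_nonneg (hR.trans ht).le]
      exact ht
    · rintro ⟨h1, h2⟩
      have h3 : 0 < ‖x‖ := hR.trans h2
      refine ⟨(‖x‖, ‖x‖⁻¹ • x), ⟨h2, ?_⟩, ?_⟩
      · rw [mem_sphere_zero_iff_norm, norm_smul, norm_inv, norm_norm, inv_mul_cancel₀ h3.ne']
      · simp only [F]
        rw [smul_inv_smul₀ h3.ne', abs_of_nonneg h1, lift3_proj2]
  rw [← himg]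
  refine IsConnected.image ?_ _ hF.continuousOn
  exact (isConnected_Ioi).prod (isConnected_sphere hrank 0 zero_le_one)

section

variable {S W C : Set E3} {μ : E3 → E3} {A : E3 ≃ₗᵢ[ℝ] E3} {R R₁ : ℝ} {ψ : E2 → ℝ}

theorem graphChart_eq (A : E3 ≃ₗᵢ[ℝ] E3) (ψ : E2 → ℝ) (x : E3) :
    graphChart A ψ x = A (lift3 (proj2 x) (x 2 + extendPlane ψ x)) := by
  rw [← lift3_add_smul, lift3_proj2]; rfl

theorem norm_graphChart_le (A : E3 ≃ₗᵢ[ℝ] E3) (ψ : E2 → ℝ) (x : E3) :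
    ‖graphChart A ψ x‖ ≤ ‖x‖ + |extendPlane ψ x| := by
  rw [graphChart, A.norm_map]
  refine (norm_add_le _ _).trans ?_
  rw [norm_smul, norm_e3, mul_one, Real.norm_eq_abs]

/-- The extension varies slowly along vertical lines. -/
theorem IsChartRadius.vertical (h : IsChartRadius ψ R₁) {k : E2} {a b : ℝ} (hab : a ≤ b)
    (ha : lift3 k a ∈ thickEnd R₁) :
    |extendPlane ψ (lift3 k b) - extendPlane ψ (lift3 k a)| ≤ (b - a) / 2 := by
  have hseg : ∀ x ∈ segment ℝ (lift3 k a) (lift3 k b), R₁ < ‖x‖ := by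
    rintro _ ⟨s, t, hs, ht, hst, rfl⟩
    refine lt_norm_of_mem_thickEnd ?_
    have hz : s • lift3 k a + t • lift3 k b = lift3 k (s * a + t * b) := by
      refine E3.ext ?_ ?_ (by simp)
      · simp; rw [← add_mul, hst, one_mul]
      · simp; rw [← add_mul, hst, one_mul]
    rw [hz]
    rcases ha with h | h
    · exact Or.inl (by simpa using h)
    · right
      simp only [lift3_two] at h ⊢
      have : s * a + t * a ≤ s * a + t * b := by gcongr
      rw [← add_mul, hst, one_mul] at this
      linarith
  have := (convex_segment (lift3 k a) (lift3 k b)).norm_image_sub_le_of_norm_fderiv_le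
    (fun x hx => (h.smooth x (hseg x hx)).differentiableAt (by simp))
    (fun x hx => h.small x (hseg x hx)) (left_mem_segment ℝ _ _) (right_mem_segment ℝ _ _)
  rw [lift3_sub_lift3, norm_smul, norm_e3, Real.norm_eq_abs, Real.norm_eq_abs,
    abs_of_nonneg (sub_nonneg.2 hab)] at this
  linarith

theorem IsChartRadius.strict (h : IsChartRadius ψ R₁) {k : E2} {a b : ℝ} (hab : a < b)
    (ha : lift3 k a ∈ thickEnd R₁) :
    a + extendPlane ψ (lift3 k a) < b + extendPlane ψ (lift3 k b) := by
  have := abs_le.1 (h.vertical hab.le ha)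
  linarith [this.1]

/-- Up to the isometry `A` the chart moves points only vertically, and the height is strictly
increasing along vertical lines. -/
theorem IsChartRadius.injOn (h : IsChartRadius ψ R₁) (A : E3 ≃ₗᵢ[ℝ] E3) :
    InjOn (graphChart A ψ) (thickEnd R₁) := by
  intro x hx y hy hxy
  rw [graphChart_eq, graphChart_eq] at hxy
  have h1 := A.injective hxy
  have h2 : proj2 x = proj2 y := by
    have := congrArg proj2 h1
    simpa using this
  have h3 : x 2 + extendPlane ψ x = y 2 + extendPlane ψ y := by
    have := congrArg (fun v : E3 => v 2) h1
    simpa using this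
  have hx' : x = lift3 (proj2 x) (x 2) := (lift3_proj2 x).symm
  have hy' : y = lift3 (proj2 x) (y 2) := by rw [h2, lift3_proj2]
  rcases lt_trichotomy (x 2) (y 2) with hlt | heq | hgt
  · have := h.strict (k := proj2 x) hlt (by rwa [← hx'])
    rw [← hx', ← hy'] at this
    linarith
  · rw [hx', hy', heq]
  · have := h.strict (k := proj2 x) hgt (by rwa [← hy'])
    rw [← hx', ← hy'] at this
    linarith

theorem IsChartRadius.hasFDerivAt (h : IsChartRadius ψ R₁) (A : E3 ≃ₗᵢ[ℝ] E3) {x : E3}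
    (hx : R₁ < ‖x‖) :
    HasFDerivAt (graphChart A ψ) ((A.toContinuousLinearEquiv : E3 →L[ℝ] E3).comp
      (ContinuousLinearMap.id ℝ E3 + (fderiv ℝ (extendPlane ψ) x).smulRight e3)) x :=
  A.toContinuousLinearEquiv.hasFDerivAt.comp x ((hasFDerivAt_id x).add
    (((h.smooth x hx).differentiableAt (by simp)).hasFDerivAt.smul_const e3))

theorem IsChartRadius.fderiv_apply (h : IsChartRadius ψ R₁) (A : E3 ≃ₗᵢ[ℝ] E3) {x : E3}
    (hx : R₁ < ‖x‖) (v : E3) :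
    fderiv ℝ (graphChart A ψ) x v = A (v + fderiv ℝ (extendPlane ψ) x v • e3) := by
  rw [(h.hasFDerivAt A hx).fderiv]; rfl

theorem IsChartRadius.fderiv_injective (h : IsChartRadius ψ R₁) (A : E3 ≃ₗᵢ[ℝ] E3) {x : E3}
    (hx : R₁ < ‖x‖) (v : E3) (hv : fderiv ℝ (graphChart A ψ) x v = 0) : v = 0 := by
  rw [h.fderiv_apply A hx, map_eq_zero_iff A A.injective] at hv
  have h1 : ‖v‖ ≤ 1 / 2 * ‖v‖ := by
    have h2 : v = -(fderiv ℝ (extendPlane ψ) x v • e3) := eq_neg_of_add_eq_zero_left hv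
    calc ‖v‖ = ‖fderiv ℝ (extendPlane ψ) x v‖ := by
          conv_lhs => rw [h2]
          rw [norm_neg, norm_smul, norm_e3, mul_one]
      _ ≤ 1 / 2 * ‖v‖ := (ContinuousLinearMap.le_opNorm _ _).trans
          (mul_le_mul_of_nonneg_right (h.small x hx) (norm_nonneg v))
  exact norm_eq_zero.1 (le_antisymm (by linarith) (norm_nonneg v))

theorem IsChartRadius.contDiffOn (h : IsChartRadius ψ R₁) (A : E3 ≃ₗᵢ[ℝ] E3) :
    ContDiffOn ℝ ∞ (graphChart A ψ) {x | R₁ < ‖x‖} := fun x hx =>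
  (A.contDiff.contDiffAt.comp x
    (contDiffAt_id.add ((h.smooth x hx).smul contDiffAt_const))).contDiffWithinAt

theorem IsChartRadius.exists_inverse (h : IsChartRadius ψ R₁) (A : E3 ≃ₗᵢ[ℝ] E3) :
    IsOpen (graphChart A ψ '' thickEnd R₁) ∧ ∃ Ξ : E3 → E3,
      (∀ x ∈ thickEnd R₁, Ξ (graphChart A ψ x) = x) ∧
      ContDiffOn ℝ ∞ Ξ (graphChart A ψ '' thickEnd R₁) :=
  exists_smooth_inverse (isOpen_thickEnd R₁)
    ((h.contDiffOn A).mono fun _ hx => lt_norm_of_mem_thickEnd hx) (h.injOn A)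
    fun _ hx => h.fderiv_injective A (lt_norm_of_mem_thickEnd hx)

/-- Every point above a point of the image of the chart is in the image. -/
theorem IsChartRadius.exists_preimage (h : IsChartRadius ψ R₁) {k : E2} {a z : ℝ}
    (ha : lift3 k a ∈ thickEnd R₁) (hz : a + extendPlane ψ (lift3 k a) ≤ z) :
    ∃ s ≥ a, lift3 k s ∈ thickEnd R₁ ∧ s + extendPlane ψ (lift3 k s) = z := by
  -- The height grows at rate at least `1/2`, so the value `z` is reached before `b`.
  set b := a + 2 * (z - (a + extendPlane ψ (lift3 k a)))
  have hab : a ≤ b := by simp only [b]; linarith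
  have hmem : ∀ s ∈ Icc a b, lift3 k s ∈ thickEnd R₁ := by
    rintro s ⟨hs, -⟩
    rcases ha with h | h
    · exact Or.inl (by simpa using h)
    · right
      simp only [lift3_two] at h ⊢
      linarith
  have hcont : ContinuousOn (fun s => s + extendPlane ψ (lift3 k s)) (Icc a b) := by
    intro s hs
    have h1 : ContinuousAt (fun s => lift3 k s) s :=
      (continuous_lift3.comp (Continuous.prodMk_right k)).continuousAt
    have h2 := (h.smooth _ (lt_norm_of_mem_thickEnd (hmem s hs))).continuousAt
    exact (continuousAt_id.add (ContinuousAt.comp (f := fun s => lift3 k s) h2 h1)).continuousWithinAt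
  have hb : z ≤ b + extendPlane ψ (lift3 k b) := by
    have := (abs_le.1 (h.vertical hab ha)).1
    simp only [b] at this ⊢
    linarith
  obtain ⟨s, hs, hsz⟩ := intermediate_value_Icc hab hcont ⟨hz, hb⟩
  exact ⟨s, hs.1, hmem s hs, hsz⟩

/-- The gradient of the extension is at most `c / |x|`, which is below `1/2` beyond radius `2c`. -/
theorem IsGraphEnd.exists_chartRadius (hG : IsGraphEnd μ C A R ψ)
    (hψ : ∀ h : E2, R < ‖h‖ → ContDiffAt ℝ ∞ ψ h) : ∃ R₁, 2 * R ≤ R₁ ∧ IsChartRadius ψ R₁ := by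
  obtain ⟨c, hc⟩ := hG.exists_logBound_extendPlane
  have hR := hG.pos
  refine ⟨max (2 * R) (2 * c), le_max_left _ _, lt_max_of_lt_left (by linarith),
    fun x hx => contDiffAt_extendPlane hR hψ ((le_max_left _ _).trans_lt hx), fun x hx => ?_⟩
  have h1 := (hc x ((le_max_left _ _).trans_lt hx)).first
  have h2 : 2 * c < ‖x‖ := (le_max_right _ _).trans_lt hx
  have h3 : 0 < ‖x‖ := by linarith [(le_max_left (2 * R) (2 * c)).trans_lt hx]
  rw [← mul_le_mul_iff_right₀ h3]
  linarith

/-- The image of the chart is the part of the region above the end, up to a bounded set. -/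
theorem IsUpperEnd.exists_end (hW : IsInnerSide S μ W) {ρ Z : ℝ}
    (hu : IsUpperEnd S W μ C A R ψ ρ) (hR₁ : IsChartRadius ψ R₁) (hRR₁ : 2 * R ≤ R₁)
    (hρ : R₁ ≤ ρ) (hZ : 0 ≤ Z) :
    ∃ R₂ ρ', 2 * R₁ ≤ R₂ ∧ graphChart A ψ '' halfSpaceEnd R₂ ⊆ aboveEnd A ψ ρ Z ∧
      (∀ y ∈ aboveEnd A ψ ρ Z, ρ' < ‖y‖ → y ∈ graphChart A ψ '' halfSpaceEnd R₂) ∧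
      ∀ y ∈ graphChart A ψ '' halfSpaceEnd R₂, ∀ᶠ y' in 𝓝 y, y' ∈ regionOf S μ →
        y' ∈ graphChart A ψ '' halfSpaceEnd R₂ := by
  obtain ⟨K, hK, hΨ⟩ := hu.graph.exists_sublinear_extendPlane (ε := 1 / 4) (by norm_num)
  have hR := hu.graph.pos
  -- The second entry ensures that a point with `|x| > R₂` near the axis is mapped above height `Z`:
  -- its height is at least `|x| - ρ` and the extension lowers it by at most `|x| / 4 + K`.
  set R₂ := max (2 * R₁) (2 * (|Z| + ρ + K)) with hR₂
  have h2R₁ : 2 * R₁ ≤ R₂ := le_max_left _ _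
  -- Beyond the first entry the preimage of a point has norm above `R₂`. Beyond the second, a point
  -- near the axis lies above the image of the point at height `R₁ + 1`, from which the preimage is
  -- found by moving up.
  refine ⟨R₂, max (5 / 4 * R₂ + K) (ρ + (R₁ + 1) + (ρ + (R₁ + 1)) / 4 + K), h2R₁, ?_, ?_, ?_⟩
  · rintro _ ⟨x, ⟨hx1, hx2⟩, rfl⟩
    rw [graphChart_eq, aboveEnd, mem_ofPred_eq, LinearIsometryEquiv.symm_apply_apply, proj2_lift3,
      lift3_two]
    rcases lt_or_ge ρ ‖proj2 x‖ with h1 | h1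
    · refine Or.inl ⟨h1, ?_⟩
      rcases hx1.eq_or_lt with h0 | h0
      · rw [← h0, zero_add]
        have : x = lift3 (proj2 x) 0 := by rw [h0, lift3_proj2]
        conv_rhs => rw [this, extendPlane_lift3]
      · have := hR₁.strict (k := proj2 x) h0 (Or.inl (by simp; linarith))
        rw [extendPlane_lift3, lift3_proj2] at this
        linarith
    · refine Or.inr ⟨h1, ?_⟩
      have h2 := norm_le_proj_add x
      rw [abs_of_nonneg hx1] at h2
      have h3 := (abs_le.1 (hΨ x (by linarith))).1
      have h4 := le_max_right (2 * R₁) (2 * (|Z| + ρ + K))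
      have h5 := le_abs_self Z
      have h6 := abs_nonneg Z
      have h7 := hR₁.pos
      linarith
  · intro y hy hyn
    set x := A.symm y
    have hyx : y = A x := by simp [x]
    have hxn : ‖x‖ = ‖y‖ := by simp [x]
    have hex : ∃ a ≥ 0, lift3 (proj2 x) a ∈ thickEnd R₁ ∧
        a + extendPlane ψ (lift3 (proj2 x) a) ≤ x 2 := by
      rcases hy with ⟨h1, h2⟩ | ⟨h1, h2⟩
      · exact ⟨0, le_rfl, Or.inl (by simp; linarith), by rw [extendPlane_lift3, zero_add]; exact h2⟩
      · refine ⟨R₁ + 1, by linarith [hR₁.pos], Or.inr (by simp), ?_⟩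
        have h3 := norm_lift3_le (proj2 x) (R₁ + 1)
        rw [abs_of_pos (by linarith [hR₁.pos])] at h3
        have h4 := (abs_le.1 (hΨ (lift3 (proj2 x) (R₁ + 1)) (by
          have := abs_coord_le (lift3 (proj2 x) (R₁ + 1)) 2
          rw [lift3_two, abs_of_pos (by linarith [hR₁.pos])] at this
          linarith))).2
        have h5 := norm_le_proj_add x
        have h6 := (le_max_right (5 / 4 * R₂ + K) _).trans_lt hyn
        rw [abs_of_nonneg (hZ.trans h2.le)] at h5
        linarith
    obtain ⟨a, ha0, ha, haz⟩ := hex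
    obtain ⟨s, hs, hsmem, hsz⟩ := hR₁.exists_preimage ha haz
    have himg : graphChart A ψ (lift3 (proj2 x) s) = y := by
      rw [graphChart_eq, proj2_lift3, lift3_two, hsz, lift3_proj2, hyx]
    refine ⟨lift3 (proj2 x) s, ⟨by simp; linarith, ?_⟩, himg⟩
    have h1 := norm_graphChart_le A ψ (lift3 (proj2 x) s)
    rw [himg] at h1
    have h2 := hΨ (lift3 (proj2 x) s) (by linarith [lt_norm_of_mem_thickEnd hsmem])
    have h3 := (le_max_left (5 / 4 * R₂ + K) _).trans_lt hyn
    linarith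
  · obtain ⟨hopen, Ξ, hΞ, hΞs⟩ := hR₁.exists_inverse A
    rintro _ ⟨x, hx, rfl⟩
    have hxt := halfSpaceEnd_subset_thickEnd h2R₁ hx
    have himg := hopen.mem_nhds (mem_image_of_mem _ hxt)
    have hcont : ContinuousAt Ξ (graphChart A ψ x) := (hΞs.contDiffAt himg).continuousAt
    have hlim : Tendsto Ξ (𝓝 (graphChart A ψ x)) (𝓝 x) := by
      have := hcont.tendsto
      rwa [hΞ x hxt] at this
    have hinv : ∀ y ∈ graphChart A ψ '' thickEnd R₁, Ξ y ∈ thickEnd R₁ ∧ graphChart A ψ (Ξ y) = y := by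
      rintro _ ⟨w, hw, rfl⟩
      rw [hΞ w hw]
      exact ⟨hw, rfl⟩
    have hnorm : ∀ᶠ y in 𝓝 (graphChart A ψ x), R₂ < ‖Ξ y‖ :=
      (hlim.norm).eventually_const_lt hx.2
    -- Near the image of a boundary point, points of the region lie on or above the graph, and
    -- monotonicity along vertical lines gives their preimages non-negative height.
    rcases hx.1.eq_or_lt with h0 | h0
    · have hxl : x = lift3 (proj2 x) 0 := by rw [h0, lift3_proj2]
      have hpn : ‖proj2 x‖ = ‖x‖ := by
        refine (pow_left_inj₀ (norm_nonneg _) (norm_nonneg _) two_ne_zero).1 ?_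
        rw [E3.norm_sq' x, ← h0]; ring
      have hproj : ∀ᶠ y in 𝓝 (graphChart A ψ x), R₁ < ‖proj2 (Ξ y)‖ := by
        refine (((proj2.continuous.tendsto x).comp hlim).norm).eventually_const_lt ?_
        rw [hpn]
        linarith [hx.2, hR₁.pos]
      have hloc : A.symm (graphChart A ψ x) = lift3 (proj2 x) (ψ (proj2 x)) := by
        rw [graphChart_eq, A.symm_apply_apply, ← h0, zero_add]
        conv_lhs => rw [hxl, extendPlane_lift3]
        simp
      have habove := hu.graph.eventually_above hW hu.subset (h := proj2 x)
        (by rw [hpn]; linarith [hx.2, hR₁.pos])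
      rw [← hloc] at habove
      filter_upwards [himg, hnorm, hproj, A.symm.continuous.continuousAt.eventually habove]
        with y hy1 hy2 hy3 hy4 hyM
      obtain ⟨hw, hwy⟩ := hinv y hy1
      refine ⟨Ξ y, ⟨?_, hy2⟩, hwy⟩
      rw [A.apply_symm_apply] at hy4
      have hle : ψ (proj2 (A.symm y)) ≤ A.symm y 2 := by
        rw [hW.region_eq] at hyM
        rcases hyM with h | h
        · exact (hy4.2.1 h).ge
        · exact (hy4.1.1 h).le
      rw [← hwy, graphChart_eq, A.symm_apply_apply, proj2_lift3, lift3_two] at hle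
      by_contra! hneg
      have := hR₁.strict (k := proj2 (Ξ y)) hneg (by rwa [lift3_proj2])
      rw [extendPlane_lift3, lift3_proj2] at this
      linarith
    · have hpos : ∀ᶠ y in 𝓝 (graphChart A ψ x), 0 < Ξ y 2 :=
        (((EuclideanSpace.proj (𝕜 := ℝ) (2 : Fin 3)).continuous.tendsto x).comp
          hlim).eventually_const_lt h0
      filter_upwards [himg, hnorm, hpos] with y hy1 hy2 hy3 _
      exact ⟨Ξ y, ⟨hy3.le, hy2⟩, (hinv y hy1).2⟩

end

/-! ### The Euclidean metric in a chart -/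

theorem uniqueDiffOn_halfSpaceEnd (R : ℝ) : UniqueDiffOn ℝ (halfSpaceEnd R) := by
  have hlin : IsLinearMap ℝ (fun x : E3 => x 2) := ⟨fun x y => by simp, fun c x => by simp⟩
  have h1 : Convex ℝ {x : E3 | 0 ≤ x 2} := convex_halfSpace_ge hlin 0
  have h2 : (interior {x : E3 | 0 ≤ x 2}).Nonempty := by
    refine ⟨e3, interior_maximal (s := {x : E3 | 0 ≤ x 2}) (t := {x : E3 | 0 < x 2})
      (fun x (hx : 0 < x 2) => hx.le)
      (isOpen_lt continuous_const (EuclideanSpace.proj (𝕜 := ℝ) (2 : Fin 3)).continuous) ?_⟩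
    simp
  have h3 : halfSpaceEnd R = {x : E3 | 0 ≤ x 2} ∩ {x : E3 | R < ‖x‖} := rfl
  rw [h3]
  exact (uniqueDiffOn_convex h1 h2).inter (isOpen_lt continuous_const continuous_norm)

section

variable {F : Type*} [NormedAddCommGroup F] [NormedSpace ℝ F] {R : ℝ} {f g : E3 → F} {x : E3}

theorem pd_eq_fderiv (hx : x ∈ halfSpaceEnd R) (hf : DifferentiableAt ℝ f x) (i : Fin 3) :
    pd (halfSpaceEnd R) i f x = fderiv ℝ f x (EuclideanSpace.single i 1) := by
  rw [pd, hf.fderivWithin (uniqueDiffOn_halfSpaceEnd R x hx)]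

theorem pd_congr {X : Set E3} (hx : x ∈ X) (hfg : ∀ y ∈ X, f y = g y) (i : Fin 3) :
    pd X i f x = pd X i g x := by
  rw [pd, pd, fderivWithin_congr hfg (hfg x hx)]

end

theorem pd_const (X : Set E3) (i : Fin 3) (c : ℝ) (x : E3) : pd X i (fun _ => c) x = 0 := by
  simp [pd]

theorem chartMetric_euclidean (R : ℝ) (Φ : E3 → E3) (i j : Fin 3) (x : E3) :
    chartMetric euclideanMetric R Φ i j x =
      inner ℝ (pd (halfSpaceEnd R) i Φ x) (pd (halfSpaceEnd R) j Φ x) := by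
  simp only [chartMetric, euclideanMetric, Fin.sum_univ_three, PiLp.inner_apply]
  simp
  ring

theorem christoffel_euclidean (M : Set E3) (k i j : Fin 3) (x : E3) :
    christoffel M euclideanMetric k i j x = 0 := by
  simp [christoffel, euclideanMetric, pd_const]

theorem ricci_euclidean (M : Set E3) (x : E3) : ricci M euclideanMetric x = 0 := by
  have h : ∀ k i j, christoffel M euclideanMetric k i j = fun _ => 0 := fun k i j =>
    funext fun x => christoffel_euclidean M k i j x
  ext i j
  simp [ricci, h, pd_const]

theorem ricci_euclidean_lower_bound (M : Set E3) (x y v : E3) {c : ℝ} (hc : 0 ≤ c) :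
    -c * (‖x‖ ^ 2)⁻¹ * quadForm (euclideanMetric y) v ≤ quadForm (ricci M euclideanMetric y) v := by
  have h1 : quadForm (euclideanMetric y) v = ‖v‖ ^ 2 := quadForm_one v
  rw [ricci_euclidean, h1]
  have h2 : quadForm 0 v = 0 := by simp [quadForm]
  rw [h2, neg_mul, neg_mul]
  exact neg_nonpos.2 (by positivity)

section

variable {C : Set E3} {μ : E3 → E3} {A : E3 ≃ₗᵢ[ℝ] E3} {R R₁ R₂ : ℝ} {ψ : E2 → ℝ}

/-- The columns of the derivative are `e_i + ∂_i Ψ e₃` up to an isometry, where `Ψ` is the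
extension. -/
theorem IsChartRadius.chartMetric_eq (h : IsChartRadius ψ R₁) (hR₂ : R₁ ≤ R₂) (i j : Fin 3)
    {x : E3} (hx : x ∈ halfSpaceEnd R₂) :
    chartMetric euclideanMetric R₂ (graphChart A ψ) i j x =
      (if i = j then 1 else 0)
      + (if i = 2 then 1 else 0) * fderiv ℝ (extendPlane ψ) x (EuclideanSpace.single j 1)
      + (if j = 2 then 1 else 0) * fderiv ℝ (extendPlane ψ) x (EuclideanSpace.single i 1)
      + fderiv ℝ (extendPlane ψ) x (EuclideanSpace.single i 1)
        * fderiv ℝ (extendPlane ψ) x (EuclideanSpace.single j 1) := by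
  have hx1 : R₁ < ‖x‖ := hR₂.trans_lt hx.2
  have hd := (h.hasFDerivAt A hx1).differentiableAt
  rw [chartMetric_euclidean, pd_eq_fderiv hx hd, pd_eq_fderiv hx hd, h.fderiv_apply A hx1,
    h.fderiv_apply A hx1, A.inner_map_map]
  simp only [inner_add_left, inner_add_right, inner_smul_left, inner_smul_right, e3,
    EuclideanSpace.inner_single_left, PiLp.single_apply]
  fin_cases i <;> fin_cases j <;> simp <;> ring

theorem IsChartRadius.hasFDerivAt_partial (h : IsChartRadius ψ R₁) {x : E3} (hx : R₁ < ‖x‖)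
    (i : Fin 3) :
    HasFDerivAt (fun y => fderiv ℝ (extendPlane ψ) y (EuclideanSpace.single i 1))
      ((ContinuousLinearMap.apply ℝ ℝ (EuclideanSpace.single i (1 : ℝ))).comp
        (fderiv ℝ (fderiv ℝ (extendPlane ψ)) x)) x :=
  (ContinuousLinearMap.apply ℝ ℝ (EuclideanSpace.single i (1 : ℝ))).hasFDerivAt.comp x
    ((h.smooth x hx).of_le (by norm_cast)).hasFDerivAt_fderiv

theorem abs_clm_single_le (T : E3 →L[ℝ] ℝ) (i : Fin 3) : |T (EuclideanSpace.single i 1)| ≤ ‖T‖ := by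
  have := T.le_opNorm (EuclideanSpace.single i 1)
  simpa using this

theorem abs_clm_single_single_le (T : E3 →L[ℝ] E3 →L[ℝ] ℝ) (i j : Fin 3) :
    |T (EuclideanSpace.single i 1) (EuclideanSpace.single j 1)| ≤ ‖T‖ := by
  refine (abs_clm_single_le _ j).trans ?_
  have := T.le_opNorm (EuclideanSpace.single i 1)
  simpa using this

/-- The metric differs from the identity by linear and quadratic terms in `DΨ`. The constant
collects these and their derivatives, one factor of each quadratic term being bounded by `c / R₁`.
-/
theorem IsGraphEnd.exists_decay (hG : IsGraphEnd μ C A R ψ) (h : IsChartRadius ψ R₁)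
    (hRR₁ : 2 * R ≤ R₁) (hR₂ : R₁ ≤ R₂) :
    ∃ c : ℝ, 0 < c ∧ ∀ x ∈ halfSpaceEnd R₂, ∀ i j l,
      |chartMetric euclideanMetric R₂ (graphChart A ψ) i j x - if i = j then 1 else 0|
        + ‖x‖ * |pd (halfSpaceEnd R₂) l (chartMetric euclideanMetric R₂ (graphChart A ψ) i j) x|
        ≤ c * ‖x‖⁻¹ := by
  obtain ⟨c, hc⟩ := hG.exists_logBound_extendPlane
  have hR₁ := h.pos
  have hc0 : 0 ≤ c := by
    have h1 : ‖(R₁ + 1) • e3‖ = R₁ + 1 := by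
      rw [norm_smul, norm_e3, mul_one, Real.norm_of_nonneg (by linarith)]
    exact (hc ((R₁ + 1) • e3) (by linarith)).nonneg
  refine ⟨4 * c + 3 * c * (c / R₁) + 1, by positivity, fun x hx i j l => ?_⟩
  have hx1 : R₁ < ‖x‖ := hR₂.trans_lt hx.2
  have hx0 : 0 < ‖x‖ := hR₁.trans hx1
  have hb := hc x (by linarith)
  set d : Fin 3 → E3 → ℝ := fun i y => fderiv ℝ (extendPlane ψ) y (EuclideanSpace.single i 1)
  set H := fderiv ℝ (fderiv ℝ (extendPlane ψ)) x
  set a : ℝ := if i = 2 then 1 else 0 with ha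
  set b : ℝ := if j = 2 then 1 else 0 with hb'
  have ha1 : |a| ≤ 1 := by rw [ha]; split_ifs <;> simp
  have hb1 : |b| ≤ 1 := by rw [hb']; split_ifs <;> simp
  have hd : ∀ i, |d i x| ≤ c / ‖x‖ := fun i => by
    rw [le_div_iff₀ hx0, mul_comm]
    exact (mul_le_mul_of_nonneg_left (abs_clm_single_le _ i) hx0.le).trans hb.first
  have hH : ∀ i, |H (EuclideanSpace.single l 1) (EuclideanSpace.single i 1)| ≤ c / ‖x‖ ^ 2 :=
    fun i => by
      rw [le_div_iff₀ (by positivity), mul_comm]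
      exact (mul_le_mul_of_nonneg_left (abs_clm_single_single_le H l i) (by positivity)).trans
        hb.second
  have hcx : c / ‖x‖ ≤ c / R₁ := div_le_div_of_nonneg_left hc0 hR₁ hx1.le
  have hcx0 : 0 ≤ c / ‖x‖ := by positivity
  have hcx2 : 0 ≤ c / ‖x‖ ^ 2 := by positivity
  have hm : HasFDerivAt (fun y => (if i = j then (1 : ℝ) else 0) + a * d j y + b * d i y
      + d i y * d j y) _ x :=
    (((hasFDerivAt_const _ x).fun_add ((h.hasFDerivAt_partial hx1 j).const_mul a)).fun_add
      ((h.hasFDerivAt_partial hx1 i).const_mul b)).fun_add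
      ((h.hasFDerivAt_partial hx1 i).fun_mul (h.hasFDerivAt_partial hx1 j))
  have hpd : pd (halfSpaceEnd R₂) l (chartMetric euclideanMetric R₂ (graphChart A ψ) i j) x =
      a * H (EuclideanSpace.single l 1) (EuclideanSpace.single j 1)
      + b * H (EuclideanSpace.single l 1) (EuclideanSpace.single i 1)
      + (d i x * H (EuclideanSpace.single l 1) (EuclideanSpace.single j 1)
      + d j x * H (EuclideanSpace.single l 1) (EuclideanSpace.single i 1)) := by
    rw [pd_congr hx (fun y hy => h.chartMetric_eq hR₂ i j hy) l, pd_eq_fderiv hx hm.differentiableAt,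
      hm.fderiv]
    simp [d, H]
  rw [hpd, h.chartMetric_eq hR₂ i j hx]
  have e1 : |(if i = j then (1 : ℝ) else 0) + a * d j x + b * d i x + d i x * d j x
      - if i = j then 1 else 0| ≤ 2 * (c / ‖x‖) + c / ‖x‖ * (c / R₁) := by
    have : (if i = j then (1 : ℝ) else 0) + a * d j x + b * d i x + d i x * d j x
      - (if i = j then 1 else 0) = a * d j x + b * d i x + d i x * d j x := by ring
    rw [this]
    refine (abs_add_three _ _ _).trans ?_
    rw [abs_mul, abs_mul, abs_mul]
    have t1 : |a| * |d j x| ≤ 1 * (c / ‖x‖) := mul_le_mul ha1 (hd j) (abs_nonneg _) zero_le_one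
    have t2 : |b| * |d i x| ≤ 1 * (c / ‖x‖) := mul_le_mul hb1 (hd i) (abs_nonneg _) zero_le_one
    have t3 : |d i x| * |d j x| ≤ c / ‖x‖ * (c / R₁) :=
      mul_le_mul (hd i) ((hd j).trans hcx) (abs_nonneg _) hcx0
    linarith
  have e2 : |a * H (EuclideanSpace.single l 1) (EuclideanSpace.single j 1)
      + b * H (EuclideanSpace.single l 1) (EuclideanSpace.single i 1)
      + (d i x * H (EuclideanSpace.single l 1) (EuclideanSpace.single j 1)
      + d j x * H (EuclideanSpace.single l 1) (EuclideanSpace.single i 1))|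
      ≤ 2 * (c / ‖x‖ ^ 2) + 2 * (c / R₁ * (c / ‖x‖ ^ 2)) := by
    refine (abs_add_le _ _).trans ((add_le_add (abs_add_le _ _) (abs_add_le _ _)).trans ?_)
    rw [abs_mul, abs_mul, abs_mul, abs_mul]
    have t1 := mul_le_mul ha1 (hH j) (abs_nonneg _) zero_le_one
    have t2 := mul_le_mul hb1 (hH i) (abs_nonneg _) zero_le_one
    have t3 := mul_le_mul ((hd i).trans hcx) (hH j) (abs_nonneg _) (by positivity)
    have t4 := mul_le_mul ((hd j).trans hcx) (hH i) (abs_nonneg _) (by positivity)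
    linarith
  have e3 := mul_le_mul_of_nonneg_left e2 hx0.le
  have e4 : ‖x‖ * (2 * (c / ‖x‖ ^ 2) + 2 * (c / R₁ * (c / ‖x‖ ^ 2))) =
      2 * (c / ‖x‖) + 2 * (c / ‖x‖ * (c / R₁)) := by
    field_simp
  have e5 : (4 * c + 3 * c * (c / R₁) + 1) * ‖x‖⁻¹ =
      4 * (c / ‖x‖) + 3 * (c / ‖x‖ * (c / R₁)) + ‖x‖⁻¹ := by
    field_simp
  have e6 : 0 < ‖x‖⁻¹ := inv_pos.2 hx0
  linarith

theorem IsGraphEnd.isAFChart (hG : IsGraphEnd μ C A R ψ) (h : IsChartRadius ψ R₁)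
    (hRR₁ : 2 * R ≤ R₁) (hR₂ : 2 * R₁ ≤ R₂) (M : Set E3) :
    IsAFChart M euclideanMetric (graphChart A ψ '' halfSpaceEnd R₂) R₂ (graphChart A ψ) := by
  have hR₁ := h.pos
  have hsub := halfSpaceEnd_subset_thickEnd hR₂
  obtain ⟨-, Ξ, hΞ, hΞs⟩ := h.exists_inverse A
  obtain ⟨c, hc, hdec⟩ := hG.exists_decay (R₂ := R₂) h hRR₁ (by linarith)
  refine ⟨by linarith, ((h.injOn A).mono hsub).bijOn_image,
    (h.contDiffOn A).mono fun x hx => lt_norm_of_mem_thickEnd (hsub hx),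
    ⟨Ξ, ⟨fun x hx => hΞ x (hsub hx), ?_⟩, hΞs.mono (image_mono hsub)⟩,
    c, hc, fun x hx => ⟨hdec x hx, fun v => ricci_euclidean_lower_bound _ _ _ _ hc.le⟩⟩
  rintro _ ⟨x, hx, rfl⟩
  rw [hΞ x (hsub hx)]

end

/-- The components of a union of disjoint, connected and relatively open sets. -/
theorem connectedComponentIn_biUnion {𝒞 : Set (Set E3)} {E : Set E3 → Set E3} {X : Set E3}
    (hX : ∀ C ∈ 𝒞, E C ⊆ X) (hconn : ∀ C ∈ 𝒞, IsConnected (E C))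
    (hopen : ∀ C ∈ 𝒞, ∃ U, IsOpen U ∧ E C = X ∩ U)
    (hdisj : ∀ C ∈ 𝒞, ∀ D ∈ 𝒞, C ≠ D → Disjoint (E C) (E D)) {C : Set E3} (hC : C ∈ 𝒞) {x : E3}
    (hx : x ∈ E C) : connectedComponentIn (⋃ D ∈ 𝒞, E D) x = E C := by
  choose! U hU hEU using hopen
  have hxU : x ∈ ⋃ D ∈ 𝒞, E D := mem_biUnion hC hx
  refine Subset.antisymm ?_
    ((hconn C hC).isPreconnected.subset_connectedComponentIn hx (subset_biUnion_of_mem hC))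
  intro y hy
  by_contra hyC
  obtain ⟨D, hD, hyD⟩ := mem_iUnion₂.1 (connectedComponentIn_subset _ _ hy)
  have hDC : D ≠ C := fun h => hyC (h ▸ hyD)
  obtain ⟨z, hz, hzC, hzD⟩ := isPreconnected_connectedComponentIn (U C) (⋃ D ∈ 𝒞 \ {C}, U D) (hU C hC)
    (isOpen_biUnion fun D hD => hU D hD.1) (fun z hz => by
      obtain ⟨D, hD, hzD⟩ := mem_iUnion₂.1 (connectedComponentIn_subset _ _ hz)
      by_cases h : D = C
      · subst h
        rw [hEU D hD] at hzD
        exact Or.inl hzD.2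
      · rw [hEU D hD] at hzD
        exact Or.inr (mem_biUnion (⟨hD, h⟩ : D ∈ 𝒞 \ {C}) hzD.2))
    ⟨x, mem_connectedComponentIn hxU, by rw [hEU C hC] at hx; exact hx.2⟩
    ⟨y, hy, mem_biUnion (⟨hD, hDC⟩ : D ∈ 𝒞 \ {C}) (by rw [hEU D hD] at hyD; exact hyD.2)⟩
  obtain ⟨D', hD', hzD'⟩ := mem_iUnion₂.1 hzD
  have hzX : z ∈ X := by
    obtain ⟨D, hD, hzD⟩ := mem_iUnion₂.1 (connectedComponentIn_subset _ _ hz)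
    exact hX D hD hzD
  have hzE : z ∈ E C := by rw [hEU C hC]; exact ⟨hzX, hzC⟩
  have hzE' : z ∈ E D' := by rw [hEU D' hD'.1]; exact ⟨hzX, hzD'⟩
  exact Set.disjoint_left.1 (hdisj C hC D' hD'.1 fun h => hD'.2 h.symm) hzE hzE'

/-- A support surface whose ends border different ends of the region bounds an asymptotically flat
half-space. -/
theorem IsInnerSide.isAFHalfSpace {S W : Set E3} {μ : E3 → E3} (hW : IsInnerSide S μ W)
    (hS : IsAFSupportSurface S μ) (hsep : EndsAreSeparated S μ) :
    IsAFHalfSpace (regionOf S μ) euclideanMetric := by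
  refine ⟨hW.isSmoothDomain, ⟨fun i j => contDiffOn_const, fun x _ => Matrix.PosDef.one⟩,
    hW.isRiemComplete, by rw [hW.domainBoundary_eq]; exact hS.noncompact, ?_⟩
  obtain ⟨𝒞, A, R, ψ, ρ₀, hfin, hsys⟩ := exists_endSystem hW hS hsep
  obtain ⟨Z₀, hsys₀⟩ := hsys ρ₀ le_rfl
  have hrad : ∀ C ∈ 𝒞, ∃ R₁, 2 * R C ≤ R₁ ∧ IsChartRadius (ψ C) R₁ := fun C hC =>
    (hsys₀.upper C hC).graph.exists_chartRadius fun h hh =>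
      (hsys₀.upper C hC).graph.contDiffAt_top hW (hsys₀.upper C hC).subset hh
  choose! R₁ hRR₁ hR₁ using hrad
  obtain ⟨Rm, hRm⟩ := hfin.exists_upper_bound R₁
  -- The chart radii depend on the ends only, so the radius of the end system can be enlarged beyond
  -- all of them afterwards.
  obtain ⟨Z, h⟩ := hsys (max ρ₀ Rm) (le_max_left _ _)
  set ρ := max ρ₀ Rm
  have hZ : 0 ≤ Z := h.pos.le.trans h.lt.le
  have hend := fun C (hC : C ∈ 𝒞) => (h.upper C hC).exists_end hW (hR₁ C hC) (hRR₁ C hC)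
    ((hRm C hC).trans (le_max_right _ _)) hZ
  choose! R₂ ρ' hR₂ habove hlarge hnhds using hend
  let E : Set E3 → Set E3 := fun C => graphChart (A C) (ψ C) '' halfSpaceEnd (R₂ C)
  have hE : ∀ C ∈ 𝒞, E C ⊆ regionOf S μ := fun C hC =>
    (habove C hC).trans (h.aboveEnd_subset hW hC)
  have hopen : ∀ C ∈ 𝒞, ∃ U, IsOpen U ∧ E C = regionOf S μ ∩ U := by
    intro C hC
    refine ⟨interior (E C ∪ (regionOf S μ)ᶜ), isOpen_interior, Subset.antisymm ?_ ?_⟩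
    · refine fun y hy => ⟨hE C hC hy, mem_interior_iff_mem_nhds.2 ?_⟩
      filter_upwards [hnhds C hC y hy] with y' hy'
      by_cases hm : y' ∈ regionOf S μ
      · exact Or.inl (hy' hm)
      · exact Or.inr hm
    · rintro y ⟨hy, hyU⟩
      exact (interior_subset hyU).resolve_right fun hn => hn hy
  have hcompl : regionOf S μ \ (regionOf S μ \ ⋃ C ∈ 𝒞, E C) = ⋃ C ∈ 𝒞, E C := by
    rw [sdiff_sdiff_cancel_left]
    exact iUnion₂_subset hE
  refine ⟨regionOf S μ \ ⋃ C ∈ 𝒞, E C, ?_, sdiff_subset, ?_⟩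
  · obtain ⟨b, hb⟩ := hfin.exists_upper_bound ρ'
    refine Metric.isCompact_of_isClosed_isBounded ?_ ?_
    · choose! U hU hEU using hopen
      have : regionOf S μ \ ⋃ C ∈ 𝒞, E C = regionOf S μ ∩ (⋃ C ∈ 𝒞, U C)ᶜ := by
        ext y
        simp only [Set.mem_sdiff, mem_iUnion₂, Set.mem_inter_iff, Set.mem_compl_iff]
        refine and_congr_right fun hy => not_congr ⟨?_, ?_⟩
        · rintro ⟨C, hC, hyC⟩
          rw [hEU C hC] at hyC
          exact ⟨C, hC, hyC.2⟩
        · rintro ⟨C, hC, hyC⟩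
          exact ⟨C, hC, by rw [hEU C hC]; exact ⟨hy, hyC⟩⟩
      rw [this]
      exact hW.isClosed_region.inter (isOpen_biUnion hU).isClosed_compl
    · refine (Metric.isBounded_closedBall (x := (0 : E3)) (r := max (ρ + Z) b)).subset ?_
      rintro y ⟨hy, hyE⟩
      rw [mem_closedBall_zero_iff]
      -- A point of the region far out lies above one of the finitely many ends, and beyond the
      -- radius `ρ'` of that end it is in the image of the chart.
      by_contra! hlt
      obtain ⟨D, hD, hyD⟩ := h.exists_mem_aboveEnd hW hy ((le_max_left _ _).trans_lt hlt)
      exact hyE (mem_biUnion hD (hlarge D hD y hyD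
        ((hb D hD).trans_lt ((le_max_right _ _).trans_lt hlt))))
  · rintro _ ⟨x, hx, rfl⟩
    rw [hcompl] at hx ⊢
    obtain ⟨C, hC, hxC⟩ := mem_iUnion₂.1 hx
    have hR₂0 : ∀ D ∈ 𝒞, 0 < R₂ D := fun D hD => by linarith [hR₂ D hD, (hR₁ D hD).pos]
    have hconn : ∀ D ∈ 𝒞, IsConnected (E D) := fun D hD =>
      (isConnected_halfSpaceEnd (hR₂0 D hD)).image _ (((hR₁ D hD).contDiffOn (A D)).continuousOn.mono
        fun x hx => lt_norm_of_mem_thickEnd (halfSpaceEnd_subset_thickEnd (hR₂ D hD) hx))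
    rw [connectedComponentIn_biUnion hE hconn hopen (fun C hC D hD hCD =>
      (h.disjoint_aboveEnd hW.disjoint hC hD hCD).mono (habove C hC) (habove D hD)) hC hxC]
    exact ⟨R₂ C, graphChart (A C) (ψ C), (h.upper C hC).graph.isAFChart (hR₁ C hC) (hRR₁ C hC)
      (hR₂ C hC) _⟩

/-! ### Calculus on the half-space -/

theorem subset_interior_halfSpaceEnd (R : ℝ) :
    {x : E3 | 0 < x 2 ∧ R < ‖x‖} ⊆ interior (halfSpaceEnd R) := by
  refine interior_maximal (fun x hx => ⟨hx.1.le, hx.2⟩) ?_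
  exact (isOpen_lt continuous_const (EuclideanSpace.proj (𝕜 := ℝ) (2 : Fin 3)).continuous).inter
    (isOpen_lt continuous_const continuous_norm)

theorem norm_sq_add_le_norm_add_smul_e3 {x : E3} (hx : 0 ≤ x 2) {t : ℝ} (ht : 0 ≤ t) :
    ‖x‖ ^ 2 + t ^ 2 ≤ ‖x + t • e3‖ ^ 2 := by
  rw [E3.norm_sq, E3.norm_sq]
  simp
  nlinarith [mul_nonneg hx ht]

theorem norm_le_norm_add_smul_e3 {x : E3} (hx : 0 ≤ x 2) {t : ℝ} (ht : 0 ≤ t) :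
    ‖x‖ ≤ ‖x + t • e3‖ :=
  (sq_le_sq₀ (norm_nonneg _) (norm_nonneg _)).1 (le_trans (le_add_of_nonneg_right (sq_nonneg t))
    (norm_sq_add_le_norm_add_smul_e3 hx ht))

theorem add_smul_e3_mem {R : ℝ} {x : E3} (hx : x ∈ halfSpaceEnd R) {t : ℝ} (ht : 0 ≤ t) :
    x + t • e3 ∈ halfSpaceEnd R := by
  refine ⟨?_, hx.2.trans_le (norm_le_norm_add_smul_e3 hx.1 ht)⟩
  have := hx.1
  simp
  linarith

theorem tendsto_add_smul_e3 (x : E3) : Tendsto (fun t : ℝ => x + t • e3) (𝓝 0) (𝓝 x) := by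
  have h : Continuous fun t : ℝ => x + t • e3 := by fun_prop
  simpa using h.tendsto 0

theorem halfSpaceEnd_subset_closure_interior (R : ℝ) :
    halfSpaceEnd R ⊆ closure (interior (halfSpaceEnd R)) := by
  intro x hx
  refine mem_closure_of_tendsto ((tendsto_add_smul_e3 x).mono_left
    (nhdsWithin_le_nhds (s := Ioi (0 : ℝ)))) ?_
  filter_upwards [self_mem_nhdsWithin] with t ht
  refine subset_interior_halfSpaceEnd R ⟨?_, (add_smul_e3_mem hx (le_of_lt ht)).2⟩
  have h1 := hx.1
  have h2 : 0 < t := ht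
  simp
  linarith

section

variable {F : Type*} [NormedAddCommGroup F] [NormedSpace ℝ F] {R : ℝ} {f g : E3 → F} {x : E3}

theorem pd_contDiffOn (hf : ContDiffOn ℝ ∞ f (halfSpaceEnd R)) (i : Fin 3) :
    ContDiffOn ℝ ∞ (pd (halfSpaceEnd R) i f) (halfSpaceEnd R) :=
  (hf.fderivWithin (uniqueDiffOn_halfSpaceEnd R) (by norm_cast)).clm_apply contDiffOn_const

/-- Symmetry of second derivatives persists at the boundary, as the half-space is in the closure of
its interior. -/
theorem pd_comm (hf : ContDiffOn ℝ ∞ f (halfSpaceEnd R)) (hx : x ∈ halfSpaceEnd R) (i j : Fin 3) :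
    pd (halfSpaceEnd R) i (pd (halfSpaceEnd R) j f) x =
      pd (halfSpaceEnd R) j (pd (halfSpaceEnd R) i f) x := by
  have hu := uniqueDiffOn_halfSpaceEnd R
  have hd : DifferentiableWithinAt ℝ (fderivWithin ℝ f (halfSpaceEnd R)) (halfSpaceEnd R) x :=
    ((hf.fderivWithin hu (m := 1) (by norm_cast)).differentiableOn (by simp)) x hx
  have h : ∀ i j, pd (halfSpaceEnd R) i (pd (halfSpaceEnd R) j f) x =
      fderivWithin ℝ (fderivWithin ℝ f (halfSpaceEnd R)) (halfSpaceEnd R) x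
        (EuclideanSpace.single i 1) (EuclideanSpace.single j 1) := by
    intro i j
    have h1 : pd (halfSpaceEnd R) j f = fun y => fderivWithin ℝ f (halfSpaceEnd R) y
      (EuclideanSpace.single j 1) := rfl
    rw [h1, pd, (hd.hasFDerivWithinAt.clm_apply
      (hasFDerivWithinAt_const (EuclideanSpace.single j (1 : ℝ)) x _)).fderivWithin (hu x hx)]
    simp
  rw [h, h]
  exact (hf x hx).isSymmSndFDerivWithinAt (by simp; norm_cast) hu
    (halfSpaceEnd_subset_closure_interior R hx) hx _ _

theorem pd_sub (hx : x ∈ halfSpaceEnd R) (hf : DifferentiableWithinAt ℝ f (halfSpaceEnd R) x)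
    (hg : DifferentiableWithinAt ℝ g (halfSpaceEnd R) x) (i : Fin 3) :
    pd (halfSpaceEnd R) i (fun y => f y - g y) x =
      pd (halfSpaceEnd R) i f x - pd (halfSpaceEnd R) i g x := by
  rw [pd, fderivWithin_fun_sub (uniqueDiffOn_halfSpaceEnd R x hx) hf hg]; rfl

theorem pd_clm {G : Type*} [NormedAddCommGroup G] [NormedSpace ℝ G] (L : F →L[ℝ] G)
    (hx : x ∈ halfSpaceEnd R) (hf : DifferentiableWithinAt ℝ f (halfSpaceEnd R) x) (i : Fin 3) :
    pd (halfSpaceEnd R) i (fun y => L (f y)) x = L (pd (halfSpaceEnd R) i f x) := by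
  have h := (L.hasFDerivAt.comp_hasFDerivWithinAt x hf.hasFDerivWithinAt).fderivWithin
    (uniqueDiffOn_halfSpaceEnd R x hx)
  have h' : fderivWithin ℝ (fun y => L (f y)) (halfSpaceEnd R) x =
    L.comp (fderivWithin ℝ f (halfSpaceEnd R) x) := h
  rw [pd, h']; rfl

theorem pd_coord {f : E3 → E3} (hx : x ∈ halfSpaceEnd R)
    (hf : DifferentiableWithinAt ℝ f (halfSpaceEnd R) x) (i k : Fin 3) :
    pd (halfSpaceEnd R) i (fun y => f y k) x = pd (halfSpaceEnd R) i f x k :=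
  pd_clm (EuclideanSpace.proj (𝕜 := ℝ) k) hx hf i

theorem pd_inner {f g : E3 → E3} (hx : x ∈ halfSpaceEnd R)
    (hf : DifferentiableWithinAt ℝ f (halfSpaceEnd R) x)
    (hg : DifferentiableWithinAt ℝ g (halfSpaceEnd R) x) (i : Fin 3) :
    pd (halfSpaceEnd R) i (fun y => inner ℝ (f y) (g y)) x =
      inner ℝ (pd (halfSpaceEnd R) i f x) (g x) + inner ℝ (f x) (pd (halfSpaceEnd R) i g x) := by
  rw [pd, (hf.hasFDerivWithinAt.inner ℝ hg.hasFDerivWithinAt).fderivWithin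
    (uniqueDiffOn_halfSpaceEnd R x hx)]
  simp [fderivInnerCLM_apply, pd]
  ring

theorem fderivWithin_apply_eq_sum (X : Set E3) (f : E3 → F) (x v : E3) :
    fderivWithin ℝ f X x v = ∑ i, v i • pd X i f x := by
  have hv : v = ∑ i, v i • EuclideanSpace.single i (1 : ℝ) := by
    ext j
    simp [Fin.sum_univ_three]
    fin_cases j <;> simp
  conv_lhs => rw [hv]
  simp [map_sum, pd]

theorem norm_fderivWithin_le {X : Set E3} {f : E3 → F} {x : E3} {b : ℝ}
    (hb : ∀ i, ‖pd X i f x‖ ≤ b) : ‖fderivWithin ℝ f X x‖ ≤ 3 * b := by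
  have hb0 : 0 ≤ b := (norm_nonneg _).trans (hb 0)
  refine ContinuousLinearMap.opNorm_le_bound _ (by positivity) fun v => ?_
  rw [fderivWithin_apply_eq_sum]
  refine (norm_sum_le _ _).trans ?_
  have h : ∀ i ∈ Finset.univ, ‖v i • pd X i f x‖ ≤ ‖v‖ * b := fun i _ => by
    rw [norm_smul]
    exact mul_le_mul (abs_coord_le v i) (hb i) (norm_nonneg _) (norm_nonneg _)
  refine (Finset.sum_le_sum h).trans (le_of_eq ?_)
  simp
  ring

end

/-! ### Nearly Euclidean metrics -/

/-- Such vectors form a basis. Writing `w = ∑ a_j G_j` gives `|w|² = ∑ a_j ⟨w, G_j⟩ ≤ 3 |a| δ`, and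
the Gram matrix bounds `|a|` by `2 |w|`. -/
theorem norm_le_of_nearly_orthonormal {G : Fin 3 → E3} {ε δ : ℝ} (hε : ε ≤ 1 / 6)
    (hG : ∀ i j, |inner ℝ (G i) (G j) - if i = j then 1 else 0| ≤ ε) {w : E3}
    (hw : ∀ j, |inner ℝ w (G j)| ≤ δ) : ‖w‖ ≤ 6 * δ := by
  let L : E3 →ₗ[ℝ] E3 :=
    { toFun := fun a => a 0 • G 0 + a 1 • G 1 + a 2 • G 2
      map_add' := fun a b => by simp [add_smul]; abel
      map_smul' := fun c a => by simp [mul_smul] }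
  have hδ : 0 ≤ δ := (abs_nonneg _).trans (hw 0)
  -- The diagonal Gram entries are at least `5/6`, and the off-diagonal ones, of size at most `1/6`,
  -- cost at most a third of `|a|²`; one half remains.
  have hlow : ∀ a, ‖a‖ ^ 2 ≤ 2 * ‖L a‖ ^ 2 := by
    intro a
    have h1 : ‖L a‖ ^ 2 = a 0 ^ 2 * inner ℝ (G 0) (G 0) + a 1 ^ 2 * inner ℝ (G 1) (G 1)
        + a 2 ^ 2 * inner ℝ (G 2) (G 2) + 2 * (a 0 * a 1) * inner ℝ (G 0) (G 1)
        + 2 * (a 0 * a 2) * inner ℝ (G 0) (G 2) + 2 * (a 1 * a 2) * inner ℝ (G 1) (G 2) := by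
      rw [← real_inner_self_eq_norm_sq]
      simp only [L, LinearMap.coe_mk, AddHom.coe_mk, inner_add_left, inner_add_right,
        inner_smul_left, inner_smul_right]
      rw [real_inner_comm (G 0) (G 1), real_inner_comm (G 0) (G 2), real_inner_comm (G 1) (G 2)]
      simp
      ring
    have hd : ∀ i, 5 / 6 ≤ inner ℝ (G i) (G i) := fun i => by
      have := (abs_le.1 (hG i i)).1
      simp only [if_true] at this
      linarith
    have ho : ∀ i j, i ≠ j → ∀ s : ℝ, -(|s| / 6) ≤ s * inner ℝ (G i) (G j) := fun i j hij s => by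
      have h2 := hG i j
      rw [if_neg hij, sub_zero] at h2
      have h3 : |s * inner ℝ (G i) (G j)| ≤ |s| * (1 / 6) := by
        rw [abs_mul]
        exact mul_le_mul_of_nonneg_left (h2.trans hε) (abs_nonneg s)
      linarith [neg_abs_le (s * inner ℝ (G i) (G j))]
    have h01 := ho 0 1 (by decide) (2 * (a 0 * a 1))
    have h02 := ho 0 2 (by decide) (2 * (a 0 * a 2))
    have h12 := ho 1 2 (by decide) (2 * (a 1 * a 2))
    have hab : ∀ s t : ℝ, |2 * (s * t)| ≤ s ^ 2 + t ^ 2 := fun s t => by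
      rw [abs_le]; constructor <;> nlinarith [sq_nonneg (s - t), sq_nonneg (s + t)]
    have := hab (a 0) (a 1)
    have := hab (a 0) (a 2)
    have := hab (a 1) (a 2)
    have := mul_le_mul_of_nonneg_left (hd 0) (sq_nonneg (a 0))
    have := mul_le_mul_of_nonneg_left (hd 1) (sq_nonneg (a 1))
    have := mul_le_mul_of_nonneg_left (hd 2) (sq_nonneg (a 2))
    rw [h1, E3.norm_sq]
    linarith
  have hinj : Function.Injective L := (injective_iff_map_eq_zero L).2 fun a ha => by
    have := hlow a
    rw [ha] at this
    have h0 : ‖a‖ ^ 2 ≤ 0 := by simpa using this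
    exact norm_eq_zero.1 (pow_eq_zero_iff two_ne_zero |>.1 (le_antisymm h0 (by positivity)))
  obtain ⟨a, rfl⟩ := (LinearMap.injective_iff_surjective.1 hinj) w
  have h1 : ‖L a‖ ^ 2 ≤ 3 * ‖a‖ * δ := by
    have h2 : ‖L a‖ ^ 2 = a 0 * inner ℝ (L a) (G 0) + a 1 * inner ℝ (L a) (G 1)
        + a 2 * inner ℝ (L a) (G 2) := by
      rw [← real_inner_self_eq_norm_sq]
      conv_lhs => rw [show L a = a 0 • G 0 + a 1 • G 1 + a 2 • G 2 from rfl]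
      rw [inner_add_right, inner_add_right, inner_smul_right, inner_smul_right, inner_smul_right]
      rfl
    have h3 : ∀ j, a j * inner ℝ (L a) (G j) ≤ ‖a‖ * δ := fun j => by
      refine (le_abs_self _).trans ?_
      rw [abs_mul]
      exact mul_le_mul (abs_coord_le a j) (hw j) (abs_nonneg _) (norm_nonneg _)
    linarith [h3 0, h3 1, h3 2]
  have h2 : ‖a‖ ≤ 2 * ‖L a‖ :=
    (sq_le_sq₀ (norm_nonneg _) (by positivity)).1 (by nlinarith [hlow a, sq_nonneg ‖L a‖])
  rcases (norm_nonneg (L a)).eq_or_lt with h0 | h0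
  · rw [← h0]; positivity
  · have h4 : ‖L a‖ * ‖L a‖ ≤ (6 * δ) * ‖L a‖ := by nlinarith
    exact le_of_mul_le_mul_right h4 h0

/-- The coefficients of the metric which is induced by `Φ` decay. -/
structure IsDecaying (R : ℝ) (Φ : E3 → E3) (c : ℝ) : Prop where
  pos : 0 < R
  smooth : ContDiffOn ℝ ∞ Φ (halfSpaceEnd R)
  metric : ∀ x ∈ halfSpaceEnd R, ∀ i j,
    |inner ℝ (pd (halfSpaceEnd R) i Φ x) (pd (halfSpaceEnd R) j Φ x) - if i = j then 1 else 0|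
      ≤ c / ‖x‖
  deriv : ∀ x ∈ halfSpaceEnd R, ∀ i j l,
    |pd (halfSpaceEnd R) l (fun y =>
      inner ℝ (pd (halfSpaceEnd R) i Φ y) (pd (halfSpaceEnd R) j Φ y)) x| ≤ c / ‖x‖ ^ 2

theorem IsAFChart.exists_isDecaying {M Mhat : Set E3} {R : ℝ} {Φ : E3 → E3}
    (h : IsAFChart M euclideanMetric Mhat R Φ) : ∃ c, 0 < c ∧ IsDecaying R Φ c := by
  obtain ⟨c, hc, hdec⟩ := h.decay
  refine ⟨c, hc, h.pos, h.smooth, fun x hx i j => ?_, fun x hx i j l => ?_⟩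
  · have h1 := (hdec x hx).1 i j 0
    rw [chartMetric_euclidean] at h1
    rw [div_eq_mul_inv]
    exact le_trans (le_add_of_nonneg_right (by positivity)) h1
  · have h1 := (hdec x hx).1 i j l
    have h2 : chartMetric euclideanMetric R Φ i j = fun y =>
      inner ℝ (pd (halfSpaceEnd R) i Φ y) (pd (halfSpaceEnd R) j Φ y) :=
      funext fun y => chartMetric_euclidean R Φ i j y
    rw [h2] at h1
    have hx0 : 0 < ‖x‖ := h.pos.trans hx.2
    have h3 := le_trans (le_add_of_nonneg_left (abs_nonneg _)) h1
    rw [le_div_iff₀ (by positivity)]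
    have h4 := mul_le_mul_of_nonneg_left h3 hx0.le
    rw [mul_comm c, mul_inv_cancel_left₀ hx0.ne'] at h4
    linarith

/-- Koszul's formula. -/
theorem IsDecaying.norm_pd_pd_le {R c : ℝ} {Φ : E3 → E3} (h : IsDecaying R Φ c) {x : E3}
    (hx : x ∈ halfSpaceEnd R) (hxc : 6 * c ≤ ‖x‖) (l i : Fin 3) :
    ‖pd (halfSpaceEnd R) l (pd (halfSpaceEnd R) i Φ) x‖ ≤ 9 * (c / ‖x‖ ^ 2) := by
  have hx0 : 0 < ‖x‖ := h.pos.trans hx.2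
  have hd : ∀ i, DifferentiableWithinAt ℝ (pd (halfSpaceEnd R) i Φ) (halfSpaceEnd R) x := fun i =>
    (pd_contDiffOn h.smooth i).differentiableOn (by simp) x hx
  have hε : c / ‖x‖ ≤ 1 / 6 := by
    rw [div_le_iff₀ hx0]; linarith
  -- `⟨∂_l ∂_i Φ, ∂_j Φ⟩ = (∂_l g_ij + ∂_i g_lj - ∂_j g_il) / 2`.
  have key : ∀ j, |inner ℝ (pd (halfSpaceEnd R) l (pd (halfSpaceEnd R) i Φ) x)
      (pd (halfSpaceEnd R) j Φ x)| ≤ 3 / 2 * (c / ‖x‖ ^ 2) := by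
    intro j
    have h1 := h.deriv x hx i j l
    have h2 := h.deriv x hx l j i
    have h3 := h.deriv x hx i l j
    rw [pd_inner hx (hd _) (hd _)] at h1 h2 h3
    rw [pd_comm h.smooth hx i l] at h2
    rw [pd_comm h.smooth hx j i, pd_comm h.smooth hx j l,
      real_inner_comm (pd (halfSpaceEnd R) l Φ x)] at h3
    rw [abs_le] at *
    constructor <;> linarith [h1.1, h1.2, h2.1, h2.2, h3.1, h3.2]
  have := norm_le_of_nearly_orthonormal hε (h.metric x hx) key
  linarith

/-! ### The limit of a chart at infinity -/

section

variable {F : Type*} [NormedAddCommGroup F] [NormedSpace ℝ F] {G : E3 → F} {R ρ b : ℝ}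

/-- At height `s` above `x` the derivative is at most `b / (|x|² + s²)`, whose integral is `(b /
|x|) arctan (s / |x|)`. -/
theorem norm_sub_le_of_vertical (hR : 0 < R) (hG : DifferentiableOn ℝ G (halfSpaceEnd R))
    (hb : ∀ y ∈ halfSpaceEnd R, ρ ≤ ‖y‖ → ‖fderivWithin ℝ G (halfSpaceEnd R) y‖ ≤ b / ‖y‖ ^ 2)
    {x : E3} (hx : x ∈ halfSpaceEnd R) (hxρ : ρ ≤ ‖x‖) {t : ℝ} (ht : 0 ≤ t) :
    ‖G (x + t • e3) - G x‖ ≤ 2 * (b / ‖x‖) := by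
  have hx0 : 0 < ‖x‖ := hR.trans hx.2
  have hmem : ∀ s ∈ Ici (0 : ℝ), x + s • e3 ∈ halfSpaceEnd R := fun s hs => add_smul_e3_mem hx hs
  have hder : ∀ s ∈ Ici (0 : ℝ), HasDerivWithinAt (fun s => G (x + s • e3) - G x)
      (fderivWithin ℝ G (halfSpaceEnd R) (x + s • e3) e3) (Ici 0) s := by
    intro s hs
    have h1 : HasDerivWithinAt (fun s : ℝ => x + s • e3) e3 (Ici 0) s := by
      simpa using (((hasDerivAt_id s).smul_const e3).const_add x).hasDerivWithinAt
    exact ((hG _ (hmem s hs)).hasFDerivWithinAt.comp_hasDerivWithinAt s h1 hmem).sub_const _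
  have hb0 : 0 ≤ b := by
    have := (norm_nonneg _).trans (hb x hx hxρ)
    rwa [le_div_iff₀ (by positivity), zero_mul] at this
  have hB : ∀ s, HasDerivAt (fun s => b / ‖x‖ * Real.arctan (s / ‖x‖))
      (b / ‖x‖ * (1 / (1 + (s / ‖x‖) ^ 2) * (1 / ‖x‖))) s := fun s =>
    (((hasDerivAt_id s).div_const ‖x‖).arctan).const_mul _
  have key := image_norm_le_of_norm_deriv_right_le_deriv_boundary
    (f := fun s => G (x + s • e3) - G x) (a := 0) (b := t)
    (fun s hs => ((hder s hs.1).continuousWithinAt).mono Icc_subset_Ici_self)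
    (fun s hs => (hder s hs.1).mono (Ici_subset_Ici.2 hs.1)) (by simp) hB (fun s hs => ?_)
    (x := t) ⟨ht, le_rfl⟩
  · refine key.trans ?_
    have h1 : Real.arctan (t / ‖x‖) ≤ 2 := by
      have := Real.arctan_lt_pi_div_two (t / ‖x‖)
      have := Real.pi_le_four
      linarith
    have h2 := mul_le_mul_of_nonneg_left h1 (show 0 ≤ b / ‖x‖ by positivity)
    linarith
  · have h1 := (ContinuousLinearMap.le_opNorm (fderivWithin ℝ G (halfSpaceEnd R) (x + s • e3)) e3)
    rw [norm_e3, mul_one] at h1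
    refine h1.trans ((hb _ (hmem s hs.1) (hxρ.trans (norm_le_norm_add_smul_e3 hx.1 hs.1))).trans ?_)
    have h2 := norm_sq_add_le_norm_add_smul_e3 hx.1 hs.1
    have h3 : b / ‖x‖ * (1 / (1 + (s / ‖x‖) ^ 2) * (1 / ‖x‖)) = b / (‖x‖ ^ 2 + s ^ 2) := by
      field_simp
    rw [h3]
    exact div_le_div_of_nonneg_left hb0 (by positivity) h2

theorem norm_sub_le_of_segment (hG : DifferentiableOn ℝ G (halfSpaceEnd R)) {k : ℝ} {x y : E3}
    (hseg : segment ℝ x y ⊆ halfSpaceEnd R)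
    (hk : ∀ z ∈ segment ℝ x y, ‖fderivWithin ℝ G (halfSpaceEnd R) z‖ ≤ k) :
    ‖G y - G x‖ ≤ k * ‖y - x‖ :=
  (convex_segment x y).norm_image_sub_le_of_norm_hasFDerivWithin_le
    (fun z hz => ((hG z (hseg hz)).hasFDerivWithinAt).mono hseg) hk (left_mem_segment ℝ x y)
    (right_mem_segment ℝ x y)

theorem le_norm_of_mem_segment {x : E3} (hx : 0 ≤ x 2) {T : ℝ} {z : E3}
    (hz : z ∈ segment ℝ (T • e3) (x + T • e3)) : T ≤ z 2 ∧ T ≤ ‖z‖ := by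
  obtain ⟨s, t, hs, ht, hst, rfl⟩ := hz
  have h1 : T ≤ (s • T • e3 + t • (x + T • e3)) 2 := by
    have h2 : (s • T • e3 + t • (x + T • e3)) 2 = (s + t) * T + t * x 2 := by simp; ring
    rw [h2, hst, one_mul]
    exact le_add_of_nonneg_right (mul_nonneg ht hx)
  exact ⟨h1, h1.trans ((le_abs_self _).trans (abs_coord_le _ 2))⟩

theorem norm_sub_le_of_segment_e3 (hR : 0 < R) (hG : DifferentiableOn ℝ G (halfSpaceEnd R))
    {k T : ℝ} {x : E3} (hx : 0 ≤ x 2) (hT : R < T)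
    (hk : ∀ z ∈ halfSpaceEnd R, T ≤ ‖z‖ → ‖fderivWithin ℝ G (halfSpaceEnd R) z‖ ≤ k) :
    ‖G (x + T • e3) - G (T • e3)‖ ≤ k * ‖x‖ := by
  have hmem : ∀ z ∈ segment ℝ (T • e3) (x + T • e3), z ∈ halfSpaceEnd R := fun z hz =>
    ⟨by linarith [(le_norm_of_mem_segment hx hz).1], hT.trans_le (le_norm_of_mem_segment hx hz).2⟩
  have := norm_sub_le_of_segment hG hmem fun z hz => hk z (hmem z hz) (le_norm_of_mem_segment hx hz).2
  rwa [add_sub_cancel_right] at this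

theorem smul_e3_mem (hR : 0 < R) {T : ℝ} (hT : R < T) : T • e3 ∈ halfSpaceEnd R := by
  have h0 : 0 < T := hR.trans hT
  refine ⟨by simp [h0.le], ?_⟩
  rwa [norm_smul, norm_e3, mul_one, Real.norm_of_nonneg h0.le]

/-- A function with derivative `O(|x|⁻²)` has a limit at infinity. -/
theorem exists_limit_of_decay [CompleteSpace F] (hR : 0 < R)
    (hG : DifferentiableOn ℝ G (halfSpaceEnd R))
    (hb : ∀ y ∈ halfSpaceEnd R, ρ ≤ ‖y‖ → ‖fderivWithin ℝ G (halfSpaceEnd R) y‖ ≤ b / ‖y‖ ^ 2) :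
    ∃ O : F, ∀ x ∈ halfSpaceEnd R, ρ ≤ ‖x‖ → ‖G x - O‖ ≤ 2 * (b / ‖x‖) := by
  set N := max R ρ + 1
  have hNR : R < N := by simp only [N]; linarith [le_max_left R ρ]
  have hNρ : ρ ≤ N := by simp only [N]; linarith [le_max_right R ρ]
  have hN0 : 0 < N := hR.trans hNR
  have hNn : ∀ n : ℕ, N ≤ N + n := fun n => le_add_of_nonneg_right (Nat.cast_nonneg n)
  let T : ℕ → ℝ := fun n => N + n
  have hT : ∀ n, 0 < T n := fun n => hN0.trans_le (hNn n)
  have hTn : ∀ n, ‖T n • e3‖ = T n := fun n => by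
    rw [norm_smul, norm_e3, mul_one, Real.norm_of_nonneg (hT n).le]
  have hTmem : ∀ n, T n • e3 ∈ halfSpaceEnd R := fun n => smul_e3_mem hR (hNR.trans_le (hNn n))
  have hTlim : Tendsto T atTop atTop :=
    tendsto_atTop_add_const_left _ _ tendsto_natCast_atTop_atTop
  have hcauchy : CauchySeq fun n => G (T n • e3) := by
    refine cauchySeq_of_le_tendsto_0' (fun n => 2 * (b / T n)) (fun n m hnm => ?_) ?_
    · have h1 := norm_sub_le_of_vertical hR hG hb (hTmem n) (by rw [hTn]; exact hNρ.trans (hNn n))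
        (t := T m - T n) (by simp only [T]; simpa using hnm)
      rw [← add_smul, add_sub_cancel, hTn] at h1
      rw [dist_comm, dist_eq_norm]
      exact h1
    · have := (tendsto_const_nhds (x := b)).div_atTop hTlim
      simpa using this.const_mul 2
  obtain ⟨O, hO⟩ := cauchySeq_tendsto_of_complete hcauchy
  refine ⟨O, fun x hx hxρ => ?_⟩
  -- The path rises from `x` to `x + T n e₃` and then crosses to the axis. The second piece has
  -- length `|x|` at distance at least `T n`, so it contributes nothing in the limit.
  have hbound : ∀ n, ‖G x - G (T n • e3)‖ ≤ 2 * (b / ‖x‖) + b / T n ^ 2 * ‖x‖ := by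
    intro n
    have h1 := norm_sub_le_of_vertical hR hG hb hx hxρ (hT n).le
    have hb0 : 0 ≤ b := by
      have := (norm_nonneg _).trans (hb x hx hxρ)
      have hx0 := hR.trans hx.2
      rwa [le_div_iff₀ (by positivity), zero_mul] at this
    have h2 := norm_sub_le_of_segment_e3 hR hG hx.1 (hNR.trans_le (hNn n))
      (k := b / T n ^ 2) (fun z hz hzT => (hb z hz (hNρ.trans ((hNn n).trans hzT))).trans
        (div_le_div_of_nonneg_left hb0 (pow_pos (hT n) 2) (pow_le_pow_left₀ (hT n).le hzT 2)))
    calc ‖G x - G (T n • e3)‖ ≤ ‖G x - G (x + T n • e3)‖ + ‖G (x + T n • e3) - G (T n • e3)‖ :=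
          norm_sub_le_norm_sub_add_norm_sub _ _ _
      _ ≤ _ := add_le_add (by rw [norm_sub_rev]; exact h1) h2
  have hlim : Tendsto (fun n => 2 * (b / ‖x‖) + b / T n ^ 2 * ‖x‖) atTop (𝓝 (2 * (b / ‖x‖))) := by
    have h1 : Tendsto (fun n => T n ^ 2) atTop atTop := (tendsto_pow_atTop two_ne_zero).comp hTlim
    have := ((tendsto_const_nhds (x := b)).div_atTop h1).mul_const ‖x‖
    simpa using this.const_add (2 * (b / ‖x‖))
  exact le_of_tendsto_of_tendsto ((tendsto_const_nhds.sub hO).norm) hlim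
    (Eventually.of_forall hbound)

end

/-! ### A Euclidean chart is asymptotic to a linear isometry in first derivatives -/

section

variable {R c : ℝ} {Φ : E3 → E3}

/-- The metric coefficients bound the first derivatives. The path goes up first, so as to avoid the
removed ball. The estimate ensures that points with far images are themselves far out. -/
theorem IsDecaying.exists_growth (h : IsDecaying R Φ c) (hc : 0 < c) :
    ∃ K L, 0 ≤ L ∧ ∀ x ∈ halfSpaceEnd R, ‖Φ x‖ ≤ K + L * ‖x‖ := by
  have hR := h.pos
  have hd : DifferentiableOn ℝ Φ (halfSpaceEnd R) := h.smooth.differentiableOn (by simp)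
  set k := 3 * (1 + c / R)
  have hk0 : 0 ≤ k := by positivity
  have hk : ∀ x ∈ halfSpaceEnd R, ‖fderivWithin ℝ Φ (halfSpaceEnd R) x‖ ≤ k := by
    intro x hx
    refine norm_fderivWithin_le fun i => ?_
    have h1 := (abs_le.1 (h.metric x hx i i)).2
    rw [if_pos rfl, real_inner_self_eq_norm_sq] at h1
    have h2 : c / ‖x‖ ≤ c / R := div_le_div_of_nonneg_left hc.le hR hx.2.le
    have h3 : 0 ≤ c / R := by positivity
    nlinarith [norm_nonneg (pd (halfSpaceEnd R) i Φ x)]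
  set T := R + 1
  refine ⟨‖Φ (T • e3)‖ + k * T, k, hk0, fun x hx => ?_⟩
  have hT0 : 0 < T := by simp only [T]; linarith
  have h1 : ‖Φ (x + T • e3) - Φ x‖ ≤ k * T := by
    have hseg : segment ℝ x (x + T • e3) ⊆ halfSpaceEnd R := by
      rintro _ ⟨s, t, hs, ht, hst, rfl⟩
      have : s • x + t • (x + T • e3) = x + (t * T) • e3 := by
        rw [smul_add, ← add_assoc, ← add_smul, hst, one_smul, smul_smul]
      rw [this]
      exact add_smul_e3_mem hx (by positivity)
    have := norm_sub_le_of_segment hd hseg fun z hz => hk z (hseg hz)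
    rwa [add_sub_cancel_left, norm_smul, norm_e3, mul_one, Real.norm_of_nonneg hT0.le] at this
  have h2 := norm_sub_le_of_segment_e3 hR hd hx.1 (show R < T by simp only [T]; linarith)
    (fun z hz _ => hk z hz)
  have h3 : ‖Φ x‖ ≤ ‖Φ x - Φ (x + T • e3)‖ + ‖Φ (x + T • e3) - Φ (T • e3)‖ + ‖Φ (T • e3)‖ := by
    have : Φ x = (Φ x - Φ (x + T • e3)) + (Φ (x + T • e3) - Φ (T • e3)) + Φ (T • e3) := by abel
    conv_lhs => rw [this]
    exact norm_add₃_le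
  rw [norm_sub_rev] at h3
  linarith

/-- The first derivatives of `F` converge to the identity, with the rates of an asymptotically flat
chart. -/
structure IsAsymptoticIdentity (R : ℝ) (F : E3 → E3) (b ρ : ℝ) : Prop where
  pos : 0 < R
  le : R ≤ ρ
  nonneg : 0 ≤ b
  smooth : ContDiffOn ℝ ∞ F (halfSpaceEnd R)
  first : ∀ x ∈ halfSpaceEnd R, ρ ≤ ‖x‖ → ∀ i,
    ‖pd (halfSpaceEnd R) i F x - EuclideanSpace.single i 1‖ ≤ b / ‖x‖
  second : ∀ x ∈ halfSpaceEnd R, ρ ≤ ‖x‖ → ∀ l i,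
    ‖pd (halfSpaceEnd R) l (pd (halfSpaceEnd R) i F) x‖ ≤ b / ‖x‖ ^ 2

theorem exists_isometry_of_orthonormal {v : Fin 3 → E3} (hv : Orthonormal ℝ v) :
    ∃ O : E3 ≃ₗᵢ[ℝ] E3, ∀ i, O (EuclideanSpace.single i 1) = v i := by
  have hcard : Fintype.card (Fin 3) = Module.finrank ℝ E3 := by simp
  let B := basisOfOrthonormalOfCardEqFinrank hv hcard
  have hB : ⇑B = v := coe_basisOfOrthonormalOfCardEqFinrank hv hcard
  let B' := B.toOrthonormalBasis (by rw [hB]; exact hv)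
  refine ⟨B'.repr.symm, fun i => ?_⟩
  rw [B'.repr_symm_single, B.coe_toOrthonormalBasis, hB]

/-- By Koszul's formula the derivatives of the coordinate fields `∂_i Φ` are of order `|x|⁻²`, so
these fields converge. Decay of the metric makes the limits orthonormal. The isometry may reverse
orientation. -/
theorem IsDecaying.exists_isometry (h : IsDecaying R Φ c) (hc : 0 < c) :
    ∃ (O : E3 ≃ₗᵢ[ℝ] E3) (b ρ : ℝ), IsAsymptoticIdentity R (fun x => O.symm (Φ x)) b ρ := by
  have hR := h.pos
  set ρ := max R (6 * c)
  have hsec : ∀ x ∈ halfSpaceEnd R, ρ ≤ ‖x‖ → ∀ l i,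
      ‖pd (halfSpaceEnd R) l (pd (halfSpaceEnd R) i Φ) x‖ ≤ 9 * (c / ‖x‖ ^ 2) :=
    fun x hx hxρ l i => h.norm_pd_pd_le hx ((le_max_right _ _).trans hxρ) l i
  have hlim : ∀ i, ∃ O : E3, ∀ x ∈ halfSpaceEnd R, ρ ≤ ‖x‖ →
      ‖pd (halfSpaceEnd R) i Φ x - O‖ ≤ 2 * (27 * c / ‖x‖) := fun i =>
    exists_limit_of_decay hR ((pd_contDiffOn h.smooth i).differentiableOn (by simp))
      fun x hx hxρ => (norm_fderivWithin_le fun l => hsec x hx hxρ l i).trans (le_of_eq (by ring))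
  choose v hv using hlim
  have hseq : ∀ i, Tendsto (fun t : ℝ => pd (halfSpaceEnd R) i Φ (t • e3)) atTop (𝓝 (v i)) := by
    intro i
    rw [tendsto_iff_norm_sub_tendsto_zero]
    have h0 : Tendsto (fun t : ℝ => 2 * (27 * c / t)) atTop (𝓝 0) := by
      simpa using ((tendsto_const_nhds (x := 27 * c)).div_atTop tendsto_id).const_mul 2
    refine squeeze_zero' (Eventually.of_forall fun t => norm_nonneg _) ?_ h0
    filter_upwards [eventually_gt_atTop R, eventually_ge_atTop ρ] with t ht htρ
    have hn : ‖t • e3‖ = t := by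
      rw [norm_smul, norm_e3, mul_one, Real.norm_of_nonneg (hR.trans ht).le]
    have := hv i (t • e3) (smul_e3_mem hR ht) (by rwa [hn])
    rwa [hn] at this
  have horth : ∀ i j, inner ℝ (v i) (v j) = if i = j then (1 : ℝ) else 0 := by
    intro i j
    have h1 : Tendsto (fun t : ℝ => inner ℝ (pd (halfSpaceEnd R) i Φ (t • e3))
        (pd (halfSpaceEnd R) j Φ (t • e3))) atTop (𝓝 (if i = j then (1 : ℝ) else 0)) := by
      rw [tendsto_iff_norm_sub_tendsto_zero]
      have h0 : Tendsto (fun t : ℝ => c / t) atTop (𝓝 0) :=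
        (tendsto_const_nhds (x := c)).div_atTop tendsto_id
      refine squeeze_zero' (Eventually.of_forall fun t => norm_nonneg _) ?_ h0
      filter_upwards [eventually_gt_atTop R] with t ht
      have hn : ‖t • e3‖ = t := by
        rw [norm_smul, norm_e3, mul_one, Real.norm_of_nonneg (hR.trans ht).le]
      have := h.metric (t • e3) (smul_e3_mem hR ht) i j
      rwa [hn] at this
    exact tendsto_nhds_unique ((hseq i).inner (hseq j)) h1
  have hon : Orthonormal ℝ v := by
    rw [orthonormal_iff_ite]; exact horth
  obtain ⟨O, hO⟩ := exists_isometry_of_orthonormal hon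
  have hpd : ∀ x ∈ halfSpaceEnd R, ∀ i, pd (halfSpaceEnd R) i (fun x => O.symm (Φ x)) x =
      O.symm (pd (halfSpaceEnd R) i Φ x) := fun x hx i =>
    pd_clm (O.symm.toContinuousLinearEquiv : E3 →L[ℝ] E3) hx
      (h.smooth.differentiableOn (by simp) x hx) i
  refine ⟨O, 54 * c, ρ, hR, le_max_left _ _, by positivity,
    O.symm.contDiff.comp_contDiffOn h.smooth, fun x hx hxρ i => ?_, fun x hx hxρ l i => ?_⟩
  · have h1 : EuclideanSpace.single i (1 : ℝ) = O.symm (v i) := by rw [← hO, O.symm_apply_apply]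
    rw [hpd x hx, h1, ← map_sub, LinearIsometryEquiv.norm_map]
    exact (hv i x hx hxρ).trans (le_of_eq (by ring))
  · have h1 : pd (halfSpaceEnd R) l (pd (halfSpaceEnd R) i (fun x => O.symm (Φ x))) x =
        O.symm (pd (halfSpaceEnd R) l (pd (halfSpaceEnd R) i Φ) x) := by
      rw [pd_congr hx (fun y hy => hpd y hy i) l]
      exact pd_clm (O.symm.toContinuousLinearEquiv : E3 →L[ℝ] E3) hx
        ((pd_contDiffOn h.smooth i).differentiableOn (by simp) x hx) l
    rw [h1, LinearIsometryEquiv.norm_map]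
    refine (hsec x hx hxρ l i).trans ?_
    rw [← mul_div_assoc]
    gcongr
    linarith

end

/-! ### Integrals over hemispheres -/

/-- The derivative of `spherePt` in the longitude. -/
noncomputable def azimuthVec (r θ φ : ℝ) : E3 :=
  !₂[-(r * (Real.sin θ * Real.sin φ)), r * (Real.sin θ * Real.cos φ), 0]

section

variable (r θ φ : ℝ)

@[simp] theorem spherePt_zero : spherePt r θ φ 0 = r * (Real.sin θ * Real.cos φ) := rfl
@[simp] theorem spherePt_one : spherePt r θ φ 1 = r * (Real.sin θ * Real.sin φ) := rfl
@[simp] theorem spherePt_two : spherePt r θ φ 2 = r * Real.cos θ := rfl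
@[simp] theorem azimuthVec_zero : azimuthVec r θ φ 0 = -(r * (Real.sin θ * Real.sin φ)) := rfl
@[simp] theorem azimuthVec_one : azimuthVec r θ φ 1 = r * (Real.sin θ * Real.cos φ) := rfl
@[simp] theorem azimuthVec_two : azimuthVec r θ φ 2 = 0 := rfl

theorem spherePt_eq_single : spherePt r θ φ =
    (r * (Real.sin θ * Real.cos φ)) • EuclideanSpace.single 0 1
    + (r * (Real.sin θ * Real.sin φ)) • EuclideanSpace.single 1 1
    + (r * Real.cos θ) • EuclideanSpace.single 2 1 :=
  E3.ext (by simp) (by simp) (by simp)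

theorem azimuthVec_eq_single : azimuthVec r θ φ =
    (-(r * (Real.sin θ * Real.sin φ))) • EuclideanSpace.single 0 1
    + (r * (Real.sin θ * Real.cos φ)) • EuclideanSpace.single 1 1 :=
  E3.ext (by simp) (by simp) (by simp)

theorem hasDerivAt_spherePt_polar :
    HasDerivAt (fun θ => spherePt r θ φ) (spherePt r (θ + Real.pi / 2) φ) θ := by
  simp only [spherePt_eq_single, Real.sin_add_pi_div_two, Real.cos_add_pi_div_two]
  exact (((((Real.hasDerivAt_sin θ).mul_const _).const_mul r).smul_const _).add
    ((((Real.hasDerivAt_sin θ).mul_const _).const_mul r).smul_const _)).add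
    (((Real.hasDerivAt_cos θ).const_mul r).smul_const _)

theorem hasDerivAt_spherePt_azimuth :
    HasDerivAt (fun φ => spherePt r θ φ) (azimuthVec r θ φ) φ := by
  have h := (((((Real.hasDerivAt_cos φ).const_mul (Real.sin θ)).const_mul r).smul_const
    (EuclideanSpace.single (0 : Fin 3) (1 : ℝ))).add
    ((((Real.hasDerivAt_sin φ).const_mul (Real.sin θ)).const_mul r).smul_const
    (EuclideanSpace.single (1 : Fin 3) (1 : ℝ)))).add
    (hasDerivAt_const φ ((r * Real.cos θ) • EuclideanSpace.single (2 : Fin 3) (1 : ℝ)))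
  simp only [spherePt_eq_single]
  convert! h using 1
  exact E3.ext (by simp) (by simp) (by simp)

theorem hasDerivAt_azimuthVec_polar :
    HasDerivAt (fun θ => azimuthVec r θ φ) (azimuthVec r (θ + Real.pi / 2) φ) θ := by
  simp only [azimuthVec_eq_single, Real.sin_add_pi_div_two]
  exact ((((Real.hasDerivAt_sin θ).mul_const _).const_mul r).neg.smul_const _).add
    ((((Real.hasDerivAt_sin θ).mul_const _).const_mul r).smul_const _)

theorem norm_spherePt {r : ℝ} (hr : 0 ≤ r) : ‖spherePt r θ φ‖ = r := by
  have h : ‖spherePt r θ φ‖ ^ 2 = r ^ 2 := by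
    rw [E3.norm_sq]; simp
    linear_combination r ^ 2 * Real.sin θ ^ 2 * Real.sin_sq_add_cos_sq φ
      + r ^ 2 * Real.sin_sq_add_cos_sq θ
  exact (pow_left_inj₀ (norm_nonneg _) hr two_ne_zero).1 h

theorem continuous_spherePt (r : ℝ) : Continuous fun p : ℝ × ℝ => spherePt r p.1 p.2 := by
  simp only [spherePt_eq_single]
  fun_prop

theorem continuous_azimuthVec (r : ℝ) : Continuous fun p : ℝ × ℝ => azimuthVec r p.1 p.2 := by
  simp only [azimuthVec_eq_single]
  fun_prop

end

theorem spherePt_mem {R r θ φ : ℝ} (hR : 0 < R) (hr : R < r) (hθ : θ ∈ Icc 0 (Real.pi / 2)) :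
    spherePt r θ φ ∈ halfSpaceEnd R := by
  have hr0 : 0 < r := hR.trans hr
  refine ⟨?_, by rwa [norm_spherePt θ φ hr0.le]⟩
  rw [spherePt_two]
  exact mul_nonneg hr0.le (Real.cos_nonneg_of_neg_pi_div_two_le_of_le
    (by linarith [hθ.1, Real.pi_pos]) hθ.2)

/-- The angle in `[0, π/2]` which is closest to a given one. -/
noncomputable def clampAngle (θ : ℝ) : ℝ := max 0 (min θ (Real.pi / 2))

theorem continuous_clampAngle : Continuous clampAngle := by unfold clampAngle; fun_prop

theorem clampAngle_mem (θ : ℝ) : clampAngle θ ∈ Icc 0 (Real.pi / 2) :=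
  ⟨le_max_left _ _, max_le (by positivity) (min_le_right _ _)⟩

theorem clampAngle_of_mem {θ : ℝ} (hθ : θ ∈ Icc 0 (Real.pi / 2)) : clampAngle θ = θ := by
  rw [clampAngle, min_eq_left hθ.2, max_eq_right hθ.1]

/-- A function of spherical coordinates, which is continuous for polar angles in `[0, π/2]`. -/
def ContinuousOnQuarter (J : ℝ → ℝ → ℝ) : Prop :=
  Continuous fun p : ℝ × ℝ => J (clampAngle p.1) p.2

/-- The integral over the spherical coordinates of a hemisphere. -/
noncomputable def quarterIntegral (J : ℝ → ℝ → ℝ) : ℝ :=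
  ∫ φ in (0 : ℝ)..(2 * Real.pi), ∫ θ in (0 : ℝ)..(Real.pi / 2), J θ φ

section

variable {J K : ℝ → ℝ → ℝ}

theorem quarterIntegral_congr (h : ∀ θ ∈ Icc 0 (Real.pi / 2), ∀ φ, J θ φ = K θ φ) :
    quarterIntegral J = quarterIntegral K := by
  refine intervalIntegral.integral_congr fun φ _ => intervalIntegral.integral_congr fun θ hθ => ?_
  rw [uIcc_of_le (by positivity)] at hθ
  exact h θ hθ φ

theorem quarterIntegral_clamp (J : ℝ → ℝ → ℝ) :
    quarterIntegral J = quarterIntegral fun θ φ => J (clampAngle θ) φ :=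
  quarterIntegral_congr fun θ hθ φ => by rw [clampAngle_of_mem hθ]

theorem quarterIntegral_sub (hJ : ContinuousOnQuarter J) (hK : ContinuousOnQuarter K) :
    quarterIntegral J - quarterIntegral K = quarterIntegral fun θ φ => J θ φ - K θ φ := by
  have h1 : ∀ {J : ℝ → ℝ → ℝ}, ContinuousOnQuarter J → ∀ φ,
      IntervalIntegrable (fun θ => J (clampAngle θ) φ) MeasureTheory.volume 0 (Real.pi / 2) :=
    fun hJ φ => (Continuous.comp hJ (Continuous.prodMk_left φ)).intervalIntegrable _ _
  have h2 : ∀ {J : ℝ → ℝ → ℝ}, ContinuousOnQuarter J → IntervalIntegrable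
      (fun φ => ∫ θ in (0 : ℝ)..(Real.pi / 2), J (clampAngle θ) φ) MeasureTheory.volume 0
      (2 * Real.pi) := fun {J} hJ => by
    refine Continuous.intervalIntegrable ?_ _ _
    exact intervalIntegral.continuous_parametric_intervalIntegral_of_continuous'
      (f := fun φ θ => J (clampAngle θ) φ) (Continuous.comp hJ continuous_swap) _ _
  rw [quarterIntegral_clamp J, quarterIntegral_clamp K,
    quarterIntegral_clamp fun θ φ => J θ φ - K θ φ, quarterIntegral, quarterIntegral,
    ← intervalIntegral.integral_sub (h2 hJ) (h2 hK)]
  exact intervalIntegral.integral_congr fun φ _ =>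
    (intervalIntegral.integral_sub (h1 hJ φ) (h1 hK φ)).symm

theorem abs_quarterIntegral_le {b : ℝ} (h : ∀ θ ∈ Icc 0 (Real.pi / 2), ∀ φ, |J θ φ| ≤ b) :
    |quarterIntegral J| ≤ b * (Real.pi / 2) * (2 * Real.pi) := by
  have h1 : ∀ φ, ‖∫ θ in (0 : ℝ)..(Real.pi / 2), J θ φ‖ ≤ b * (Real.pi / 2) := fun φ => by
    have := intervalIntegral.norm_integral_le_of_norm_le_const (a := 0) (b := Real.pi / 2) (C := b)
      (f := fun θ => J θ φ) fun θ hθ => by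
        rw [uIoc_of_le (by positivity)] at hθ
        exact h θ ⟨hθ.1.le, hθ.2⟩ φ
    rwa [sub_zero, abs_of_pos (by positivity)] at this
  have := intervalIntegral.norm_integral_le_of_norm_le_const (a := 0) (b := 2 * Real.pi)
    (C := b * (Real.pi / 2)) (f := fun φ => ∫ θ in (0 : ℝ)..(Real.pi / 2), J θ φ)
    fun φ _ => h1 φ
  rwa [sub_zero, abs_of_pos (by positivity)] at this

theorem quarterIntegral_swap (hJ : ContinuousOnQuarter J) :
    quarterIntegral J =
      ∫ θ in (0 : ℝ)..(Real.pi / 2), ∫ φ in (0 : ℝ)..(2 * Real.pi), J θ φ := by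
  rw [quarterIntegral_clamp, quarterIntegral]
  have h : ∫ θ in (0 : ℝ)..(Real.pi / 2), ∫ φ in (0 : ℝ)..(2 * Real.pi), J θ φ =
      ∫ θ in (0 : ℝ)..(Real.pi / 2), ∫ φ in (0 : ℝ)..(2 * Real.pi), J (clampAngle θ) φ := by
    refine intervalIntegral.integral_congr fun θ hθ => ?_
    rw [uIcc_of_le (by positivity)] at hθ
    simp only [clampAngle_of_mem hθ]
  rw [h]
  have hc : Continuous (Function.uncurry fun φ θ => J (clampAngle θ) φ) :=
    Continuous.comp hJ continuous_swap
  refine MeasureTheory.intervalIntegral_intervalIntegral_swap ?_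
  exact (hc.continuousOn.integrableOn_compact (isCompact_uIcc.prod isCompact_uIcc)).mono_set
    (prod_mono uIoc_subset_uIcc uIoc_subset_uIcc)

/-- The fundamental theorem of calculus in each variable: periodicity in `φ` annihilates one
integral, and the other leaves its end values in `θ`. -/
theorem quarterIntegral_sub_of_hasDerivAt {a b h k : ℝ → ℝ → ℝ} (hh : ContinuousOnQuarter h)
    (hk : ContinuousOnQuarter k)
    (ha : ∀ φ, ∀ θ ∈ Icc 0 (Real.pi / 2),
      HasDerivWithinAt (fun θ => a θ φ) (h θ φ) (Icc 0 (Real.pi / 2)) θ)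
    (hb : ∀ θ ∈ Icc 0 (Real.pi / 2), ∀ φ, HasDerivAt (b θ) (k θ φ) φ)
    (hper : ∀ θ ∈ Icc 0 (Real.pi / 2), b θ (2 * Real.pi) = b θ 0) :
    quarterIntegral (fun θ φ => h θ φ - k θ φ) =
      ∫ φ in (0 : ℝ)..(2 * Real.pi), (a (Real.pi / 2) φ - a 0 φ) := by
  have hpi : (0 : ℝ) ≤ Real.pi / 2 := by positivity
  have hk0 : quarterIntegral k = 0 := by
    rw [quarterIntegral_swap hk]
    have : ∀ θ ∈ uIcc 0 (Real.pi / 2), ∫ φ in (0 : ℝ)..(2 * Real.pi), k θ φ = 0 := by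
      intro θ hθ
      rw [uIcc_of_le hpi] at hθ
      have hcont : Continuous fun φ => k θ φ := by
        have := Continuous.comp hk (Continuous.prodMk_right θ)
        simpa [Function.comp_def, clampAngle_of_mem hθ] using this
      rw [intervalIntegral.integral_eq_sub_of_hasDerivAt (fun φ _ => hb θ hθ φ)
        (hcont.intervalIntegrable _ _), hper θ hθ, sub_self]
    rw [intervalIntegral.integral_congr this]
    simp
  rw [← quarterIntegral_sub hh hk, hk0, sub_zero]
  refine intervalIntegral.integral_congr fun φ _ => ?_
  have hint : IntervalIntegrable (fun θ => h θ φ) MeasureTheory.volume 0 (Real.pi / 2) := by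
    have h1 : IntervalIntegrable (fun θ => h (clampAngle θ) φ) MeasureTheory.volume 0
        (Real.pi / 2) := (Continuous.comp hh (Continuous.prodMk_left φ)).intervalIntegrable _ _
    refine h1.congr fun θ hθ => ?_
    rw [uIoc_of_le hpi] at hθ
    simp only [clampAngle_of_mem ⟨hθ.1.le, hθ.2⟩]
  exact intervalIntegral.integral_eq_sub_of_hasDerivAt_of_le hpi
    (fun θ hθ => (ha φ θ hθ).continuousWithinAt)
    (fun θ hθ => (ha φ θ (Ioo_subset_Icc_self hθ)).hasDerivAt (Icc_mem_nhds hθ.1 hθ.2)) hint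

end

/-! ### Stokes' theorem for hemispheres -/

/-- The radial component of the curl of a vector field. -/
noncomputable def radialCurl (R : ℝ) (V : E3 → E3) (x : E3) : ℝ :=
  (pd (halfSpaceEnd R) 1 V x 2 - pd (halfSpaceEnd R) 2 V x 1) * (x 0 / ‖x‖)
  + (pd (halfSpaceEnd R) 2 V x 0 - pd (halfSpaceEnd R) 0 V x 2) * (x 1 / ‖x‖)
  + (pd (halfSpaceEnd R) 0 V x 1 - pd (halfSpaceEnd R) 1 V x 0) * (x 2 / ‖x‖)

section

variable {R r : ℝ}

theorem continuous_comp_spherePt {F : Type*} [TopologicalSpace F] {Q : E3 → F} (hR : 0 < R)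
    (hr : R < r) (hQ : ContinuousOn Q (halfSpaceEnd R)) :
    Continuous fun p : ℝ × ℝ => Q (spherePt r (clampAngle p.1) p.2) := by
  refine hQ.comp_continuous (f := fun p : ℝ × ℝ => spherePt r (clampAngle p.1) p.2)
    ((continuous_spherePt r).comp (g := fun p : ℝ × ℝ => spherePt r p.1 p.2)
      (f := fun p : ℝ × ℝ => (clampAngle p.1, p.2)) ?_)
    fun p => spherePt_mem hR hr (clampAngle_mem p.1)
  exact (continuous_clampAngle.comp continuous_fst).prodMk continuous_snd

theorem continuousOnQuarter_comp {Q : E3 → ℝ} (hR : 0 < R) (hr : R < r)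
    (hQ : ContinuousOn Q (halfSpaceEnd R)) :
    ContinuousOnQuarter fun θ φ => Q (spherePt r θ φ) * (r ^ 2 * Real.sin θ) := by
  have h1 := continuous_comp_spherePt hR hr hQ
  have h2 : Continuous fun p : ℝ × ℝ => r ^ 2 * Real.sin (clampAngle p.1) :=
    continuous_const.mul (Real.continuous_sin.comp (continuous_clampAngle.comp continuous_fst))
  unfold ContinuousOnQuarter
  exact h1.mul h2

variable {V : E3 → E3}

/-- The flux density of the curl is `∂_θ ⟨V, ∂_φ⟩ - ∂_φ ⟨V, ∂_θ⟩`, with `∂_φ = azimuthVec r θ φ` and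
`∂_θ = spherePt r (θ + π/2) φ`. The common mixed term is kept in both brackets so that each is an
exact derivative. -/
theorem radialCurl_spherePt (hr : 0 < r) (θ φ : ℝ) :
    radialCurl R V (spherePt r θ φ) * (r ^ 2 * Real.sin θ) =
      (inner ℝ (V (spherePt r θ φ)) (azimuthVec r (θ + Real.pi / 2) φ)
        + inner ℝ (fderivWithin ℝ V (halfSpaceEnd R) (spherePt r θ φ)
            (spherePt r (θ + Real.pi / 2) φ)) (azimuthVec r θ φ))
      - (inner ℝ (V (spherePt r θ φ)) (azimuthVec r (θ + Real.pi / 2) φ)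
        + inner ℝ (fderivWithin ℝ V (halfSpaceEnd R) (spherePt r θ φ) (azimuthVec r θ φ))
            (spherePt r (θ + Real.pi / 2) φ)) := by
  rw [fderivWithin_apply_eq_sum, fderivWithin_apply_eq_sum, Fin.sum_univ_three, Fin.sum_univ_three,
    radialCurl, norm_spherePt θ φ hr.le,
    add_sub_add_left_eq_sub]
  generalize pd (halfSpaceEnd R) 0 V (spherePt r θ φ) = a
  generalize pd (halfSpaceEnd R) 1 V (spherePt r θ φ) = b
  generalize pd (halfSpaceEnd R) 2 V (spherePt r θ φ) = c
  simp only [PiLp.inner_apply, Fin.sum_univ_three, PiLp.add_apply, PiLp.smul_apply,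
    spherePt_zero, spherePt_one, spherePt_two, azimuthVec_zero, azimuthVec_one, azimuthVec_two,
    Real.sin_add_pi_div_two, Real.cos_add_pi_div_two, smul_eq_mul, RCLike.inner_apply, conj_trivial]
  field_simp
  linear_combination (-(a 1 - b 0) * r * Real.sin θ * Real.cos θ) * Real.sin_sq_add_cos_sq φ

theorem continuous_clampAngle_prodMk {f : ℝ → ℝ → E3}
    (hf : Continuous fun p : ℝ × ℝ => f p.1 p.2) (s : ℝ) :
    Continuous fun p : ℝ × ℝ => f (clampAngle p.1 + s) p.2 :=
  hf.comp (g := fun p : ℝ × ℝ => f p.1 p.2) (f := fun p : ℝ × ℝ => (clampAngle p.1 + s, p.2))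
    (((continuous_clampAngle.comp continuous_fst).add continuous_const).prodMk continuous_snd)

theorem continuousOnQuarter_inner_fderivWithin (hR : 0 < R) (hr : R < r)
    (hV : ContDiffOn ℝ ∞ V (halfSpaceEnd R)) {f g : ℝ → ℝ → E3}
    (hf : Continuous fun p : ℝ × ℝ => f p.1 p.2) (hg : Continuous fun p : ℝ × ℝ => g p.1 p.2)
    (s t : ℝ) :
    ContinuousOnQuarter fun θ φ =>
      inner ℝ (V (spherePt r θ φ)) (azimuthVec r (θ + Real.pi / 2) φ)
      + inner ℝ (fderivWithin ℝ V (halfSpaceEnd R) (spherePt r θ φ) (f (θ + s) φ))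
        (g (θ + t) φ) := by
  have c1 := continuous_clampAngle_prodMk (continuous_azimuthVec r) (Real.pi / 2)
  have c2 := continuous_clampAngle_prodMk hf s
  have c3 := continuous_clampAngle_prodMk hg t
  have cV := continuous_comp_spherePt hR hr hV.continuousOn
  have cD := continuous_comp_spherePt hR hr
    (hV.continuousOn_fderivWithin (uniqueDiffOn_halfSpaceEnd R) (by simp))
  unfold ContinuousOnQuarter
  exact (cV.inner (𝕜 := ℝ) c1).add ((cD.clm_apply c2).inner (𝕜 := ℝ) c3)

/-- Stokes' theorem for the hemisphere. The pole does not contribute since `azimuthVec` vanishes at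
`θ = 0`. -/
theorem quarterIntegral_radialCurl (hR : 0 < R) (hr : R < r)
    (hV : ContDiffOn ℝ ∞ V (halfSpaceEnd R)) :
    quarterIntegral (fun θ φ => radialCurl R V (spherePt r θ φ) * (r ^ 2 * Real.sin θ)) =
      ∫ φ in (0 : ℝ)..(2 * Real.pi),
        inner ℝ (V (spherePt r (Real.pi / 2) φ)) (azimuthVec r (Real.pi / 2) φ) := by
  have hr0 : 0 < r := hR.trans hr
  have hd : ∀ θ ∈ Icc 0 (Real.pi / 2), ∀ φ, HasFDerivWithinAt V
      (fderivWithin ℝ V (halfSpaceEnd R) (spherePt r θ φ)) (halfSpaceEnd R) (spherePt r θ φ) :=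
    fun θ hθ φ => (hV.differentiableOn (by simp) _ (spherePt_mem hR hr hθ)).hasFDerivWithinAt
  have hh := continuousOnQuarter_inner_fderivWithin hR hr hV (continuous_spherePt r)
    (continuous_azimuthVec r) (Real.pi / 2) 0
  have hk := continuousOnQuarter_inner_fderivWithin hR hr hV (continuous_azimuthVec r)
    (continuous_spherePt r) 0 (Real.pi / 2)
  simp only [add_zero] at hh hk
  simp only [radialCurl_spherePt hr0]
  refine (quarterIntegral_sub_of_hasDerivAt
    (a := fun θ φ => inner ℝ (V (spherePt r θ φ)) (azimuthVec r θ φ))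
    (b := fun θ φ => inner ℝ (V (spherePt r θ φ)) (spherePt r (θ + Real.pi / 2) φ))
    hh hk ?_ ?_ ?_).trans ?_
  · intro φ θ hθ
    have h1 : HasDerivWithinAt (fun θ => V (spherePt r θ φ))
        (fderivWithin ℝ V (halfSpaceEnd R) (spherePt r θ φ) (spherePt r (θ + Real.pi / 2) φ))
        (Icc 0 (Real.pi / 2)) θ :=
      (hd θ hθ φ).comp_hasDerivWithinAt θ
        (hasDerivAt_spherePt_polar r θ φ).hasDerivWithinAt fun θ h => spherePt_mem hR hr h
    exact h1.inner ℝ (hasDerivAt_azimuthVec_polar r θ φ).hasDerivWithinAt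
  · intro θ hθ φ
    have h1 : HasDerivAt (fun φ => V (spherePt r θ φ))
        (fderivWithin ℝ V (halfSpaceEnd R) (spherePt r θ φ) (azimuthVec r θ φ)) φ := by
      rw [← hasDerivWithinAt_univ]
      exact (hd θ hθ φ).comp_hasDerivWithinAt φ
        (hasDerivAt_spherePt_azimuth r θ φ).hasDerivWithinAt fun φ _ => spherePt_mem hR hr hθ
    exact h1.inner ℝ (hasDerivAt_spherePt_azimuth r (θ + Real.pi / 2) φ)
  · intro θ _
    simp [spherePt]
  · have h0 : ∀ φ, azimuthVec r 0 φ = 0 := fun φ => E3.ext (by simp) (by simp) (by simp)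
    simp only [h0, inner_zero_right, sub_zero]

end

/-! ### The boundary term which determines the mass -/

/-- The curl of a map. -/
noncomputable def curl (R : ℝ) (F : E3 → E3) (x : E3) : E3 :=
  !₂[pd (halfSpaceEnd R) 1 F x 2 - pd (halfSpaceEnd R) 2 F x 1,
    pd (halfSpaceEnd R) 2 F x 0 - pd (halfSpaceEnd R) 0 F x 2,
    pd (halfSpaceEnd R) 0 F x 1 - pd (halfSpaceEnd R) 1 F x 0]

/-- The integrand of the integral over the hemisphere in the mass. -/
noncomputable def massIntegrand (R : ℝ) (F : E3 → E3) (x : E3) : ℝ :=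
  ∑ i, ∑ j, (pd (halfSpaceEnd R) j (chartMetric euclideanMetric R F i j) x
    - pd (halfSpaceEnd R) i (chartMetric euclideanMetric R F j j) x) * (x i / ‖x‖)

section

variable {R : ℝ} {F : E3 → E3}

theorem contDiffOn_pd_coord (hF : ContDiffOn ℝ ∞ F (halfSpaceEnd R)) (i k : Fin 3) :
    ContDiffOn ℝ ∞ (fun x => pd (halfSpaceEnd R) i F x k) (halfSpaceEnd R) :=
  (EuclideanSpace.proj (𝕜 := ℝ) k).contDiff.comp_contDiffOn (pd_contDiffOn hF i)

theorem contDiffOn_curl (hF : ContDiffOn ℝ ∞ F (halfSpaceEnd R)) :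
    ContDiffOn ℝ ∞ (curl R F) (halfSpaceEnd R) := by
  refine (contDiffOn_euclidean (𝕜 := ℝ)).2 fun i => ?_
  fin_cases i
  · exact (contDiffOn_pd_coord hF 1 2).sub (contDiffOn_pd_coord hF 2 1)
  · exact (contDiffOn_pd_coord hF 2 0).sub (contDiffOn_pd_coord hF 0 2)
  · exact (contDiffOn_pd_coord hF 0 1).sub (contDiffOn_pd_coord hF 1 0)

theorem contDiffOn_chartMetric (hF : ContDiffOn ℝ ∞ F (halfSpaceEnd R)) (i j : Fin 3) :
    ContDiffOn ℝ ∞ (chartMetric euclideanMetric R F i j) (halfSpaceEnd R) := by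
  rw [show chartMetric euclideanMetric R F i j = fun x => inner ℝ (pd (halfSpaceEnd R) i F x)
    (pd (halfSpaceEnd R) j F x) from funext fun x => chartMetric_euclidean R F i j x]
  exact (pd_contDiffOn hF i).inner ℝ (pd_contDiffOn hF j)

theorem continuousOn_massIntegrand (hR : 0 < R) (hF : ContDiffOn ℝ ∞ F (halfSpaceEnd R)) :
    ContinuousOn (massIntegrand R F) (halfSpaceEnd R) := by
  refine continuousOn_finsetSum _ fun i _ => continuousOn_finsetSum _ fun j _ => ?_
  refine ((pd_contDiffOn (contDiffOn_chartMetric hF i j) j).continuousOn.sub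
    (pd_contDiffOn (contDiffOn_chartMetric hF j j) i).continuousOn).mul ?_
  exact (EuclideanSpace.proj (𝕜 := ℝ) i).continuous.continuousOn.div continuous_norm.continuousOn
    fun x hx => (hR.trans hx.2).ne'

theorem pd_curl (hF : ContDiffOn ℝ ∞ F (halfSpaceEnd R)) {x : E3} (hx : x ∈ halfSpaceEnd R)
    (l : Fin 3) :
    pd (halfSpaceEnd R) l (curl R F) x =
      !₂[pd (halfSpaceEnd R) l (pd (halfSpaceEnd R) 1 F) x 2
          - pd (halfSpaceEnd R) l (pd (halfSpaceEnd R) 2 F) x 1,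
        pd (halfSpaceEnd R) l (pd (halfSpaceEnd R) 2 F) x 0
          - pd (halfSpaceEnd R) l (pd (halfSpaceEnd R) 0 F) x 2,
        pd (halfSpaceEnd R) l (pd (halfSpaceEnd R) 0 F) x 1
          - pd (halfSpaceEnd R) l (pd (halfSpaceEnd R) 1 F) x 0] := by
  have hd : DifferentiableWithinAt ℝ (curl R F) (halfSpaceEnd R) x :=
    (contDiffOn_curl hF).differentiableOn (by simp) x hx
  have h : ∀ i j k m, pd (halfSpaceEnd R) l
      (fun y => pd (halfSpaceEnd R) i F y j - pd (halfSpaceEnd R) k F y m) x =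
      pd (halfSpaceEnd R) l (pd (halfSpaceEnd R) i F) x j
        - pd (halfSpaceEnd R) l (pd (halfSpaceEnd R) k F) x m := by
    intro i j k m
    rw [pd_sub hx ((contDiffOn_pd_coord hF i j).differentiableOn (by simp) x hx)
      ((contDiffOn_pd_coord hF k m).differentiableOn (by simp) x hx),
      pd_coord hx ((pd_contDiffOn hF i).differentiableOn (by simp) x hx),
      pd_coord hx ((pd_contDiffOn hF k).differentiableOn (by simp) x hx)]
  refine E3.ext ?_ ?_ ?_
  · rw [← pd_coord hx hd]; exact h 1 2 2 1
  · rw [← pd_coord hx hd]; exact h 2 0 0 2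
  · rw [← pd_coord hx hd]; exact h 0 1 1 0

/-- The identity `curl curl F = ∇ div F - ΔF`, in radial direction. -/
theorem radialCurl_curl (hF : ContDiffOn ℝ ∞ F (halfSpaceEnd R)) {x : E3}
    (hx : x ∈ halfSpaceEnd R) :
    radialCurl R (curl R F) x = -∑ i, ∑ j,
      (pd (halfSpaceEnd R) j (pd (halfSpaceEnd R) j F) x i
        - pd (halfSpaceEnd R) i (pd (halfSpaceEnd R) j F) x j) * (x i / ‖x‖) := by
  rw [radialCurl]
  simp only [pd_curl hF hx, Fin.sum_univ_three]
  rw [pd_comm hF hx 1 0, pd_comm hF hx 2 0, pd_comm hF hx 2 1]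
  simp
  ring

/-- In `∂_j g_ij - ∂_i g_jj` one of the two terms `⟨∂_i ∂_j F, ∂_j F⟩` cancels. -/
theorem massIntegrand_eq (hF : ContDiffOn ℝ ∞ F (halfSpaceEnd R)) {x : E3}
    (hx : x ∈ halfSpaceEnd R) :
    massIntegrand R F x = ∑ i, ∑ j,
      (inner ℝ (pd (halfSpaceEnd R) i F x) (pd (halfSpaceEnd R) j (pd (halfSpaceEnd R) j F) x)
      - inner ℝ (pd (halfSpaceEnd R) i (pd (halfSpaceEnd R) j F) x) (pd (halfSpaceEnd R) j F x))
      * (x i / ‖x‖) := by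
  refine Finset.sum_congr rfl fun i _ => Finset.sum_congr rfl fun j _ => ?_
  congr 1
  have hd : ∀ i, DifferentiableWithinAt ℝ (pd (halfSpaceEnd R) i F) (halfSpaceEnd R) x :=
    fun i => (pd_contDiffOn hF i).differentiableOn (by simp) x hx
  have h : ∀ i j, chartMetric euclideanMetric R F i j = fun x =>
      inner ℝ (pd (halfSpaceEnd R) i F x) (pd (halfSpaceEnd R) j F x) :=
    fun i j => funext fun x => chartMetric_euclidean R F i j x
  rw [h, h, pd_inner hx (hd i) (hd j), pd_inner hx (hd j) (hd j), pd_comm hF hx j i,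
    real_inner_comm (pd (halfSpaceEnd R) i (pd (halfSpaceEnd R) j F) x) (pd (halfSpaceEnd R) j F x)]
  ring

variable {b ρ : ℝ}

/-- Replacing each undifferentiated `∂_i F` by `e_i` turns the integrand into the negative radial
component of `curl curl F`. The nine index pairs contribute two errors each, a product of `b / |x|`
and `b / |x|²`. Integrated over the hemisphere the total is `O(1/r)`. -/
theorem IsAsymptoticIdentity.abs_massIntegrand_add_le (h : IsAsymptoticIdentity R F b ρ) {x : E3}
    (hx : x ∈ halfSpaceEnd R) (hρ : ρ ≤ ‖x‖) :
    |massIntegrand R F x + radialCurl R (curl R F) x| ≤ 18 * b ^ 2 / ‖x‖ ^ 3 := by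
  have hx0 : 0 < ‖x‖ := h.pos.trans hx.2
  rw [massIntegrand_eq h.smooth hx, radialCurl_curl h.smooth hx, ← sub_eq_add_neg]
  simp only [← Finset.sum_sub_distrib, ← sub_mul]
  have key : ∀ i ∈ Finset.univ, ∀ j ∈ Finset.univ,
      |(inner ℝ (pd (halfSpaceEnd R) i F x) (pd (halfSpaceEnd R) j (pd (halfSpaceEnd R) j F) x)
      - inner ℝ (pd (halfSpaceEnd R) i (pd (halfSpaceEnd R) j F) x) (pd (halfSpaceEnd R) j F x)
      - (pd (halfSpaceEnd R) j (pd (halfSpaceEnd R) j F) x i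
        - pd (halfSpaceEnd R) i (pd (halfSpaceEnd R) j F) x j)) * (x i / ‖x‖)|
      ≤ 2 * b ^ 2 / ‖x‖ ^ 3 := by
    intro i _ j _
    have e1 : ∀ (v : E3) (k : Fin 3), v k = inner ℝ v (EuclideanSpace.single k 1) := by
      intro v k; simp [EuclideanSpace.inner_single_right]
    have e2 : (inner ℝ (pd (halfSpaceEnd R) i F x) (pd (halfSpaceEnd R) j (pd (halfSpaceEnd R) j F) x)
        - inner ℝ (pd (halfSpaceEnd R) i (pd (halfSpaceEnd R) j F) x) (pd (halfSpaceEnd R) j F x)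
        - (pd (halfSpaceEnd R) j (pd (halfSpaceEnd R) j F) x i
          - pd (halfSpaceEnd R) i (pd (halfSpaceEnd R) j F) x j)) =
        inner ℝ (pd (halfSpaceEnd R) i F x - EuclideanSpace.single i 1)
          (pd (halfSpaceEnd R) j (pd (halfSpaceEnd R) j F) x)
        - inner ℝ (pd (halfSpaceEnd R) i (pd (halfSpaceEnd R) j F) x)
          (pd (halfSpaceEnd R) j F x - EuclideanSpace.single j 1) := by
      rw [e1 _ i, e1 _ j, inner_sub_left, inner_sub_right,
        real_inner_comm (EuclideanSpace.single i 1)]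
      ring
    have b1 := (abs_real_inner_le_norm (pd (halfSpaceEnd R) i F x - EuclideanSpace.single i 1)
      (pd (halfSpaceEnd R) j (pd (halfSpaceEnd R) j F) x)).trans
      (mul_le_mul (h.first x hx hρ i) (h.second x hx hρ j j) (norm_nonneg _)
        (div_nonneg h.nonneg hx0.le))
    have b2 := (abs_real_inner_le_norm (pd (halfSpaceEnd R) i (pd (halfSpaceEnd R) j F) x)
      (pd (halfSpaceEnd R) j F x - EuclideanSpace.single j 1)).trans
      (mul_le_mul (h.second x hx hρ i j) (h.first x hx hρ j) (norm_nonneg _)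
        (div_nonneg h.nonneg (by positivity)))
    have b3 : |x i / ‖x‖| ≤ 1 := by
      rw [abs_div, abs_norm]
      exact div_le_one_of_le₀ (abs_coord_le x i) hx0.le
    rw [abs_mul, e2]
    refine (mul_le_of_le_one_right (abs_nonneg _) b3).trans ((abs_sub _ _).trans
      ((add_le_add b1 b2).trans (le_of_eq ?_)))
    field_simp
    ring
  refine (Finset.abs_sum_le_sum_abs _ _).trans ((Finset.sum_le_sum fun i hi =>
    (Finset.abs_sum_le_sum_abs _ _).trans (Finset.sum_le_sum (key i hi))).trans (le_of_eq ?_))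
  simp
  ring

end

/-! ### The fluxes over the hemisphere and the circle, up to `O(1/r)` -/

section

variable {R r : ℝ} {F : E3 → E3}

theorem hemisphereFlux_eq (F : E3 → E3) (R r : ℝ) : hemisphereFlux euclideanMetric R F r =
    quarterIntegral fun θ φ => massIntegrand R F (spherePt r θ φ) * (r ^ 2 * Real.sin θ) := rfl

theorem chartMetric_isometry (O : E3 ≃ₗᵢ[ℝ] E3) (hF : ContDiffOn ℝ ∞ F (halfSpaceEnd R)) {x : E3}
    (hx : x ∈ halfSpaceEnd R) (i j : Fin 3) :
    chartMetric euclideanMetric R (fun y => O (F y)) i j x =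
      chartMetric euclideanMetric R F i j x := by
  have hd : DifferentiableWithinAt ℝ F (halfSpaceEnd R) x := hF.differentiableOn (by simp) x hx
  have h : ∀ i, pd (halfSpaceEnd R) i (fun y => O (F y)) x = O (pd (halfSpaceEnd R) i F x) :=
    fun i => pd_clm (O.toContinuousLinearEquiv : E3 →L[ℝ] E3) hx hd i
  rw [chartMetric_euclidean, chartMetric_euclidean, h, h, O.inner_map_map]

theorem hemisphereFlux_isometry (O : E3 ≃ₗᵢ[ℝ] E3) (hF : ContDiffOn ℝ ∞ F (halfSpaceEnd R))
    (hR : 0 < R) (hr : R < r) :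
    hemisphereFlux euclideanMetric R (fun y => O (F y)) r =
      hemisphereFlux euclideanMetric R F r := by
  rw [hemisphereFlux_eq, hemisphereFlux_eq]
  refine quarterIntegral_congr fun θ hθ φ => ?_
  have hx : spherePt r θ φ ∈ halfSpaceEnd R := spherePt_mem hR hr hθ
  congr 1
  refine Finset.sum_congr rfl fun i _ => Finset.sum_congr rfl fun j _ => ?_
  rw [pd_congr hx (fun y hy => chartMetric_isometry O hF hy i j),
    pd_congr hx (fun y hy => chartMetric_isometry O hF hy j j)]

theorem spherePt_equator_mem (hR : 0 < R) (hr : R < r) (φ : ℝ) :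
    spherePt r (Real.pi / 2) φ ∈ halfSpaceEnd R :=
  spherePt_mem hR hr ⟨by positivity, le_rfl⟩

theorem circleFlux_isometry (O : E3 ≃ₗᵢ[ℝ] E3) (hF : ContDiffOn ℝ ∞ F (halfSpaceEnd R))
    (hR : 0 < R) (hr : R < r) :
    circleFlux euclideanMetric R (fun y => O (F y)) r = circleFlux euclideanMetric R F r := by
  rw [circleFlux, circleFlux]
  refine intervalIntegral.integral_congr fun φ _ => ?_
  simp only [chartMetric_isometry O hF (spherePt_equator_mem hR hr φ)]

theorem continuous_comp_equator {G : Type*} [TopologicalSpace G] {Q : E3 → G} (hR : 0 < R)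
    (hr : R < r) (hQ : ContinuousOn Q (halfSpaceEnd R)) :
    Continuous fun φ => Q (spherePt r (Real.pi / 2) φ) := by
  refine hQ.comp_continuous (f := fun φ => spherePt r (Real.pi / 2) φ) ?_
    fun φ => spherePt_equator_mem hR hr φ
  exact (continuous_spherePt r).comp (g := fun p : ℝ × ℝ => spherePt r p.1 p.2)
    (f := fun φ => (Real.pi / 2, φ)) (by fun_prop)

/-- The derivative of the height of `F` in the radial direction, at a point of the equator. -/
noncomputable def radialSlope (R : ℝ) (F : E3 → E3) (r φ : ℝ) : ℝ :=
  Real.cos φ * pd (halfSpaceEnd R) 0 F (spherePt r (Real.pi / 2) φ) 2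
    + Real.sin φ * pd (halfSpaceEnd R) 1 F (spherePt r (Real.pi / 2) φ) 2

theorem inner_curl_equator (φ : ℝ) :
    inner ℝ (curl R F (spherePt r (Real.pi / 2) φ)) (azimuthVec r (Real.pi / 2) φ) =
      r * (Real.cos φ * pd (halfSpaceEnd R) 2 F (spherePt r (Real.pi / 2) φ) 0
        + Real.sin φ * pd (halfSpaceEnd R) 2 F (spherePt r (Real.pi / 2) φ) 1
        - radialSlope R F r φ) := by
  simp [PiLp.inner_apply, Fin.sum_univ_three, curl, radialSlope]
  ring

variable {b ρ : ℝ}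

theorem IsAsymptoticIdentity.abs_hemisphereFlux_le (h : IsAsymptoticIdentity R F b ρ)
    (hr : ρ < r) :
    |hemisphereFlux euclideanMetric R F r + ∫ φ in (0 : ℝ)..(2 * Real.pi),
      inner ℝ (curl R F (spherePt r (Real.pi / 2) φ)) (azimuthVec r (Real.pi / 2) φ)|
      ≤ 18 * b ^ 2 / r * (Real.pi / 2) * (2 * Real.pi) := by
  have hR := h.pos
  have hRr := h.le.trans_lt hr
  have hr0 := hR.trans hRr
  have hc := contDiffOn_curl h.smooth
  have hQ := continuousOnQuarter_comp hR hRr (continuousOn_massIntegrand hR h.smooth)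
  have hK : ContinuousOn (fun x => -radialCurl R (curl R F) x) (halfSpaceEnd R) := by
    have h1 : ∀ i k, ContinuousOn (fun x => pd (halfSpaceEnd R) i (curl R F) x k)
        (halfSpaceEnd R) := fun i k => (contDiffOn_pd_coord hc i k).continuousOn
    have h2 : ∀ i : Fin 3, ContinuousOn (fun x : E3 => x i / ‖x‖) (halfSpaceEnd R) := fun i =>
      (EuclideanSpace.proj (𝕜 := ℝ) i).continuous.continuousOn.div continuous_norm.continuousOn
        fun x hx => (hR.trans hx.2).ne'
    exact (((((h1 1 2).sub (h1 2 1)).mul (h2 0)).add (((h1 2 0).sub (h1 0 2)).mul (h2 1))).add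
      (((h1 0 1).sub (h1 1 0)).mul (h2 2))).neg
  have hK' := continuousOnQuarter_comp hR hRr hK
  have hneg : quarterIntegral (fun θ φ =>
      -radialCurl R (curl R F) (spherePt r θ φ) * (r ^ 2 * Real.sin θ)) =
      -∫ φ in (0 : ℝ)..(2 * Real.pi),
        inner ℝ (curl R F (spherePt r (Real.pi / 2) φ)) (azimuthVec r (Real.pi / 2) φ) := by
    rw [← quarterIntegral_radialCurl hR hRr hc, quarterIntegral, quarterIntegral]
    simp only [neg_mul, intervalIntegral.integral_neg]
  rw [← sub_neg_eq_add, ← hneg, hemisphereFlux_eq, quarterIntegral_sub hQ hK']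
  refine abs_quarterIntegral_le fun θ hθ φ => ?_
  have hn := norm_spherePt θ φ hr0.le
  have h1 := h.abs_massIntegrand_add_le (spherePt_mem hR hRr hθ (φ := φ)) (by rw [hn]; exact hr.le)
  rw [hn] at h1
  rw [← sub_mul, sub_neg_eq_add, abs_mul, abs_mul, abs_of_nonneg (sq_nonneg r)]
  calc _ ≤ 18 * b ^ 2 / r ^ 3 * (r ^ 2 * 1) := mul_le_mul h1 (mul_le_mul_of_nonneg_left
        (Real.abs_sin_le_one θ) (sq_nonneg r)) (by positivity) (by positivity)
    _ = _ := by field_simp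

/-- The coefficient `g_{i3}` equals `∂₃ F_i + ∂_i F₃` up to a product of two terms `b / r`. The curl
contains the difference of these derivatives, which accounts for twice the slope. -/
theorem IsAsymptoticIdentity.abs_circleFlux_integrand_le (h : IsAsymptoticIdentity R F b ρ)
    (hr : ρ < r) (φ : ℝ) :
    |(∑ i, chartMetric euclideanMetric R F i 2 (spherePt r (Real.pi / 2) φ)
      * (spherePt r (Real.pi / 2) φ i / ‖spherePt r (Real.pi / 2) φ‖)) * r
      - (inner ℝ (curl R F (spherePt r (Real.pi / 2) φ)) (azimuthVec r (Real.pi / 2) φ)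
        + 2 * r * radialSlope R F r φ)| ≤ 2 * b ^ 2 / r := by
  have hR := h.pos
  have hRr := h.le.trans_lt hr
  have hr0 := hR.trans hRr
  have hn := norm_spherePt (Real.pi / 2) φ hr0.le
  have hx := spherePt_equator_mem hR hRr φ
  rw [inner_curl_equator, radialSlope]
  simp only [chartMetric_euclidean, Fin.sum_univ_three, hn, spherePt_zero, spherePt_one,
    spherePt_two, Real.sin_pi_div_two, Real.cos_pi_div_two]
  generalize hxx : spherePt r (Real.pi / 2) φ = x at *
  have key : ∀ i : Fin 3, i ≠ 2 → |inner ℝ (pd (halfSpaceEnd R) i F x) (pd (halfSpaceEnd R) 2 F x)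
      - (pd (halfSpaceEnd R) 2 F x i + pd (halfSpaceEnd R) i F x 2)| ≤ b ^ 2 / r ^ 2 := by
    intro i hi
    have e1 : ∀ (v : E3) (k : Fin 3), v k = inner ℝ v (EuclideanSpace.single k 1) := by
      intro v k; simp [EuclideanSpace.inner_single_right]
    have e3 : inner ℝ (EuclideanSpace.single i (1 : ℝ)) (EuclideanSpace.single (2 : Fin 3) (1 : ℝ))
        = (0 : ℝ) := by
      simp [EuclideanSpace.inner_single_right, Ne.symm hi]
    have e2 : inner ℝ (pd (halfSpaceEnd R) i F x) (pd (halfSpaceEnd R) 2 F x)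
        - (pd (halfSpaceEnd R) 2 F x i + pd (halfSpaceEnd R) i F x 2) =
        inner ℝ (pd (halfSpaceEnd R) i F x - EuclideanSpace.single i 1)
          (pd (halfSpaceEnd R) 2 F x - EuclideanSpace.single 2 1) := by
      rw [e1 _ i, e1 _ 2, inner_sub_left, inner_sub_right, inner_sub_right, e3,
        real_inner_comm (EuclideanSpace.single i 1)]
      ring
    rw [e2]
    refine (abs_real_inner_le_norm _ _).trans ((mul_le_mul (h.first x hx (by rw [hn]; exact hr.le) i)
      (h.first x hx (by rw [hn]; exact hr.le) 2) (norm_nonneg _)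
      (div_nonneg h.nonneg (by positivity))).trans (le_of_eq ?_))
    rw [hn]; field_simp
  have k0 := key 0 (by decide)
  have k1 := key 1 (by decide)
  set u := inner ℝ (pd (halfSpaceEnd R) 0 F x) (pd (halfSpaceEnd R) 2 F x)
    - (pd (halfSpaceEnd R) 2 F x 0 + pd (halfSpaceEnd R) 0 F x 2) with hu
  set v := inner ℝ (pd (halfSpaceEnd R) 1 F x) (pd (halfSpaceEnd R) 2 F x)
    - (pd (halfSpaceEnd R) 2 F x 1 + pd (halfSpaceEnd R) 1 F x 2) with hv
  have e : ∀ A B C P Q P' Q' : ℝ, u = A - (P + P') → v = B - (Q + Q') →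
      (A * (r * (1 * Real.cos φ) / r) + B * (r * (1 * Real.sin φ) / r) + C * (r * 0 / r)) * r
      - (r * (Real.cos φ * P + Real.sin φ * Q - (Real.cos φ * P' + Real.sin φ * Q'))
        + 2 * r * (Real.cos φ * P' + Real.sin φ * Q')) =
      r * (Real.cos φ * u + Real.sin φ * v) := by
    intro A B C P Q P' Q' h1 h2
    rw [h1, h2]; field_simp; ring
  rw [e _ _ _ _ _ _ _ hu hv, abs_mul, abs_of_pos hr0]
  have h1 : |Real.cos φ * u + Real.sin φ * v| ≤ b ^ 2 / r ^ 2 + b ^ 2 / r ^ 2 := by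
    refine (abs_add_le _ _).trans (add_le_add ?_ ?_)
    · rw [abs_mul]
      exact (mul_le_of_le_one_left (abs_nonneg _) (Real.abs_cos_le_one φ)).trans k0
    · rw [abs_mul]
      exact (mul_le_of_le_one_left (abs_nonneg _) (Real.abs_sin_le_one φ)).trans k1
  refine (mul_le_mul_of_nonneg_left h1 hr0.le).trans (le_of_eq ?_)
  field_simp
  ring

theorem continuous_inner_curl_equator (hR : 0 < R) (hr : R < r)
    (hF : ContDiffOn ℝ ∞ F (halfSpaceEnd R)) : Continuous fun φ : ℝ => (inner ℝ
      (curl R F (spherePt r (Real.pi / 2) φ)) (azimuthVec r (Real.pi / 2) φ) : ℝ) := by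
  have h1 := continuous_comp_equator hR hr (contDiffOn_curl hF).continuousOn
  have h2 : Continuous fun φ : ℝ => azimuthVec r (Real.pi / 2) φ :=
    (continuous_azimuthVec r).comp (g := fun p : ℝ × ℝ => azimuthVec r p.1 p.2)
      (f := fun φ => (Real.pi / 2, φ)) (by fun_prop)
  exact h1.inner (𝕜 := ℝ) h2

theorem continuous_radialSlope (hR : 0 < R) (hr : R < r)
    (hF : ContDiffOn ℝ ∞ F (halfSpaceEnd R)) : Continuous (radialSlope R F r) :=
  (Real.continuous_cos.mul (continuous_comp_equator hR hr (contDiffOn_pd_coord hF 0 2).continuousOn)).add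
    (Real.continuous_sin.mul (continuous_comp_equator hR hr (contDiffOn_pd_coord hF 1 2).continuousOn))

theorem continuous_circleFlux_integrand (hR : 0 < R) (hr : R < r)
    (hF : ContDiffOn ℝ ∞ F (halfSpaceEnd R)) : Continuous fun φ =>
      (∑ i, chartMetric euclideanMetric R F i 2 (spherePt r (Real.pi / 2) φ)
      * (spherePt r (Real.pi / 2) φ i / ‖spherePt r (Real.pi / 2) φ‖)) * r := by
  refine (continuous_finsetSum _ fun i _ => (continuous_comp_equator hR hr
    (contDiffOn_chartMetric hF i 2).continuousOn).mul ?_).mul continuous_const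
  exact continuous_comp_equator (Q := fun x : E3 => x i / ‖x‖) hR hr
    ((EuclideanSpace.proj (𝕜 := ℝ) i).continuous.continuousOn.div continuous_norm.continuousOn
        fun x hx => (hR.trans hx.2).ne')

/-- The boundary integrals of the curl from the hemisphere and from the circle have opposite signs
and cancel. The combination of the two fluxes in the mass is made for this cancellation. -/
theorem IsAsymptoticIdentity.exists_flux_bound (h : IsAsymptoticIdentity R F b ρ) :
    ∃ C, ∀ r, ρ < r → |hemisphereFlux euclideanMetric R F r + circleFlux euclideanMetric R F r
      - 2 * r * ∫ φ in (0 : ℝ)..(2 * Real.pi), radialSlope R F r φ| ≤ C / r := by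
  refine ⟨18 * b ^ 2 * (Real.pi / 2) * (2 * Real.pi) + 2 * b ^ 2 * (2 * Real.pi), fun r hr => ?_⟩
  have hR := h.pos
  have hRr := h.le.trans_lt hr
  have hr0 := hR.trans hRr
  have h1 := h.abs_hemisphereFlux_le hr
  have i1 := (continuous_inner_curl_equator hR hRr h.smooth).intervalIntegrable
    (μ := MeasureTheory.volume) 0 (2 * Real.pi)
  have i2 : IntervalIntegrable (fun φ => 2 * r * radialSlope R F r φ) MeasureTheory.volume 0
    (2 * Real.pi) := (continuous_const.mul (continuous_radialSlope hR hRr h.smooth)).intervalIntegrable _ _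
  have i3 := (continuous_circleFlux_integrand hR hRr h.smooth).intervalIntegrable
    (μ := MeasureTheory.volume) 0 (2 * Real.pi)
  have h2 := intervalIntegral.norm_integral_le_of_norm_le_const (a := 0) (b := 2 * Real.pi)
    (f := fun φ => (∑ i, chartMetric euclideanMetric R F i 2 (spherePt r (Real.pi / 2) φ)
      * (spherePt r (Real.pi / 2) φ i / ‖spherePt r (Real.pi / 2) φ‖)) * r
      - (inner ℝ (curl R F (spherePt r (Real.pi / 2) φ)) (azimuthVec r (Real.pi / 2) φ)
        + 2 * r * radialSlope R F r φ))
    fun φ _ => h.abs_circleFlux_integrand_le hr φ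
  rw [intervalIntegral.integral_sub i3 (i1.add i2), intervalIntegral.integral_add i1 i2,
    intervalIntegral.integral_const_mul, sub_zero, abs_of_pos (by positivity : 0 < 2 * Real.pi),
    Real.norm_eq_abs] at h2
  have e : ∀ a c k s : ℝ, a + c - s = (a + k) + (c - (k + s)) := fun a c k s => by ring
  rw [circleFlux, e _ _ (∫ φ in (0 : ℝ)..(2 * Real.pi),
      inner ℝ (curl R F (spherePt r (Real.pi / 2) φ)) (azimuthVec r (Real.pi / 2) φ))]
  refine (abs_add_le _ _).trans ((add_le_add h1 h2).trans (le_of_eq ?_))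
  field_simp

end

/-! ### The boundary of a chart at infinity -/

theorem isPreconnected_exterior {ρ : ℝ} (hρ : 0 ≤ ρ) : IsPreconnected {h : E2 | ρ < ‖h‖} := by
  have h1 : {h : E2 | ρ < ‖h‖} = (fun p : ℝ × ℝ => polarPt p.1 p.2) '' (Ioi ρ ×ˢ univ) := by
    ext h
    constructor
    · intro hh
      obtain ⟨φ, -, hφ⟩ := exists_polarPt h
      exact ⟨(‖h‖, φ), ⟨hh, mem_univ _⟩, hφ.symm⟩
    · rintro ⟨⟨r, φ⟩, ⟨hr, -⟩, rfl⟩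
      change ρ < ‖polarPt r φ‖
      rw [norm_polarPt (hρ.trans (le_of_lt hr))]
      exact hr
  rw [h1]
  refine (isPreconnected_Ioi.prod isPreconnected_univ).image _ (Continuous.continuousOn ?_)
  simp only [polarPt_eq_single]
  fun_prop

section

variable {R ρ b : ℝ} {F : E3 → E3}

theorem norm_lift3_zero (h : E2) : ‖lift3 h 0‖ = ‖h‖ := by
  have := norm_lift3_sq h 0
  exact (pow_left_inj₀ (norm_nonneg _) (norm_nonneg _) two_ne_zero).1 (by linarith)

theorem lift3_zero_mem {h : E2} (hh : R < ‖h‖) : lift3 h 0 ∈ halfSpaceEnd R :=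
  ⟨by simp, by rwa [norm_lift3_zero]⟩

theorem hasFDerivAt_boundary (hF : ContDiffOn ℝ ∞ F (halfSpaceEnd R)) {h : E2} (hh : R < ‖h‖) :
    HasFDerivAt (fun h => F (lift3 h 0))
      ((fderivWithin ℝ F (halfSpaceEnd R) (lift3 h 0)).comp incl2) h := by
  have h1 : HasFDerivWithinAt F (fderivWithin ℝ F (halfSpaceEnd R) (lift3 h 0)) (halfSpaceEnd R)
      (incl2 h) := (hF.differentiableOn (by simp) _ (lift3_zero_mem hh)).hasFDerivWithinAt
  have h2 : HasFDerivWithinAt (fun h => F (incl2 h))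
      ((fderivWithin ℝ F (halfSpaceEnd R) (lift3 h 0)).comp incl2) {h : E2 | R < ‖h‖} h :=
    h1.comp h incl2.hasFDerivAt.hasFDerivWithinAt fun k hk => lift3_zero_mem hk
  exact h2.hasFDerivAt ((isOpen_exterior R).mem_nhds hh)

theorem IsAsymptoticIdentity.norm_fderivWithin_sub_le (h : IsAsymptoticIdentity R F b ρ) {x : E3}
    (hx : x ∈ halfSpaceEnd R) (hxρ : ρ ≤ ‖x‖) :
    ‖fderivWithin ℝ F (halfSpaceEnd R) x - ContinuousLinearMap.id ℝ E3‖ ≤ 3 * (b / ‖x‖) := by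
  have hd : DifferentiableWithinAt ℝ F (halfSpaceEnd R) x :=
    h.smooth.differentiableOn (by simp) x hx
  have hu := uniqueDiffOn_halfSpaceEnd R x hx
  have h1 : fderivWithin ℝ (fun y => F y - y) (halfSpaceEnd R) x =
      fderivWithin ℝ F (halfSpaceEnd R) x - ContinuousLinearMap.id ℝ E3 := by
    rw [fderivWithin_fun_sub hu hd differentiableWithinAt_fun_id, fderivWithin_fun_id hu]
  rw [← h1]
  refine norm_fderivWithin_le fun i => ?_
  have h2 : pd (halfSpaceEnd R) i (fun y => F y - y) x =
      pd (halfSpaceEnd R) i F x - EuclideanSpace.single i 1 := by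
    rw [pd, h1]; rfl
  rw [h2]
  exact h.first x hx hxρ i

theorem IsAsymptoticIdentity.norm_fderiv_boundary_le (h : IsAsymptoticIdentity R F b ρ) {k : E2}
    (hk : ρ < ‖k‖) :
    ‖(fderivWithin ℝ F (halfSpaceEnd R) (lift3 k 0)).comp incl2 - incl2‖ ≤ 3 * b / ‖k‖ := by
  have h1 := h.norm_fderivWithin_sub_le (lift3_zero_mem (h.le.trans_lt hk))
    (by rw [norm_lift3_zero]; exact hk.le)
  rw [norm_lift3_zero] at h1
  have h2 : (fderivWithin ℝ F (halfSpaceEnd R) (lift3 k 0)).comp incl2 - incl2 =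
      (fderivWithin ℝ F (halfSpaceEnd R) (lift3 k 0) - ContinuousLinearMap.id ℝ E3).comp incl2 := by
    ext v; simp
  have h3 : ‖incl2‖ ≤ 1 := ContinuousLinearMap.opNorm_le_bound _ zero_le_one fun v => by
    rw [incl2_apply, norm_lift3_zero, one_mul]
  rw [h2]
  refine (ContinuousLinearMap.opNorm_comp_le _ _).trans
    ((mul_le_of_le_one_right (norm_nonneg _) h3).trans (h1.trans (le_of_eq (by ring))))

/-- The derivative of the displacement is `O(1/|k|)`, so the displacement is logarithmic. It need
not be bounded, and sublinear growth is all that is used. -/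
theorem IsAsymptoticIdentity.exists_boundary_bound (h : IsAsymptoticIdentity R F b ρ) {ε : ℝ}
    (hε : 0 < ε) : ∃ K, 0 ≤ K ∧ ∀ k : E2, ρ < ‖k‖ → ‖F (lift3 k 0) - lift3 k 0‖ ≤ ε * ‖k‖ + K := by
  have hρ : 0 < ρ := h.pos.trans_le h.le
  have hd : ∀ k : E2, ρ < ‖k‖ → HasFDerivAt (fun k => F (lift3 k 0) - lift3 k 0)
      ((fderivWithin ℝ F (halfSpaceEnd R) (lift3 k 0)).comp incl2 - incl2) k := fun k hk =>
    (hasFDerivAt_boundary h.smooth (h.le.trans_lt hk)).sub incl2.hasFDerivAt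
  refine exists_sublinear_bound (c := 3 * b) hρ (fun k hk => (hd k hk).differentiableAt)
    (fun k hk => ?_) hε
  rw [(hd k hk).fderiv]
  have hk0 : 0 < ‖k‖ := hρ.trans hk
  have := mul_le_mul_of_nonneg_left (h.norm_fderiv_boundary_le hk) hk0.le
  rwa [mul_div_cancel₀ _ hk0.ne'] at this

end

/-! ### Charts map the boundary to the boundary -/

section

variable {S W Ω Mhat : Set E3} {μ : E3 → E3} {R : ℝ} {Φ : E3 → E3}

theorem IsInnerSide.mem_nhds_component (hW : IsInnerSide S μ W) (hΩ : IsCompact Ω)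
    (hM : Mhat ∈ componentsOf (regionOf S μ \ Ω)) {p : E3} (hp : p ∈ Mhat) (hpW : p ∈ W) :
    Mhat ∈ 𝓝 p := by
  obtain ⟨q, hq, rfl⟩ := hM
  have hpΩ := (connectedComponentIn_subset _ _ hp).2
  obtain ⟨ε, hε, hball⟩ := Metric.isOpen_iff.1 (hW.isOpen.sdiff hΩ.isClosed) p ⟨hpW, hpΩ⟩
  refine Filter.mem_of_superset (Metric.ball_mem_nhds p hε) ?_
  rw [connectedComponentIn_eq hp]
  refine (convex_ball p ε).isPreconnected.subset_connectedComponentIn (Metric.mem_ball_self hε) ?_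
  refine hball.trans (sdiff_subset_sdiff_left ?_)
  rw [hW.region_eq]
  exact subset_union_right

/-- If a boundary point were mapped into `W`, the inverse chart would be smooth in a full
neighbourhood and its third coordinate would be critical at the minimum `0`. Along the image of the
vertical ray this coordinate increases at unit rate. -/
theorem IsAFChart.map_boundary (hW : IsInnerSide S μ W) (hΩ : IsCompact Ω)
    (hM : Mhat ∈ componentsOf (regionOf S μ \ Ω))
    (h : IsAFChart (regionOf S μ) euclideanMetric Mhat R Φ) {x : E3} (hx : x ∈ halfSpaceEnd R)
    (hx2 : x 2 = 0) : Φ x ∈ S := by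
  obtain ⟨Ξ, hinv, hΞ⟩ := h.smooth_inv
  have hΦx := h.bijOn.mapsTo hx
  obtain ⟨q, hq, hMq⟩ := id hM
  have hreg : Φ x ∈ regionOf S μ := (connectedComponentIn_subset _ _ (hMq ▸ hΦx)).1
  rw [hW.region_eq] at hreg
  refine hreg.resolve_right fun hxW => ?_
  have hnhds := hW.mem_nhds_component hΩ hM hΦx hxW
  have hd : DifferentiableAt ℝ (fun y => Ξ y 2) (Φ x) :=
    (EuclideanSpace.proj (𝕜 := ℝ) (2 : Fin 3)).differentiableAt.comp (Φ x)
      ((hΞ.contDiffAt hnhds).differentiableAt (by simp))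
  have hmin : IsLocalMin (fun y => Ξ y 2) (Φ x) := by
    filter_upwards [hnhds] with y hy
    obtain ⟨z, hz, rfl⟩ := h.bijOn.surjOn hy
    change Ξ (Φ x) 2 ≤ Ξ (Φ z) 2
    rw [hinv.1 hx, hinv.1 hz, hx2]
    exact hz.1
  have h0 := hmin.fderiv_eq_zero
  have hline : HasDerivWithinAt (fun t : ℝ => x + t • e3) e3 (Ici 0) 0 := by
    simpa using (((hasDerivAt_id (0 : ℝ)).smul_const e3).const_add x).hasDerivWithinAt
  have hΦd := (h.smooth.differentiableOn (by simp) x hx).hasFDerivWithinAt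
  have hc : HasDerivWithinAt (fun t : ℝ => Φ (x + t • e3))
      (fderivWithin ℝ Φ (halfSpaceEnd R) x e3) (Ici 0) 0 :=
    HasFDerivWithinAt.comp_hasDerivWithinAt (t := halfSpaceEnd R) (0 : ℝ) (by simpa using hΦd) hline
      fun t ht => add_smul_e3_mem hx ht
  have hc2 : HasDerivWithinAt (fun t : ℝ => Ξ (Φ (x + t • e3)) 2) 0 (Ici 0) 0 := by
    have := HasFDerivAt.comp_hasDerivWithinAt (0 : ℝ) (l := fun y => Ξ y 2)
      (by simpa using hd.hasFDerivAt) hc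
    simp only [h0, _root_.zero_apply] at this
    exact this
  have hc3 : HasDerivWithinAt (fun t : ℝ => t) 0 (Ici 0) (0 : ℝ) := by
    refine hc2.congr (fun t ht => ?_) ?_
    · rw [hinv.1 (add_smul_e3_mem hx ht)]; simp [hx2]
    · rw [hinv.1 (add_smul_e3_mem hx le_rfl)]; simp [hx2]
  have := (uniqueDiffOn_Ici (0 : ℝ) 0 self_mem_Ici).eq_deriv _ hc3
    (hasDerivAt_id (0 : ℝ)).hasDerivWithinAt
  exact zero_ne_one this

/-- If an interior point were mapped to `S`, the defining function composed with the chart would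
have a maximum there. The derivative of the chart is surjective, so the defining function would be
critical on `S`. -/
theorem IsAFChart.notMem_surface_of_pos (hW : IsInnerSide S μ W)
    (hM : Mhat ∈ componentsOf (regionOf S μ \ Ω))
    (h : IsAFChart (regionOf S μ) euclideanMetric Mhat R Φ) {x : E3} (hx : x ∈ halfSpaceEnd R)
    (hx2 : 0 < x 2) : Φ x ∉ S := by
  intro hxS
  obtain ⟨Ξ, hinv, hΞ⟩ := h.smooth_inv
  have hMr : Mhat ⊆ regionOf S μ := by
    obtain ⟨q, hq, rfl⟩ := hM
    exact (connectedComponentIn_subset _ _).trans sdiff_subset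
  have hX : halfSpaceEnd R ∈ 𝓝 x :=
    mem_interior_iff_mem_nhds.1 (subset_interior_halfSpaceEnd R ⟨hx2, hx.2⟩)
  have hΦd := ((h.smooth.contDiffAt hX).differentiableAt (by simp)).hasFDerivAt
  have hΞd := (hΞ.differentiableOn (by simp) _ (h.bijOn.mapsTo hx)).hasFDerivWithinAt
  have hcomp : HasFDerivAt (fun y => Ξ (Φ y))
      ((fderivWithin ℝ Ξ Mhat (Φ x)).comp (fderiv ℝ Φ x)) x :=
    (hΞd.comp x hΦd.hasFDerivWithinAt h.bijOn.mapsTo).hasFDerivAt hX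
  have hid : HasFDerivAt (fun y => Ξ (Φ y)) (ContinuousLinearMap.id ℝ E3) x :=
    (hasFDerivAt_id x).congr_of_eventuallyEq (by filter_upwards [hX] with y hy using hinv.1 hy)
  have heq := hcomp.unique hid
  have hinj : Function.Injective (fderiv ℝ Φ x : E3 →ₗ[ℝ] E3) := by
    intro v w hvw
    have h1 := DFunLike.congr_fun heq v
    have h2 := DFunLike.congr_fun heq w
    have hvw' : fderiv ℝ Φ x v = fderiv ℝ Φ x w := hvw
    simp only [ContinuousLinearMap.comp_apply, ContinuousLinearMap.id_apply] at h1 h2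
    rw [← h1, ← h2, hvw']
  have hsurj := LinearMap.injective_iff_surjective.1 hinj
  obtain ⟨U, f, hxU, hf⟩ := hW.exists_defining _ hxS
  have hUn := hf.isOpen.mem_nhds hxU
  have hfd := ((hf.smooth.contDiffAt hUn).differentiableAt (by simp)).hasFDerivAt
  have hmax : IsLocalMax (fun y => f (Φ y)) x := by
    filter_upwards [hX, hΦd.continuousAt.preimage_mem_nhds hUn] with y hy hyU
    change f (Φ y) ≤ f (Φ x)
    rw [(hf.mem_surface _ hxU).1 hxS]
    have hr := hMr (h.bijOn.mapsTo hy)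
    rw [hW.region_eq] at hr
    rcases hr with hr | hr
    · exact ((hf.mem_surface _ hyU).1 hr).le
    · exact ((hf.mem_inner _ hyU).1 hr).le
  have h0 := hmax.hasFDerivAt_eq_zero (hfd.comp x hΦd)
  refine hf.gradient_ne _ ⟨hxS, hxU⟩ ?_
  have hz : fderiv ℝ f (Φ x) = 0 := by
    ext v
    obtain ⟨w, rfl⟩ := hsurj v
    exact DFunLike.congr_fun h0 w
  rw [gradient, hz, map_zero]

end

theorem IsAsymptoticIdentity.mono {R b ρ ρ' : ℝ} {F : E3 → E3} (h : IsAsymptoticIdentity R F b ρ)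
    (hρ : ρ ≤ ρ') : IsAsymptoticIdentity R F b ρ' :=
  ⟨h.pos, h.le.trans hρ, h.nonneg, h.smooth, fun x hx hxρ => h.first x hx (hρ.trans hxρ),
    fun x hx hxρ => h.second x hx (hρ.trans hxρ)⟩

/-- The map `F` is asymptotic to the identity, and after the rotation `B` it maps the plane to the
graph of `ψ` and the points above the plane to points above the graph. -/
structure IsBoundaryTrace (R : ℝ) (F : E3 → E3) (b ρ : ℝ) (B : E3 ≃ₗᵢ[ℝ] E3) (R₀ : ℝ) (ψ : E2 → ℝ)
    (c : ℝ) : Prop where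
  asymptotic : IsAsymptoticIdentity R F b ρ
  pos : 0 < R₀
  smooth : ∀ h : E2, R₀ < ‖h‖ → ContDiffAt ℝ 2 ψ h
  decay : ∀ h : E2, R₀ < ‖h‖ →
    ‖h‖ * ‖fderiv ℝ ψ h‖ + ‖h‖ ^ 2 * ‖fderiv ℝ (fderiv ℝ ψ) h‖ ≤ c
  mem : ∀ k : E2, ρ < ‖k‖ → R₀ < ‖proj2 (B (F (lift3 k 0)))‖
  coord : ∀ k : E2, ρ < ‖k‖ → B (F (lift3 k 0)) 2 = ψ (proj2 (B (F (lift3 k 0))))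
  above : ∀ k : E2, ρ < ‖k‖ → ∀ᶠ t : ℝ in 𝓝[>] 0,
    ψ (proj2 (B (F (lift3 k 0 + t • e3)))) ≤ B (F (lift3 k 0 + t • e3)) 2

section

variable {S W Ω Ω' Shat Mhat : Set E3} {μ : E3 → E3} {R R₀ b ρ : ℝ} {Φ : E3 → E3}
  {A O : E3 ≃ₗᵢ[ℝ] E3} {ψ : E2 → ℝ}

/-- The image of the exterior of a disc is a connected subset of `S - Ω`. It contains a far point of
`Shat`, so it lies in this component. -/
theorem IsAFChart.exists_boundary_mem_end (hW : IsInnerSide S μ W) (hΩ : IsCompact Ω)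
    (hC : Shat ∈ componentsOf (S \ Ω)) (hG : IsGraphEnd μ Shat A R₀ ψ) (hΩ' : IsCompact Ω')
    (hM : Mhat ∈ componentsOf (regionOf S μ \ Ω'))
    (h : IsAFChart (regionOf S μ) euclideanMetric Mhat R Φ)
    (hb : Bornology.IsBounded (Shat \ Mhat))
    (hF : IsAsymptoticIdentity R (fun x => O.symm (Φ x)) b ρ) :
    ∃ ρ', ρ ≤ ρ' ∧ ∀ k : E2, ρ' < ‖k‖ → Φ (lift3 k 0) ∈ Shat := by
  obtain ⟨C, hC0, hCb⟩ := hF.exists_boundary_bound (ε := 1 / 2) (by norm_num)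
  obtain ⟨K₀, hK₀⟩ := hΩ.isBounded.exists_norm_le
  obtain ⟨K₁, hK₁⟩ := hb.exists_norm_le
  obtain ⟨c, hc, hdec⟩ := h.exists_isDecaying
  obtain ⟨K, L, hL, hKL⟩ := hdec.exists_growth hc
  have hR := h.pos
  have hρ : 0 < ρ := hR.trans_le hF.le
  set ρ' := max ρ (2 * (K₀ + C))
  have hρ' : 0 < ρ' := hρ.trans_le (le_max_left _ _)
  have hsub : (fun k : E2 => Φ (lift3 k 0)) '' {k | ρ' < ‖k‖} ⊆ S \ Ω := by
    rintro _ ⟨k, hk, rfl⟩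
    have hkρ : ρ < ‖k‖ := (le_max_left _ _).trans_lt hk
    have hk2 : 2 * (K₀ + C) < ‖k‖ := (le_max_right _ _).trans_lt hk
    refine ⟨h.map_boundary hW hΩ' hM (lift3_zero_mem (hF.le.trans_lt hkρ)) (by simp), fun hmem => ?_⟩
    have h1 := hCb k hkρ
    have h2 := norm_sub_norm_le (lift3 k 0) (O.symm (Φ (lift3 k 0)))
    rw [norm_sub_rev, norm_lift3_zero, O.symm.norm_map] at h2
    have h3 := hK₀ _ hmem
    linarith
  have hcont : ContinuousOn (fun k : E2 => Φ (lift3 k 0)) {k | ρ' < ‖k‖} := fun k hk =>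
    (hasFDerivAt_boundary h.smooth ((hF.le.trans (le_max_left _ _)).trans_lt
      hk)).continuousAt.continuousWithinAt
  have hpre := (isPreconnected_exterior hρ'.le).image _ hcont
  refine ⟨ρ', le_max_left _ _, fun k hk => ?_⟩
  -- A point of `Shat` of norm at least `m` is in `Mhat` because of `K₁`, and its preimage is beyond
  -- `ρ'` because of the growth bound.
  obtain ⟨m, hm⟩ : ∃ m : ℝ, m = max (max R₀ K₁) (K + L * ρ') + 1 := ⟨_, rfl⟩
  have hm1 : R₀ < m := by
    have := (le_max_left R₀ K₁).trans (le_max_left _ (K + L * ρ')); linarith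
  have hm2 : K₁ < m := by
    have := (le_max_right R₀ K₁).trans (le_max_left _ (K + L * ρ')); linarith
  have hm3 : K + L * ρ' < m := by
    have := le_max_right (max R₀ K₁) (K + L * ρ'); linarith
  have hn : ‖polarPt m 0‖ = m := norm_polarPt (hG.pos.trans hm1).le 0
  obtain ⟨q, hqC, hqn⟩ : ∃ q ∈ Shat, m ≤ ‖q‖ := by
    refine ⟨_, hG.mem (h := polarPt m 0) (by rwa [hn]), ?_⟩
    rw [A.norm_map]
    exact hn.ge.trans (norm_le_norm_lift3 _ _)
  have hqM : q ∈ Mhat := by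
    by_contra hq
    have := hK₁ q ⟨hqC, hq⟩
    linarith
  obtain ⟨x, hx, hxq⟩ := h.bijOn.surjOn hqM
  obtain ⟨p, hp, rfl⟩ := hC
  have hqS : q ∈ S := (connectedComponentIn_subset _ _ hqC).1
  have hx2 : x 2 = 0 := by
    by_contra hne
    exact h.notMem_surface_of_pos hW hM hx (lt_of_le_of_ne hx.1 (Ne.symm hne)) (hxq ▸ hqS)
  have hxl : x = lift3 (proj2 x) 0 := E3.ext (by simp) (by simp) (by simpa using hx2)
  have hxρ : ρ' < ‖proj2 x‖ := by
    rw [← norm_lift3_zero, ← hxl]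
    by_contra! hle
    have h1 := hKL x hx
    have h2 := mul_le_mul_of_nonneg_left hle hL
    rw [hxq] at h1
    linarith
  have hqi : q ∈ (fun k : E2 => Φ (lift3 k 0)) '' {k | ρ' < ‖k‖} :=
    ⟨proj2 x, hxρ, by change Φ (lift3 (proj2 x) 0) = q; rw [← hxl, hxq]⟩
  rw [connectedComponentIn_eq hqC]
  exact hpre.subset_connectedComponentIn hqi hsub ⟨k, hk, rfl⟩

/-- The rotation `B` is `A⁻¹ O`, so that `B ∘ F` is the chart seen in the coordinates in which the
end is a graph. -/
theorem IsAFChart.exists_isBoundaryTrace (hW : IsInnerSide S μ W) (hΩ : IsCompact Ω)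
    (hC : Shat ∈ componentsOf (S \ Ω)) (hG : IsGraphEnd μ Shat A R₀ ψ) (hΩ' : IsCompact Ω')
    (hM : Mhat ∈ componentsOf (regionOf S μ \ Ω'))
    (h : IsAFChart (regionOf S μ) euclideanMetric Mhat R Φ)
    (hb : Bornology.IsBounded (Shat \ Mhat)) :
    ∃ (O B : E3 ≃ₗᵢ[ℝ] E3) (b ρ c : ℝ),
      IsBoundaryTrace R (fun x => O.symm (Φ x)) b ρ B R₀ ψ c := by
  obtain ⟨c, hc, hdec⟩ := h.exists_isDecaying
  obtain ⟨O, b, ρ, hF⟩ := hdec.exists_isometry hc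
  obtain ⟨ρ', hρ', hmem⟩ := h.exists_boundary_mem_end hW hΩ hC hG hΩ' hM hb hF
  obtain ⟨c', hc'⟩ := hG.decay
  have hB : ∀ x, (O.trans A.symm) (O.symm x) = A.symm x := fun x => by simp
  have hCS : Shat ⊆ S := by
    obtain ⟨p, hp, rfl⟩ := hC
    exact (connectedComponentIn_subset _ _).trans sdiff_subset
  have hMr : Mhat ⊆ regionOf S μ := by
    obtain ⟨q, hq, rfl⟩ := hM
    exact (connectedComponentIn_subset _ _).trans sdiff_subset
  refine ⟨O, O.trans A.symm, b, ρ', c', hF.mono hρ', hG.pos, fun x hx => hG.contDiffAt hx, hc',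
    fun k hk => ?_, fun k hk => ?_, fun k hk => ?_⟩
  · simp only [hB]
    exact (hG.mem_iff.1 (hmem k hk)).1
  · simp only [hB]
    exact (hG.mem_iff.1 (hmem k hk)).2
  · simp only [hB]
    have hk' := hG.mem_iff.1 (hmem k hk)
    have hx : lift3 k 0 ∈ halfSpaceEnd R := lift3_zero_mem ((hF.le.trans hρ').trans_lt hk)
    have hpt : A.symm (Φ (lift3 k 0)) = lift3 (proj2 (A.symm (Φ (lift3 k 0))))
        (ψ (proj2 (A.symm (Φ (lift3 k 0))))) := by
      rw [← hk'.2]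
      exact E3.ext (by simp) (by simp) (by simp)
    have hev := hG.eventually_above hW hCS hk'.1
    rw [← hpt] at hev
    have hin : ∀ᶠ t : ℝ in 𝓝[>] 0, lift3 k 0 + t • e3 ∈ halfSpaceEnd R := by
      filter_upwards [self_mem_nhdsWithin] with t ht using add_smul_e3_mem hx (le_of_lt ht)
    have ht : Tendsto (fun t : ℝ => A.symm (Φ (lift3 k 0 + t • e3))) (𝓝[>] 0)
        (𝓝 (A.symm (Φ (lift3 k 0)))) := by
      refine (A.symm.continuous.tendsto _).comp ((h.smooth.continuousOn _ hx).tendsto.comp ?_)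
      exact tendsto_nhdsWithin_iff.2
        ⟨(tendsto_add_smul_e3 (lift3 k 0)).mono_left nhdsWithin_le_nhds, hin⟩
    filter_upwards [ht.eventually hev, hin] with t h1 h2
    rw [A.apply_symm_apply] at h1
    have hr := hMr (h.bijOn.mapsTo h2)
    rw [hW.region_eq] at hr
    rcases hr with hr | hr
    · exact (h1.2.1 hr).ge
    · exact (h1.1.1 hr).le

end

/-! ### The asymptotic position of the chart -/

theorem le_of_forall_mul_le {a b K : ℝ} (h : ∀ t : ℝ, 1 < t → a * t ≤ b * t + K) : a ≤ b := by
  by_contra! hlt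
  have hab : 0 < a - b := sub_pos.2 hlt
  have h1 := h (max 1 (K / (a - b)) + 1) (by linarith [le_max_left 1 (K / (a - b))])
  have h2 : K / (a - b) < max 1 (K / (a - b)) + 1 := by linarith [le_max_right 1 (K / (a - b))]
  rw [div_lt_iff₀ hab] at h2
  linarith

section

variable {R b ρ R₀ c : ℝ} {F : E3 → E3} {B : E3 ≃ₗᵢ[ℝ] E3} {ψ : E2 → ℝ}

namespace IsBoundaryTrace

theorem decay_nonneg (h : IsBoundaryTrace R F b ρ B R₀ ψ c) : 0 ≤ c := by
  have h1 := h.decay (polarPt (R₀ + 1) 0)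
    (by rw [norm_polarPt (by linarith [h.pos])]; linarith)
  exact le_trans (by positivity) h1

theorem norm_fderiv_le (h : IsBoundaryTrace R F b ρ B R₀ ψ c) {x : E2} (hx : R₀ < ‖x‖) :
    ‖fderiv ℝ ψ x‖ ≤ c / ‖x‖ := by
  rw [le_div_iff₀ (h.pos.trans hx), mul_comm]
  exact (le_add_of_nonneg_right (by positivity)).trans (h.decay x hx)

theorem exists_sublinear (h : IsBoundaryTrace R F b ρ B R₀ ψ c) {ε : ℝ} (hε : 0 < ε) :
    ∃ K, 0 ≤ K ∧ ∀ x : E2, R₀ < ‖x‖ → |ψ x| ≤ ε * ‖x‖ + K :=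
  exists_sublinear_bound (c := c) h.pos (fun x hx => (h.smooth x hx).differentiableAt (by simp))
    (fun x hx => (le_add_of_nonneg_right (by positivity)).trans (h.decay x hx)) hε

theorem exists_norm_le (h : IsBoundaryTrace R F b ρ B R₀ ψ c) :
    ∃ K, 0 ≤ K ∧ ∀ k : E2, ρ < ‖k‖ → ‖k‖ ≤ 4 * ‖proj2 (B (F (lift3 k 0)))‖ + K := by
  obtain ⟨K₁, hK₁, h1⟩ := h.asymptotic.exists_boundary_bound (ε := 1 / 2) (by norm_num)
  obtain ⟨K₂, hK₂, h2⟩ := h.exists_sublinear (ε := 1) one_pos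
  refine ⟨2 * K₁ + 2 * K₂, by positivity, fun k hk => ?_⟩
  have e1 := norm_sub_norm_le (lift3 k 0) (F (lift3 k 0))
  rw [norm_sub_rev, norm_lift3_zero] at e1
  have e2 := h1 k hk
  have e3 := h2 _ (h.mem k hk)
  have e4 := norm_lift3_le (proj2 (B (F (lift3 k 0)))) (B (F (lift3 k 0)) 2)
  have e5 : lift3 (proj2 (B (F (lift3 k 0)))) (B (F (lift3 k 0)) 2) = B (F (lift3 k 0)) :=
    E3.ext (by simp) (by simp) (by simp)
  rw [e5, B.norm_map, h.coord k hk] at e4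
  linarith

theorem coord_two (B : E3 ≃ₗᵢ[ℝ] E3) (y : E3) : B y 2 = inner ℝ y (B.symm e3) :=
  symm_coord_two B.symm y

/-- Along the ray in direction `v` the displacement of `F` and the height of the graph are both
sublinear. The component of `t v` along `B⁻¹ e₃` is thus `o(t)`, while it is linear in `t`. -/
theorem inner_horizontal_eq_zero (h : IsBoundaryTrace R F b ρ B R₀ ψ c) (v : E2) :
    inner ℝ (lift3 v 0) (B.symm e3) = 0 := by
  have hρ : 0 < ρ := h.asymptotic.pos.trans_le h.asymptotic.le
  have hw : ‖B.symm e3‖ = 1 := by simp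
  rcases eq_or_ne v 0 with rfl | hv
  · have h0 : lift3 0 0 = 0 := E3.ext (by simp) (by simp) (by simp)
    rw [h0, inner_zero_left]
  have hv0 : 0 < ‖v‖ := norm_pos_iff.2 hv
  rw [← abs_nonpos_iff]
  refine le_of_forall_pos_le_add fun ε hε => ?_
  rw [zero_add]
  obtain ⟨δ, hδ, hδε, hδ1⟩ : ∃ δ > 0, δ * (4 * ‖v‖) ≤ ε ∧ δ ≤ 1 := by
    refine ⟨min 1 (ε / (4 * ‖v‖)), by positivity, ?_, min_le_left _ _⟩
    rw [← le_div_iff₀ (by positivity)]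
    exact min_le_right _ _
  obtain ⟨K₁, hK₁, h1⟩ := h.asymptotic.exists_boundary_bound hδ
  obtain ⟨K₂, hK₂, h2⟩ := h.exists_sublinear hδ
  -- Of the `3 δ |v|`, one part is the displacement and two bound the height of the graph at a point
  -- of norm at most `2 |v| t`, up to constants.
  refine (le_of_forall_mul_le (b := δ * (3 * ‖v‖)) (K := |inner ℝ (lift3 v 0) (B.symm e3)| * (ρ / ‖v‖) + δ * K₁ + K₂ + K₁) fun t ht => ?_).trans
    (le_trans (by nlinarith) hδε)
  have ht0 : 0 < t := one_pos.trans ht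
  rcases le_or_gt (‖t • v‖) ρ with hle | hlt
  · rw [norm_smul, Real.norm_eq_abs, abs_of_pos ht0, ← le_div_iff₀ hv0] at hle
    have := mul_le_mul_of_nonneg_left hle (abs_nonneg (inner ℝ (lift3 v 0) (B.symm e3)))
    have : 0 ≤ δ * (3 * ‖v‖) * t := by positivity
    have : 0 ≤ δ * K₁ := by positivity
    linarith
  have f1 := h1 _ hlt
  have f2 := h2 _ (h.mem _ hlt)
  rw [← h.coord _ hlt, coord_two] at f2
  have f3 := norm_proj2_le (B (F (lift3 (t • v) 0)))
  rw [B.norm_map] at f3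
  have f4 := norm_le_norm_add_norm_sub' (F (lift3 (t • v) 0)) (lift3 (t • v) 0)
  rw [norm_lift3_zero] at f4
  have f5 := abs_real_inner_le_norm (F (lift3 (t • v) 0) - lift3 (t • v) 0) (B.symm e3)
  rw [hw, mul_one, inner_sub_left] at f5
  have f6 := abs_sub_abs_le_abs_sub (inner ℝ (lift3 (t • v) 0) (B.symm e3))
    (inner ℝ (F (lift3 (t • v) 0)) (B.symm e3))
  rw [abs_sub_comm] at f6
  have f7 : lift3 (t • v) 0 = t • lift3 v 0 := E3.ext (by simp) (by simp) (by simp)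
  have f8 : |inner ℝ (lift3 (t • v) 0) (B.symm e3)| = |inner ℝ (lift3 v 0) (B.symm e3)| * t := by
    rw [f7, real_inner_smul_left, abs_mul, abs_of_pos ht0, mul_comm]
  have f9 : ‖t • v‖ = ‖v‖ * t := by rw [norm_smul, Real.norm_eq_abs, abs_of_pos ht0, mul_comm]
  rw [f8] at f6
  rw [f9] at f1 f4
  have g1 : δ * ‖proj2 (B (F (lift3 (t • v) 0)))‖ ≤ δ * (‖v‖ * t + (δ * (‖v‖ * t) + K₁)) :=
    mul_le_mul_of_nonneg_left (by linarith) hδ.le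
  have g2 : δ * (δ * (‖v‖ * t)) ≤ 1 * (δ * (‖v‖ * t)) :=
    mul_le_mul_of_nonneg_right hδ1 (by positivity)
  have g3 : 0 ≤ |inner ℝ (lift3 v 0) (B.symm e3)| * (ρ / ‖v‖) := by positivity
  nlinarith

/-- The height above the graph vanishes at the boundary and is non-negative above it, so its
one-sided vertical derivative is non-negative. The error terms tend to zero with `k` and exclude the
direction `-e₃`. -/
theorem normal_nonneg (h : IsBoundaryTrace R F b ρ B R₀ ψ c) {k : E2} (hk : ρ < ‖k‖) :
    0 ≤ inner ℝ e3 (B.symm e3) + b / ‖k‖ + c / ‖proj2 (B (F (lift3 k 0)))‖ * (1 + b / ‖k‖) := by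
  have hx : lift3 k 0 ∈ halfSpaceEnd R := lift3_zero_mem (h.asymptotic.le.trans_lt hk)
  set p := pd (halfSpaceEnd R) 2 F (lift3 k 0) with hp
  have hp1 : ‖p - e3‖ ≤ b / ‖k‖ := by
    have := h.asymptotic.first _ hx (by rw [norm_lift3_zero]; exact hk.le) 2
    rwa [norm_lift3_zero] at this
  have hline : HasDerivWithinAt (fun t : ℝ => lift3 k 0 + t • e3) e3 (Ici 0) 0 := by
    simpa using (((hasDerivAt_id (0 : ℝ)).smul_const e3).const_add (lift3 k 0)).hasDerivWithinAt
  have hFd := (h.asymptotic.smooth.differentiableOn (by simp) _ hx).hasFDerivWithinAt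
  have h1 : HasDerivWithinAt (fun t : ℝ => F (lift3 k 0 + t • e3)) p (Ici 0) 0 :=
    HasFDerivWithinAt.comp_hasDerivWithinAt (t := halfSpaceEnd R) (0 : ℝ) (by simpa using hFd) hline
      fun t ht => add_smul_e3_mem hx ht
  have h2 : HasDerivWithinAt (fun t : ℝ => B (F (lift3 k 0 + t • e3))) (B p) (Ici 0) 0 :=
    (B.toContinuousLinearEquiv : E3 →L[ℝ] E3).hasFDerivAt.comp_hasDerivWithinAt (0 : ℝ) h1
  have h3 : HasDerivWithinAt (fun t : ℝ => B (F (lift3 k 0 + t • e3)) 2) (B p 2) (Ici 0) 0 :=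
    (EuclideanSpace.proj (𝕜 := ℝ) (2 : Fin 3)).hasFDerivAt.comp_hasDerivWithinAt (0 : ℝ) h2
  have h4 : HasDerivWithinAt (fun t : ℝ => proj2 (B (F (lift3 k 0 + t • e3)))) (proj2 (B p))
      (Ici 0) 0 := proj2.hasFDerivAt.comp_hasDerivWithinAt (0 : ℝ) h2
  have hψd := ((h.smooth _ (h.mem k hk)).differentiableAt (by simp)).hasFDerivAt
  have h5 : HasDerivWithinAt (fun t : ℝ => ψ (proj2 (B (F (lift3 k 0 + t • e3)))))
      (fderiv ℝ ψ (proj2 (B (F (lift3 k 0)))) (proj2 (B p))) (Ici 0) 0 :=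
    HasFDerivAt.comp_hasDerivWithinAt (l := ψ) (0 : ℝ) (by simpa using hψd) h4
  have h6 := (hasDerivWithinAt_iff_tendsto_slope' self_notMem_Ioi).1
    ((h3.sub h5).mono Ioi_subset_Ici_self)
  have h7 := ge_of_tendsto h6 (b := 0) (by
    filter_upwards [h.above k hk, self_mem_nhdsWithin] with t ht ht0
    have ht0' : 0 < t := ht0
    rw [slope_def_field]
    simp only [Pi.sub_apply, zero_smul, add_zero, h.coord k hk, sub_self, sub_zero]
    exact div_nonneg (sub_nonneg.2 ht) ht0'.le)
  have hpn : ‖p‖ ≤ 1 + b / ‖k‖ := by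
    have := norm_le_norm_add_norm_sub' p e3
    rw [norm_e3] at this
    linarith
  have h8 : B p 2 ≤ inner ℝ e3 (B.symm e3) + b / ‖k‖ := by
    rw [coord_two]
    have := (le_abs_self _).trans (abs_real_inner_le_norm (p - e3) (B.symm e3))
    rw [inner_sub_left, B.symm.norm_map, norm_e3, mul_one] at this
    linarith
  have h9 : |fderiv ℝ ψ (proj2 (B (F (lift3 k 0)))) (proj2 (B p))| ≤
      c / ‖proj2 (B (F (lift3 k 0)))‖ * (1 + b / ‖k‖) := by
    refine ((fderiv ℝ ψ (proj2 (B (F (lift3 k 0))))).le_opNorm _).trans ?_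
    refine mul_le_mul (h.norm_fderiv_le (h.mem k hk)) ?_ (norm_nonneg _)
      (div_nonneg h.decay_nonneg (norm_nonneg _))
    exact (norm_proj2_le _).trans (by rwa [B.norm_map])
  have h10 := neg_abs_le (fderiv ℝ ψ (proj2 (B (F (lift3 k 0)))) (proj2 (B p)))
  linarith

/-- The chart maps the upper half-space to the side above the graph. -/
theorem map_e3 (h : IsBoundaryTrace R F b ρ B R₀ ψ c) : B e3 = e3 := by
  set w := B.symm e3 with hw
  have h0 : w 0 = 0 := by
    have := h.inner_horizontal_eq_zero (EuclideanSpace.single 0 1)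
    simpa [PiLp.inner_apply, Fin.sum_univ_three] using this
  have h1 : w 1 = 0 := by
    have := h.inner_horizontal_eq_zero (EuclideanSpace.single 1 1)
    simpa [PiLp.inner_apply, Fin.sum_univ_three] using this
  have hwn : ‖w‖ = 1 := by simp [w]
  have hsq := E3.norm_sq w
  rw [hwn, h0, h1] at hsq
  have hinner : inner ℝ e3 w = w 2 := by simp [e3, EuclideanSpace.inner_single_left]
  have hpos : w 2 ≠ -1 := by
    intro hneg
    obtain ⟨K, hK, hk⟩ := h.exists_norm_le
    have hρ : 0 < ρ := h.asymptotic.pos.trans_le h.asymptotic.le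
    have hb := h.asymptotic.nonneg
    have hc := h.decay_nonneg
    -- At this distance `b / m ≤ 1/4` and `c / y ≤ 1/4`, so the errors sum to less than `1`.
    set m := ρ + 4 * b + 16 * c + 4 + K + 1 with hm
    have hn : ‖polarPt m 0‖ = m := norm_polarPt (by positivity) 0
    have hkρ : ρ < ‖polarPt m 0‖ := by rw [hn]; linarith
    have e1 := h.normal_nonneg hkρ
    have e2 := hk _ hkρ
    rw [hn] at e1 e2
    rw [← hw, hinner, hneg] at e1
    set y := ‖proj2 (B (F (lift3 (polarPt m 0) 0)))‖
    have hy : 4 * c + 1 ≤ y := by linarith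
    have e3 : b / m ≤ 1 / 4 := by
      rw [div_le_iff₀ (by positivity)]; linarith
    have e4 : c / y ≤ 1 / 4 := by
      rw [div_le_iff₀ (by linarith)]; linarith
    have e5 : 0 ≤ b / m := by positivity
    have e6 : c / y * (1 + b / m) ≤ 1 / 4 * (1 + 1 / 4) :=
      mul_le_mul e4 (by linarith) (by positivity) (by norm_num)
    linarith
  have h2 : w 2 = 1 := by
    have : (w 2 - 1) * (w 2 + 1) = 0 := by linarith
    rcases mul_eq_zero.1 this with h | h
    · linarith
    · exact absurd (by linarith) hpos
  have hwe : w = e3 := E3.ext (by simp [h0, e3]) (by simp [h1, e3]) (by simp [h2, e3])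
  rw [← hwe, hw, B.apply_symm_apply, ← hw, hwe]

/-- The horizontal part of the rotation. -/
theorem exists_plane_isometry (h : IsBoundaryTrace R F b ρ B R₀ ψ c) :
    ∃ Q : E2 ≃ₗᵢ[ℝ] E2, ∀ x : E3, proj2 (B x) = Q (proj2 x) ∧ B x 2 = x 2 := by
  have hB := h.map_e3
  have hBs : B.symm e3 = e3 := by rw [B.symm_apply_eq, hB]
  have h2 : ∀ x, B x 2 = x 2 := fun x => by
    rw [coord_two, hBs]; simp [e3, EuclideanSpace.inner_single_right]
  let Q : E2 →ₗᵢ[ℝ] E2 :=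
    { toLinearMap := ((proj2.comp (B.toContinuousLinearEquiv : E3 →L[ℝ] E3)).comp incl2 :
        E2 →L[ℝ] E2)
      norm_map' := fun x => by
        change ‖proj2 (B (lift3 x 0))‖ = ‖x‖
        have h3 := E3.norm_sq' (B (lift3 x 0))
        rw [B.norm_map, norm_lift3_zero, h2] at h3
        exact (pow_left_inj₀ (norm_nonneg _) (norm_nonneg _) two_ne_zero).1 (by simpa using h3.symm) }
  refine ⟨Q.toLinearIsometryEquiv rfl, fun x => ⟨?_, h2 x⟩⟩
  change proj2 (B x) = proj2 (B (lift3 (proj2 x) 0))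
  have hx : x = lift3 (proj2 x) 0 + x 2 • e3 := E3.ext (by simp) (by simp) (by simp)
  conv_lhs => rw [hx, map_add, map_smul, hB, map_add, map_smul]
  have : proj2 e3 = 0 := E2.ext (by simp [e3]) (by simp [e3])
  rw [this, smul_zero, add_zero]

end IsBoundaryTrace

end

/-! ### Comparison of the masses -/

theorem spherePt_equator (r φ : ℝ) : spherePt r (Real.pi / 2) φ = lift3 (polarPt r φ) 0 :=
  E3.ext (by simp) (by simp) (by simp)

theorem polarPt_add (α φ : ℝ) : polarPt 1 (α + φ) =
    Real.cos φ • polarPt 1 α + Real.sin φ • polarPt 1 (α + Real.pi / 2) := by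
  refine E2.ext ?_ ?_
  · simp [Real.cos_add]; ring
  · simp [Real.sin_add]; ring

/-- Isometries of the plane are rotations or reflections. -/
theorem exists_isometry_polarPt (Q : E2 ≃ₗᵢ[ℝ] E2) :
    ∃ α : ℝ, (∀ φ, Q (polarPt 1 φ) = polarPt 1 (α + φ)) ∨ ∀ φ, Q (polarPt 1 φ) = polarPt 1 (α - φ) := by
  obtain ⟨α, -, hα⟩ := exists_polarPt (Q (polarPt 1 0))
  rw [Q.norm_map, norm_polarPt zero_le_one] at hα
  set v := Q (polarPt 1 (0 + Real.pi / 2)) with hv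
  have hn : ‖v‖ ^ 2 = 1 := by rw [hv, Q.norm_map, norm_polarPt zero_le_one, one_pow]
  have ho : inner ℝ (Q (polarPt 1 0)) v = 0 := by
    rw [hv, Q.inner_map_map]
    simp [PiLp.inner_apply, Fin.sum_univ_two]
  rw [hα] at ho
  simp [PiLp.inner_apply, Fin.sum_univ_two] at ho
  rw [E2.norm_sq] at hn
  have hcs := Real.sin_sq_add_cos_sq α
  have hQ : ∀ φ, Q (polarPt 1 φ) = Real.cos φ • polarPt 1 α + Real.sin φ • v := by
    intro φ
    have := polarPt_add 0 φ
    rw [zero_add] at this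
    rw [this, map_add, map_smul, map_smul, hα, hv]
  -- The image `v` of the second basis vector is a unit vector orthogonal to `polarPt 1 α`, hence `s
  -- = ±1` times the rotated vector. The sign distinguishes rotations from reflections.
  obtain ⟨s, hs⟩ : ∃ s, s = -v 0 * Real.sin α + v 1 * Real.cos α := ⟨_, rfl⟩
  have h0 : v 0 = -(s * Real.sin α) := by
    rw [hs]
    linear_combination (-(v 0)) * hcs + Real.cos α * ho
  have h1 : v 1 = s * Real.cos α := by
    rw [hs]
    linear_combination (-(v 1)) * hcs + Real.sin α * ho
  have hs2 : (s - 1) * (s + 1) = 0 := by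
    rw [h0, h1] at hn
    linear_combination hn - s ^ 2 * hcs
  refine ⟨α, (mul_eq_zero.1 hs2).imp (fun h φ => ?_) fun h φ => ?_⟩
  · have hs1 : s = 1 := by linarith
    rw [hQ, polarPt_add]
    refine E2.ext ?_ ?_
    · simp [h0, hs1, Real.cos_add_pi_div_two]
    · simp [h1, hs1, Real.sin_add_pi_div_two]
  · have hs1 : s = -1 := by linarith
    rw [hQ, sub_eq_add_neg, polarPt_add]
    refine E2.ext ?_ ?_
    · simp [h0, hs1, Real.cos_add_pi_div_two]
    · simp [h1, hs1, Real.sin_add_pi_div_two]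

/-- A shift or reversal of the angle does not change an integral over a full period. -/
theorem integral_polarPt_isometry (Q : E2 ≃ₗᵢ[ℝ] E2) (f : E2 → ℝ) :
    ∫ φ in (0 : ℝ)..(2 * Real.pi), f (Q (polarPt 1 φ)) =
      ∫ φ in (0 : ℝ)..(2 * Real.pi), f (polarPt 1 φ) := by
  have hper : Function.Periodic (fun φ => f (polarPt 1 φ)) (2 * Real.pi) := fun φ => by
    have : polarPt 1 (φ + 2 * Real.pi) = polarPt 1 φ := E2.ext (by simp) (by simp)
    simp only [this]
  obtain ⟨α, h | h⟩ := exists_isometry_polarPt Q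
  · simp only [h]
    rw [intervalIntegral.integral_comp_add_left (fun φ => f (polarPt 1 φ)), add_zero,
      hper.intervalIntegral_add_eq α 0, zero_add]
  · simp only [h]
    rw [intervalIntegral.integral_comp_sub_left (fun φ => f (polarPt 1 φ)), sub_zero]
    have := hper.intervalIntegral_add_eq (α - 2 * Real.pi) 0
    rwa [sub_add_cancel, zero_add] at this

theorem integral_fderiv_isometry (ψ : E2 → ℝ) (Q : E2 ≃ₗᵢ[ℝ] E2) (r : ℝ) :
    ∫ φ in (0 : ℝ)..(2 * Real.pi), fderiv ℝ ψ (Q (polarPt r φ)) (Q (polarPt 1 φ)) =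
      ∫ φ in (0 : ℝ)..(2 * Real.pi), fderiv ℝ ψ (polarPt r φ) (polarPt 1 φ) := by
  have := integral_polarPt_isometry Q fun v => fderiv ℝ ψ (r • v) v
  simpa only [← map_smul, ← polarPt_eq_smul] using this

section

variable {R b ρ R₀ c : ℝ} {F : E3 → E3} {B : E3 ≃ₗᵢ[ℝ] E3} {ψ : E2 → ℝ} {Q : E2 ≃ₗᵢ[ℝ] E2}

theorem radialSlope_eq (R : ℝ) (F : E3 → E3) (r φ : ℝ) : radialSlope R F r φ =
    fderivWithin ℝ F (halfSpaceEnd R) (lift3 (polarPt r φ) 0) (incl2 (polarPt 1 φ)) 2 := by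
  rw [radialSlope, fderivWithin_apply_eq_sum, spherePt_equator, incl2_apply]
  simp [Fin.sum_univ_three]

namespace IsBoundaryTrace

/-- Differentiation along the plane of the identity which says that its image lies on the graph. -/
theorem fderiv_boundary (h : IsBoundaryTrace R F b ρ B R₀ ψ c)
    (hQ : ∀ x : E3, proj2 (B x) = Q (proj2 x) ∧ B x 2 = x 2) {k : E2} (hk : ρ < ‖k‖) (v : E2) :
    fderivWithin ℝ F (halfSpaceEnd R) (lift3 k 0) (incl2 v) 2 =
      fderiv ℝ ψ (Q (proj2 (F (lift3 k 0))))
        (Q (proj2 (fderivWithin ℝ F (halfSpaceEnd R) (lift3 k 0) (incl2 v)))) := by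
  have h1 := hasFDerivAt_boundary h.asymptotic.smooth (h.asymptotic.le.trans_lt hk)
  have h2 := (EuclideanSpace.proj (𝕜 := ℝ) (2 : Fin 3)).hasFDerivAt.comp k h1
  have h3 := (proj2.hasFDerivAt (x := F (lift3 k 0))).comp k h1
  have h4 := (Q.toContinuousLinearEquiv : E2 →L[ℝ] E2).hasFDerivAt.comp k h3
  have hm := h.mem k hk
  rw [(hQ _).1] at hm
  have h5 : HasFDerivAt (fun k => ψ (Q (proj2 (F (lift3 k 0))))) _ k :=
    HasFDerivAt.comp k (((h.smooth _ hm).differentiableAt (by simp)).hasFDerivAt) h4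
  have h6 : (fun k => F (lift3 k 0) 2) =ᶠ[𝓝 k] fun k => ψ (Q (proj2 (F (lift3 k 0)))) := by
    filter_upwards [(isOpen_exterior ρ).mem_nhds hk] with k' hk'
    have := h.coord k' hk'
    rwa [(hQ _).1, (hQ _).2] at this
  exact DFunLike.congr_fun (h2.unique (h5.congr_of_eventuallyEq h6)) v

theorem norm_fderiv_sub_le (h : IsBoundaryTrace R F b ρ B R₀ ψ c) {x y : E2} {s : ℝ} (hs : R₀ < s)
    (hxs : 2 * s ≤ ‖x‖) (hxy : ‖y - x‖ ≤ s) :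
    ‖fderiv ℝ ψ y - fderiv ℝ ψ x‖ ≤ c / s ^ 2 * ‖y - x‖ := by
  have hs0 : 0 < s := h.pos.trans hs
  have hball : ∀ z ∈ Metric.closedBall x s, s ≤ ‖z‖ := fun z hz => by
    rw [mem_closedBall_iff_norm] at hz
    have := norm_sub_norm_le x z
    rw [norm_sub_rev] at this
    linarith
  refine (convex_closedBall x s).norm_image_sub_le_of_norm_fderiv_le (𝕜 := ℝ) (fun z hz => ?_)
    (fun z hz => ?_) (Metric.mem_closedBall_self hs0.le) (by rwa [mem_closedBall_iff_norm])
  · exact ((h.smooth z (hs.trans_le (hball z hz))).fderiv_right (m := 1)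
      (by norm_num)).differentiableAt (by simp)
  · have hzs := hball z hz
    rw [le_div_iff₀ (by positivity)]
    have h1 := h.decay z (hs.trans_le hzs)
    have h2 : 0 ≤ ‖fderiv ℝ (fderiv ℝ ψ) z‖ := ContinuousLinearMap.opNorm_nonneg _
    have h3 : s ^ 2 ≤ ‖z‖ ^ 2 := by gcongr
    have h4 : 0 ≤ ‖z‖ * ‖fderiv ℝ ψ z‖ := by positivity
    calc _ = s ^ 2 * ‖fderiv ℝ (fderiv ℝ ψ) z‖ := mul_comm _ _
      _ ≤ ‖z‖ ^ 2 * ‖fderiv ℝ (fderiv ℝ ψ) z‖ := mul_le_mul_of_nonneg_right h3 h2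
      _ ≤ c := by linarith

/-- Two replacements are made: the horizontal derivative of `F` by the identity, at cost `O(1/r²)`,
and the base point by `polarPt r φ`. The second costs `|D²ψ|` times the sublinear displacement,
which is `o(1/r)`; this uses the second order decay of `ψ`. -/
theorem exists_slope_bound (h : IsBoundaryTrace R F b ρ B R₀ ψ c)
    (hQ : ∀ x : E3, proj2 (B x) = Q (proj2 x) ∧ B x 2 = x 2) {ε : ℝ} (hε : 0 < ε) :
    ∃ C ρ₁, 0 ≤ C ∧ ∀ r, ρ₁ < r → ∀ φ, |radialSlope R F r φ
      - fderiv ℝ ψ (Q (polarPt r φ)) (Q (polarPt 1 φ))| ≤ ε / r + C / r ^ 2 := by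
  have hc := h.decay_nonneg
  have hb := h.asymptotic.nonneg
  obtain ⟨δ, hδ, hδε, hδ1⟩ : ∃ δ > 0, 4 * c * δ ≤ ε ∧ δ ≤ 1 / 4 := by
    refine ⟨min (1 / 4) (ε / (4 * c + 1)), by positivity, ?_, min_le_left _ _⟩
    have h1 : min (1 / 4) (ε / (4 * c + 1)) ≤ ε / (4 * c + 1) := min_le_right _ _
    rw [le_div_iff₀ (by positivity)] at h1
    have h2 : 0 ≤ min (1 / 4) (ε / (4 * c + 1)) := by positivity
    linarith
  obtain ⟨K, hK, hKb⟩ := h.asymptotic.exists_boundary_bound hδ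
  refine ⟨6 * b * c + 4 * c * K, max (max ρ (4 * K)) (2 * R₀), by positivity, fun r hr φ => ?_⟩
  have hrρ : ρ < r := (le_max_left ρ _).trans_lt ((le_max_left _ _).trans_lt hr)
  have hrK : 4 * K < r := (le_max_right ρ _).trans_lt ((le_max_left _ _).trans_lt hr)
  have hrR : 2 * R₀ < r := (le_max_right _ _).trans_lt hr
  have hr0 : 0 < r := (h.asymptotic.pos.trans_le h.asymptotic.le).trans hrρ
  set k := polarPt r φ with hkdef
  set ν := polarPt 1 φ
  have hν : ‖ν‖ = 1 := norm_polarPt zero_le_one φ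
  have hk : ‖k‖ = r := norm_polarPt hr0.le φ
  have hkρ : ρ < ‖k‖ := by rwa [hk]
  rw [radialSlope_eq, h.fderiv_boundary hQ hkρ]
  set G := proj2 (F (lift3 k 0))
  set D := fderivWithin ℝ F (halfSpaceEnd R) (lift3 k 0)
  have hGk : ‖G - k‖ ≤ δ * r + K := by
    have h1 := hKb k hkρ
    have h2 := norm_proj2_le (F (lift3 k 0) - lift3 k 0)
    rw [map_sub, proj2_lift3] at h2
    rw [hk] at h1
    exact h2.trans h1
  have hδr : δ * r ≤ 1 / 4 * r := mul_le_mul_of_nonneg_right hδ1 hr0.le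
  have hG : r / 2 ≤ ‖G‖ := by
    have := norm_sub_norm_le k G
    rw [norm_sub_rev, hk] at this
    linarith
  have hDν : ‖proj2 (D (incl2 ν)) - ν‖ ≤ 3 * b / r := by
    have h1 := h.asymptotic.norm_fderiv_boundary_le hkρ
    have h2 := (norm_proj2_le _).trans ((D.comp incl2 - incl2).le_opNorm ν)
    rw [hν, mul_one] at h2
    have h3 : proj2 ((D.comp incl2 - incl2) ν) = proj2 (D (incl2 ν)) - ν := by
      simp [incl2_apply]
    rw [h3] at h2
    rw [hk] at h1
    exact h2.trans h1
  have e1 : |fderiv ℝ ψ (Q G) (Q (proj2 (D (incl2 ν)))) - fderiv ℝ ψ (Q G) (Q ν)|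
      ≤ 2 * c / r * (3 * b / r) := by
    rw [← map_sub, ← map_sub]
    refine ((fderiv ℝ ψ (Q G)).le_opNorm _).trans ?_
    rw [Q.norm_map]
    refine mul_le_mul ?_ hDν (norm_nonneg _) (by positivity)
    refine (h.norm_fderiv_le (x := Q G) (by rw [Q.norm_map]; linarith)).trans ?_
    rw [Q.norm_map, div_le_div_iff₀ (by linarith) hr0]
    nlinarith
  have e2 : |fderiv ℝ ψ (Q G) (Q ν) - fderiv ℝ ψ (Q k) (Q ν)| ≤
      c / (r / 2) ^ 2 * (δ * r + K) := by
    have h1 := h.norm_fderiv_sub_le (x := Q k) (y := Q G) (s := r / 2) (by linarith)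
      (by rw [Q.norm_map, hk]; linarith) (by rw [← map_sub, Q.norm_map]; linarith)
    rw [← map_sub, Q.norm_map] at h1
    have h2 := (fderiv ℝ ψ (Q G) - fderiv ℝ ψ (Q k)).le_opNorm (Q ν)
    rw [Q.norm_map, hν, mul_one] at h2
    exact h2.trans (h1.trans (mul_le_mul_of_nonneg_left hGk (by positivity)))
  have e3 : 2 * c / r * (3 * b / r) + c / (r / 2) ^ 2 * (δ * r + K) =
      (4 * c * δ) / r + (6 * b * c + 4 * c * K) / r ^ 2 := by
    field_simp
    ring
  refine (abs_sub_le _ (fderiv ℝ ψ (Q G) (Q ν)) _).trans ((add_le_add e1 e2).trans ?_)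
  rw [e3]
  gcongr

theorem tendsto_slope (h : IsBoundaryTrace R F b ρ B R₀ ψ c) :
    Tendsto (fun r : ℝ => r * (∫ φ in (0 : ℝ)..(2 * Real.pi), radialSlope R F r φ)
      - r * ∫ φ in (0 : ℝ)..(2 * Real.pi), fderiv ℝ ψ (polarPt r φ) (polarPt 1 φ)) atTop (𝓝 0) := by
  obtain ⟨Q, hQ⟩ := h.exists_plane_isometry
  rw [Metric.tendsto_atTop]
  intro ε hε
  have hπ := Real.pi_pos
  obtain ⟨C, ρ₁, hC, hC'⟩ := h.exists_slope_bound hQ (ε := ε / (2 * (2 * Real.pi))) (by positivity)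
  refine ⟨max (max ρ₁ R₀) (max R (2 * (C * (2 * Real.pi)) / ε)) + 1, fun r hr => ?_⟩
  have hr' : max (max ρ₁ R₀) (max R (2 * (C * (2 * Real.pi)) / ε)) < r := by linarith
  simp only [max_lt_iff] at hr'
  obtain ⟨⟨hr1, hr2⟩, hr3, hr4⟩ := hr'
  have hr0 : 0 < r := h.pos.trans hr2
  have hcont : Continuous fun φ => fderiv ℝ ψ (Q (polarPt r φ)) (Q (polarPt 1 φ)) := by
    have hp : ∀ s, Continuous fun φ => Q (polarPt s φ) := fun s => by
      have h1 : Continuous fun φ => polarPt s φ := by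
        simp only [polarPt_eq_single]
        fun_prop
      exact Q.continuous.comp h1
    refine Continuous.clm_apply (continuous_iff_continuousAt.2 fun φ => ?_) (hp 1)
    have hn : R₀ < ‖Q (polarPt r φ)‖ := by rwa [Q.norm_map, norm_polarPt hr0.le]
    exact ContinuousAt.comp (g := fderiv ℝ ψ) (((h.smooth _ hn).fderiv_right (m := 1)
      (by norm_num)).continuousAt) (hp r).continuousAt
  have i1 := (continuous_radialSlope h.asymptotic.pos hr3 h.asymptotic.smooth).intervalIntegrable
    (μ := MeasureTheory.volume) 0 (2 * Real.pi)
  have h1 := intervalIntegral.norm_integral_le_of_norm_le_const (a := 0) (b := 2 * Real.pi)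
    (f := fun φ => radialSlope R F r φ - fderiv ℝ ψ (Q (polarPt r φ)) (Q (polarPt 1 φ)))
    fun φ _ => hC' r hr1 φ
  rw [intervalIntegral.integral_sub i1 (hcont.intervalIntegrable _ _), integral_fderiv_isometry ψ Q,
    sub_zero, abs_of_pos (by positivity : 0 < 2 * Real.pi), Real.norm_eq_abs] at h1
  rw [Real.dist_eq, sub_zero, ← mul_sub, abs_mul, abs_of_pos hr0]
  refine (mul_le_mul_of_nonneg_left h1 hr0.le).trans_lt ?_
  have e1 : r * ((ε / (2 * (2 * Real.pi)) / r + C / r ^ 2) * (2 * Real.pi)) =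
      ε / 2 + C * (2 * Real.pi) / r := by
    field_simp
  rw [e1]
  have e2 : C * (2 * Real.pi) / r < ε / 2 := by
    rw [div_lt_iff₀ hε] at hr4
    rw [div_lt_iff₀ hr0]
    linarith
  linarith

/-- Combines the flux expansion with the comparison of slopes; the factor is `2 / (16π) = (1/4) ·
1/(2π)`. -/
theorem tendsto_mass (h : IsBoundaryTrace R F b ρ B R₀ ψ c) :
    Tendsto (fun r : ℝ => 1 / (16 * Real.pi)
        * (hemisphereFlux euclideanMetric R F r + circleFlux euclideanMetric R F r)
      - 1 / 4 * (1 / (2 * Real.pi) * ∫ φ in (0 : ℝ)..(2 * Real.pi),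
        fderiv ℝ ψ !₂[r * Real.cos φ, r * Real.sin φ] !₂[Real.cos φ, Real.sin φ] * r))
      atTop (𝓝 0) := by
  obtain ⟨C, hC⟩ := h.asymptotic.exists_flux_bound
  have h1 : Tendsto (fun r => hemisphereFlux euclideanMetric R F r
      + circleFlux euclideanMetric R F r
      - 2 * r * ∫ φ in (0 : ℝ)..(2 * Real.pi), radialSlope R F r φ) atTop (𝓝 0) := by
    refine squeeze_zero_norm' ?_ (tendsto_const_nhds.div_atTop tendsto_id : Tendsto
      (fun r : ℝ => C / r) atTop (𝓝 0))
    filter_upwards [eventually_gt_atTop ρ] with r hr using hC r hr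
  have h2 := (h1.add (h.tendsto_slope.const_mul 2)).const_mul (1 / (16 * Real.pi))
  simp only [mul_zero, add_zero] at h2
  refine h2.congr fun r => ?_
  have e1 : ∀ φ, (!₂[Real.cos φ, Real.sin φ] : E2) = polarPt 1 φ := fun φ =>
    E2.ext (by simp) (by simp)
  have e2 : ∀ φ, (!₂[r * Real.cos φ, r * Real.sin φ] : E2) = polarPt r φ := fun φ => rfl
  simp only [e1, e2, intervalIntegral.integral_mul_const]
  have := Real.pi_pos
  field_simp
  ring

end IsBoundaryTrace

end

theorem IsAFChart.tendsto_mass {S W Ω Ω' Shat Mhat : Set E3} {μ : E3 → E3} {R R₀ : ℝ} {Φ : E3 → E3}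
    {A : E3 ≃ₗᵢ[ℝ] E3} {ψ : E2 → ℝ} (hW : IsInnerSide S μ W) (hΩ : IsCompact Ω)
    (hC : Shat ∈ componentsOf (S \ Ω)) (hG : IsGraphEnd μ Shat A R₀ ψ) (hΩ' : IsCompact Ω')
    (hM : Mhat ∈ componentsOf (regionOf S μ \ Ω'))
    (h : IsAFChart (regionOf S μ) euclideanMetric Mhat R Φ)
    (hb : Bornology.IsBounded (Shat \ Mhat)) :
    Tendsto (fun r : ℝ => 1 / (16 * Real.pi)
        * (hemisphereFlux euclideanMetric R Φ r + circleFlux euclideanMetric R Φ r)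
      - 1 / 4 * (1 / (2 * Real.pi) * ∫ φ in (0 : ℝ)..(2 * Real.pi),
        fderiv ℝ ψ !₂[r * Real.cos φ, r * Real.sin φ] !₂[Real.cos φ, Real.sin φ] * r))
      atTop (𝓝 0) := by
  obtain ⟨O, B, b, ρ, c, hB⟩ := h.exists_isBoundaryTrace hW hΩ hC hG hΩ' hM hb
  refine hB.tendsto_mass.congr' ?_
  filter_upwards [eventually_gt_atTop R] with r hr
  rw [hemisphereFlux_isometry O.symm h.smooth h.pos hr, circleFlux_isometry O.symm h.smooth h.pos hr]

theorem mainTheorem6 (S : Set E3) (μ : E3 → E3) (hS : IsAFSupportSurface S μ) :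
    (EndsAreSeparated S μ → IsAFHalfSpace (regionOf S μ) euclideanMetric) ∧
    (∀ (Ω Shat : Set E3) (A : E3 ≃ₗᵢ[ℝ] E3) (R₀ : ℝ) (ψ : E2 → ℝ)
        (Ω' Mhat : Set E3) (R : ℝ) (Φ : E3 → E3),
      IsCompact Ω → Shat ∈ componentsOf (S \ Ω) → IsGraphEnd μ Shat A R₀ ψ →
      IsCompact Ω' → Mhat ∈ componentsOf (regionOf S μ \ Ω') →
      IsAFChart (regionOf S μ) euclideanMetric Mhat R Φ →
      Bornology.IsBounded (Shat \ Mhat) →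
      ((∃ m, HasExteriorMass ψ m) ↔ ∃ m, HasADMMass euclideanMetric R Φ m) ∧
      ∀ mExt mADM, HasExteriorMass ψ mExt → HasADMMass euclideanMetric R Φ mADM →
        mExt = 4 * mADM) ∧
    (∀ S' : Set E3, IsExteriorSurface S μ S' →
      ∃ M' : Set E3, IsExteriorRegion S μ M' ∧ S' = exteriorBoundary S M') := by
  obtain ⟨W, hW⟩ := exists_isInnerSide hS.closed hS.connected hS.surface
  refine ⟨hW.isAFHalfSpace hS, ?_, fun S' hS' => exists_exteriorRegion hW hS.closed hS.connected hS'⟩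
  intro Ω Shat A R₀ ψ Ω' Mhat R Φ hΩ hC hG hΩ' hM hΦ hb
  -- The two expressions under the limits differ asymptotically by the factor four only, whether or
  -- not either converges.
  have key := hΦ.tendsto_mass hW hΩ hC hG hΩ' hM hb
  refine ⟨⟨fun ⟨m, hm⟩ => ⟨1 / 4 * m, ?_⟩, fun ⟨m, hm⟩ => ⟨4 * m, ?_⟩⟩, fun mExt mADM hExt hADM => ?_⟩
  · exact (zero_add (1 / 4 * m) ▸ key.add (hm.const_mul (1 / 4))).congr fun r => by ring
  · exact (sub_zero (4 * m) ▸ mul_zero (4 : ℝ) ▸ (hm.const_mul 4).sub (key.const_mul 4)).congr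
      fun r => by ring
  · have := tendsto_nhds_unique key (hADM.sub (hExt.const_mul (1 / 4)))
    linarith
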